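/- Let $A$ and $B$ be separable real C*-algebras (with trivial gradings), and let $\mathcal{K}$ be the algebra of compact operators on a separable infinite-dimensional real Hilbert space, $\mathcal{M}(\cdot)$ the multiplier algebra. A Kasparov $(A,B)$-bimodule is a triple $(E,\phi,T)$ where $E$ is a countably generated $\mathbb{Z}/2$-graded Hilbert $B$-module, $\phi\colon A\to\mathcal{L}(E)$ is a $*$-homomorphism into the operators of degree $0$, and $T\in\mathcal{L}(E)$ has degree $1$, such that $(T-T^*)\phi(a)$, $(T^2-1)\phi(a)$ and $[T,\phi(a)]$ lie in $\mathcal{K}(E)$ for all $a\in A$. Two of them, $(E_i,\phi_i,T_i)$ for $i=0,1$, are homotopic if there is a Kasparov $(A,B\otimes C[0,1])$-bimodule whose push-forward $(E\otimes_{\varepsilon_i}B,\ \phi\otimes 1,\ T\otimes 1)$ along the evaluation $\varepsilon_i\colon B\otimes C[0,1]\to B$ at $i$ is unitarily equivalent to $(E_i,\phi_i,T_i)$, by a unitary of degree $0$, for $i=0,1$. $KK(A,B)$ is the set of homotopy classes, with addition induced by the direct sum. A $KK(A,B)$-cycle is a triple $(\phi_+,\phi_-,U)$ where $\phi_\pm\colon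 A\to\mathcal{M}(\mathcal{K}\otimes B)$ are $*$-homomorphisms and $U\in\mathcal{M}(\mathcal{K}\otimes B)$ is such that $U\phi_+(a)-\phi_-(a)U$, $\phi_+(a)(U^*U-1)$ and $\phi_-(a)(UU^*-1)$ lie in $\mathcal{K}\otimes B$ for all $a\in A$; it is degenerate if all these elements are zero. Two cycles are homotopic if they are the images, under the maps $\mathcal{M}(\mathcal{K}\otimes B\otimes C[0,1])\to\mathcal{M}(\mathcal{K}\otimes B)$ induced by evaluation at $0$ and at $1$, of one $KK(A,B\otimes C[0,1])$-cycle. The sum of two cycles is their diagonal sum, where $M_2(\mathcal{M}(\mathcal{K}\otimes B))$ is identified with $\mathcal{M}(\mathcal{K}\otimes B)$ by means of an isomorphism $M_2(\mathcal{K})\cong\mathcal{K}$. Two cycles $x,y$ are equivalent if $x\oplus d$ and $y\oplus e$ are homotopic for some degenerate cycles $d,e$. $\mathbf{KK}(A,B)$ is the set of equivalence classes of cycles, with addition induced by $\oplus$. Then $KK(A,B)$ and $\mathbf{KK}(A,B)$ are abelian groups under these additions, and $KK(A,B)\cong\mathbf{KK}(A,B)$ as groups. -/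

import Mathlib

open scoped MultiplierAlgebra TensorProduct

universe u v w

namespace RealKK

noncomputable section

/-! ### Real C*-algebras -/

/-- A (not necessarily unital) real C*-algebra: a real Banach *-algebra that is isometrically
*-isomorphic to a norm closed *-algebra of bounded operators on a real Hilbert space. (The C*-identity
alone does not suffice over `ℝ`: it also holds for `ℂ` with the trivial involution.) -/
class RealCStarAlgebra (A : Type u) extends NonUnitalNormedRing A, StarRing A, CompleteSpace A,
    CStarRing A, NormedSpace ℝ A, IsScalarTower ℝ A A, SMulCommClass ℝ A A, StarModule ℝ A where
  exists_isometric_rep : ∃ (H : Type u) (_ : NormedAddCommGroup H) (_ : InnerProductSpace ℝ H)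
    (_ : CompleteSpace H) (π : A →⋆ₙₐ[ℝ] (H →L[ℝ] H)), Isometry π

/-! ### Hilbert modules over real C*-algebras -/

/-- The positive cone of a *-ring: the finite sums of elements `star s * s`, as in Mathlib's
`StarOrderedRing`. -/
def posCone (B : Type v) [NonUnitalNormedRing B] [StarRing B] : AddSubmonoid B :=
  AddSubmonoid.closure (Set.range fun s : B => star s * s)

/-- A pre-Hilbert `B`-module structure on `E`: a right action `act x b = x · b` of `B` and a `B`-valued
inner product, linear in the second variable, that induces the norm of `E`. A Hilbert `B`-module is
such an `E` that is moreover complete. -/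
class HilbertModule (B : Type v) (E : Type w) [NonUnitalNormedRing B] [StarRing B] [NormedSpace ℝ B]
    [NormedAddCommGroup E] [NormedSpace ℝ E] extends Inner B E where
  act : E → B → E
  add_act (x y : E) (b : B) : act (x + y) b = act x b + act y b
  act_add (x : E) (b c : B) : act x (b + c) = act x b + act x c
  smul_act (r : ℝ) (x : E) (b : B) : act (r • x) b = r • act x b
  act_smul (r : ℝ) (x : E) (b : B) : act x (r • b) = r • act x b
  act_mul (x : E) (b c : B) : act x (b * c) = act (act x b) c
  inner_add_right (x y z : E) : inner x (y + z) = inner x y + inner x z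
  inner_smul_right (r : ℝ) (x y : E) : inner x (r • y) = r • inner x y
  inner_act_right (x y : E) (b : B) : inner x (act y b) = inner x y * b
  star_inner (x y : E) : star (inner x y) = inner y x
  inner_self_mem (x : E) : inner x x ∈ posCone B
  norm_sq (x : E) : ‖x‖ ^ 2 = ‖inner x x‖


section HilbertModule

variable (B : Type v) [NonUnitalNormedRing B] [StarRing B] [NormedSpace ℝ B]
variable (E : Type w) [NormedAddCommGroup E] [NormedSpace ℝ E] [HilbertModule B E]

/-- `E` is countably generated: it has a countable subset `s` such that the closed submodule
generated by `s` is `E`. -/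
def CountablyGenerated : Prop :=
  ∃ s : Set E, s.Countable ∧
    Dense (Submodule.span ℝ {y : E | ∃ x ∈ s, ∃ b : B, y = HilbertModule.act x b} : Set E)

/-- The compact operators `𝒦(E)`: the closed linear span of the rank one operators
`z ↦ x · ⟪y, z⟫`. -/
def compactOperators : Submodule ℝ (E →L[ℝ] E) :=
  (Submodule.span ℝ
    {T : E →L[ℝ] E | ∃ x y : E, ∀ z, T z = HilbertModule.act x (inner B y z)}).topologicalClosure

variable {E} in
/-- `S` is the adjoint of `T`; the operators that have an adjoint form `ℒ(E)`. -/
def IsAdjointOf (S T : E →L[ℝ] E) : Prop :=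
  ∀ x y : E, inner B (T x) y = inner B x (S y)

end HilbertModule

/-! ### Kasparov bimodules -/

/-- A Kasparov `(A, B)`-bimodule `(E, φ, T)` for `A` and `B` with their trivial gradings. The grading
`E = E⁰ ⊕ E¹` of the countably generated Hilbert `B`-module `E` is given by its grading operator
`γ`, which is `1` on `E⁰` and `-1` on `E¹`; a degree zero operator commutes with `γ`, a degree one
operator anticommutes with `γ`. As every `φ a` has degree zero, the graded commutator of `T` and `φ a`
is the usual one. -/
structure KasparovBimodule (A : Type u) (B : Type v)
    [NonUnitalNormedRing A] [StarRing A] [NormedSpace ℝ A]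
    [NonUnitalNormedRing B] [StarRing B] [NormedSpace ℝ B] where
  E : Type v
  [normedAddCommGroup : NormedAddCommGroup E]
  [normedSpace : NormedSpace ℝ E]
  [completeSpace : CompleteSpace E]
  [hilbertModule : HilbertModule B E]
  countablyGenerated : CountablyGenerated B E
  γ : E →L[ℝ] E
  γ_sq : γ * γ = 1
  γ_act (x : E) (b : B) : γ (HilbertModule.act x b) = HilbertModule.act (γ x) b
  γ_inner (x y : E) : inner B (γ x) (γ y) = inner B x y
  φ : A →ₙₐ[ℝ] (E →L[ℝ] E)
  φ_star (a : A) : IsAdjointOf B (φ (star a)) (φ a)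
  φ_even (a : A) : γ * φ a = φ a * γ
  T : E →L[ℝ] E
  Tadj : E →L[ℝ] E
  T_adjoint : IsAdjointOf B Tadj T
  T_odd : γ * T = -(T * γ)
  compact_adjoint (a : A) : (T - Tadj) * φ a ∈ compactOperators B E
  compact_square (a : A) : (T * T - 1) * φ a ∈ compactOperators B E
  compact_commutator (a : A) : T * φ a - φ a * T ∈ compactOperators B E

attribute [instance] KasparovBimodule.normedAddCommGroup KasparovBimodule.normedSpace
  KasparovBimodule.completeSpace KasparovBimodule.hilbertModule

namespace KasparovBimodule

section

variable {A : Type u} [NonUnitalNormedRing A] [StarRing A] [NormedSpace ℝ A]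
variable {B : Type v} [NonUnitalNormedRing B] [StarRing B] [NormedSpace ℝ B]
variable {B' : Type v} [NonUnitalNormedRing B'] [StarRing B'] [NormedSpace ℝ B']

/-- Unitary equivalence: a degree zero unitary `u` intertwines the representations and operators. -/
def UnitarilyEquivalent (x y : KasparovBimodule A B) : Prop :=
  ∃ u : x.E ≃ₗ[ℝ] y.E,
    (∀ e f, inner B (u e) (u f) = inner B e f) ∧
    (∀ e, u (x.γ e) = y.γ (u e)) ∧
    (∀ a e, u (x.φ a e) = y.φ a (u e)) ∧
    (∀ e, u (x.T e) = y.T (u e))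

/-- `y` is the push-forward `(E ⊗_β B', φ ⊗ 1, T ⊗ 1)` of `x = (E, φ, T)` along `β : B → B'`: its
module is the completion of the algebraic tensor product `E ⊗ B'` for the inner product
`⟪e ⊗ b, f ⊗ c⟫ = b* β(⟪e, f⟫) c`, with canonical map `j`, and its operators act as `γ ⊗ 1`, `φ ⊗ 1`
and `T ⊗ 1`. (This determines `y` up to unitary equivalence.) -/
def IsPushforward (β : B →⋆ₙₐ[ℝ] B') (x : KasparovBimodule A B) (y : KasparovBimodule A B') :
    Prop :=
  ∃ j : x.E ⊗[ℝ] B' →ₗ[ℝ] y.E,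
    DenseRange j ∧
    (∀ e b c, j (e ⊗ₜ (b * c)) = HilbertModule.act (j (e ⊗ₜ b)) c) ∧
    (∀ e f b c, inner B' (j (e ⊗ₜ b)) (j (f ⊗ₜ c)) = star b * β (inner B e f) * c) ∧
    (∀ e b, y.γ (j (e ⊗ₜ b)) = j (x.γ e ⊗ₜ b)) ∧
    (∀ a e b, y.φ a (j (e ⊗ₜ b)) = j (x.φ a e ⊗ₜ b)) ∧
    (∀ e b, y.T (j (e ⊗ₜ b)) = j (x.T e ⊗ₜ b))

end

end KasparovBimodule

/-- Evaluation at `t ∈ [0, 1]`, a *-homomorphism from `B ⊗ C[0, 1] = C([0, 1], B)` to `B`. -/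
def evalAt (B : Type v) [NonUnitalNormedRing B] [StarRing B] [NormedStarGroup B] [NormedSpace ℝ B]
    (t : unitInterval) : C(unitInterval, B) →⋆ₙₐ[ℝ] B where
  toFun f := f t
  map_smul' _ _ := rfl
  map_zero' := rfl
  map_add' _ _ := rfl
  map_mul' _ _ := rfl
  map_star' _ := rfl

namespace KasparovBimodule

variable {A : Type u} [NonUnitalNormedRing A] [StarRing A] [NormedSpace ℝ A]
variable {B : Type v} [NonUnitalNormedRing B] [StarRing B] [NormedStarGroup B] [NormedSpace ℝ B]

/-- Homotopy of Kasparov bimodules, through a Kasparov `(A, B ⊗ C[0, 1])`-bimodule. -/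
def Homotopic (x₀ x₁ : KasparovBimodule A B) : Prop :=
  ∃ (z : KasparovBimodule A C(unitInterval, B)) (z₀ z₁ : KasparovBimodule A B),
    IsPushforward (evalAt B 0) z z₀ ∧ UnitarilyEquivalent z₀ x₀ ∧
    IsPushforward (evalAt B 1) z z₁ ∧ UnitarilyEquivalent z₁ x₁

end KasparovBimodule

/-! ### Direct sums of Hilbert modules -/

section Positivity

variable {B : Type v} [RealCStarAlgebra B]

/-- The quadratic form of a positive element in an isometric representation. -/
theorem isPositive_of_mem_posCone {H : Type v} [NormedAddCommGroup H] [InnerProductSpace ℝ H]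
    [CompleteSpace H] (π : B →⋆ₙₐ[ℝ] (H →L[ℝ] H)) {p : B} (hp : p ∈ posCone B) :
    (π p).IsPositive := by
  induction hp using AddSubmonoid.closure_induction with
  | mem x hx =>
    obtain ⟨s, rfl⟩ := hx
    rw [map_mul, map_star]
    exact ContinuousLinearMap.isPositive_adjoint_comp_self (π s)
  | zero => rw [map_zero]; exact ContinuousLinearMap.isPositive_zero
  | add x y _ _ hx hy => rw [map_add]; exact hx.add hy

theorem norm_le_iff_of_mem_posCone {H : Type v} [NormedAddCommGroup H] [InnerProductSpace ℝ H]
    [CompleteSpace H] {π : B →⋆ₙₐ[ℝ] (H →L[ℝ] H)} (hπ : Isometry π) {p : B} (hp : p ∈ posCone B)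
    {C : ℝ} (hC : 0 ≤ C) : ‖p‖ ≤ C ↔ ∀ ξ : H, inner ℝ (π p ξ) ξ ≤ C * ‖ξ‖ ^ 2 := by
  have hpos := isPositive_of_mem_posCone π hp
  have hn : ‖π p‖ = ‖p‖ := (AddMonoidHomClass.isometry_iff_norm π).1 hπ p
  constructor
  · intro h ξ
    calc inner ℝ (π p ξ) ξ ≤ ‖π p ξ‖ * ‖ξ‖ := real_inner_le_norm _ _
      _ ≤ (‖π p‖ * ‖ξ‖) * ‖ξ‖ := by gcongr; exact (π p).le_opNorm ξ
      _ ≤ (C * ‖ξ‖) * ‖ξ‖ := by rw [hn]; gcongr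
      _ = C * ‖ξ‖ ^ 2 := by ring
  · intro h
    rw [← hn, (π p).norm_eq_iSup_rayleighQuotient hpos.isSymmetric]
    refine ciSup_le fun ξ => ?_
    have h0 : 0 ≤ inner ℝ (π p ξ) ξ := hpos.inner_nonneg_left ξ
    rw [ContinuousLinearMap.rayleighQuotient, ContinuousLinearMap.reApplyInnerSelf_apply,
      RCLike.re_to_real, abs_of_nonneg (by positivity)]
    exact div_le_of_le_mul₀ (by positivity) hC (h ξ)

theorem norm_le_norm_add_of_mem_posCone {p q : B} (hp : p ∈ posCone B) (hq : q ∈ posCone B) :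
    ‖p‖ ≤ ‖p + q‖ := by
  obtain ⟨H, _, _, _, π, hπ⟩ := RealCStarAlgebra.exists_isometric_rep (A := B)
  rw [norm_le_iff_of_mem_posCone hπ hp (norm_nonneg _)]
  intro ξ
  have h1 := (norm_le_iff_of_mem_posCone hπ (add_mem hp hq) (norm_nonneg _)).1 le_rfl ξ
  have h2 : 0 ≤ inner ℝ (π q ξ) ξ := (isPositive_of_mem_posCone π hq).inner_nonneg_left ξ
  rw [map_add, add_apply, inner_add_left] at h1
  linarith

/-- The triangle inequality for the norm of a `B`-valued inner product. -/
theorem sqrt_norm_inner_add_le {M : Type w} [AddCommGroup M] [Module ℝ M] (f : M → M → B)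
    (f_add : ∀ x y z, f x (y + z) = f x y + f x z) (f_smul : ∀ (r : ℝ) x y, f x (r • y) = r • f x y)
    (f_star : ∀ x y, star (f x y) = f y x) (f_pos : ∀ x, f x x ∈ posCone B) (x y : M) :
    √‖f (x + y) (x + y)‖ ≤ √‖f x x‖ + √‖f y y‖ := by
  obtain ⟨H, _, _, _, π, hπ⟩ := RealCStarAlgebra.exists_isometric_rep (A := B)
  rw [Real.sqrt_le_left (by positivity), norm_le_iff_of_mem_posCone hπ (f_pos _) (by positivity)]
  intro ξ
  have f_add' : ∀ x y z, f (x + y) z = f x z + f y z := fun x y z => by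
    rw [← f_star, f_add, star_add, f_star, f_star]
  have hsymm : ∀ x y, inner ℝ (π (f x y) ξ) ξ = inner ℝ (π (f y x) ξ) ξ := fun x y => by
    rw [← f_star x y, map_star, ContinuousLinearMap.star_eq_adjoint,
      ContinuousLinearMap.adjoint_inner_left, real_inner_comm]
  have hx := (norm_le_iff_of_mem_posCone hπ (f_pos x) (norm_nonneg _)).1 le_rfl ξ
  have hy := (norm_le_iff_of_mem_posCone hπ (f_pos y) (norm_nonneg _)).1 le_rfl ξ
  have hquad : ∀ z, 0 ≤ inner ℝ (π (f z z) ξ) ξ := fun z =>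
    (isPositive_of_mem_posCone π (f_pos z)).inner_nonneg_left ξ
  set a := inner ℝ (π (f x x) ξ) ξ with ha
  set b := inner ℝ (π (f x y) ξ) ξ with hb
  set c := inner ℝ (π (f y y) ξ) ξ with hc
  have f_smul' : ∀ (r : ℝ) x y, f (r • x) y = r • f x y := fun r x y => by
    rw [← f_star, f_smul, star_smul, f_star]; simp
  have hd : ∀ r : ℝ, 0 ≤ c * (r * r) + 2 * b * r + a := fun r => by
    have h := hquad (x + r • y)
    simp only [f_add, f_add', f_smul, f_smul', map_add, map_smul, add_apply,
      smul_apply, inner_add_left, real_inner_smul_left] at h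
    rw [hsymm y x, ← ha, ← hb, ← hc] at h
    linarith
  have hdisc := discrim_le_zero hd
  rw [discrim] at hdisc
  have hbsq : b ^ 2 ≤ (√‖f x x‖ * √‖f y y‖ * ‖ξ‖ ^ 2) ^ 2 := by
    have h3 : a * c ≤ (‖f x x‖ * ‖ξ‖ ^ 2) * (‖f y y‖ * ‖ξ‖ ^ 2) :=
      mul_le_mul hx hy (hquad y) (by positivity)
    rw [mul_pow, mul_pow, Real.sq_sqrt (norm_nonneg _), Real.sq_sqrt (norm_nonneg _)]
    nlinarith
  have hb' : b ≤ √‖f x x‖ * √‖f y y‖ * ‖ξ‖ ^ 2 := le_of_abs_le (abs_le_of_sq_le_sq hbsq (by positivity))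
  simp only [f_add, f_add', map_add, add_apply, inner_add_left]
  rw [hsymm y x, ← ha, ← hb, ← hc]
  have h1 := Real.sq_sqrt (norm_nonneg (f x x))
  have h2 := Real.sq_sqrt (norm_nonneg (f y y))
  nlinarith

end Positivity

/-- The direct sum `E ⊕ F` of two Hilbert `B`-modules; the parameter `B` determines its norm. -/
@[ext]
structure HilbertSum (B : Type v) (E F : Type w) : Type w where
  fst : E
  snd : F

namespace HilbertSum

section Algebra

variable {B : Type v} {E F : Type w} [AddCommGroup E] [Module ℝ E] [AddCommGroup F] [Module ℝ F]

/-- The underlying set of `E ⊕ F` is `E × F`. -/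
def equivProd (B : Type v) (E F : Type w) : HilbertSum B E F ≃ E × F where
  toFun x := (x.fst, x.snd)
  invFun x := ⟨x.1, x.2⟩

instance {E F : Type w} [AddCommGroup E] [AddCommGroup F] : AddCommGroup (HilbertSum B E F) :=
  (equivProd B E F).addCommGroup

instance : Module ℝ (HilbertSum B E F) := (equivProd B E F).module ℝ

/-- The underlying vector space of `E ⊕ F` is `E × F`. -/
def linearEquivProd (B : Type v) (E F : Type w) [AddCommGroup E] [Module ℝ E] [AddCommGroup F]
    [Module ℝ F] : HilbertSum B E F ≃ₗ[ℝ] E × F :=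
  (equivProd B E F).linearEquiv ℝ

end Algebra

variable {B : Type v} [RealCStarAlgebra B]
variable {E F : Type w} [NormedAddCommGroup E] [NormedSpace ℝ E] [HilbertModule B E]
  [NormedAddCommGroup F] [NormedSpace ℝ F] [HilbertModule B F]

instance : Inner B (HilbertSum B E F) where
  inner x y := inner B x.fst y.fst + inner B x.snd y.snd

theorem inner_def (x y : HilbertSum B E F) :
    inner B x y = inner B x.fst y.fst + inner B x.snd y.snd := rfl

theorem inner_add_right (x y z : HilbertSum B E F) :
    inner B x (y + z) = inner B x y + inner B x z := by
  change inner B x.fst (y.fst + z.fst) + inner B x.snd (y.snd + z.snd) = _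
  rw [HilbertModule.inner_add_right, HilbertModule.inner_add_right, inner_def, inner_def]
  abel

theorem inner_smul_right (r : ℝ) (x y : HilbertSum B E F) :
    inner B x (r • y) = r • inner B x y := by
  change inner B x.fst (r • y.fst) + inner B x.snd (r • y.snd) = _
  rw [HilbertModule.inner_smul_right, HilbertModule.inner_smul_right, inner_def, smul_add]

theorem star_inner (x y : HilbertSum B E F) : star (inner B x y) = inner B y x := by
  rw [inner_def, star_add, HilbertModule.star_inner, HilbertModule.star_inner, inner_def]

theorem inner_self_mem (x : HilbertSum B E F) : inner B x x ∈ posCone B :=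
  add_mem (HilbertModule.inner_self_mem _) (HilbertModule.inner_self_mem _)

instance : Norm (HilbertSum B E F) where
  norm x := √‖inner B x x‖

theorem norm_sq (x : HilbertSum B E F) : ‖x‖ ^ 2 = ‖inner B x x‖ :=
  Real.sq_sqrt (norm_nonneg _)

theorem norm_fst_le (x : HilbertSum B E F) : ‖x.fst‖ ≤ ‖x‖ := by
  refine Real.le_sqrt_of_sq_le ?_
  rw [HilbertModule.norm_sq (B := B), inner_def]
  exact norm_le_norm_add_of_mem_posCone (HilbertModule.inner_self_mem _)
    (HilbertModule.inner_self_mem _)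

theorem norm_snd_le (x : HilbertSum B E F) : ‖x.snd‖ ≤ ‖x‖ := by
  refine Real.le_sqrt_of_sq_le ?_
  rw [HilbertModule.norm_sq (B := B), inner_def, add_comm]
  exact norm_le_norm_add_of_mem_posCone (HilbertModule.inner_self_mem _)
    (HilbertModule.inner_self_mem _)

theorem norm_le_add (x : HilbertSum B E F) : ‖x‖ ≤ ‖x.fst‖ + ‖x.snd‖ := by
  refine Real.sqrt_le_iff.2 ⟨by positivity, ?_⟩
  rw [inner_def]
  refine (norm_add_le _ _).trans ?_
  rw [← HilbertModule.norm_sq (B := B), ← HilbertModule.norm_sq (B := B)]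
  nlinarith [norm_nonneg x.fst, norm_nonneg x.snd]

theorem normedSpaceCore : NormedSpace.Core ℝ (HilbertSum B E F) where
  norm_nonneg _ := Real.sqrt_nonneg _
  norm_smul r x := by
    have h : inner B (r • x) (r • x) = (r * r) • inner B x x := by
      rw [inner_smul_right, ← star_inner, inner_smul_right, star_smul, star_inner, star_trivial,
        smul_smul]
    change √‖inner B (r • x) (r • x)‖ = ‖r‖ * √‖inner B x x‖
    rw [h, norm_smul, norm_mul, Real.sqrt_mul (by positivity), Real.sqrt_mul_self (norm_nonneg _)]
  norm_triangle x y := sqrt_norm_inner_add_le (fun x y : HilbertSum B E F => inner B x y)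
    inner_add_right inner_smul_right star_inner inner_self_mem x y
  norm_eq_zero_iff x := by
    constructor
    · intro h
      have h1 := norm_fst_le x
      have h2 := norm_snd_le x
      rw [h] at h1 h2
      exact HilbertSum.ext (norm_le_zero_iff.1 h1) (norm_le_zero_iff.1 h2)
    · rintro rfl
      refine le_antisymm ((norm_le_add _).trans_eq ?_) (Real.sqrt_nonneg _)
      change ‖(0 : E)‖ + ‖(0 : F)‖ = 0
      simp

instance : NormedAddCommGroup (HilbertSum B E F) := NormedAddCommGroup.ofCore normedSpaceCore

instance : NormedSpace ℝ (HilbertSum B E F) := NormedSpace.ofCore normedSpaceCore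

instance : HilbertModule B (HilbertSum B E F) where
  act x b := ⟨HilbertModule.act x.fst b, HilbertModule.act x.snd b⟩
  add_act _ _ _ := HilbertSum.ext (HilbertModule.add_act _ _ _) (HilbertModule.add_act _ _ _)
  act_add _ _ _ := HilbertSum.ext (HilbertModule.act_add _ _ _) (HilbertModule.act_add _ _ _)
  smul_act _ _ _ := HilbertSum.ext (HilbertModule.smul_act _ _ _) (HilbertModule.smul_act _ _ _)
  act_smul _ _ _ := HilbertSum.ext (HilbertModule.act_smul _ _ _) (HilbertModule.act_smul _ _ _)
  act_mul _ _ _ := HilbertSum.ext (HilbertModule.act_mul _ _ _) (HilbertModule.act_mul _ _ _)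
  inner_add_right := inner_add_right
  inner_smul_right := inner_smul_right
  inner_act_right x y b := by
    change inner B x.fst (HilbertModule.act y.fst b) + inner B x.snd (HilbertModule.act y.snd b) = _
    rw [HilbertModule.inner_act_right, HilbertModule.inner_act_right, ← add_mul]
    rfl
  star_inner := star_inner
  inner_self_mem := inner_self_mem
  norm_sq := norm_sq

/-- The topology of `E ⊕ F` is the product topology. -/
def equivL (B : Type v) [RealCStarAlgebra B] (E F : Type w)
    [NormedAddCommGroup E] [NormedSpace ℝ E] [HilbertModule B E]
    [NormedAddCommGroup F] [NormedSpace ℝ F] [HilbertModule B F] :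
    HilbertSum B E F ≃L[ℝ] E × F :=
  (linearEquivProd B E F).toContinuousLinearEquivOfBounds 1 2
    (fun x => by
      rw [one_mul]
      exact max_le (norm_fst_le x) (norm_snd_le x))
    (fun x => by
      refine (norm_le_add _).trans ?_
      rw [two_mul]
      exact add_le_add (_root_.norm_fst_le x) (_root_.norm_snd_le x))

instance [CompleteSpace E] [CompleteSpace F] : CompleteSpace (HilbertSum B E F) :=
  (completeSpace_congr (equivL B E F).isUniformEmbedding).2 inferInstance

/-- The operator `S ⊕ T` on `E ⊕ F`. -/
def diag (B : Type v) [RealCStarAlgebra B] {E F : Type w}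
    [NormedAddCommGroup E] [NormedSpace ℝ E] [HilbertModule B E]
    [NormedAddCommGroup F] [NormedSpace ℝ F] [HilbertModule B F]
    (S : E →L[ℝ] E) (T : F →L[ℝ] F) : HilbertSum B E F →L[ℝ] HilbertSum B E F :=
  ((equivL B E F).symm : E × F →L[ℝ] HilbertSum B E F) ∘L S.prodMap T ∘L
    (equivL B E F : HilbertSum B E F →L[ℝ] E × F)

theorem diag_apply (S : E →L[ℝ] E) (T : F →L[ℝ] F) (x : HilbertSum B E F) :
    diag B S T x = ⟨S x.fst, T x.snd⟩ := rfl

theorem diag_mul (S S' : E →L[ℝ] E) (T T' : F →L[ℝ] F) :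
    diag B S T * diag B S' T' = diag B (S * S') (T * T') := rfl

theorem diag_add (S S' : E →L[ℝ] E) (T T' : F →L[ℝ] F) :
    diag B S T + diag B S' T' = diag B (S + S') (T + T') := rfl

theorem diag_sub (S S' : E →L[ℝ] E) (T T' : F →L[ℝ] F) :
    diag B S T - diag B S' T' = diag B (S - S') (T - T') := rfl

theorem diag_neg (S : E →L[ℝ] E) (T : F →L[ℝ] F) : -diag B S T = diag B (-S) (-T) := rfl

theorem diag_one : diag B (1 : E →L[ℝ] E) (1 : F →L[ℝ] F) = 1 := rfl

theorem isAdjointOf_diag {S S' : E →L[ℝ] E} {T T' : F →L[ℝ] F} (hS : IsAdjointOf B S S')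
    (hT : IsAdjointOf B T T') : IsAdjointOf B (diag B S T) (diag B S' T') := fun x y => by
  simp only [inner_def, diag_apply]
  rw [hS, hT]

theorem inner_zero_right' (x : E) : inner B x (0 : E) = 0 := by
  have h := HilbertModule.inner_smul_right (B := B) 0 x x
  rwa [zero_smul, zero_smul] at h

theorem act_zero' (x : E) : HilbertModule.act x (0 : B) = 0 := by
  have h := HilbertModule.act_smul 0 x (0 : B)
  rwa [zero_smul, zero_smul] at h

theorem zero_act' (b : B) : HilbertModule.act (0 : E) b = 0 := by
  have h := HilbertModule.smul_act 0 (0 : E) b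
  rwa [zero_smul, zero_smul] at h

theorem inner_zero_left' (x : E) : inner B (0 : E) x = 0 := by
  rw [← HilbertModule.star_inner, inner_zero_right', star_zero]

/-- The linear map `S ↦ S ⊕ 0`. -/
def diagLeft : (E →L[ℝ] E) →L[ℝ] (HilbertSum B E F →L[ℝ] HilbertSum B E F) :=
  (LinearMap.mkContinuous
    { toFun := fun S => diag B S (0 : F →L[ℝ] F)
      map_add' := fun S S' => by rw [diag_add, add_zero]
      map_smul' := fun r S => by
        ext x
        · rfl
        · exact (smul_zero r).symm } 1 (fun S => by
    rw [one_mul]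
    refine ContinuousLinearMap.opNorm_le_bound _ (norm_nonneg _) fun x => ?_
    refine (norm_le_add (diag B S 0 x)).trans ?_
    simp only [diag_apply, zero_apply, norm_zero, add_zero]
    exact (S.le_opNorm _).trans (by gcongr; exact norm_fst_le x)))

/-- The linear map `T ↦ 0 ⊕ T`. -/
def diagRight : (F →L[ℝ] F) →L[ℝ] (HilbertSum B E F →L[ℝ] HilbertSum B E F) :=
  (LinearMap.mkContinuous
    { toFun := fun T => diag B (0 : E →L[ℝ] E) T
      map_add' := fun T T' => by rw [diag_add, add_zero]
      map_smul' := fun r T => by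
        ext x
        · exact (smul_zero r).symm
        · rfl } 1 (fun T => by
    rw [one_mul]
    refine ContinuousLinearMap.opNorm_le_bound _ (norm_nonneg _) fun x => ?_
    refine (norm_le_add (diag B 0 T x)).trans ?_
    simp only [diag_apply, zero_apply, norm_zero, zero_add]
    exact (T.le_opNorm _).trans (by gcongr; exact norm_snd_le x)))

theorem map_mem_of_mem_closure_span {X Y : Type*} [NormedAddCommGroup X] [NormedSpace ℝ X]
    [NormedAddCommGroup Y] [NormedSpace ℝ Y] (f : X →L[ℝ] Y) {s : Set X} {t : Set Y}
    (h : ∀ x ∈ s, f x ∈ t) {x : X} (hx : x ∈ (Submodule.span ℝ s).topologicalClosure) :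
    f x ∈ (Submodule.span ℝ t).topologicalClosure := by
  refine map_mem_closure f.continuous hx fun y hy => ?_
  have : Submodule.span ℝ s ≤ (Submodule.span ℝ t).comap (f : X →ₗ[ℝ] Y) :=
    Submodule.span_le.2 fun z hz => Submodule.subset_span (h z hz)
  exact this hy

theorem diag_mem_compactOperators {S : E →L[ℝ] E} {T : F →L[ℝ] F}
    (hS : S ∈ compactOperators B E) (hT : T ∈ compactOperators B F) :
    diag B S T ∈ compactOperators B (HilbertSum B E F) := by
  have h : diag B S T = diagLeft S + diagRight T := by
    change diag B S T = diag B S 0 + diag B 0 T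
    rw [diag_add, add_zero, zero_add]
  rw [h]
  refine add_mem (map_mem_of_mem_closure_span diagLeft ?_ hS)
    (map_mem_of_mem_closure_span diagRight ?_ hT)
  · rintro S ⟨x, y, hS⟩
    refine ⟨⟨x, 0⟩, ⟨y, 0⟩, fun z => ?_⟩
    change (⟨S z.fst, 0⟩ : HilbertSum B E F) =
      ⟨HilbertModule.act x (inner B y z.fst + inner B (0 : F) z.snd),
        HilbertModule.act (0 : F) (inner B y z.fst + inner B (0 : F) z.snd)⟩
    rw [inner_zero_left', add_zero, zero_act', hS]
  · rintro T ⟨x, y, hT⟩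
    refine ⟨⟨0, x⟩, ⟨0, y⟩, fun z => ?_⟩
    change (⟨0, T z.snd⟩ : HilbertSum B E F) =
      ⟨HilbertModule.act (0 : E) (inner B (0 : E) z.fst + inner B y z.snd),
        HilbertModule.act x (inner B (0 : E) z.fst + inner B y z.snd)⟩
    rw [inner_zero_left', zero_add, zero_act', hT]

theorem countablyGenerated (hE : CountablyGenerated B E) (hF : CountablyGenerated B F) :
    CountablyGenerated B (HilbertSum B E F) := by
  obtain ⟨s, hs, hs'⟩ := hE
  obtain ⟨t, ht, ht'⟩ := hF
  let i : E →L[ℝ] HilbertSum B E F :=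
    ((equivL B E F).symm : E × F →L[ℝ] HilbertSum B E F) ∘L ContinuousLinearMap.inl ℝ E F
  let j : F →L[ℝ] HilbertSum B E F :=
    ((equivL B E F).symm : E × F →L[ℝ] HilbertSum B E F) ∘L ContinuousLinearMap.inr ℝ E F
  refine ⟨i '' s ∪ j '' t, (hs.image _).union (ht.image _), fun x => ?_⟩
  have hx : x = i x.fst + j x.snd := by
    change x = (⟨x.fst + 0, 0 + x.snd⟩ : HilbertSum B E F)
    rw [add_zero, zero_add]
  rw [hx]
  change _ ∈ (Submodule.span ℝ _).topologicalClosure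
  refine add_mem (map_mem_of_mem_closure_span i ?_ (hs' _))
    (map_mem_of_mem_closure_span j ?_ (ht' _))
  · rintro _ ⟨y, hy, b, rfl⟩
    refine ⟨i y, Or.inl ⟨y, hy, rfl⟩, b, ?_⟩
    change (⟨HilbertModule.act y b, 0⟩ : HilbertSum B E F) =
      ⟨HilbertModule.act y b, HilbertModule.act (0 : F) b⟩
    rw [zero_act']
  · rintro _ ⟨y, hy, b, rfl⟩
    refine ⟨j y, Or.inr ⟨y, hy, rfl⟩, b, ?_⟩
    change (⟨0, HilbertModule.act y b⟩ : HilbertSum B E F) =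
      ⟨HilbertModule.act (0 : E) b, HilbertModule.act y b⟩
    rw [zero_act']

end HilbertSum

namespace KasparovBimodule

variable {A : Type u} [RealCStarAlgebra A] {B : Type v} [RealCStarAlgebra B]

/-- The direct sum `(E ⊕ F, φ ⊕ ψ, S ⊕ T)` of two Kasparov bimodules. -/
def sum (x y : KasparovBimodule A B) : KasparovBimodule A B where
  E := HilbertSum B x.E y.E
  countablyGenerated := HilbertSum.countablyGenerated x.countablyGenerated y.countablyGenerated
  γ := HilbertSum.diag B x.γ y.γ
  γ_sq := by rw [HilbertSum.diag_mul, x.γ_sq, y.γ_sq, HilbertSum.diag_one]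
  γ_act _ _ := HilbertSum.ext (x.γ_act _ _) (y.γ_act _ _)
  γ_inner e f := by
    simp only [HilbertSum.inner_def, HilbertSum.diag_apply]
    rw [x.γ_inner, y.γ_inner]
  φ :=
    { toFun := fun a => HilbertSum.diag B (x.φ a) (y.φ a)
      map_smul' := fun r a => by rw [map_smul, map_smul]; rfl
      map_zero' := by rw [map_zero, map_zero]; rfl
      map_add' := fun a b => by rw [map_add, map_add]; rfl
      map_mul' := fun a b => by rw [map_mul, map_mul]; rfl }
  φ_star a := HilbertSum.isAdjointOf_diag (x.φ_star a) (y.φ_star a)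
  φ_even a := by
    change HilbertSum.diag B x.γ y.γ * HilbertSum.diag B (x.φ a) (y.φ a) =
      HilbertSum.diag B (x.φ a) (y.φ a) * HilbertSum.diag B x.γ y.γ
    rw [HilbertSum.diag_mul, HilbertSum.diag_mul, x.φ_even, y.φ_even]
  T := HilbertSum.diag B x.T y.T
  Tadj := HilbertSum.diag B x.Tadj y.Tadj
  T_adjoint := HilbertSum.isAdjointOf_diag x.T_adjoint y.T_adjoint
  T_odd := by
    rw [HilbertSum.diag_mul, HilbertSum.diag_mul, HilbertSum.diag_neg, x.T_odd, y.T_odd]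
  compact_adjoint a :=
    HilbertSum.diag_mem_compactOperators (x.compact_adjoint a) (y.compact_adjoint a)
  compact_square a :=
    HilbertSum.diag_mem_compactOperators (x.compact_square a) (y.compact_square a)
  compact_commutator a :=
    HilbertSum.diag_mem_compactOperators (x.compact_commutator a) (y.compact_commutator a)

end KasparovBimodule

/-- `KK(A, B)`: the homotopy classes of Kasparov `(A, B)`-bimodules. (`Quot` divides by the equivalence
relation generated by homotopy, which is homotopy itself.) -/
def KK (A : Type u) (B : Type v) [RealCStarAlgebra A] [RealCStarAlgebra B] :
    Type (max u (v + 1)) :=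
  Quot (KasparovBimodule.Homotopic (A := A) (B := B))

/-- The class of a Kasparov bimodule in `KK(A, B)`. -/
def KK.mk {A : Type u} {B : Type v} [RealCStarAlgebra A] [RealCStarAlgebra B]
    (x : KasparovBimodule A B) : KK A B :=
  Quot.mk _ x

/-! ### The C*-algebra `𝒦 ⊗ B` -/

section Stabilization

variable {H : Type v} [NormedAddCommGroup H] [InnerProductSpace ℝ H]

/-- The Hilbert space `ℓ²(ℕ) ⊗ H = ℓ²(ℕ, H)`. -/
def L2 (H : Type v) [NormedAddCommGroup H] : Type v := lp (fun _ : ℕ => H) 2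

instance : NormedAddCommGroup (L2 H) := inferInstanceAs (NormedAddCommGroup (lp (fun _ : ℕ => H) 2))

instance : InnerProductSpace ℝ (L2 H) :=
  inferInstanceAs (InnerProductSpace ℝ (lp (fun _ : ℕ => H) 2))

instance [CompleteSpace H] : CompleteSpace (L2 H) :=
  inferInstanceAs (CompleteSpace (lp (fun _ : ℕ => H) 2))

namespace L2

/-- The inclusion of the `i`-th summand of `ℓ²(ℕ, H)`. -/
def single (H : Type v) [NormedAddCommGroup H] [InnerProductSpace ℝ H] (i : ℕ) : H →L[ℝ] L2 H :=
  lp.singleContinuousLinearMap ℝ (fun _ : ℕ => H) 2 i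

/-- The `i`-th coordinate on `ℓ²(ℕ, H)`. -/
def coord (H : Type v) [NormedAddCommGroup H] [InnerProductSpace ℝ H] (i : ℕ) : L2 H →L[ℝ] H :=
  lp.evalCLM ℝ (fun _ : ℕ => H) 2 i

theorem ext {ξ η : L2 H} (h : ∀ n, coord H n ξ = coord H n η) : ξ = η :=
  lp.ext (funext h)

theorem coord_single_self (i : ℕ) (h : H) : coord H i (single H i h) = h :=
  lp.single_apply_self (E := fun _ : ℕ => H) 2 i h

theorem coord_single_of_ne {i j : ℕ} (hij : j ≠ i) (h : H) : coord H j (single H i h) = 0 :=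
  lp.single_apply_ne (E := fun _ : ℕ => H) 2 i h hij

theorem inner_single_left (i : ℕ) (h : H) (ξ : L2 H) :
    inner ℝ (single H i h) ξ = inner ℝ h (coord H i ξ) :=
  lp.inner_single_left (𝕜 := ℝ) (G := fun _ : ℕ => H) i h ξ

theorem inner_single_right (i : ℕ) (h : H) (ξ : L2 H) :
    inner ℝ ξ (single H i h) = inner ℝ (coord H i ξ) h :=
  lp.inner_single_right (𝕜 := ℝ) (G := fun _ : ℕ => H) i h ξ

end L2

/-- The elementary tensor `e i j ⊗ T`, where `e i j` are the matrix units of `ℓ²(ℕ)`: the operator on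
`ℓ²(ℕ, H)` whose `(i, j)` entry is `T` and whose other entries vanish. -/
def matrixUnit (i j : ℕ) (T : H →L[ℝ] H) : L2 H →L[ℝ] L2 H :=
  L2.single H i ∘L T ∘L L2.coord H j

/-- For injective `σ : ℕ → ℕ` the coisometry `ξ ↦ ξ ∘ σ` of `ℓ²(ℕ, H)`. -/
def restriction (σ : ℕ ↪ ℕ) : L2 H →L[ℝ] L2 H :=
  LinearMap.mkContinuous (E := lp (fun _ : ℕ => H) 2) (F := lp (fun _ : ℕ => H) 2)
    { toFun := fun ξ => ⟨fun n => ξ (σ n), by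
        refine memℓp_gen ?_
        exact ((lp.memℓp ξ).summable (by norm_num)).comp_injective σ.injective⟩
      map_add' := fun _ _ => rfl
      map_smul' := fun _ _ => rfl } 1 (fun ξ => by
    rw [one_mul]
    refine lp.norm_le_of_forall_sum_le (by norm_num) (norm_nonneg _) fun s => ?_
    have h := lp.sum_rpow_le_norm_rpow (p := 2) (by norm_num) ξ (s.map σ)
    rwa [Finset.sum_map] at h)

theorem coord_restriction (σ : ℕ ↪ ℕ) (ξ : L2 H) (n : ℕ) :
    L2.coord H n (restriction σ ξ) = L2.coord H (σ n) ξ := rfl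

theorem matrixUnit_mul_restriction (σ : ℕ ↪ ℕ) (i j : ℕ) (T : H →L[ℝ] H) :
    matrixUnit i j T * restriction σ = matrixUnit i (σ j) T := rfl

theorem restriction_mul_matrixUnit (σ : ℕ ↪ ℕ) (i j : ℕ) (T : H →L[ℝ] H) :
    restriction σ * matrixUnit (σ i) j T = matrixUnit i j T := by
  refine ContinuousLinearMap.ext fun ξ => L2.ext fun n => ?_
  change L2.coord H (σ n) (L2.single H (σ i) (T (L2.coord H j ξ))) =
    L2.coord H n (L2.single H i (T (L2.coord H j ξ)))
  by_cases h : n = i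
  · subst h
    rw [L2.coord_single_self, L2.coord_single_self]
  · rw [L2.coord_single_of_ne h, L2.coord_single_of_ne (fun h' => h (σ.injective h'))]

theorem restriction_mul_matrixUnit_of_notMem (σ : ℕ ↪ ℕ) {i : ℕ} (j : ℕ) (T : H →L[ℝ] H)
    (hi : i ∉ Set.range σ) : restriction σ * matrixUnit i j T = 0 := by
  refine ContinuousLinearMap.ext fun ξ => L2.ext fun n => ?_
  exact L2.coord_single_of_ne (fun h => hi ⟨n, h⟩) _

variable [CompleteSpace H]

theorem star_matrixUnit (i j : ℕ) (T : H →L[ℝ] H) :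
    star (matrixUnit i j T) = matrixUnit j i (star T) := by
  rw [ContinuousLinearMap.star_eq_adjoint]
  symm
  rw [ContinuousLinearMap.eq_adjoint_iff]
  intro ξ η
  change inner ℝ (L2.single H j (star T (L2.coord H i ξ))) η =
    inner ℝ ξ (L2.single H i (T (L2.coord H j η)))
  rw [L2.inner_single_left, L2.inner_single_right, ContinuousLinearMap.star_eq_adjoint,
    ContinuousLinearMap.adjoint_inner_left]

variable {B : Type v} [RealCStarAlgebra B]

/-- The spatial tensor product `𝒦 ⊗ π(B)` on `ℓ²(ℕ, H)`, where `𝒦` is the algebra of compact operators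
of `ℓ²(ℕ)`: the closed *-algebra generated by the elementary tensors `e i j ⊗ π b`. -/
def spatialTensor (π : B →⋆ₙₐ[ℝ] (H →L[ℝ] H)) : NonUnitalStarSubalgebra ℝ (L2 H →L[ℝ] L2 H) :=
  (NonUnitalStarAlgebra.adjoin ℝ
    {T : L2 H →L[ℝ] L2 H | ∃ i j b, T = matrixUnit i j (π b)}).topologicalClosure

theorem matrixUnit_mem_adjoin (π : B →⋆ₙₐ[ℝ] (H →L[ℝ] H)) (i j : ℕ) (b : B) :
    matrixUnit i j (π b) ∈ NonUnitalStarAlgebra.adjoin ℝ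
      {T : L2 H →L[ℝ] L2 H | ∃ i j b, T = matrixUnit i j (π b)} :=
  NonUnitalStarAlgebra.subset_adjoin ℝ _ ⟨i, j, b, rfl⟩

theorem restriction_mem_adjoin (π : B →⋆ₙₐ[ℝ] (H →L[ℝ] H)) (σ : ℕ ↪ ℕ) {x : L2 H →L[ℝ] L2 H}
    (hx : x ∈ NonUnitalStarAlgebra.adjoin ℝ
      {T : L2 H →L[ℝ] L2 H | ∃ i j b, T = matrixUnit i j (π b)}) :
    (restriction σ * x ∈ NonUnitalStarAlgebra.adjoin ℝ
        {T : L2 H →L[ℝ] L2 H | ∃ i j b, T = matrixUnit i j (π b)} ∧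
      x * restriction σ ∈ NonUnitalStarAlgebra.adjoin ℝ
        {T : L2 H →L[ℝ] L2 H | ∃ i j b, T = matrixUnit i j (π b)}) ∧
    (restriction σ * star x ∈ NonUnitalStarAlgebra.adjoin ℝ
        {T : L2 H →L[ℝ] L2 H | ∃ i j b, T = matrixUnit i j (π b)} ∧
      star x * restriction σ ∈ NonUnitalStarAlgebra.adjoin ℝ
        {T : L2 H →L[ℝ] L2 H | ∃ i j b, T = matrixUnit i j (π b)}) := by
  have key : ∀ i j b, restriction σ * matrixUnit i j (π b) ∈ NonUnitalStarAlgebra.adjoin ℝ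
        {T : L2 H →L[ℝ] L2 H | ∃ i j b, T = matrixUnit i j (π b)} ∧
      matrixUnit i j (π b) * restriction σ ∈ NonUnitalStarAlgebra.adjoin ℝ
        {T : L2 H →L[ℝ] L2 H | ∃ i j b, T = matrixUnit i j (π b)} := fun i j b => by
    refine ⟨?_, matrixUnit_mem_adjoin π i (σ j) b⟩
    by_cases hi : i ∈ Set.range σ
    · obtain ⟨k, rfl⟩ := hi
      rw [restriction_mul_matrixUnit]
      exact matrixUnit_mem_adjoin π k j b
    · rw [restriction_mul_matrixUnit_of_notMem σ j _ hi]
      exact zero_mem _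
  induction hx using NonUnitalStarAlgebra.adjoin_induction with
  | mem x hx =>
    obtain ⟨i, j, b, rfl⟩ := hx
    rw [star_matrixUnit, ← map_star]
    exact ⟨key i j b, key j i (star b)⟩
  | add x y _ _ hx hy =>
    simp only [star_add, mul_add, add_mul]
    exact ⟨⟨add_mem hx.1.1 hy.1.1, add_mem hx.1.2 hy.1.2⟩,
      ⟨add_mem hx.2.1 hy.2.1, add_mem hx.2.2 hy.2.2⟩⟩
  | zero => simp only [star_zero, mul_zero, zero_mul, zero_mem, and_self]
  | mul x y hx' hy' hx hy =>
    simp only [star_mul]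
    refine ⟨⟨?_, ?_⟩, ⟨?_, ?_⟩⟩
    · rw [← mul_assoc]; exact mul_mem hx.1.1 hy'
    · rw [mul_assoc]; exact mul_mem hx' hy.1.2
    · rw [← mul_assoc]; exact mul_mem hy.2.1 (star_mem hx')
    · rw [mul_assoc]; exact mul_mem (star_mem hy') hx.2.2
  | smul r x _ hx =>
    simp only [star_smul, star_trivial, mul_smul_comm, smul_mul_assoc]
    exact ⟨⟨SMulMemClass.smul_mem r hx.1.1, SMulMemClass.smul_mem r hx.1.2⟩,
      ⟨SMulMemClass.smul_mem r hx.2.1, SMulMemClass.smul_mem r hx.2.2⟩⟩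
  | star x _ hx => rw [star_star]; exact ⟨hx.2, hx.1⟩

theorem restriction_mul_mem (π : B →⋆ₙₐ[ℝ] (H →L[ℝ] H)) (σ : ℕ ↪ ℕ) {x : L2 H →L[ℝ] L2 H}
    (hx : x ∈ spatialTensor π) : restriction σ * x ∈ spatialTensor π :=
  map_mem_closure (f := fun y => restriction σ * y) (continuous_const_mul (restriction σ)) hx
    fun _ hy => (restriction_mem_adjoin π σ hy).1.1

theorem mul_restriction_mem (π : B →⋆ₙₐ[ℝ] (H →L[ℝ] H)) (σ : ℕ ↪ ℕ) {x : L2 H →L[ℝ] L2 H}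
    (hx : x ∈ spatialTensor π) : x * restriction σ ∈ spatialTensor π :=
  map_mem_closure (f := fun y => y * restriction σ) (continuous_mul_const (restriction σ)) hx
    fun _ hy => (restriction_mem_adjoin π σ hy).1.2

variable (B)

/-- The Hilbert space of a chosen isometric representation of `B`. -/
def RepSpace : Type v := (RealCStarAlgebra.exists_isometric_rep (A := B)).choose

instance : NormedAddCommGroup (RepSpace B) :=
  (RealCStarAlgebra.exists_isometric_rep (A := B)).choose_spec.choose

instance : InnerProductSpace ℝ (RepSpace B) :=
  (RealCStarAlgebra.exists_isometric_rep (A := B)).choose_spec.choose_spec.choose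

instance : CompleteSpace (RepSpace B) :=
  (RealCStarAlgebra.exists_isometric_rep (A := B)).choose_spec.choose_spec.choose_spec.choose

/-- A chosen isometric representation of `B`. -/
def rep : B →⋆ₙₐ[ℝ] (RepSpace B →L[ℝ] RepSpace B) :=
  (RealCStarAlgebra.exists_isometric_rep
    (A := B)).choose_spec.choose_spec.choose_spec.choose_spec.choose

theorem isometry_rep : Isometry (rep B) :=
  (RealCStarAlgebra.exists_isometric_rep
    (A := B)).choose_spec.choose_spec.choose_spec.choose_spec.choose_spec

/-- The real C*-algebra `𝒦 ⊗ B`. (Up to isomorphism, the spatial tensor product does not depend on the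
faithful representation of `B`, and it is the only C*-tensor product since `𝒦` is nuclear.) -/
def KTensor : Type v := spatialTensor (rep B)

instance : NonUnitalNormedRing (KTensor B) :=
  inferInstanceAs (NonUnitalNormedRing (spatialTensor (rep B)))

instance : StarRing (KTensor B) := inferInstanceAs (StarRing (spatialTensor (rep B)))

instance : CompleteSpace (KTensor B) :=
  (NonUnitalStarSubalgebra.isClosed_topologicalClosure _).completeSpace_coe

instance : CStarRing (KTensor B) := ⟨fun x => CStarRing.norm_mul_self_le x.1⟩

instance : NormedSpace ℝ (KTensor B) where
  toModule := inferInstanceAs (Module ℝ (spatialTensor (rep B)))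
  norm_smul_le r x := norm_smul_le r x.1

instance : RealCStarAlgebra (KTensor B) where
  smul_assoc r x y := Subtype.ext (smul_mul_assoc r x.1 y.1)
  smul_comm r x y := Subtype.ext (mul_smul_comm r x.1 y.1).symm
  star_smul r x := Subtype.ext (star_smul r x.1)
  exists_isometric_rep := ⟨L2 (RepSpace B), inferInstance, inferInstance, inferInstance,
    { toFun := Subtype.val
      map_smul' := fun _ _ => rfl
      map_zero' := rfl
      map_add' := fun _ _ => rfl
      map_mul' := fun _ _ => rfl
      map_star' := fun _ => rfl }, isometry_subtype_coe⟩

/-- The multiplier of `𝒦 ⊗ B` given by the coisometry `ξ ↦ ξ ∘ σ` of `ℓ²(ℕ)`. -/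
def restrictionMultiplier (σ : ℕ ↪ ℕ) : 𝓜(ℝ, KTensor B) where
  fst := LinearMap.mkContinuous
    { toFun := fun x => ⟨restriction σ * x.1, restriction_mul_mem _ σ x.2⟩
      map_add' := fun x y => Subtype.ext (mul_add _ x.1 y.1)
      map_smul' := fun r x => Subtype.ext (mul_smul_comm r _ x.1) } ‖restriction (H := RepSpace B) σ‖
    (fun x => norm_mul_le _ x.1)
  snd := LinearMap.mkContinuous
    { toFun := fun x => ⟨x.1 * restriction σ, mul_restriction_mem _ σ x.2⟩
      map_add' := fun x y => Subtype.ext (add_mul x.1 y.1 _)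
      map_smul' := fun r x => Subtype.ext (smul_mul_assoc r x.1 _) } ‖restriction (H := RepSpace B) σ‖
    (fun x => (norm_mul_le x.1 _).trans_eq (mul_comm _ _))
  central x y := Subtype.ext (mul_assoc x.1 (restriction σ) y.1)

end Stabilization

/-! ### The Fredholm picture -/

/-- A cycle `(φ₊, φ₋, U)` for `A` with values in the multiplier algebra of the C*-algebra `J`, modulo
its ideal `J`. For `J = 𝒦 ⊗ B` these are the `KK(A, B)`-cycles. -/
@[ext]
structure FredholmCycle (A : Type u) (J : Type v) [NonUnitalNormedRing A] [StarRing A]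
    [NormedSpace ℝ A] [NonUnitalNormedRing J] [StarRing J] [NormedStarGroup J] [NormedSpace ℝ J]
    [IsScalarTower ℝ J J] [SMulCommClass ℝ J J] [StarModule ℝ J] where
  φpos : A →⋆ₙₐ[ℝ] 𝓜(ℝ, J)
  φneg : A →⋆ₙₐ[ℝ] 𝓜(ℝ, J)
  U : 𝓜(ℝ, J)
  intertwine_mem (a : A) :
    U * φpos a - φneg a * U ∈ Set.range (DoubleCentralizer.coe ℝ : J → 𝓜(ℝ, J))
  pos_mem (a : A) :
    φpos a * (star U * U - 1) ∈ Set.range (DoubleCentralizer.coe ℝ : J → 𝓜(ℝ, J))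
  neg_mem (a : A) :
    φneg a * (U * star U - 1) ∈ Set.range (DoubleCentralizer.coe ℝ : J → 𝓜(ℝ, J))

section Multiplier

variable {J : Type v} [NonUnitalNormedRing J] [NormedSpace ℝ J]
    [IsScalarTower ℝ J J] [SMulCommClass ℝ J J]

/-- The map `𝓜(C([0, 1], J)) → 𝓜(J)` induced by evaluation at `t`. It is computed here on the constant
functions; see `multiplierEval_fst` and `multiplierEval_snd`. -/
def multiplierEval (t : unitInterval) (m : 𝓜(ℝ, C(unitInterval, J))) : 𝓜(ℝ, J) where
  fst := ContinuousMap.evalCLM ℝ t ∘L m.fst ∘L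
    { toFun := ContinuousMap.const unitInterval
      map_add' := fun _ _ => rfl
      map_smul' := fun _ _ => rfl
      cont := ContinuousMap.continuous_const' }
  snd := ContinuousMap.evalCLM ℝ t ∘L m.snd ∘L
    { toFun := ContinuousMap.const unitInterval
      map_add' := fun _ _ => rfl
      map_smul' := fun _ _ => rfl
      cont := ContinuousMap.continuous_const' }
  central x y := congrArg (fun f : C(unitInterval, J) => f t)
    (m.central (ContinuousMap.const unitInterval x) (ContinuousMap.const unitInterval y))

theorem multiplierEval_fst [StarRing J] [CStarRing J] (t : unitInterval) (m : 𝓜(ℝ, C(unitInterval, J)))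
    (f : C(unitInterval, J)) : (multiplierEval t m).fst (f t) = m.fst f t := by
  have h : ∀ y : J, y * (multiplierEval t m).fst (f t) = y * m.fst f t := fun y => by
    rw [← (multiplierEval t m).central]
    exact congrArg (fun f : C(unitInterval, J) => f t)
      (m.central (ContinuousMap.const unitInterval y) f)
  have h' := h (star ((multiplierEval t m).fst (f t) - m.fst f t))
  rw [← sub_eq_zero, ← mul_sub] at h'
  exact sub_eq_zero.1 (CStarRing.star_mul_self_eq_zero_iff _ |>.1 h')

theorem multiplierEval_snd [StarRing J] [CStarRing J] (t : unitInterval) (m : 𝓜(ℝ, C(unitInterval, J)))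
    (f : C(unitInterval, J)) : (multiplierEval t m).snd (f t) = m.snd f t := by
  have h : ∀ y : J, (multiplierEval t m).snd (f t) * y = m.snd f t * y := fun y => by
    rw [(multiplierEval t m).central]
    exact (congrArg (fun f : C(unitInterval, J) => f t)
      (m.central f (ContinuousMap.const unitInterval y))).symm
  have h' := h (star ((multiplierEval t m).snd (f t) - m.snd f t))
  rw [← sub_eq_zero, ← sub_mul] at h'
  exact sub_eq_zero.1 (CStarRing.mul_star_self_eq_zero_iff _ |>.1 h')

theorem fst_mul [StarRing J] [CStarRing J] (m : 𝓜(ℝ, J)) (x y : J) : m.fst (x * y) = m.fst x * y := by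
  have h : ∀ z : J, z * (m.fst (x * y) - m.fst x * y) = 0 := fun z => by
    rw [mul_sub, ← m.central, ← mul_assoc, ← mul_assoc, ← m.central, sub_self]
  exact sub_eq_zero.1 (CStarRing.star_mul_self_eq_zero_iff _ |>.1 (h _))

theorem mul_snd [StarRing J] [CStarRing J] (m : 𝓜(ℝ, J)) (x y : J) : m.snd (x * y) = x * m.snd y := by
  have h : ∀ z : J, (m.snd (x * y) - x * m.snd y) * z = 0 := fun z => by
    rw [sub_mul, m.central, mul_assoc, mul_assoc, m.central, sub_self]
  exact sub_eq_zero.1 (CStarRing.mul_star_self_eq_zero_iff _ |>.1 (h _))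

theorem mul_coe_mem [StarRing J] [CStarRing J] (m : 𝓜(ℝ, J)) {x : 𝓜(ℝ, J)}
    (hx : x ∈ Set.range (DoubleCentralizer.coe ℝ : J → 𝓜(ℝ, J))) :
    m * x ∈ Set.range (DoubleCentralizer.coe ℝ : J → 𝓜(ℝ, J)) := by
  obtain ⟨j, rfl⟩ := hx
  refine ⟨m.fst j, DoubleCentralizer.ext ℝ J _ _ (Prod.ext (ContinuousLinearMap.ext fun y => ?_)
    (ContinuousLinearMap.ext fun y => ?_))⟩
  · change m.fst j * y = m.fst (j * y)
    exact (fst_mul m j y).symm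
  · exact (m.central y j).symm

theorem coe_mul_mem [StarRing J] [CStarRing J] (m : 𝓜(ℝ, J)) {x : 𝓜(ℝ, J)}
    (hx : x ∈ Set.range (DoubleCentralizer.coe ℝ : J → 𝓜(ℝ, J))) :
    x * m ∈ Set.range (DoubleCentralizer.coe ℝ : J → 𝓜(ℝ, J)) := by
  obtain ⟨j, rfl⟩ := hx
  refine ⟨m.snd j, DoubleCentralizer.ext ℝ J _ _ (Prod.ext (ContinuousLinearMap.ext fun y => ?_)
    (ContinuousLinearMap.ext fun y => ?_))⟩
  · exact m.central j y
  · change y * m.snd j = m.snd (y * j)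
    exact (mul_snd m y j).symm

end Multiplier

section CornerSum

variable {B : Type v} [RealCStarAlgebra B]

/-- `n ↦ 2 n`. -/
def evenEmb : ℕ ↪ ℕ := ⟨fun n => 2 * n, fun _ _ h => by simpa using h⟩

/-- `n ↦ 2 n + 1`. -/
def oddEmb : ℕ ↪ ℕ := ⟨fun n => 2 * n + 1, fun _ _ h => by simpa using h⟩

theorem restriction_mul_star_restriction {H : Type v} [NormedAddCommGroup H]
    [InnerProductSpace ℝ H] [CompleteSpace H] (σ : ℕ ↪ ℕ) :
    (restriction σ : L2 H →L[ℝ] L2 H) * star (restriction σ) = 1 := by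
  refine ContinuousLinearMap.ext fun ξ => L2.ext fun n => ext_inner_left ℝ fun h => ?_
  change inner ℝ h (L2.coord H (σ n) (star (restriction σ) ξ)) = inner ℝ h (L2.coord H n ξ)
  rw [← L2.inner_single_left, ← L2.inner_single_left, ContinuousLinearMap.star_eq_adjoint,
    ContinuousLinearMap.adjoint_inner_right]
  congr 1
  refine L2.ext fun m => ?_
  rw [coord_restriction]
  by_cases hm : m = n
  · subst hm
    rw [L2.coord_single_self, L2.coord_single_self]
  · rw [L2.coord_single_of_ne hm, L2.coord_single_of_ne (fun h' => hm (σ.injective h'))]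

theorem restriction_mul_star_restriction_of_ne {H : Type v} [NormedAddCommGroup H]
    [InnerProductSpace ℝ H] [CompleteSpace H] {σ τ : ℕ ↪ ℕ} (hστ : ∀ m n, τ m ≠ σ n) :
    (restriction σ : L2 H →L[ℝ] L2 H) * star (restriction τ) = 0 := by
  refine ContinuousLinearMap.ext fun ξ => L2.ext fun n => ext_inner_left ℝ fun h => ?_
  change inner ℝ h (L2.coord H (σ n) (star (restriction τ) ξ)) = inner ℝ h (0 : H)
  rw [← L2.inner_single_left, ContinuousLinearMap.star_eq_adjoint,
    ContinuousLinearMap.adjoint_inner_right, inner_zero_right]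
  have : restriction τ (L2.single H (σ n) h) = 0 := L2.ext fun m => by
    rw [coord_restriction, L2.coord_single_of_ne (hστ m n), map_zero]
  rw [this, inner_zero_left]

theorem restrictionMultiplier_fst (σ : ℕ ↪ ℕ) (x : KTensor B) :
    ((restrictionMultiplier B σ).fst x).1 =
      restriction σ * x.1 := rfl

theorem restrictionMultiplier_mul_star (σ τ : ℕ ↪ ℕ) (x : KTensor B) :
    ((restrictionMultiplier B σ * star (restrictionMultiplier B τ)).fst x).1 =
       restriction σ * star (restriction τ) * x.1 ∧
    ((restrictionMultiplier B σ * star (restrictionMultiplier B τ)).snd x).1 =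
       x.1 * (restriction σ * star (restriction τ)) := by
  constructor
  · change restriction σ * star (star x.1 * restriction τ) = _
    rw [star_mul, star_star, mul_assoc]
  · change star (restriction τ * star (x.1 * restriction σ)) = _
    rw [star_mul, star_star, mul_assoc]

theorem restrictionMultiplier_mul_star_self (σ : ℕ ↪ ℕ) :
    restrictionMultiplier B σ * star (restrictionMultiplier B σ) = 1 := by
  refine DoubleCentralizer.ext ℝ (KTensor B) _ _ (Prod.ext (ContinuousLinearMap.ext fun x =>
    Subtype.ext ?_) (ContinuousLinearMap.ext fun x => Subtype.ext ?_))
  · rw [(restrictionMultiplier_mul_star σ σ x).1, restriction_mul_star_restriction, one_mul]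
    rfl
  · rw [(restrictionMultiplier_mul_star σ σ x).2, restriction_mul_star_restriction, mul_one]
    rfl

theorem restrictionMultiplier_mul_star_of_ne {σ τ : ℕ ↪ ℕ} (hστ : ∀ m n, τ m ≠ σ n) :
    restrictionMultiplier B σ * star (restrictionMultiplier B τ) = 0 := by
  refine DoubleCentralizer.ext ℝ (KTensor B) _ _ (Prod.ext (ContinuousLinearMap.ext fun x =>
    Subtype.ext ?_) (ContinuousLinearMap.ext fun x => Subtype.ext ?_))
  · rw [(restrictionMultiplier_mul_star σ τ x).1, restriction_mul_star_restriction_of_ne hστ,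
      zero_mul]
    rfl
  · rw [(restrictionMultiplier_mul_star σ τ x).2, restriction_mul_star_restriction_of_ne hστ,
      mul_zero]
    rfl

/-- The diagonal matrix with entries `m` and `n`, where `M₂(𝓜(𝒦 ⊗ B))` is identified with
`𝓜(𝒦 ⊗ B)` by means of the isomorphism `M₂(𝒦) ≅ 𝒦` that is given by the decomposition of `ℕ` into the
even and the odd numbers. -/
def cornerSum (m n : 𝓜(ℝ, KTensor B)) : 𝓜(ℝ, KTensor B) :=
  star (restrictionMultiplier B evenEmb) * m * restrictionMultiplier B evenEmb +
    star (restrictionMultiplier B oddEmb) * n * restrictionMultiplier B oddEmb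

theorem cornerSum_mul (m n m' n' : 𝓜(ℝ, KTensor B)) :
    cornerSum m n * cornerSum m' n' = cornerSum (m * m') (n * n') := by
  have h1 := restrictionMultiplier_mul_star_self (B := B) evenEmb
  have h2 := restrictionMultiplier_mul_star_self (B := B) oddEmb
  have h3 : restrictionMultiplier B evenEmb * star (restrictionMultiplier B oddEmb) = 0 :=
    restrictionMultiplier_mul_star_of_ne fun m n h => by
      change 2 * m + 1 = 2 * n at h
      omega
  have h4 : restrictionMultiplier B oddEmb * star (restrictionMultiplier B evenEmb) = 0 :=
    restrictionMultiplier_mul_star_of_ne fun m n h => by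
      change 2 * m = 2 * n + 1 at h
      omega
  unfold cornerSum
  generalize restrictionMultiplier B evenEmb = p at *
  generalize restrictionMultiplier B oddEmb = q at *
  have e1 : star p * m * p * (star p * m' * p) = star p * (m * m') * p := by
    calc _ = star p * m * (p * star p) * m' * p := by noncomm_ring
      _ = _ := by rw [h1]; noncomm_ring
  have e2 : star q * n * q * (star q * n' * q) = star q * (n * n') * q := by
    calc _ = star q * n * (q * star q) * n' * q := by noncomm_ring
      _ = _ := by rw [h2]; noncomm_ring
  have e3 : star p * m * p * (star q * n' * q) = 0 := by
    calc _ = star p * m * (p * star q) * n' * q := by noncomm_ring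
      _ = _ := by rw [h3]; noncomm_ring
  have e4 : star q * n * q * (star p * m' * p) = 0 := by
    calc _ = star q * n * (q * star p) * m' * p := by noncomm_ring
      _ = _ := by rw [h4]; noncomm_ring
  rw [add_mul, mul_add, mul_add, e1, e2, e3, e4, add_zero, zero_add]

theorem cornerSum_star (m n : 𝓜(ℝ, KTensor B)) :
    star (cornerSum m n) = cornerSum (star m) (star n) := by
  simp only [cornerSum, star_add, star_mul, star_star, mul_assoc]

theorem cornerSum_add (m n m' n' : 𝓜(ℝ, KTensor B)) :
    cornerSum (m + m') (n + n') = cornerSum m n + cornerSum m' n' := by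
  simp only [cornerSum, mul_add, add_mul]
  abel

theorem cornerSum_sub (m n m' n' : 𝓜(ℝ, KTensor B)) :
    cornerSum (m - m') (n - n') = cornerSum m n - cornerSum m' n' := by
  simp only [cornerSum, mul_sub, sub_mul]
  abel

theorem cornerSum_zero : cornerSum (0 : 𝓜(ℝ, KTensor B)) 0 = 0 := by
  simp only [cornerSum, mul_zero, zero_mul, add_zero]

theorem cornerSum_smul (r : ℝ) (m n : 𝓜(ℝ, KTensor B)) :
    cornerSum (r • m) (r • n) = r • cornerSum m n := by
  simp only [cornerSum, mul_smul_comm, smul_mul_assoc, smul_add]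

theorem cornerSum_mem {m n : 𝓜(ℝ, KTensor B)}
    (hm : m ∈ Set.range (DoubleCentralizer.coe ℝ : KTensor B → 𝓜(ℝ, KTensor B)))
    (hn : n ∈ Set.range (DoubleCentralizer.coe ℝ : KTensor B → 𝓜(ℝ, KTensor B))) :
    cornerSum m n ∈ Set.range (DoubleCentralizer.coe ℝ : KTensor B → 𝓜(ℝ, KTensor B)) := by
  obtain ⟨x, hx⟩ := coe_mul_mem (restrictionMultiplier B evenEmb)
    (mul_coe_mem (star (restrictionMultiplier B evenEmb)) hm)
  obtain ⟨y, hy⟩ := coe_mul_mem (restrictionMultiplier B oddEmb)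
    (mul_coe_mem (star (restrictionMultiplier B oddEmb)) hn)
  refine ⟨x + y, ?_⟩
  rw [cornerSum, ← hx, ← hy]
  exact map_add (DoubleCentralizer.coeHom (𝕜 := ℝ) (A := KTensor B)) x y

variable {A : Type u} [RealCStarAlgebra A]

/-- The direct sum of two *-homomorphisms into `𝓜(𝒦 ⊗ B)`. -/
def cornerSumHom (φ ψ : A →⋆ₙₐ[ℝ] 𝓜(ℝ, KTensor B)) : A →⋆ₙₐ[ℝ] 𝓜(ℝ, KTensor B) where
  toFun a := cornerSum (φ a) (ψ a)
  map_smul' r a := by rw [map_smul, map_smul, cornerSum_smul]; rfl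
  map_zero' := by rw [map_zero, map_zero, cornerSum_zero]
  map_add' a b := by rw [map_add, map_add, cornerSum_add]
  map_mul' a b := by rw [map_mul, map_mul, cornerSum_mul]
  map_star' a := by rw [map_star, map_star, cornerSum_star]

end CornerSum

namespace FredholmCycle

section

variable {A : Type u} [NonUnitalNormedRing A] [StarRing A] [NormedSpace ℝ A]
variable {J : Type v} [NonUnitalNormedRing J] [StarRing J] [NormedStarGroup J] [NormedSpace ℝ J]
    [IsScalarTower ℝ J J] [SMulCommClass ℝ J J] [StarModule ℝ J]

/-- A cycle is degenerate if its defining elements of `J` vanish. -/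
def IsDegenerate (x : FredholmCycle A J) : Prop :=
  ∀ a : A, x.U * x.φpos a - x.φneg a * x.U = 0 ∧ x.φpos a * (star x.U * x.U - 1) = 0 ∧
    x.φneg a * (x.U * star x.U - 1) = 0

/-- Homotopy of cycles, through a cycle for `J ⊗ C[0, 1] = C([0, 1], J)`. For `J = 𝒦 ⊗ B` that is a
`KK(A, B ⊗ C[0, 1])`-cycle. -/
def Homotopic (x₀ x₁ : FredholmCycle A J) : Prop :=
  ∃ z : FredholmCycle A C(unitInterval, J),
    ((∀ a, multiplierEval 0 (z.φpos a) = x₀.φpos a) ∧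
      (∀ a, multiplierEval 0 (z.φneg a) = x₀.φneg a) ∧ multiplierEval 0 z.U = x₀.U) ∧
    ((∀ a, multiplierEval 1 (z.φpos a) = x₁.φpos a) ∧
      (∀ a, multiplierEval 1 (z.φneg a) = x₁.φneg a) ∧ multiplierEval 1 z.U = x₁.U)

end

variable {A : Type u} [RealCStarAlgebra A] {B : Type v} [RealCStarAlgebra B]

/-- The direct sum of two `KK(A, B)`-cycles. -/
def sum (x y : FredholmCycle A (KTensor B)) : FredholmCycle A (KTensor B) where
  φpos := cornerSumHom x.φpos y.φpos
  φneg := cornerSumHom x.φneg y.φneg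
  U := cornerSum x.U y.U
  intertwine_mem a := by
    change cornerSum _ _ * cornerSum _ _ - cornerSum _ _ * cornerSum _ _ ∈ _
    rw [cornerSum_mul, cornerSum_mul, ← cornerSum_sub]
    exact cornerSum_mem (x.intertwine_mem a) (y.intertwine_mem a)
  pos_mem a := by
    change cornerSum _ _ * (star (cornerSum _ _) * cornerSum _ _ - 1) ∈ _
    rw [mul_sub, mul_one, cornerSum_star, cornerSum_mul, cornerSum_mul, ← cornerSum_sub]
    refine cornerSum_mem ?_ ?_
    · simpa only [mul_sub, mul_one] using x.pos_mem a
    · simpa only [mul_sub, mul_one] using y.pos_mem a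
  neg_mem a := by
    change cornerSum _ _ * (cornerSum _ _ * star (cornerSum _ _) - 1) ∈ _
    rw [mul_sub, mul_one, cornerSum_star, cornerSum_mul, cornerSum_mul, ← cornerSum_sub]
    refine cornerSum_mem ?_ ?_
    · simpa only [mul_sub, mul_one] using x.neg_mem a
    · simpa only [mul_sub, mul_one] using y.neg_mem a

/-- Equivalence of cycles: they become homotopic after degenerate cycles are added. -/
def Equivalent (x y : FredholmCycle A (KTensor B)) : Prop :=
  ∃ d e : FredholmCycle A (KTensor B), d.IsDegenerate ∧ e.IsDegenerate ∧
    Homotopic (x.sum d) (y.sum e)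

end FredholmCycle

/-- The Fredholm picture `𝐊𝐊(A, B)`: the equivalence classes of `KK(A, B)`-cycles. (`Quot` divides
by the equivalence relation generated by `Equivalent`, which is `Equivalent` itself.) -/
def FredholmKK (A : Type u) (B : Type v) [RealCStarAlgebra A] [RealCStarAlgebra B] :
    Type (max u v) :=
  Quot (FredholmCycle.Equivalent (A := A) (B := B))

/-- The class of a cycle in `𝐊𝐊(A, B)`. -/
def FredholmKK.mk {A : Type u} {B : Type v} [RealCStarAlgebra A] [RealCStarAlgebra B]
    (x : FredholmCycle A (KTensor B)) : FredholmKK A B :=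
  Quot.mk _ x

end

end RealKK

/-! Both theories describe the same operators, once all modules are placed inside one standard
module. Let ℓ²(B) be the module of columns of 𝒦 ⊗ B. Its adjointable operators are the multipliers
of 𝒦 ⊗ B, and its compact operators are 𝒦 ⊗ B itself. A cycle (φ₊, φ₋, U) is therefore a bimodule on
ℓ²(B) ⊕ ℓ²(B) ≅ ℓ²(B), with representation φ₊ ⊕ φ₋ and the odd self-adjoint operator with corners U
and U* (`FredholmCycle.toBimodule`). Conversely, a countably generated module E embeds into ℓ²(B) by
an isometry v with an adjoint, which is the part of Kasparov's stabilization theorem that is needed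
(`exists_isometric_embedding`). Then v carries the even and odd parts of φ and the corner E⁰ → E¹ of
T to a cycle (`KasparovBimodule.toCycle`).

These assignments are well defined and inverse to each other for three reasons. A change of
embedding conjugates the cycle by a partial isometry that acts as the identity on it. Such a
conjugation does not change the class: after a zero summand is added, there is room for a rotation
(`homotopic_of_isConj`, `equivalent_of_isConj`). All constructions are made for an arbitrary
stabilization J of D. As C([0, 1], 𝒦 ⊗ B) is a stabilization of C([0, 1], B), a homotopy is an
object of the same kind, and only compatibility with evaluation remains to be checked
(`isPushforward_toBimodule`, `IsPushforward.exists_toCycle`). On the side of bimodules, degenerate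
summands and the complement of an embedded module are removed by one homotopy: the paths in F that
begin in the range of a projection P connect the part of F in the range of P with F, provided that
all compact defects live on P (`IsOperatorPath.homotopic`). The same homotopy absorbs the compact
perturbation by which T is replaced with a self-adjoint operator (`homotopic_of_isometry`).

For the group structure, isometries in a Cuntz algebra give commutativity, associativity and
absorption of degenerate cycles. The inverse of (φ₊, φ₋, U) is (φ₋, φ₊, U*), because diag(U, U*) can
be rotated into a degenerate operator. The addition of KK is transported along the bijection, and it
is the direct sum because E ⊕ F can be embedded by embedding E into the even and F into the odd half
of the columns.

The analytic tool throughout is the power series of √(1 − z), which converges on the closed unit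
ball of a real Banach algebra. It identifies the positive cone, it shows that x lies in the closure
of x·B, it bounds the norm of X ⊗ 1, and it yields the embedding into ℓ²(B). -/

namespace RealKK

noncomputable section

open Filter Topology

/-! ### Square roots -/

section SqrtSeries

/-- The coefficients of the power series of `1 - √(1 - z)`, without the vanishing constant one. -/
def sqrtCoeff (n : ℕ) : ℝ := 2 * catalan n / 4 ^ (n + 1)

theorem sqrtCoeff_nonneg (n : ℕ) : 0 ≤ sqrtCoeff n := by unfold sqrtCoeff; positivity

/-- The partial sums telescope through the recursion of the central binomial coefficients. Their
bound by one makes the series converge on the whole closed unit ball, boundary included. -/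
theorem sum_sqrtCoeff (N : ℕ) :
    ∑ n ∈ Finset.range N, sqrtCoeff n = 1 - N.centralBinom / 4 ^ N := by
  induction N with
  | zero => simp
  | succ N ih =>
    rw [Finset.sum_range_succ, ih, sqrtCoeff]
    have h1 : ((N : ℝ) + 1) * (N + 1).centralBinom = 2 * (2 * N + 1) * N.centralBinom := by
      exact_mod_cast Nat.succ_mul_centralBinom_succ N
    have h2 : ((N : ℝ) + 1) * catalan N = N.centralBinom := by
      exact_mod_cast succ_mul_catalan_eq_centralBinom N
    have h3 : (N : ℝ) + 1 ≠ 0 := by positivity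
    have h4 : ((N + 1).centralBinom : ℝ) = 2 * (2 * N + 1) * catalan N := by
      apply mul_left_cancel₀ h3
      rw [h1, ← h2]
      ring
    rw [h4, ← h2, pow_succ]
    field_simp
    ring

theorem summable_sqrtCoeff : Summable sqrtCoeff :=
  summable_of_sum_range_le (c := 1) sqrtCoeff_nonneg fun N => by
    rw [sum_sqrtCoeff]
    have : (0 : ℝ) ≤ N.centralBinom / 4 ^ N := by positivity
    linarith

/-- The convolution recursion of the Catalan numbers; it is the equation s² = 2s − z for s = 1 − √(1
− z), read off coefficient by coefficient. -/
theorem sum_antidiagonal_sqrtCoeff (n : ℕ) :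
    ∑ kl ∈ Finset.HasAntidiagonal.antidiagonal n, sqrtCoeff kl.1 * sqrtCoeff kl.2 = 2 * sqrtCoeff (n + 1) := by
  have h : ∀ kl ∈ Finset.HasAntidiagonal.antidiagonal n, sqrtCoeff kl.1 * sqrtCoeff kl.2 =
      4 / 4 ^ (n + 2) * ((catalan kl.1 * catalan kl.2 : ℕ) : ℝ) := fun kl hkl => by
    rw [← Finset.HasAntidiagonal.mem_antidiagonal.1 hkl, sqrtCoeff, sqrtCoeff]
    push_cast
    rw [div_mul_div_comm, ← pow_add, show kl.1 + 1 + (kl.2 + 1) = kl.1 + kl.2 + 2 by ring]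
    ring
  rw [Finset.sum_congr rfl h, ← Finset.mul_sum, ← Nat.cast_sum, ← catalan_succ', sqrtCoeff]
  ring

variable {R : Type*} [NormedRing R] [NormedAlgebra ℝ R]

/-- The power series `1 - √(1 - z)`. -/
def sqrtSeries (z : R) : R := ∑' n, sqrtCoeff n • z ^ (n + 1)

theorem summable_norm_sqrtSeries {z : R} (hz : ‖z‖ ≤ 1) :
    Summable fun n => ‖sqrtCoeff n • z ^ (n + 1)‖ := by
  refine summable_sqrtCoeff.of_nonneg_of_le (fun _ => norm_nonneg _) fun n => ?_
  rw [norm_smul, Real.norm_of_nonneg (sqrtCoeff_nonneg n)]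
  refine mul_le_of_le_one_right (sqrtCoeff_nonneg n) ?_
  exact (norm_pow_le' z n.succ_pos).trans (pow_le_one₀ (norm_nonneg _) hz)

variable [CompleteSpace R]

theorem sqrtSeries_mul_self {z : R} (hz : ‖z‖ ≤ 1) :
    sqrtSeries z * sqrtSeries z = (2 : ℝ) • sqrtSeries z - z := by
  have hs := summable_norm_sqrtSeries hz
  rw [sqrtSeries, tsum_mul_tsum_eq_tsum_sum_antidiagonal_of_summable_norm hs hs]
  have h : ∀ n, ∑ kl ∈ Finset.HasAntidiagonal.antidiagonal n,
      sqrtCoeff kl.1 • z ^ (kl.1 + 1) * sqrtCoeff kl.2 • z ^ (kl.2 + 1) =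
      (2 : ℝ) • sqrtCoeff (n + 1) • z ^ (n + 1 + 1) := fun n => by
    rw [smul_smul, ← sum_antidiagonal_sqrtCoeff, Finset.sum_smul]
    refine Finset.sum_congr rfl fun kl hkl => ?_
    rw [smul_mul_smul_comm, ← pow_add, ← Finset.HasAntidiagonal.mem_antidiagonal.1 hkl]
    congr 2
    ring
  rw [tsum_congr h, tsum_const_smul'', hs.of_norm.tsum_eq_zero_add]
  -- The square of the series begins in degree two, and the linear term of the doubled series is
  -- exactly z.
  have h0 : (2 : ℝ) • sqrtCoeff 0 • z ^ (0 + 1) = z := by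
    rw [smul_smul, sqrtCoeff, catalan_zero]
    norm_num
  rw [smul_add, h0]
  abel

theorem one_sub_sqrtSeries_mul_self {z : R} (hz : ‖z‖ ≤ 1) :
    (1 - sqrtSeries z) * (1 - sqrtSeries z) = 1 - z := by
  rw [mul_sub, sub_mul, sub_mul, sqrtSeries_mul_self hz, two_smul]
  noncomm_ring

theorem sqrtSeries_mem {z : R} (hz : ‖z‖ ≤ 1) {W : Submodule ℝ R} (hW : IsClosed (W : Set R))
    (h : ∀ n, z ^ (n + 1) ∈ W) : sqrtSeries z ∈ W :=
  hW.mem_of_tendsto (summable_norm_sqrtSeries hz).of_norm.hasSum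
    (Eventually.of_forall fun _ => sum_mem fun n _ => W.smul_mem _ (h n))

/-- At z = 1 the quadratic equation of the series reads (s − 1)² = 0. -/
theorem tsum_sqrtCoeff : ∑' n, sqrtCoeff n = 1 := by
  have h := sqrtSeries_mul_self (z := (1 : ℝ)) (by simp)
  have h' : sqrtSeries (1 : ℝ) = ∑' n, sqrtCoeff n := by simp [sqrtSeries]
  rw [h', smul_eq_mul] at h
  nlinarith

/-- As the coefficients sum to one, √(1 − z) = ∑ cₙ (1 − zⁿ⁺¹). This places the root in closed
subspaces that need not contain the unit. -/
theorem one_sub_sqrtSeries_mem {z : R} (hz : ‖z‖ ≤ 1) {W : Submodule ℝ R}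
    (hW : IsClosed (W : Set R)) (h : ∀ n, 1 - z ^ (n + 1) ∈ W) : 1 - sqrtSeries z ∈ W := by
  have h1 : HasSum (fun n => sqrtCoeff n • (1 : R)) ((1 : ℝ) • 1) :=
    (tsum_sqrtCoeff ▸ summable_sqrtCoeff.hasSum).smul_const 1
  rw [one_smul] at h1
  refine hW.mem_of_tendsto (h1.sub (summable_norm_sqrtSeries hz).of_norm.hasSum)
    (Eventually.of_forall fun _ => sum_mem fun n _ => ?_)
  rw [← smul_sub]
  exact W.smul_mem _ (h n)

end SqrtSeries

/-! ### Positive elements of a real C*-algebra -/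

section Positivity

variable {B : Type v} [RealCStarAlgebra B]
variable {H : Type v} [NormedAddCommGroup H] [InnerProductSpace ℝ H] [CompleteSpace H]

/-- With z = 1 − π p, the root of π p is √(1 − z). The range of π is closed and contains every 1 −
zⁿ⁺¹, so the root has a preimage s even if `B` has no unit. -/
theorem exists_star_mul_self_of_isPositive {π : B →⋆ₙₐ[ℝ] (H →L[ℝ] H)} (hπ : Isometry π) {p : B}
    (hp : (π p).IsPositive) (hp1 : ‖p‖ ≤ 1) : ∃ s, p = star s * s := by
  have hn : ‖π p‖ ≤ 1 := by rwa [(AddMonoidHomClass.isometry_iff_norm π).1 hπ p]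
  set z : H →L[ℝ] H := 1 - π p with hz
  have hsa : IsSelfAdjoint z := (IsSelfAdjoint.one _).sub hp.isSelfAdjoint
  -- As 0 ≤ π p ≤ 1, the Rayleigh quotients of z have absolute value at most one, and for a
  -- self-adjoint operator they determine the norm.
  have hz1 : ‖z‖ ≤ 1 := by
    rw [z.norm_eq_iSup_rayleighQuotient
      ((ContinuousLinearMap.isSelfAdjoint_iff_isSymmetric).1 hsa)]
    refine ciSup_le fun ξ => ?_
    rw [ContinuousLinearMap.rayleighQuotient, ContinuousLinearMap.reApplyInnerSelf_apply,
      RCLike.re_to_real, abs_div, abs_of_nonneg (sq_nonneg ‖ξ‖)]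
    refine div_le_of_le_mul₀ (by positivity) zero_le_one ?_
    have h0 : 0 ≤ inner ℝ (π p ξ) ξ := hp.inner_nonneg_left ξ
    have h1 : inner ℝ (π p ξ) ξ ≤ ‖ξ‖ ^ 2 := by
      refine (real_inner_le_norm _ _).trans ?_
      rw [sq]
      gcongr
      simpa using (π p).le_of_opNorm_le hn ξ
    have h2 : inner ℝ (z ξ) ξ = ‖ξ‖ ^ 2 - inner ℝ (π p ξ) ξ := by
      rw [hz, sub_apply, one_apply_eq_self, inner_sub_left, real_inner_self_eq_norm_sq]
    rw [h2, abs_le]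
    constructor <;> linarith
  let W : Submodule ℝ (H →L[ℝ] H) := LinearMap.range (π : B →ₗ[ℝ] (H →L[ℝ] H))
  have hW : IsClosed (W : Set (H →L[ℝ] H)) := by
    have : (W : Set (H →L[ℝ] H)) = Set.range π := rfl
    rw [this]
    exact hπ.isClosedEmbedding.isClosed_range
  have hmul : ∀ n, ∀ w ∈ W, z ^ n * w ∈ W := fun n w hw => by
    induction n with
    | zero => simpa
    | succ n ih =>
      obtain ⟨b, hb⟩ := ih
      have hb' : π b = z ^ n * w := hb
      refine ⟨b - p * b, ?_⟩
      change π (b - p * b) = _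
      rw [map_sub, map_mul, hb', hz, pow_succ', mul_assoc, sub_mul, one_mul]
  obtain ⟨s, hs⟩ := one_sub_sqrtSeries_mem hz1 hW fun n => by
    induction n with
    | zero => exact ⟨p, by simp [hz]⟩
    | succ n ih =>
      have : 1 - z ^ (n + 1 + 1) = (1 - z ^ (n + 1)) + z ^ (n + 1) * π p := by
        rw [pow_succ z (n + 1), show π p = 1 - z by rw [hz]; abel]
        noncomm_ring
      rw [this]
      exact add_mem ih (hmul _ _ ⟨p, rfl⟩)
  have hs' : π s = 1 - sqrtSeries z := hs
  have hstar : star (sqrtSeries z) = sqrtSeries z := by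
    refine sqrtSeries_mem hz1 (W := LinearMap.eqLocus
      (starLinearEquiv ℝ : (H →L[ℝ] H) ≃ₗ⋆[ℝ] (H →L[ℝ] H)).toLinearMap LinearMap.id) ?_
      fun n => (hsa.pow (n + 1)).star_eq
    exact isClosed_eq continuous_star continuous_id
  refine ⟨s, hπ.injective ?_⟩
  rw [map_mul, map_star, hs', star_sub, star_one, hstar, one_sub_sqrtSeries_mul_self hz1, hz]
  abel

theorem smul_mem_posCone {p : B} (hp : p ∈ posCone B) {r : ℝ} (hr : 0 ≤ r) : r • p ∈ posCone B := by
  induction hp using AddSubmonoid.closure_induction with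
  | mem x hx =>
    obtain ⟨s, rfl⟩ := hx
    refine AddSubmonoid.subset_closure ⟨√r • s, ?_⟩
    change star (√r • s) * (√r • s) = _
    rw [star_smul, star_trivial, smul_mul_smul_comm, Real.mul_self_sqrt hr]
  | zero => rw [smul_zero]; exact zero_mem _
  | add x y _ _ hx hy => rw [smul_add]; exact add_mem hx hy

/-- Scaling by the norm reduces this to the contractive case. Together with
`isPositive_of_mem_posCone` it makes positivity a question about one operator in one isometric
representation. -/
theorem mem_posCone_of_isPositive {π : B →⋆ₙₐ[ℝ] (H →L[ℝ] H)} (hπ : Isometry π) {p : B}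
    (hp : (π p).IsPositive) : p ∈ posCone B := by
  by_cases h0 : p = 0
  · rw [h0]; exact zero_mem _
  have h0' : ‖p‖ ≠ 0 := norm_ne_zero_iff.2 h0
  obtain ⟨s, hs⟩ := exists_star_mul_self_of_isPositive hπ (p := ‖p‖⁻¹ • p)
    (by rw [map_smul]; exact hp.smul_of_nonneg (by positivity))
    (by rw [norm_smul, norm_inv, norm_norm, inv_mul_cancel₀ h0'])
  have : p = ‖p‖ • (star s * s) := by rw [← hs, smul_smul, mul_inv_cancel₀ h0', one_smul]
  rw [this]
  exact smul_mem_posCone (AddSubmonoid.subset_closure ⟨s, rfl⟩) (norm_nonneg _)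

theorem star_eq_of_mem_posCone {p : B} (hp : p ∈ posCone B) : star p = p := by
  induction hp using AddSubmonoid.closure_induction with
  | mem x hx => obtain ⟨s, rfl⟩ := hx; simp
  | zero => simp
  | add x y _ _ hx hy => rw [star_add, hx, hy]

theorem norm_le_norm_of_sub_mem {p q : B} (hp : p ∈ posCone B) (h : q - p ∈ posCone B) :
    ‖p‖ ≤ ‖q‖ := by
  have := norm_le_norm_add_of_mem_posCone hp h
  rwa [add_sub_cancel] at this

end Positivity

end

end RealKK

namespace RealKK

noncomputable section

open Filter Topology

/-! ### Basic theory of Hilbert modules -/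

namespace HilbertModule

variable {B : Type v} [RealCStarAlgebra B]
variable {E : Type*} [NormedAddCommGroup E] [NormedSpace ℝ E] [HilbertModule B E]
variable {F : Type*} [NormedAddCommGroup F] [NormedSpace ℝ F] [HilbertModule B F]
variable {G : Type*} [NormedAddCommGroup G] [NormedSpace ℝ G] [HilbertModule B G]

theorem inner_add_left (x y z : E) : inner B (x + y) z = inner B x z + inner B y z := by
  rw [← star_inner, inner_add_right, star_add, star_inner, star_inner]

theorem inner_smul_left (r : ℝ) (x y : E) : inner B (r • x) y = r • inner B x y := by
  rw [← star_inner, inner_smul_right, star_smul, star_inner, star_trivial]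

theorem inner_act_left (x y : E) (b : B) : inner B (act x b) y = star b * inner B x y := by
  rw [← star_inner, inner_act_right, star_mul, star_inner]

theorem inner_sub_right (x y z : E) : inner B x (y - z) = inner B x y - inner B x z :=
  map_sub (AddMonoidHom.mk' (fun y => inner B x y) (inner_add_right x)) y z

theorem inner_sub_left (x y z : E) : inner B (x - y) z = inner B x z - inner B y z := by
  rw [← star_inner, inner_sub_right, star_sub, star_inner, star_inner]

theorem inner_act_sub_smul (x y : E) (r : ℝ) :
    inner B (act x (inner B x y) - r • y) (act x (inner B x y) - r • y) =
      star (inner B x y) * inner B x x * inner B x y - r • (star (inner B x y) * inner B x y) -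
        r • (star (inner B x y) * inner B x y) + r • r • inner B y y := by
  rw [inner_sub_left, inner_sub_right, inner_sub_right, inner_smul_left, inner_smul_right,
    inner_smul_left, inner_smul_right, inner_act_left, inner_act_left, inner_act_right,
    inner_act_right, ← star_inner x y, mul_assoc]
  abel

/-- The quadratic form of `π p` at `ξ`, as a linear functional of `p`. -/
def quadForm {H : Type v} [NormedAddCommGroup H] [InnerProductSpace ℝ H] [CompleteSpace H]
    (π : B →⋆ₙₐ[ℝ] (H →L[ℝ] H)) (ξ : H) : B →ₗ[ℝ] ℝ where
  toFun p := inner ℝ (π p ξ) ξ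
  map_add' p q := by rw [map_add, add_apply, _root_.inner_add_left]
  map_smul' r p := by rw [map_smul, smul_apply, real_inner_smul_left]; rfl

theorem quadForm_star_mul {H : Type v} [NormedAddCommGroup H] [InnerProductSpace ℝ H]
    [CompleteSpace H] (π : B →⋆ₙₐ[ℝ] (H →L[ℝ] H)) (ξ : H) (b c : B) :
    quadForm π ξ (star b * c) = inner ℝ (π c ξ) (π b ξ) := by
  change inner ℝ (π (star b * c) ξ) ξ = _
  rw [map_mul, map_star, ContinuousLinearMap.star_eq_adjoint]
  exact ContinuousLinearMap.adjoint_inner_left (π b) ξ (π c ξ)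

theorem quadForm_star_mul_mul {H : Type v} [NormedAddCommGroup H] [InnerProductSpace ℝ H]
    [CompleteSpace H] (π : B →⋆ₙₐ[ℝ] (H →L[ℝ] H)) (ξ : H) (b p : B) :
    quadForm π ξ (star b * p * b) = quadForm π (π b ξ) p := by
  rw [mul_assoc, quadForm_star_mul, map_mul]
  rfl

theorem norm_le_iff_quadForm {H : Type v} [NormedAddCommGroup H] [InnerProductSpace ℝ H]
    [CompleteSpace H] {π : B →⋆ₙₐ[ℝ] (H →L[ℝ] H)} (hπ : Isometry π) {p : B} (hp : p ∈ posCone B)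
    {C : ℝ} (hC : 0 ≤ C) : ‖p‖ ≤ C ↔ ∀ ξ : H, quadForm π ξ p ≤ C * ‖ξ‖ ^ 2 :=
  norm_le_iff_of_mem_posCone hπ hp hC

theorem quadForm_nonneg {H : Type v} [NormedAddCommGroup H] [InnerProductSpace ℝ H]
    [CompleteSpace H] (π : B →⋆ₙₐ[ℝ] (H →L[ℝ] H)) (ξ : H) {p : B} (hp : p ∈ posCone B) :
    0 ≤ quadForm π ξ p :=
  (isPositive_of_mem_posCone π hp).inner_nonneg_left ξ

/-- The Cauchy–Schwarz inequality. With a = ⟪x, y⟫ and r = ‖x‖², the inner square of x·a − r y is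
positive; this is evaluated in the vector functionals of an isometric representation, where ⟪x, x⟫
is bounded by r. -/
theorem norm_inner_le (x y : E) : ‖inner B x y‖ ≤ ‖x‖ * ‖y‖ := by
  by_cases hx : x = 0
  · subst hx
    have : inner B (0 : E) y = 0 := by simpa using inner_smul_left (B := B) 0 (0 : E) y
    simp [this]
  obtain ⟨H, _, _, _, π, hπ⟩ := RealCStarAlgebra.exists_isometric_rep (A := B)
  have hr : 0 < ‖x‖ ^ 2 := by positivity
  have key : ‖star (inner B x y) * inner B x y‖ ≤ ‖x‖ ^ 2 * ‖y‖ ^ 2 := by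
    rw [norm_le_iff_quadForm hπ (AddSubmonoid.subset_closure ⟨_, rfl⟩) (by positivity)]
    intro ξ
    have h := quadForm_nonneg π ξ (inner_self_mem (B := B) (act x (inner B x y) - ‖x‖ ^ 2 • y))
    have h1 := (norm_le_iff_quadForm hπ (inner_self_mem (B := B) x) (norm_nonneg _)).1 le_rfl
      (π (inner B x y) ξ)
    have h2 := (norm_le_iff_quadForm hπ (inner_self_mem (B := B) y) (norm_nonneg _)).1 le_rfl ξ
    have h3 : quadForm π ξ (star (inner B x y) * inner B x y) = ‖π (inner B x y) ξ‖ ^ 2 := by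
      rw [quadForm_star_mul, real_inner_self_eq_norm_sq]
    rw [inner_act_sub_smul, map_add, map_sub, map_sub, quadForm_star_mul_mul, map_smul, map_smul,
      map_smul] at h
    simp only [smul_eq_mul] at h
    rw [← norm_sq] at h1 h2
    rw [← h3] at h1
    have h5 := mul_le_mul_of_nonneg_left h2 (mul_pos hr hr).le
    change quadForm π ξ (star (inner B x y) * inner B x y) ≤ _
    refine le_of_mul_le_mul_left (le_trans ?_ (h5.trans_eq ?_)) hr
    · linarith
    · ring
  rw [CStarRing.norm_star_mul_self, ← mul_pow, ← sq] at key
  exact le_of_sq_le_sq key (by positivity)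

theorem norm_act_le (x : E) (b : B) : ‖act x b‖ ≤ ‖x‖ * ‖b‖ := by
  refine le_of_sq_le_sq ?_ (by positivity)
  rw [norm_sq (B := B), inner_act_right, inner_act_left, mul_pow, norm_sq (B := B)]
  calc _ ≤ ‖star b‖ * ‖inner B x x‖ * ‖b‖ := (norm_mul_le _ _).trans (by gcongr; exact norm_mul_le _ _)
    _ = _ := by rw [norm_star]; ring

variable (B E) in
/-- The inner product as a continuous bilinear map. -/
def innerL : E →L[ℝ] E →L[ℝ] B :=
  LinearMap.mkContinuous₂ (LinearMap.mk₂ ℝ (fun x y : E => inner B x y) inner_add_left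
    inner_smul_left inner_add_right inner_smul_right) 1 fun x y => by
      rw [one_mul]; exact norm_inner_le x y

variable (B E) in
/-- The module action as a continuous bilinear map. -/
def actL : E →L[ℝ] B →L[ℝ] E :=
  LinearMap.mkContinuous₂ (LinearMap.mk₂ ℝ (fun (x : E) (b : B) => act x b) add_act
    smul_act act_add act_smul) 1 fun x y => by
      rw [one_mul]; exact norm_act_le x y

theorem continuous_inner : Continuous fun z : E × E => inner B z.1 z.2 :=
  (innerL B E).continuous₂

theorem continuous_act : Continuous fun z : E × B => act z.1 z.2 :=
  (actL B E).continuous₂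

theorem inner_zero_right (x : E) : inner B x (0 : E) = 0 := map_zero (innerL B E x)

theorem inner_zero_left (x : E) : inner B (0 : E) x = 0 := by
  rw [← star_inner, inner_zero_right, star_zero]

theorem act_zero (x : E) : act x (0 : B) = 0 := map_zero (actL B E x)

theorem zero_act (b : B) : act (0 : E) b = 0 := map_zero ((actL B E).flip b)

variable (B) in
theorem eq_zero_of_inner_self {x : E} (h : inner B x x = 0) : x = 0 := by
  have := norm_sq (B := B) x
  rw [h, norm_zero] at this
  simpa using this

variable (B) in
theorem ext_inner_left {x y : E} (h : ∀ z : E, inner B z x = inner B z y) : x = y := by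
  refine sub_eq_zero.1 (eq_zero_of_inner_self B ?_)
  rw [inner_sub_right, h, sub_self]

variable (B) in
theorem ext_inner_right {x y : E} (h : ∀ z : E, inner B x z = inner B y z) : x = y :=
  ext_inner_left B fun z => by rw [← star_inner, h, star_inner]

variable (B) in
/-- `S` is an adjoint of `T`, for operators between two Hilbert modules. -/
def IsAdj (T : E →L[ℝ] F) (S : F →L[ℝ] E) : Prop :=
  ∀ x y, inner B (T x) y = inner B x (S y)

namespace IsAdj

variable {T T' : E →L[ℝ] F} {S S' : F →L[ℝ] E}

theorem symm (h : IsAdj B T S) : IsAdj B S T := fun x y => by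
  rw [← star_inner, ← h, star_inner]

theorem unique (h : IsAdj B T S) (h' : IsAdj B T S') : S = S' :=
  ContinuousLinearMap.ext fun y => ext_inner_left B fun x => by rw [← h, ← h']

/-- The existence of an adjoint forces linearity over `B`, which is why the representation and the
operator of a bimodule are not required to have it. -/
theorem map_act (h : IsAdj B T S) (x : E) (b : B) : T (act x b) = act (T x) b :=
  ext_inner_right B fun z => by rw [h, inner_act_left, inner_act_left, h]

theorem comp (h : IsAdj B T S) {X : F →L[ℝ] G} {Y : G →L[ℝ] F} (h' : IsAdj B X Y) :
    IsAdj B (X ∘L T) (S ∘L Y) := fun x y => by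
  rw [ContinuousLinearMap.comp_apply, ContinuousLinearMap.comp_apply, h', h]

theorem mul {T T' S S' : E →L[ℝ] E} (h : IsAdj B T S) (h' : IsAdj B T' S') :
    IsAdj B (T * T') (S' * S) := h'.comp h

theorem add (h : IsAdj B T S) (h' : IsAdj B T' S') : IsAdj B (T + T') (S + S') := fun x y => by
  rw [add_apply, add_apply, inner_add_left, inner_add_right, h, h']

theorem sub (h : IsAdj B T S) (h' : IsAdj B T' S') : IsAdj B (T - T') (S - S') := fun x y => by
  rw [sub_apply, sub_apply, inner_sub_left, inner_sub_right, h, h']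

theorem smul (h : IsAdj B T S) (r : ℝ) : IsAdj B (r • T) (r • S) := fun x y => by
  rw [smul_apply, smul_apply, inner_smul_left, inner_smul_right, h]

variable (B E F) in
theorem zero : IsAdj B (0 : E →L[ℝ] F) 0 := fun x y => by
  rw [zero_apply, zero_apply, inner_zero_left, inner_zero_right]

variable (B E) in
theorem one : IsAdj B (1 : E →L[ℝ] E) 1 := fun _ _ => rfl

theorem pow {T S : E →L[ℝ] E} (h : IsAdj B T S) (n : ℕ) : IsAdj B (T ^ n) (S ^ n) := by
  induction n with
  | zero => exact one B E
  | succ n ih => rw [pow_succ, pow_succ']; exact ih.mul h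

theorem sum {ι : Type*} (s : Finset ι) {T : ι → E →L[ℝ] F} {S : ι → F →L[ℝ] E}
    (h : ∀ i ∈ s, IsAdj B (T i) (S i)) : IsAdj B (∑ i ∈ s, T i) (∑ i ∈ s, S i) := by
  induction s using Finset.cons_induction with
  | empty => exact zero B E F
  | cons i s hi ih =>
    rw [Finset.sum_cons, Finset.sum_cons]
    exact (h i (Finset.mem_cons_self i s)).add
      (ih fun j hj => h j (Finset.mem_cons_of_mem hj))

/-- ‖S y‖² is the norm of ⟪T (S y), y⟫, which Cauchy–Schwarz bounds by C ‖S y‖ ‖y‖. -/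
theorem norm_le (h : IsAdj B T S) {C : ℝ} (hC : 0 ≤ C) (hT : ‖T‖ ≤ C) : ‖S‖ ≤ C := by
  refine S.opNorm_le_bound hC fun y => ?_
  by_cases h0 : ‖S y‖ = 0
  · rw [h0]; positivity
  refine le_of_mul_le_mul_right ?_ ((norm_nonneg (S y)).lt_of_ne' h0)
  rw [← sq, norm_sq (B := B), ← h]
  refine (norm_inner_le _ _).trans ?_
  calc _ ≤ C * ‖S y‖ * ‖y‖ := by gcongr; exact T.le_of_opNorm_le hT _
    _ = _ := by ring

theorem of_tendsto {ι : Type*} {l : Filter ι} [l.NeBot] {T : ι → E →L[ℝ] F} {S : ι → F →L[ℝ] E}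
    {T₀ : E →L[ℝ] F} {S₀ : F →L[ℝ] E} (hT : ∀ x, Tendsto (fun i => T i x) l (𝓝 (T₀ x)))
    (hS : ∀ x, Tendsto (fun i => S i x) l (𝓝 (S₀ x))) (h : ∀ i, IsAdj B (T i) (S i)) :
    IsAdj B T₀ S₀ := fun x y => by
  have h1 := ((innerL B F).flip y).continuous.tendsto _ |>.comp (hT x)
  have h2 := (innerL B E x).continuous.tendsto _ |>.comp (hS y)
  refine tendsto_nhds_unique h1 (h2.congr fun i => ?_)
  exact (h i x y).symm

end IsAdj

variable (B) in
/-- The rank one operator `z ↦ x · ⟪y, z⟫`. -/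
def rankOne (x : F) (y : E) : E →L[ℝ] F := actL B F x ∘L innerL B E y

theorem rankOne_apply (x : F) (y z : E) : rankOne B x y z = act x (inner B y z) := rfl

theorem isAdj_rankOne (x : F) (y : E) : IsAdj B (rankOne B x y) (rankOne B y x) := fun z t => by
  rw [rankOne_apply, rankOne_apply, inner_act_left, inner_act_right, star_inner]

theorem rankOne_mem (x y : E) : rankOne B x y ∈ compactOperators B E :=
  subset_closure (Submodule.subset_span ⟨x, y, fun _ => rfl⟩)

theorem comp_rankOne {X : F →L[ℝ] G} {X' : G →L[ℝ] F} (h : IsAdj B X X') (x : F) (y : E) :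
    X ∘L rankOne B x y = rankOne B (X x) y :=
  ContinuousLinearMap.ext fun z => h.map_act x (inner B y z)

theorem rankOne_comp {X : E →L[ℝ] F} {X' : F →L[ℝ] E} (h : IsAdj B X X') (x : G) (y : F) :
    rankOne B x y ∘L X = rankOne B x (X' y) :=
  ContinuousLinearMap.ext fun z => by
    rw [ContinuousLinearMap.comp_apply, rankOne_apply, rankOne_apply, h.symm]

/-- The rank one operator of x and y is carried to that of X x and Y y. With one of the outer
factors equal to 1 this is the ideal property of the compact operators. -/
theorem comp_mem_compactOperators {X Y : E →L[ℝ] F} {X' Y' : F →L[ℝ] E} (hX : IsAdj B X X')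
    (hY : IsAdj B Y Y') {k : E →L[ℝ] E} (hk : k ∈ compactOperators B E) :
    X ∘L k ∘L Y' ∈ compactOperators B F := by
  refine HilbertSum.map_mem_of_mem_closure_span
    (ContinuousLinearMap.compL ℝ F E F X ∘L (ContinuousLinearMap.compL ℝ F E E).flip Y') ?_ hk
  rintro T ⟨x, y, hT⟩
  refine ⟨X x, Y y, fun z => ?_⟩
  change X (T (Y' z)) = _
  rw [hT, hX.map_act, hY]

theorem mul_mem_compactOperators {X X' k : E →L[ℝ] E} (hX : IsAdj B X X')
    (hk : k ∈ compactOperators B E) : X * k ∈ compactOperators B E :=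
  comp_mem_compactOperators hX (IsAdj.one B E) hk

theorem mem_compactOperators_mul {X X' k : E →L[ℝ] E} (hX : IsAdj B X X')
    (hk : k ∈ compactOperators B E) : k * X ∈ compactOperators B E :=
  comp_mem_compactOperators (IsAdj.one B E) hX.symm hk

theorem exists_isAdj_of_mem_span {k : E →L[ℝ] E} (hk : k ∈ Submodule.span ℝ
    {T : E →L[ℝ] E | ∃ x y : E, ∀ z, T z = act x (inner B y z)}) :
    ∃ k' ∈ compactOperators B E, IsAdj B k k' := by
  induction hk using Submodule.span_induction with
  | mem T hT =>
    obtain ⟨x, y, hT⟩ := hT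
    obtain rfl : T = rankOne B x y := ContinuousLinearMap.ext hT
    exact ⟨_, rankOne_mem y x, isAdj_rankOne x y⟩
  | zero => exact ⟨0, zero_mem _, IsAdj.zero B E E⟩
  | add S T _ _ hS hT =>
    obtain ⟨S', h1, h2⟩ := hS
    obtain ⟨T', h3, h4⟩ := hT
    exact ⟨S' + T', add_mem h1 h3, h2.add h4⟩
  | smul r T _ hT =>
    obtain ⟨T', h1, h2⟩ := hT
    exact ⟨r • T', Submodule.smul_mem _ r h1, h2.smul r⟩

/-- Taking adjoints does not increase norms and is explicit on the span of the rank one operators,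
so approximations of k yield approximations of k'. -/
theorem IsAdj.mem_compactOperators {k k' : E →L[ℝ] E} (h : IsAdj B k k')
    (hk : k ∈ compactOperators B E) : k' ∈ compactOperators B E := by
  refine Metric.mem_closure_iff.2 fun ε hε => ?_
  obtain ⟨l, hl, hkl⟩ := Metric.mem_closure_iff.1 hk (ε / 2) (by positivity)
  obtain ⟨l', hl', hll⟩ := exists_isAdj_of_mem_span hl
  obtain ⟨m, hm, hlm⟩ := Metric.mem_closure_iff.1 hl' (ε / 2) (by positivity)
  refine ⟨m, hm, ?_⟩
  have : dist k' l' ≤ ε / 2 := by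
    rw [dist_eq_norm] at hkl ⊢
    exact (h.sub hll).norm_le (by positivity) hkl.le
  linarith [dist_triangle k' l' m]

end HilbertModule

end

end RealKK

namespace RealKK

noncomputable section

open Filter Topology

/-! ### Square roots and nondegeneracy in Hilbert modules -/

namespace HilbertModule

variable {B : Type v} [RealCStarAlgebra B]
variable {E : Type*} [NormedAddCommGroup E] [NormedSpace ℝ E] [HilbertModule B E]

/-- A real C*-algebra is a Hilbert module over itself. -/
instance self : HilbertModule B B where
  inner a b := star a * b
  act a b := a * b
  add_act := add_mul
  act_add := mul_add
  smul_act := smul_mul_assoc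
  act_smul r x b := mul_smul_comm r x b
  act_mul x b c := (mul_assoc x b c).symm
  inner_add_right x := mul_add (star x)
  inner_smul_right r x y := mul_smul_comm r (star x) y
  inner_act_right x y b := (mul_assoc (star x) y b).symm
  star_inner x y := by simp
  inner_self_mem x := AddSubmonoid.subset_closure ⟨x, rfl⟩
  norm_sq x := by rw [CStarRing.norm_star_mul_self, sq]

theorem self_inner (a b : B) : inner B a b = star a * b := rfl

variable (B) in
-- Only self-adjointness is needed, since ‖Z‖ ≤ 1 already makes 1 − Z positive. The self-adjoint
-- operators form a closed real subspace that contains the powers of Z, hence the sum of the series.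
theorem exists_sqrt_one_sub [CompleteSpace E] {Z : E →L[ℝ] E} (hZ : ‖Z‖ ≤ 1) (hs : IsAdj B Z Z) :
    ∃ Y : E →L[ℝ] E, IsAdj B Y Y ∧ Y * Y = 1 - Z := by
  refine ⟨1 - sqrtSeries Z, (IsAdj.one B E).sub ?_, one_sub_sqrtSeries_mul_self hZ⟩
  let W : Submodule ℝ (E →L[ℝ] E) :=
    { carrier := {T | IsAdj B T T}
      add_mem' := fun h h' => h.add h'
      zero_mem' := IsAdj.zero B E E
      smul_mem' := fun r _ h => h.smul r }
  refine sqrtSeries_mem hZ (W := W) ?_ fun n => hs.pow (n + 1)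
  have : (W : Set (E →L[ℝ] E)) = ⋂ x, ⋂ y, {T | innerL B E (T x) y = innerL B E x (T y)} := by
    ext T
    simp only [Set.mem_iInter]
    rfl
  rw [this]
  exact isClosed_iInter fun x => isClosed_iInter fun y => isClosed_eq (by fun_prop) (by fun_prop)

/-! ### Decay of the powers of √(1 − S) -/

section Deflation

variable {R S : E →L[ℝ] E}

theorem isAdj_of_mul_self (hR : IsAdj B R R) (hRS : R * R = 1 - S) : IsAdj B S S := by
  have : S = 1 - R * R := by rw [hRS]; abel
  rw [this]
  exact (IsAdj.one B E).sub (hR.mul hR)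

theorem inner_self_sub_inner_apply (hR : IsAdj B R R) (hRS : R * R = 1 - S) (e : E) :
    inner B e e - inner B (R e) (R e) = inner B e (S e) := by
  have : R (R e) = e - S e := congrArg (fun T : E →L[ℝ] E => T e) hRS
  rw [hR, this, inner_sub_right]
  abel

theorem norm_apply_le_of_mul_self (hR : IsAdj B R R) (hRS : R * R = 1 - S)
    (hS : ∀ e, inner B e (S e) ∈ posCone B) (e : E) : ‖R e‖ ≤ ‖e‖ := by
  refine le_of_sq_le_sq ?_ (norm_nonneg _)
  rw [norm_sq (B := B), norm_sq (B := B)]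
  refine norm_le_norm_of_sub_mem (inner_self_mem _) ?_
  rw [inner_self_sub_inner_apply hR hRS]
  exact hS e

/-- R commutes with S = 1 − R², so R S R = S − S². Hence the elements ⟪Rᵏ e, S Rᵏ e⟫ decrease with
k. -/
theorem inner_sub_inner_apply (hR : IsAdj B R R) (hRS : R * R = 1 - S) (e : E) :
    inner B e (S e) - inner B (R e) (S (R e)) = inner B (S e) (S e) := by
  have hS : S = 1 - R * R := by rw [hRS]; abel
  have h : R (S (R e)) = S e - S (S e) := by
    have : R * S * R = S - S * S := by
      rw [hS]
      noncomm_ring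
    exact congrArg (fun T : E →L[ℝ] E => T e) this
  rw [hR, h, inner_sub_right, isAdj_of_mul_self hR hRS]
  abel

theorem sum_inner_pow (hR : IsAdj B R R) (hRS : R * R = 1 - S) (N : ℕ) (e : E) :
    ∑ k ∈ Finset.range N, inner B ((R ^ k) e) (S ((R ^ k) e)) =
      inner B e e - inner B ((R ^ N) e) ((R ^ N) e) := by
  induction N with
  | zero => simp
  | succ N ih =>
    rw [Finset.sum_range_succ, ih, ← inner_self_sub_inner_apply hR hRS, pow_succ']
    change _ = inner B e e - inner B (R ((R ^ N) e)) (R ((R ^ N) e))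
    abel

/-- The elements ⟪Rᵏ e, S Rᵏ e⟫ for k < N telescope to at most ⟪e, e⟫, and as they decrease each of
them dominates the N-th one. -/
theorem inner_self_sub_smul_mem (hR : IsAdj B R R) (hRS : R * R = 1 - S) (N : ℕ) (e : E) :
    inner B e e - (N : ℝ) • inner B ((R ^ N) e) (S ((R ^ N) e)) ∈ posCone B := by
  have hanti : ∀ n k, inner B ((R ^ k) e) (S ((R ^ k) e)) -
      inner B ((R ^ (k + n)) e) (S ((R ^ (k + n)) e)) ∈ posCone B := fun n k => by
    induction n with
    | zero => rw [add_zero, sub_self]; exact zero_mem _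
    | succ n ih =>
      have h := inner_sub_inner_apply hR hRS ((R ^ (k + n)) e)
      have h' := add_mem ih (inner_self_mem (B := B) (S ((R ^ (k + n)) e)))
      rw [← h, sub_add_sub_cancel] at h'
      rw [← add_assoc, pow_succ']
      exact h'
  have h1 : inner B e e - (N : ℝ) • inner B ((R ^ N) e) (S ((R ^ N) e)) =
      ∑ k ∈ Finset.range N, (inner B ((R ^ k) e) (S ((R ^ k) e)) -
        inner B ((R ^ N) e) (S ((R ^ N) e))) + inner B ((R ^ N) e) ((R ^ N) e) := by
    rw [Finset.sum_sub_distrib, sum_inner_pow hR hRS, Finset.sum_const, Finset.card_range,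
      Nat.cast_smul_eq_nsmul]
    abel
  rw [h1]
  refine add_mem (sum_mem fun k hk => ?_) (inner_self_mem _)
  have := hanti (N - k) k
  rwa [Nat.add_sub_cancel' (Finset.mem_range.1 hk).le] at this

/-- For z = Rᴺ g one has ⟪Rᴺ z, g⟫ = ⟪z, z⟫, so the lower bound on S at Rᴺ z, combined with the
decay estimate at z, gives N ⟪z, z⟫² ≤ ⟪z, z⟫. In norms this is N ‖z‖⁴ ≤ ‖z‖². -/
theorem mul_norm_pow_apply_sq_le (hR : IsAdj B R R) (hRS : R * R = 1 - S) {g : E}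
    (hg : ∀ e, inner B e (S e) - inner B e g * inner B g e ∈ posCone B) (N : ℕ) :
    N * ‖(R ^ N) g‖ ^ 2 ≤ 1 := by
  set z := (R ^ N) g with hz
  by_cases h0 : ‖z‖ = 0
  · rw [h0]; simp
  have h1 := inner_self_sub_smul_mem hR hRS N z
  have h2 := smul_mem_posCone (hg ((R ^ N) z)) (Nat.cast_nonneg N)
  have h3 := add_mem h1 h2
  have h4 : inner B ((R ^ N) z) g = inner B z z := by rw [hR.pow N, ← hz]
  have h5 : inner B g ((R ^ N) z) = inner B z z := by rw [← hR.pow N, ← hz]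
  rw [h4, h5, smul_sub, sub_add_sub_cancel] at h3
  have hpos : (N : ℝ) • (inner B z z * inner B z z) ∈ posCone B := by
    refine smul_mem_posCone (AddSubmonoid.subset_closure ⟨inner B z z, ?_⟩) (Nat.cast_nonneg N)
    change star (inner B z z) * inner B z z = _
    rw [star_inner]
  have h6 := norm_le_norm_of_sub_mem hpos h3
  have h7 : ‖inner B z z * inner B z z‖ = ‖z‖ ^ 2 * ‖z‖ ^ 2 := by
    have := CStarRing.norm_star_mul_self (x := inner B z z)
    rwa [star_inner, ← norm_sq] at this
  rw [norm_smul, h7, ← norm_sq, Real.norm_natCast, ← mul_assoc] at h6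
  have h8 : 0 < ‖z‖ ^ 2 := by positivity
  exact le_of_mul_le_mul_right (h6.trans_eq (one_mul _).symm) h8

theorem tendsto_pow_apply_zero (hR : IsAdj B R R) (hRS : R * R = 1 - S) {g : E}
    (hg : ∀ e, inner B e (S e) - inner B e g * inner B g e ∈ posCone B) :
    Tendsto (fun N => (R ^ N) g) atTop (𝓝 0) := by
  rw [tendsto_zero_iff_norm_tendsto_zero]
  have h2 : Tendsto (fun N => ‖(R ^ N) g‖ ^ 2) atTop (𝓝 0) := by
    refine squeeze_zero' (Eventually.of_forall fun _ => sq_nonneg _) ?_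
      tendsto_inv_atTop_nhds_zero_nat
    filter_upwards [eventually_gt_atTop 0] with N hN
    rw [← one_div, le_div_iff₀ (by exact_mod_cast hN), mul_comm]
    exact mul_norm_pow_apply_sq_le hR hRS hg N
  have h3 := h2.sqrt
  rw [Real.sqrt_zero] at h3
  exact h3.congr fun N => Real.sqrt_sq (norm_nonneg _)

end Deflation

theorem tendsto_apply_zero_of_mem_closure {X Y : Type*} [NormedAddCommGroup X] [NormedSpace ℝ X]
    [NormedAddCommGroup Y] [NormedSpace ℝ Y] {T : ℕ → X →L[ℝ] Y} (hT : ∀ n x, ‖T n x‖ ≤ ‖x‖)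
    {s : Set X} (hs : ∀ x ∈ s, Tendsto (fun n => T n x) atTop (𝓝 0)) {x : X}
    (hx : x ∈ (Submodule.span ℝ s).topologicalClosure) :
    Tendsto (fun n => T n x) atTop (𝓝 0) := by
  have hspan : ∀ y ∈ Submodule.span ℝ s, Tendsto (fun n => T n y) atTop (𝓝 0) := fun y hy => by
    induction hy using Submodule.span_induction with
    | mem y hy => exact hs y hy
    | zero => simp
    | add y z _ _ hy hz => simpa using hy.add hz
    | smul r y _ hy => simpa using hy.const_smul r
  rw [Metric.tendsto_atTop]
  intro ε hε
  obtain ⟨y, hy, hxy⟩ := Metric.mem_closure_iff.1 hx (ε / 2) (by positivity)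
  obtain ⟨N, hN⟩ := Metric.tendsto_atTop.1 (hspan y hy) (ε / 2) (by positivity)
  refine ⟨N, fun n hn => ?_⟩
  have h1 := hN n hn
  rw [dist_zero_right] at h1 ⊢
  have h2 := hT n (x - y)
  rw [map_sub, ← dist_eq_norm x y] at h2
  have h3 := norm_sub_norm_le (T n x) (T n y)
  linarith

/-- Let S be the rank one operator of x and x. The vectors R²ᴺ x = (1 − S)ᴺ x have the form x − x·b,
and they tend to zero by the decay of the powers of R. This does the work of an approximate unit. -/
theorem mem_closure_range_act_of_norm_le [CompleteSpace E] {x : E} (hx : ‖x‖ ≤ 1) :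
    x ∈ closure (Set.range fun b : B => act x b) := by
  have hS : ‖rankOne B x x‖ ≤ 1 := by
    refine ContinuousLinearMap.opNorm_le_bound _ zero_le_one fun z => ?_
    rw [rankOne_apply]
    calc _ ≤ ‖x‖ * ‖inner B x z‖ := norm_act_le _ _
      _ ≤ ‖x‖ * (‖x‖ * ‖z‖) := by gcongr; exact norm_inner_le _ _
      _ ≤ 1 * (1 * ‖z‖) := by gcongr
      _ = _ := by ring
  obtain ⟨R, hR, hRS⟩ := exists_sqrt_one_sub B hS (isAdj_rankOne x x)
  have hin : ∀ e, inner B e (rankOne B x x e) = star (inner B x e) * inner B x e := fun e => by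
    rw [rankOne_apply, inner_act_right, star_inner]
  have ht := tendsto_pow_apply_zero (B := B) (g := x) hR hRS
    (fun e => by rw [hin, star_inner, sub_self]; exact zero_mem _)
  have hb : ∀ N, ∃ b : B, (R ^ (2 * N)) x = x - act x b := fun N => by
    induction N with
    | zero => exact ⟨0, by simp [act_zero]⟩
    | succ N ih =>
      obtain ⟨b, hb⟩ := ih
      -- One more factor 1 − S turns x − x·b into x − x·b − x·⟪x, x − x·b⟫.
      refine ⟨b + inner B x (x - act x b), ?_⟩
      have : R ^ (2 * (N + 1)) = (R * R) * R ^ (2 * N) := by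
        rw [mul_add, mul_one, add_comm, pow_add, sq]
      rw [this, hRS]
      change (R ^ (2 * N)) x - rankOne B x x ((R ^ (2 * N)) x) = _
      rw [hb, rankOne_apply, act_add]
      abel
  choose b hb using hb
  have ht2 := ht.comp (tendsto_id.const_mul_atTop' (two_pos : 0 < 2))
  have ht3 : Tendsto (fun N => act x (b N)) atTop (𝓝 x) := by
    have := (tendsto_const_nhds (x := x)).sub ht2
    rw [sub_zero] at this
    refine this.congr fun N => ?_
    change x - (R ^ (2 * N)) x = _
    rw [hb]
    abel
  exact mem_closure_of_tendsto ht3 (Eventually.of_forall fun N => ⟨_, rfl⟩)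

variable (B) in
theorem mem_closure_range_act [CompleteSpace E] (x : E) :
    x ∈ closure (Set.range fun b : B => act x b) := by
  by_cases h0 : x = 0
  · exact subset_closure ⟨0, (act_zero x).trans h0.symm⟩
  have h0' : ‖x‖ ≠ 0 := norm_ne_zero_iff.2 h0
  have h := mem_closure_range_act_of_norm_le (B := B) (x := ‖x‖⁻¹ • x)
    (by rw [norm_smul, norm_inv, norm_norm, inv_mul_cancel₀ h0'])
  have h2 := map_mem_closure (continuous_const_smul ‖x‖) h
    (t := Set.range fun b : B => act x b) (by
      rintro _ ⟨b, rfl⟩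
      refine ⟨b, ?_⟩
      change act x b = ‖x‖ • act (‖x‖⁻¹ • x) b
      rw [smul_act, smul_smul, mul_inv_cancel₀ h0', one_smul])
  rwa [smul_smul, mul_inv_cancel₀ h0', one_smul] at h2

theorem mem_closure_mul (a : B) : a ∈ closure (Set.range fun b : B => a * b) :=
  mem_closure_range_act B a

variable (B E) in
-- A dense sequence generates, because every x lies in the closure of x·B.
theorem countablyGenerated_of_separableSpace [CompleteSpace E]
    [TopologicalSpace.SeparableSpace E] : CountablyGenerated B E := by
  obtain ⟨s, hs, hd⟩ := TopologicalSpace.exists_countable_dense E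
  refine ⟨s, hs, (hd.mono fun x hx => ?_).of_closure⟩
  refine closure_mono ?_ (mem_closure_range_act B x)
  rintro _ ⟨b, rfl⟩
  exact Submodule.subset_span ⟨x, hx, b, rfl⟩

/-- Over a separable algebra countable generation is thereby reduced to separability, which passes
to closed submodules and to modules of paths. -/
theorem _root_.RealKK.CountablyGenerated.separableSpace [TopologicalSpace.SeparableSpace B]
    (h : CountablyGenerated B E) : TopologicalSpace.SeparableSpace E := by
  obtain ⟨s, hs, hd⟩ := h
  have h1 : TopologicalSpace.IsSeparable {y : E | ∃ x ∈ s, ∃ b : B, y = act x b} := by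
    have : {y : E | ∃ x ∈ s, ∃ b : B, y = act x b} =
        ⋃ x ∈ s, Set.range fun b : B => act x b := by
      ext y
      simp [eq_comm]
    rw [this]
    have := hs.to_subtype
    rw [Set.biUnion_eq_iUnion]
    exact TopologicalSpace.IsSeparable.iUnion fun x =>
      TopologicalSpace.isSeparable_range (actL B E (x : E)).continuous
  have h2 := (h1.span (R := ℝ)).closure
  rw [hd.closure_eq] at h2
  exact TopologicalSpace.isSeparable_univ_iff.1 h2

variable (B E) in
-- The factor from `B` is kept on purpose: ⟪y·d, e⟫ = d* ⟪y, e⟫ is an entry that a column with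
-- coefficient d* can produce, whereas for y alone a unit would be needed.
theorem exists_dense_act [CompleteSpace E] [TopologicalSpace.SeparableSpace E]
    [TopologicalSpace.SeparableSpace B] :
    ∃ (y : ℕ → E) (d : ℕ → B), DenseRange fun n => act (y n) (d n) := by
  have hE : DenseRange (TopologicalSpace.denseSeq E) := TopologicalSpace.denseRange_denseSeq E
  have hB : DenseRange (TopologicalSpace.denseSeq B) := TopologicalSpace.denseRange_denseSeq B
  refine ⟨fun n => TopologicalSpace.denseSeq E n.unpair.1,
    fun n => TopologicalSpace.denseSeq B n.unpair.2, fun x => ?_⟩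
  have h1 : DenseRange fun z : E × B => act z.1 z.2 := fun x =>
    closure_mono (by rintro _ ⟨b, rfl⟩; exact ⟨(x, b), rfl⟩) (mem_closure_range_act B x)
  have h2 := h1.comp (hE.prodMap hB) continuous_act x
  refine closure_mono ?_ h2
  rintro _ ⟨⟨i, j⟩, rfl⟩
  exact ⟨Nat.pair i j, by simp⟩

end HilbertModule

end

end RealKK

namespace RealKK

noncomputable section

open Filter Topology

/-! ### Interior tensor products -/

namespace HilbertModule

section InteriorTensor

variable {B : Type v} [RealCStarAlgebra B] {B' : Type v} [RealCStarAlgebra B']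
variable {E : Type*} [NormedAddCommGroup E] [NormedSpace ℝ E] [HilbertModule B E]
variable {F : Type*} [NormedAddCommGroup F] [NormedSpace ℝ F] [HilbertModule B F]
variable {E' : Type*} [NormedAddCommGroup E'] [NormedSpace ℝ E'] [HilbertModule B' E']
variable {F' : Type*} [NormedAddCommGroup F'] [NormedSpace ℝ F'] [HilbertModule B' F']

/-- `E'` is, by means of `j`, the interior tensor product of `E` and `B'` along `β : B → B'`. -/
structure IsInteriorTensor (β : B →⋆ₙₐ[ℝ] B') (j : E ⊗[ℝ] B' →ₗ[ℝ] E') : Prop where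
  denseRange : DenseRange j
  inner_tmul (e f : E) (b c : B') :
    inner B' (j (e ⊗ₜ b)) (j (f ⊗ₜ c)) = star b * β (inner B e f) * c

variable {β : B →⋆ₙₐ[ℝ] B'} {j : E ⊗[ℝ] B' →ₗ[ℝ] E'} {j' : F ⊗[ℝ] B' →ₗ[ℝ] F'}

theorem IsInteriorTensor.inner_rTensor (hj : IsInteriorTensor β j) (hj' : IsInteriorTensor β j')
    {X : E →L[ℝ] F} {X' : F →L[ℝ] E} (h : IsAdj B X X') (z : E ⊗[ℝ] B') (w : F ⊗[ℝ] B') :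
    inner B' (j' ((X : E →ₗ[ℝ] F).rTensor B' z)) (j' w) =
      inner B' (j z) (j ((X' : F →ₗ[ℝ] E).rTensor B' w)) := by
  induction z using TensorProduct.induction_on with
  | zero => simp [inner_zero_left]
  | add z₁ z₂ h₁ h₂ => rw [map_add, map_add, map_add, inner_add_left, inner_add_left, h₁, h₂]
  | tmul e b =>
    induction w using TensorProduct.induction_on with
    | zero => simp [inner_zero_right]
    | add w₁ w₂ h₁ h₂ => rw [map_add, map_add, map_add, inner_add_right, inner_add_right, h₁, h₂]
    | tmul f c =>
      rw [LinearMap.rTensor_tmul, LinearMap.rTensor_tmul, hj'.inner_tmul, hj.inner_tmul]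
      congr 3
      exact h e f

/-- If Y² = 1 − c⁻² X*X, then c² ⟪z, z⟫ is the sum of the inner square of (X ⊗ 1) z and of c² times
that of (Y ⊗ 1) z. Both are positive, so the first is bounded by the total. -/
theorem IsInteriorTensor.norm_rTensor_le [CompleteSpace E] (hj : IsInteriorTensor β j)
    (hj' : IsInteriorTensor β j') {X : E →L[ℝ] F} {X' : F →L[ℝ] E} (h : IsAdj B X X') {c : ℝ}
    (hc : 0 ≤ c) (hX : ‖X‖ ≤ c) (z : E ⊗[ℝ] B') :
    ‖j' ((X : E →ₗ[ℝ] F).rTensor B' z)‖ ≤ c * ‖j z‖ := by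
  rcases hc.eq_or_lt with rfl | hc
  · obtain rfl : X = 0 := norm_le_zero_iff.1 hX
    simp
  have hZ : ‖(c ^ 2)⁻¹ • (X' ∘L X)‖ ≤ 1 := by
    rw [norm_smul, norm_inv, Real.norm_of_nonneg (sq_nonneg c), inv_mul_le_one₀ (by positivity), sq]
    refine (ContinuousLinearMap.opNorm_comp_le _ _).trans ?_
    exact mul_le_mul (h.norm_le hc.le hX) hX (norm_nonneg _) hc.le
  obtain ⟨Y, hY, hYZ⟩ := exists_sqrt_one_sub B hZ ((h.comp h.symm).smul (c ^ 2)⁻¹)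
  have h1 := hj.inner_rTensor hj' h z ((X : E →ₗ[ℝ] F).rTensor B' z)
  have h2 := hj.inner_rTensor hj hY z ((Y : E →ₗ[ℝ] E).rTensor B' z)
  have h3 : c ^ 2 • inner B' (j z) (j z) =
      inner B' (j' ((X : E →ₗ[ℝ] F).rTensor B' z)) (j' ((X : E →ₗ[ℝ] F).rTensor B' z)) +
        c ^ 2 • inner B' (j ((Y : E →ₗ[ℝ] E).rTensor B' z)) (j ((Y : E →ₗ[ℝ] E).rTensor B' z)) := by
    rw [h1, h2, ← inner_smul_right, ← inner_smul_right, ← inner_add_right, ← map_smul, ← map_smul,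
      ← map_add]
    congr 2
    clear h1 h2
    induction z using TensorProduct.induction_on with
    | zero => simp
    | add z₁ z₂ h₁ h₂ =>
      simp only [map_add, smul_add] at h₁ h₂ ⊢
      rw [h₁, h₂]
      abel
    | tmul e b =>
      simp only [LinearMap.rTensor_tmul, TensorProduct.smul_tmul']
      rw [← TensorProduct.add_tmul]
      congr 1
      have : Y (Y e) = e - (c ^ 2)⁻¹ • X' (X e) := congrArg (fun T : E →L[ℝ] E => T e) hYZ
      change c ^ 2 • e = X' (X e) + c ^ 2 • Y (Y e)
      rw [this, smul_sub, smul_smul, mul_inv_cancel₀ (by positivity), one_smul]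
      abel
  have h4 := norm_le_norm_add_of_mem_posCone
    (inner_self_mem (B := B') (j' ((X : E →ₗ[ℝ] F).rTensor B' z)))
    (smul_mem_posCone (inner_self_mem (B := B') (j ((Y : E →ₗ[ℝ] E).rTensor B' z)))
      (sq_nonneg c))
  rw [← h3, norm_smul, ← norm_sq, ← norm_sq, Real.norm_of_nonneg (sq_nonneg c), ← mul_pow] at h4
  exact le_of_sq_le_sq h4 (by positivity)

variable [CompleteSpace F']

/-- The operator `X ⊗ 1` between interior tensor products. -/
def tensorMap (j : E ⊗[ℝ] B' →ₗ[ℝ] E') (j' : F ⊗[ℝ] B' →ₗ[ℝ] F') (X : E →L[ℝ] F) : E' →L[ℝ] F' :=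
  (j' ∘ₗ (X : E →ₗ[ℝ] F).rTensor B').extendOfNorm j

variable [CompleteSpace E]

theorem IsInteriorTensor.tensorMap_apply (hj : IsInteriorTensor β j) (hj' : IsInteriorTensor β j')
    {X : E →L[ℝ] F} {X' : F →L[ℝ] E} (h : IsAdj B X X') (z : E ⊗[ℝ] B') :
    tensorMap j j' X (j z) = j' ((X : E →ₗ[ℝ] F).rTensor B' z) :=
  LinearMap.extendOfNorm_eq (f := j' ∘ₗ (X : E →ₗ[ℝ] F).rTensor B') hj.denseRange
    ⟨‖X‖, hj.norm_rTensor_le hj' h (norm_nonneg X) le_rfl⟩ z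

theorem IsInteriorTensor.norm_tensorMap_le (hj : IsInteriorTensor β j)
    (hj' : IsInteriorTensor β j') {X : E →L[ℝ] F} {X' : F →L[ℝ] E} (h : IsAdj B X X') :
    ‖tensorMap j j' X‖ ≤ ‖X‖ :=
  LinearMap.opNorm_extendOfNorm_le (f := j' ∘ₗ (X : E →ₗ[ℝ] F).rTensor B') hj.denseRange (norm_nonneg X)
    (hj.norm_rTensor_le hj' h (norm_nonneg X) le_rfl)

theorem IsInteriorTensor.isAdj_tensorMap [CompleteSpace F] [CompleteSpace E']
    (hj : IsInteriorTensor β j) (hj' : IsInteriorTensor β j')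
    {X : E →L[ℝ] F} {X' : F →L[ℝ] E} (h : IsAdj B X X') :
    IsAdj B' (tensorMap j j' X) (tensorMap j' j X') := fun x y => by
  refine hj.denseRange.induction_on (p := fun x => inner B' (tensorMap j j' X x) y =
    inner B' x (tensorMap j' j X' y)) x ?_ fun z => ?_
  · exact isClosed_eq (((innerL B' F').flip y).continuous.comp (ContinuousLinearMap.continuous _))
      ((innerL B' E').flip _).continuous
  refine hj'.denseRange.induction_on (p := fun y => inner B' (tensorMap j j' X (j z)) y =
    inner B' (j z) (tensorMap j' j X' y)) y ?_ fun w => ?_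
  · exact isClosed_eq (innerL B' F' _).continuous
      ((innerL B' E' _).continuous.comp (ContinuousLinearMap.continuous _))
  rw [hj.tensorMap_apply hj' h, hj'.tensorMap_apply hj h.symm, hj.inner_rTensor hj' h]

end InteriorTensor

end HilbertModule

/-! ### Continuous functions on the unit interval -/

section Path

/-- The Bernstein approximations of f are finite sums of such products and converge uniformly.
Claims about paths are thereby reduced to elementary tensors g ⊗ x. -/
theorem mem_of_forall_smul_const_mem {V : Type*} [NormedAddCommGroup V] [NormedSpace ℝ V]
    {W : Submodule ℝ C(unitInterval, V)} (hW : IsClosed (W : Set C(unitInterval, V)))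
    {f : C(unitInterval, V)}
    (h : ∀ (g : C(unitInterval, ℝ)) (t : unitInterval), g • ContinuousMap.const unitInterval (f t) ∈ W) :
    f ∈ W :=
  hW.mem_of_tendsto (bernsteinApproximation_uniform f)
    (Eventually.of_forall fun _ => sum_mem fun _ _ => h _ _)

variable {B : Type v} [RealCStarAlgebra B]
variable {H : Type v} [NormedAddCommGroup H] [InnerProductSpace ℝ H] [CompleteSpace H]

theorem norm_map_apply_le {π : B →⋆ₙₐ[ℝ] (H →L[ℝ] H)} (hπ : Isometry π) (f : C(unitInterval, B))
    (t : unitInterval) (h : H) : ‖π (f t) h‖ ≤ ‖f‖ * ‖h‖ := by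
  refine (π (f t)).le_of_opNorm_le ?_ h
  rw [(AddMonoidHomClass.isometry_iff_norm π).1 hπ]
  exact f.norm_coe_le_norm t

/-- The operator on `ℓ²([0, 1], H)` that acts at `t` as `π (f t)`. -/
def pathRepLinear {π : B →⋆ₙₐ[ℝ] (H →L[ℝ] H)} (hπ : Isometry π) (f : C(unitInterval, B)) :
    lp (fun _ : unitInterval => H) 2 →ₗ[ℝ] lp (fun _ : unitInterval => H) 2 where
  toFun ξ := ⟨fun t => π (f t) (ξ t), by
    refine memℓp_gen ?_
    refine (((lp.memℓp ξ).summable (by norm_num)).mul_left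
      (‖f‖ ^ (2 : ENNReal).toReal)).of_nonneg_of_le (fun _ => by positivity) fun t => ?_
    rw [← Real.mul_rpow (norm_nonneg _) (norm_nonneg _)]
    exact Real.rpow_le_rpow (norm_nonneg _) (norm_map_apply_le hπ f t _) (by norm_num)⟩
  map_add' ξ η := Subtype.ext (funext fun t => map_add (π (f t)) (ξ t) (η t))
  map_smul' r ξ := Subtype.ext (funext fun t => map_smul (π (f t)) r (ξ t))

theorem norm_pathRepLinear_le {π : B →⋆ₙₐ[ℝ] (H →L[ℝ] H)} (hπ : Isometry π)
    (f : C(unitInterval, B)) (ξ : lp (fun _ : unitInterval => H) 2) :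
    ‖pathRepLinear hπ f ξ‖ ≤ ‖f‖ * ‖ξ‖ := by
  refine lp.norm_le_of_forall_sum_le (by norm_num) (by positivity) fun s => ?_
  rw [Real.mul_rpow (norm_nonneg _) (norm_nonneg _)]
  refine le_trans ?_ (mul_le_mul_of_nonneg_left
    (lp.sum_rpow_le_norm_rpow (p := 2) (by norm_num) ξ s) (by positivity))
  rw [Finset.mul_sum]
  refine Finset.sum_le_sum fun t _ => ?_
  rw [← Real.mul_rpow (norm_nonneg _) (norm_nonneg _)]
  exact Real.rpow_le_rpow (norm_nonneg _) (norm_map_apply_le hπ f t _) (by norm_num)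

/-- The representation of `C([0, 1], B)` on `ℓ²([0, 1], H)` that is given by a representation of `B`
on `H`. -/
def pathRep {π : B →⋆ₙₐ[ℝ] (H →L[ℝ] H)} (hπ : Isometry π) : C(unitInterval, B) →⋆ₙₐ[ℝ]
    (lp (fun _ : unitInterval => H) 2 →L[ℝ] lp (fun _ : unitInterval => H) 2) where
  toFun f := (pathRepLinear hπ f).mkContinuous ‖f‖ (norm_pathRepLinear_le hπ f)
  map_smul' r f := by
    refine ContinuousLinearMap.ext fun ξ => Subtype.ext (funext fun t => ?_)
    change π (r • f t) (ξ t) = r • π (f t) (ξ t)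
    rw [map_smul]
    rfl
  map_zero' := by
    refine ContinuousLinearMap.ext fun ξ => Subtype.ext (funext fun t => ?_)
    change π 0 (ξ t) = 0
    rw [map_zero]
    rfl
  map_add' f g := by
    refine ContinuousLinearMap.ext fun ξ => Subtype.ext (funext fun t => ?_)
    change π (f t + g t) (ξ t) = π (f t) (ξ t) + π (g t) (ξ t)
    rw [map_add]
    rfl
  map_mul' f g := by
    refine ContinuousLinearMap.ext fun ξ => Subtype.ext (funext fun t => ?_)
    change π (f t * g t) (ξ t) = π (f t) (π (g t) (ξ t))
    rw [map_mul]
    rfl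
  map_star' f := by
    rw [ContinuousLinearMap.star_eq_adjoint, ContinuousLinearMap.eq_adjoint_iff]
    intro ξ η
    rw [lp.inner_eq_tsum, lp.inner_eq_tsum]
    refine tsum_congr fun t => ?_
    change inner ℝ (π (star (f t)) (ξ t)) (η t) = inner ℝ (ξ t) (π (f t) (η t))
    rw [map_star, ContinuousLinearMap.star_eq_adjoint, ContinuousLinearMap.adjoint_inner_left]

/-- A vector h placed at the single point t detects ‖π (f t) h‖; the direct sum over the discrete
set of points has such vectors. -/
theorem isometry_pathRep {π : B →⋆ₙₐ[ℝ] (H →L[ℝ] H)} (hπ : Isometry π) : Isometry (pathRep hπ) := by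
  classical
  suffices h : ∀ f, ‖pathRep hπ f‖ = ‖f‖ by
    refine Isometry.of_dist_eq fun f g => ?_
    rw [dist_eq_norm, dist_eq_norm, ← h, map_sub]
  refine fun f => le_antisymm ?_ ?_
  · exact LinearMap.mkContinuous_norm_le _ (norm_nonneg f) (norm_pathRepLinear_le hπ f)
  · refine (ContinuousMap.norm_le f (norm_nonneg (pathRep hπ f))).2 fun t => ?_
    rw [← (AddMonoidHomClass.isometry_iff_norm π).1 hπ]
    refine ContinuousLinearMap.opNorm_le_bound _ (norm_nonneg _) fun h => ?_
    have h1 := lp.norm_apply_le_norm (p := 2) two_ne_zero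
      (pathRep hπ f (lp.single (E := fun _ : unitInterval => H) 2 t h)) t
    have h2 : pathRep hπ f (lp.single (E := fun _ : unitInterval => H) 2 t h) t = π (f t) h := by
      change π (f t) (lp.single (E := fun _ : unitInterval => H) 2 t h t) = _
      rw [lp.single_apply_self]
    rw [h2] at h1
    refine h1.trans ((ContinuousLinearMap.le_opNorm _ _).trans_eq ?_)
    rw [lp.norm_single (by norm_num)]

instance : RealCStarAlgebra C(unitInterval, B) where
  exists_isometric_rep := by
    obtain ⟨H, _, _, _, π, hπ⟩ := RealCStarAlgebra.exists_isometric_rep (A := B)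
    exact ⟨lp (fun _ : unitInterval => H) 2, inferInstance, inferInstance, inferInstance,
      pathRep hπ, isometry_pathRep hπ⟩

/-- Positivity in `C([0, 1], B)` is pointwise positivity. -/
theorem mem_posCone_of_forall {f : C(unitInterval, B)} (h : ∀ t, f t ∈ posCone B) :
    f ∈ posCone C(unitInterval, B) := by
  obtain ⟨H, _, _, _, π, hπ⟩ := RealCStarAlgebra.exists_isometric_rep (A := B)
  -- Decompositions of the values f t into squares, chosen for each t, need not be continuous in t.
  -- The representation turns the claim into positivity of one diagonal operator.
  refine mem_posCone_of_isPositive (isometry_pathRep hπ) ?_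
  rw [ContinuousLinearMap.isPositive_iff]
  refine ⟨?_, fun ξ => ?_⟩
  · rw [← ContinuousLinearMap.isSelfAdjoint_iff_isSymmetric, isSelfAdjoint_iff, ← map_star]
    congr 1
    exact ContinuousMap.ext fun t => star_eq_of_mem_posCone (h t)
  · rw [lp.inner_eq_tsum]
    exact tsum_nonneg fun t => (isPositive_of_mem_posCone π (h t)).inner_nonneg_left (ξ t)

end Path

end

end RealKK

namespace RealKK

noncomputable section

open Filter Topology HilbertModule

/-! ### Stabilizations and their column modules -/

/-- `J` is a stabilization of `D`, i.e. `J ≅ 𝒦 ⊗ D`: there are a full corner `e₀₀ ⊗ D ⊂ J` and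
coisometries `even` and `odd` of a Cuntz algebra in the multiplier algebra of `J`. -/
class Stabilization (D J : Type v) [RealCStarAlgebra D] [RealCStarAlgebra J] where
  corner : D →⋆ₙₐ[ℝ] J
  isometry_corner : Isometry corner
  even : 𝓜(ℝ, J)
  odd : 𝓜(ℝ, J)
  even_mul_star : even * star even = 1
  odd_mul_star : odd * star odd = 1
  even_mul_star_odd : even * star odd = 0
  star_mul_add : star even * even + star odd * odd = 1
  -- This is what makes the adjoints of the approximate embeddings converge in
  -- `exists_isometric_embedding`.
  tendsto_odd_pow (x : J) : Tendsto (fun n => (odd ^ n).fst x) atTop (𝓝 0)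
  corner_mul_mul (a b : D) (x : J) : ∃ d, corner a * x * corner b = corner d
  dense_span (x : J) :
    x ∈ (Submodule.span ℝ {z : J | ∃ x d y, z = x * corner d * y}).topologicalClosure

theorem map_mem_of_mem_closure {X Y : Type*} [NormedAddCommGroup X] [NormedSpace ℝ X]
    [NormedAddCommGroup Y] [NormedSpace ℝ Y] (f : X →L[ℝ] Y) {s : Set X} {W : Submodule ℝ Y}
    (hW : IsClosed (W : Set Y)) (h : ∀ x ∈ s, f x ∈ W) {x : X}
    (hx : x ∈ (Submodule.span ℝ s).topologicalClosure) : f x ∈ W := by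
  have h1 : (Submodule.span ℝ s).topologicalClosure ≤ W.comap (f : X →ₗ[ℝ] Y) :=
    Submodule.topologicalClosure_minimal _ (Submodule.span_le.2 h) (hW.preimage f.continuous)
  exact h1 hx

theorem isClosed_compactOperators (B : Type v) [RealCStarAlgebra B] (E : Type w)
    [NormedAddCommGroup E] [NormedSpace ℝ E] [HilbertModule B E] :
    IsClosed (compactOperators B E : Set (E →L[ℝ] E)) :=
  Submodule.isClosed_topologicalClosure _

section Col

variable (D J : Type v) [RealCStarAlgebra D] [RealCStarAlgebra J] [Stabilization D J]

local notation "cor" => Stabilization.corner (D := D) (J := J)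

/-- The columns of a stabilization `J ≅ 𝒦 ⊗ D`, i.e. the Hilbert module `ℓ²(D)`. -/
def colSubmodule : Submodule ℝ J :=
  (Submodule.span ℝ {z : J | ∃ x d, z = x * cor d}).topologicalClosure

/-- The Hilbert module `ℓ²(D)`, as the module of columns of `J ≅ 𝒦 ⊗ D`. -/
def Col : Type v := colSubmodule D J

instance : NormedAddCommGroup (Col D J) :=
  inferInstanceAs (NormedAddCommGroup (colSubmodule D J))

instance : NormedSpace ℝ (Col D J) := inferInstanceAs (NormedSpace ℝ (colSubmodule D J))

instance : CoeOut (Col D J) J := ⟨Subtype.val⟩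

/-- The inclusion of the columns into `J`. -/
def Col.incl : Col D J →L[ℝ] J := (colSubmodule D J).subtypeL

theorem isClosed_colSubmodule : IsClosed (colSubmodule D J : Set J) :=
  Submodule.isClosed_topologicalClosure _

instance : CompleteSpace (Col D J) := (isClosed_colSubmodule D J).completeSpace_coe

theorem mul_corner_mem (x : J) (d : D) : x * cor d ∈ colSubmodule D J :=
  subset_closure (Submodule.subset_span ⟨x, d, rfl⟩)

theorem norm_corner (d : D) : ‖cor d‖ = ‖d‖ :=
  (AddMonoidHomClass.isometry_iff_norm _).1 Stabilization.isometry_corner d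

/-- `cor d` is a limit of products `cor d * cor e`, also when `D` has no unit. -/
theorem corner_mem (d : D) : cor d ∈ colSubmodule D J := by
  refine (isClosed_colSubmodule D J).closure_subset ?_
  refine map_mem_closure Stabilization.isometry_corner.continuous (mem_closure_mul d) ?_
  rintro _ ⟨e, rfl⟩
  change cor (d * e) ∈ _
  rw [map_mul]
  exact mul_corner_mem D J _ e

variable {D J}

theorem fst_mem_colSubmodule (m : 𝓜(ℝ, J)) {x : J} (hx : x ∈ colSubmodule D J) :
    m.fst x ∈ colSubmodule D J := by
  refine map_mem_of_mem_closure m.fst (isClosed_colSubmodule D J) ?_ hx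
  rintro _ ⟨y, d, rfl⟩
  rw [fst_mul]
  exact mul_corner_mem D J _ d

/-- For generators the product is `cor (star d) * (star x * y) * cor e`, which `corner_mul_mul`
places in the corner, and the corner is closed. It turns `star x * y` into a `D`-valued inner
product on the columns. -/
theorem star_mul_mem_range_corner {x y : J} (hx : x ∈ colSubmodule D J)
    (hy : y ∈ colSubmodule D J) : ∃ d, cor d = star x * y := by
  let W : Submodule ℝ J := LinearMap.range (cor : D →ₗ[ℝ] J)
  have hW : IsClosed (W : Set J) := by
    have : (W : Set J) = Set.range cor := rfl
    rw [this]
    exact Stabilization.isometry_corner.isClosedEmbedding.isClosed_range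
  have hstar : ∀ z ∈ W, star z ∈ W := by
    rintro _ ⟨d, rfl⟩
    exact ⟨star d, map_star (cor) d⟩
  have h1 : ∀ x ∈ {z : J | ∃ x d, z = x * cor d}, ∀ y ∈ colSubmodule D J, star x * y ∈ W := by
    rintro _ ⟨x, d, rfl⟩ y hy
    refine map_mem_of_mem_closure (ContinuousLinearMap.mul ℝ J (star (x * cor d))) hW ?_ hy
    rintro _ ⟨y, e, rfl⟩
    obtain ⟨f, hf⟩ := Stabilization.corner_mul_mul (J := J) (star d) e (star x * y)
    refine ⟨f, hf.symm.trans ?_⟩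
    change _ = star (x * cor d) * (y * cor e)
    rw [map_star, star_mul, mul_assoc, mul_assoc, mul_assoc]
  have h2 := map_mem_of_mem_closure (ContinuousLinearMap.mul ℝ J (star y)) hW (fun x hx' => by
    have := hstar _ (h1 x hx' y hy)
    rwa [star_mul, star_star] at this) hx
  obtain ⟨d, hd⟩ := hstar _ h2
  refine ⟨d, hd.trans ?_⟩
  rw [ContinuousLinearMap.mul_apply', star_mul, star_star]

instance : Inner D (Col D J) where
  inner x y := (star_mul_mem_range_corner x.2 y.2).choose

theorem corner_inner (x y : Col D J) : cor (inner D x y) = star (x : J) * y :=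
  (star_mul_mem_range_corner x.2 y.2).choose_spec

theorem eq_of_corner_eq {d e : D} (h : cor d = cor e) : d = e :=
  Stabilization.isometry_corner.injective h

instance : HilbertModule D (Col D J) where
  act x d := ⟨x * cor d, mul_corner_mem D J x d⟩
  add_act x y d := Subtype.ext (add_mul _ _ _)
  act_add x d e := Subtype.ext (by
    change (x : J) * cor (d + e) = x * cor d + x * cor e
    rw [map_add, mul_add])
  smul_act r x d := Subtype.ext (smul_mul_assoc r (x : J) (cor d))
  act_smul r x d := Subtype.ext (by
    change (x : J) * cor (r • d) = r • (x * cor d)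
    rw [map_smul, mul_smul_comm])
  act_mul x d e := Subtype.ext (by
    change (x : J) * cor (d * e) = x * cor d * cor e
    rw [map_mul, mul_assoc])
  inner_add_right x y z := eq_of_corner_eq (J := J) (by
    rw [map_add, corner_inner, corner_inner, corner_inner]
    exact mul_add _ _ _)
  inner_smul_right r x y := eq_of_corner_eq (J := J) (by
    rw [map_smul, corner_inner, corner_inner]
    exact mul_smul_comm _ _ _)
  inner_act_right x y d := eq_of_corner_eq (J := J) (by
    rw [map_mul, corner_inner, mul_assoc]
    exact corner_inner x (⟨y * cor d, mul_corner_mem D J y d⟩ : Col D J))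
  star_inner x y := eq_of_corner_eq (J := J) (by
    rw [map_star, corner_inner, corner_inner, star_mul, star_star])
  inner_self_mem x := by
    obtain ⟨H, _, _, _, π, hπ⟩ := RealCStarAlgebra.exists_isometric_rep (A := J)
    -- The inner square is `star x * x` with x in `J`, not visibly a sum of squares from `D`.
    -- Positivity is therefore tested in a representation of `J`, restricted to the corner.
    refine mem_posCone_of_isPositive (π := π.comp cor)
      (hπ.comp Stabilization.isometry_corner) ?_
    rw [NonUnitalStarAlgHom.comp_apply, corner_inner]
    exact isPositive_of_mem_posCone π (AddSubmonoid.subset_closure ⟨_, rfl⟩)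
  norm_sq x := by
    rw [← norm_corner D J, corner_inner, CStarRing.norm_star_mul_self, sq]
    rfl

variable (D J) in
/-- The column whose only entry is `d`. -/
def colCorner (d : D) : Col D J := ⟨cor d, corner_mem D J d⟩

theorem colCorner_act (d e : D) : act (colCorner D J d) e = colCorner D J (d * e) :=
  Subtype.ext (map_mul cor d e).symm

theorem inner_colCorner (d e : D) : inner D (colCorner D J d) (colCorner D J e) = star d * e :=
  eq_of_corner_eq (J := J) (by
    rw [corner_inner, map_mul, map_star]
    rfl)

theorem norm_colCorner (d : D) : ‖colCorner D J d‖ = ‖d‖ := norm_corner D J d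

/-! ### Multipliers as operators on columns -/

variable (D) in
/-- The operator on the columns of `J` that is given by a multiplier of `J`. -/
def colMap (m : 𝓜(ℝ, J)) : Col D J →L[ℝ] Col D J :=
  ContinuousLinearMap.codRestrict (m.fst ∘L Col.incl D J) (colSubmodule D J)
    fun x => fst_mem_colSubmodule m x.2

theorem coe_colMap (m : 𝓜(ℝ, J)) (x : Col D J) : (colMap D m x : J) = m.fst x := rfl

theorem colMap_mul (m n : 𝓜(ℝ, J)) : colMap D (m * n) = colMap D m * colMap D n := rfl

theorem colMap_add (m n : 𝓜(ℝ, J)) : colMap D (m + n) = colMap D m + colMap D n := rfl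

theorem colMap_sub (m n : 𝓜(ℝ, J)) : colMap D (m - n) = colMap D m - colMap D n := rfl

theorem colMap_smul (r : ℝ) (m : 𝓜(ℝ, J)) : colMap D (r • m) = r • colMap D m := rfl

theorem colMap_one : colMap D (1 : 𝓜(ℝ, J)) = 1 := rfl

theorem colMap_zero : colMap D (0 : 𝓜(ℝ, J)) = 0 := rfl

theorem colMap_pow (m : 𝓜(ℝ, J)) (n : ℕ) : colMap D (m ^ n) = colMap D m ^ n := by
  induction n with
  | zero => rfl
  | succ n ih => rw [pow_succ, pow_succ, colMap_mul, ih]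

theorem isAdj_colMap (m : 𝓜(ℝ, J)) : IsAdj D (colMap D m) (colMap D (star m)) := fun x y =>
  eq_of_corner_eq (J := J) (by
    rw [corner_inner, corner_inner, coe_colMap, coe_colMap, DoubleCentralizer.star_fst, ← star_mul,
      m.central, star_mul, star_star])

theorem norm_colMap_le (m : 𝓜(ℝ, J)) (x : Col D J) : ‖colMap D m x‖ ≤ ‖m‖ * ‖x‖ := by
  rw [← m.norm_fst]
  exact m.fst.le_opNorm x

variable (D J) in
/-- The multiplication `Col ⊗ J → J`. -/
def colTensor : Col D J ⊗[ℝ] J →ₗ[ℝ] J :=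
  TensorProduct.lift ((LinearMap.mul ℝ J) ∘ₗ (Col.incl D J : Col D J →ₗ[ℝ] J))

theorem colTensor_tmul (x : Col D J) (y : J) : colTensor D J (x ⊗ₜ y) = x * y := rfl

variable (D) in
theorem mem_closure_range_colTensor (x : J) :
    x ∈ closure (LinearMap.range (colTensor D J) : Set J) := by
  refine closure_mono ?_ (Stabilization.dense_span (D := D) x)
  refine SetLike.coe_subset_coe.2 (Submodule.span_le.2 ?_)
  rintro _ ⟨x, d, y, rfl⟩
  exact ⟨(⟨x * cor d, mul_corner_mem D J x d⟩ : Col D J) ⊗ₜ y, rfl⟩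

variable (D J) in
-- Thanks to this, an adjointable operator X on the columns extends as X ⊗ 1 to `J`. Density of the
-- range is fullness of the corner.
theorem isInteriorTensor_colTensor :
    IsInteriorTensor (Stabilization.corner (D := D) (J := J)) (colTensor D J) where
  denseRange x := mem_closure_range_colTensor D x
  inner_tmul x y b c := by
    rw [corner_inner, colTensor_tmul, colTensor_tmul, self_inner, star_mul]
    simp only [mul_assoc]

/-- The products of columns with `J` span a dense subspace, which determines left multiplication;
centrality then determines right multiplication. Identities between multipliers can thus be checked
on columns. -/
theorem multiplier_ext {m n : 𝓜(ℝ, J)} (h : colMap D m = colMap D n) : m = n := by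
  have h1 : m.fst = n.fst := by
    refine ContinuousLinearMap.ext fun x => ?_
    refine (isInteriorTensor_colTensor D J).denseRange.induction_on
      (p := fun x => m.fst x = n.fst x) x (isClosed_eq m.fst.continuous n.fst.continuous)
      fun z => ?_
    induction z using TensorProduct.induction_on with
    | zero => rw [map_zero, map_zero, map_zero]
    | add z w hz hw => rw [map_add, map_add, map_add, hz, hw]
    | tmul x y =>
      rw [colTensor_tmul, fst_mul, fst_mul, ← coe_colMap, h]
      rfl
  have h2 : m.snd = n.snd := by
    refine ContinuousLinearMap.ext fun x => ?_
    have h3 : ∀ y, (m.snd x - n.snd x) * y = 0 := fun y => by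
      rw [sub_mul, m.central, n.central, h1, sub_self]
    exact sub_eq_zero.1 (CStarRing.mul_star_self_eq_zero_iff _ |>.1 (h3 _))
  exact DoubleCentralizer.ext ℝ J m n (Prod.ext h1 h2)

/-- The multiplier that is given by an adjointable operator on the columns. -/
def toMultiplier {X X' : Col D J →L[ℝ] Col D J} (h : IsAdj D X X') : 𝓜(ℝ, J) where
  fst := tensorMap (colTensor D J) (colTensor D J) X
  -- Right multiplication is x ↦ (X* x*)*, and centrality is the adjoint relation in `J` as a module
  -- over itself.
  snd := LinearMap.mkContinuous
    { toFun := fun x => star (tensorMap (colTensor D J) (colTensor D J) X' (star x))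
      map_add' := fun x y => by rw [star_add, map_add, star_add]
      map_smul' := fun r x => by rw [star_smul, map_smul, star_smul]; rfl }
    ‖tensorMap (colTensor D J) (colTensor D J) X'‖ (fun x => by
      change ‖star (tensorMap (colTensor D J) (colTensor D J) X' (star x))‖ ≤ _
      rw [norm_star, ← norm_star x]
      exact ContinuousLinearMap.le_opNorm _ _)
  central x y := by
    have hj := isInteriorTensor_colTensor D J
    have := (hj.isAdj_tensorMap hj h.symm) (star x) y
    rwa [self_inner, self_inner, star_star] at this

/-- X ⊗ 1 is known on the products of x with the corner, and these products approximate x. -/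
theorem colMap_toMultiplier {X X' : Col D J →L[ℝ] Col D J} (h : IsAdj D X X') :
    colMap D (toMultiplier h) = X := by
  refine ContinuousLinearMap.ext fun x => ?_
  have hj := isInteriorTensor_colTensor D J
  have h1 : ∀ y ∈ Set.range fun d : D => act x d, colMap D (toMultiplier h) y = X y := by
    rintro _ ⟨d, rfl⟩
    refine Subtype.ext ?_
    rw [h.map_act]
    change tensorMap (colTensor D J) (colTensor D J) X (colTensor D J (x ⊗ₜ cor d)) = _
    rw [hj.tensorMap_apply hj h]
    rfl
  exact closure_minimal h1 (isClosed_eq (ContinuousLinearMap.continuous _) X.continuous)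
    (mem_closure_range_act D x)

theorem norm_toMultiplier_le {X X' : Col D J →L[ℝ] Col D J} (h : IsAdj D X X') :
    ‖toMultiplier h‖ ≤ ‖X‖ := by
  have hj := isInteriorTensor_colTensor D J
  rw [← DoubleCentralizer.norm_fst]
  exact hj.norm_tensorMap_le hj h

variable (D) in
-- A multiplier is recovered from its operator on the columns as X ⊗ 1, whose norm is at most ‖X‖.
theorem norm_le_norm_colMap (m : 𝓜(ℝ, J)) : ‖m‖ ≤ ‖colMap D m‖ := by
  have h : m = toMultiplier (isAdj_colMap (D := D) m) :=
    multiplier_ext (D := D) (colMap_toMultiplier _).symm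
  conv_lhs => rw [h]
  exact norm_toMultiplier_le _

theorem norm_coe_multiplier (x : J) : ‖(DoubleCentralizer.coe ℝ x : 𝓜(ℝ, J))‖ = ‖x‖ := by
  rw [← DoubleCentralizer.norm_fst, DoubleCentralizer.coe_fst]
  exact ContinuousLinearMap.opNorm_mul_apply ℝ J x

theorem coe_multiplier_add (x y : J) : (DoubleCentralizer.coe ℝ (x + y) : 𝓜(ℝ, J)) =
    DoubleCentralizer.coe ℝ x + DoubleCentralizer.coe ℝ y :=
  map_add (DoubleCentralizer.coeHom (𝕜 := ℝ) (A := J)) x y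

theorem coe_multiplier_smul (r : ℝ) (x : J) : (DoubleCentralizer.coe ℝ (r • x) : 𝓜(ℝ, J)) =
    r • (DoubleCentralizer.coe ℝ x : 𝓜(ℝ, J)) :=
  map_smul (DoubleCentralizer.coeHom (𝕜 := ℝ) (A := J)) r x

theorem coe_multiplier_zero : (DoubleCentralizer.coe ℝ (0 : J) : 𝓜(ℝ, J)) = 0 :=
  map_zero (DoubleCentralizer.coeHom (𝕜 := ℝ) (A := J))

theorem isometry_coe_multiplier : Isometry (DoubleCentralizer.coe ℝ : J → 𝓜(ℝ, J)) := by
  refine Isometry.of_dist_eq fun x y => ?_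
  rw [dist_eq_norm, dist_eq_norm, ← norm_coe_multiplier (x - y)]
  congr 1
  exact (map_sub (DoubleCentralizer.coeHom (𝕜 := ℝ) (A := J)) x y).symm

theorem isClosed_range_coe_multiplier :
    IsClosed (Set.range (DoubleCentralizer.coe ℝ : J → 𝓜(ℝ, J))) :=
  isometry_coe_multiplier.isClosedEmbedding.isClosed_range

theorem coe_coe_multiplier (x : J) (y : Col D J) :
    (colMap D (DoubleCentralizer.coe ℝ x : 𝓜(ℝ, J)) y : J) = x * y := rfl

theorem colMap_coe_mul_star (x y : Col D J) :
    colMap D (DoubleCentralizer.coe ℝ ((x : J) * star (y : J)) : 𝓜(ℝ, J)) = rankOne D x y := by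
  refine ContinuousLinearMap.ext fun z => Subtype.ext ?_
  rw [coe_coe_multiplier, mul_assoc, ← corner_inner]
  rfl

variable (D) in
-- The product x d y is approximated by x (d e) y = (x d) (y* e*)*, a column times the adjoint of a
-- column.
theorem dense_span_mul_star (x : J) :
    x ∈ (Submodule.span ℝ {z : J | ∃ x y : Col D J, z = x * star (y : J)}).topologicalClosure := by
  refine map_mem_of_mem_closure (ContinuousLinearMap.id ℝ J)
    (Submodule.isClosed_topologicalClosure _) ?_ (Stabilization.dense_span (D := D) x)
  rintro _ ⟨x, d, y, rfl⟩
  change x * cor d * y ∈ closure _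
  have hf : Continuous fun e : D => x * cor e * y :=
    (continuous_const.mul Stabilization.isometry_corner.continuous).mul continuous_const
  refine map_mem_closure (f := fun e : D => x * cor e * y) hf (mem_closure_mul d) ?_
  rintro _ ⟨e, rfl⟩
  refine Submodule.subset_span ⟨⟨x * cor d, mul_corner_mem D J x d⟩,
    ⟨star y * cor (star e), mul_corner_mem D J _ _⟩, ?_⟩
  change x * cor (d * e) * y = x * cor d * star (star y * cor (star e))
  rw [star_mul, star_star, ← map_star, star_star, map_mul, mul_assoc, mul_assoc, mul_assoc]

variable (D) in
/-- Left multiplication of `J` on its columns, as a linear map. -/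
def leftMul : J →ₗ[ℝ] (Col D J →L[ℝ] Col D J) where
  toFun x := colMap D (DoubleCentralizer.coe ℝ x : 𝓜(ℝ, J))
  map_add' x y := by rw [coe_multiplier_add, colMap_add]
  map_smul' r x := by rw [coe_multiplier_smul, colMap_smul]; rfl

theorem leftMul_apply (x : J) :
    leftMul D x = colMap D (DoubleCentralizer.coe ℝ x : 𝓜(ℝ, J)) := rfl

theorem norm_leftMul_le (x : J) : ‖leftMul D x‖ ≤ 1 * ‖x‖ := by
  rw [one_mul, leftMul_apply]
  refine ContinuousLinearMap.opNorm_le_bound _ (norm_nonneg x) fun z => ?_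
  rw [← norm_coe_multiplier x]
  exact norm_colMap_le _ z

variable (D) in
-- The element x y* of `J` acts on the columns as the rank one operator of x and y, and such
-- elements span a dense subspace of `J`.
theorem colMap_mem_compactOperators {m : 𝓜(ℝ, J)}
    (hm : m ∈ Set.range (DoubleCentralizer.coe ℝ : J → 𝓜(ℝ, J))) :
    colMap D m ∈ compactOperators D (Col D J) := by
  obtain ⟨x, rfl⟩ := hm
  have h : (leftMul D).mkContinuous 1 norm_leftMul_le x ∈ compactOperators D (Col D J) := by
    refine map_mem_of_mem_closure _ (isClosed_compactOperators D (Col D J)) ?_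
      (dense_span_mul_star D x)
    rintro _ ⟨x, y, rfl⟩
    rw [LinearMap.mkContinuous_apply, leftMul_apply, colMap_coe_mul_star]
    exact rankOne_mem x y
  rwa [LinearMap.mkContinuous_apply] at h

section

variable {E : Type*} [NormedAddCommGroup E] [NormedSpace ℝ E] [HilbertModule D E]

/-- If k is the rank one operator of x and y, then v k v* is left multiplication by (v x) (v y)*. In
general k is approximated; the multiplier norm is controlled by the norm on the columns, and `J` is
closed in its multiplier algebra. -/
theorem mem_range_coe_of_colMap_eq {v : E →L[ℝ] Col D J} {v' : Col D J →L[ℝ] E} (hv : IsAdj D v v')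
    {k : E →L[ℝ] E} (hk : k ∈ compactOperators D E) {m : 𝓜(ℝ, J)}
    (hm : colMap D m = v ∘L k ∘L v') :
    m ∈ Set.range (DoubleCentralizer.coe ℝ : J → 𝓜(ℝ, J)) := by
  have h1 : ∀ l ∈ Submodule.span ℝ {T : E →L[ℝ] E | ∃ x y : E, ∀ z, T z = act x (inner D y z)},
      ∃ x : J, colMap D (DoubleCentralizer.coe ℝ x : 𝓜(ℝ, J)) = v ∘L l ∘L v' := fun l hl => by
    induction hl using Submodule.span_induction with
    | mem l hl =>
      obtain ⟨x, y, hl⟩ := hl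
      obtain rfl : l = rankOne D x y := ContinuousLinearMap.ext hl
      refine ⟨(v x : J) * star (v y : J), ?_⟩
      rw [colMap_coe_mul_star, rankOne_comp hv.symm, comp_rankOne hv]
    | zero =>
      refine ⟨0, ?_⟩
      rw [coe_multiplier_zero, colMap_zero, ContinuousLinearMap.zero_comp,
        ContinuousLinearMap.comp_zero]
    | add l l' _ _ hl hl' =>
      obtain ⟨x, hx⟩ := hl
      obtain ⟨y, hy⟩ := hl'
      refine ⟨x + y, ?_⟩
      rw [coe_multiplier_add, colMap_add, hx, hy, ContinuousLinearMap.add_comp,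
        ContinuousLinearMap.comp_add]
    | smul r l _ hl =>
      obtain ⟨x, hx⟩ := hl
      refine ⟨r • x, ?_⟩
      rw [coe_multiplier_smul, colMap_smul, hx, ContinuousLinearMap.smul_comp,
        ContinuousLinearMap.comp_smul]
  rw [← isClosed_range_coe_multiplier.closure_eq]
  refine Metric.mem_closure_iff.2 fun ε hε => ?_
  -- The summand 1 keeps the denominator positive if v or v' vanishes.
  obtain ⟨l, hl, hkl⟩ := Metric.mem_closure_iff.1 hk (ε / (‖v‖ * ‖v'‖ + 1)) (by positivity)
  obtain ⟨x, hx⟩ := h1 l hl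
  refine ⟨_, ⟨x, rfl⟩, ?_⟩
  rw [dist_eq_norm] at hkl ⊢
  refine (norm_le_norm_colMap D _).trans_lt ?_
  have h2 : colMap D (m - DoubleCentralizer.coe ℝ x) = v ∘L (k - l) ∘L v' := by
    rw [colMap_sub, hm, hx]
    refine ContinuousLinearMap.ext fun z => ?_
    change v (k (v' z)) - v (l (v' z)) = v (k (v' z) - l (v' z))
    rw [map_sub]
  rw [h2]
  calc ‖v ∘L (k - l) ∘L v'‖ ≤ ‖v‖ * (‖k - l‖ * ‖v'‖) :=
        (ContinuousLinearMap.opNorm_comp_le _ _).trans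
          (by gcongr; exact ContinuousLinearMap.opNorm_comp_le _ _)
    _ = ‖v‖ * ‖v'‖ * ‖k - l‖ := by ring
    _ ≤ (‖v‖ * ‖v'‖ + 1) * ‖k - l‖ := by gcongr; linarith
    _ < (‖v‖ * ‖v'‖ + 1) * (ε / (‖v‖ * ‖v'‖ + 1)) := by gcongr
    _ = ε := by field_simp

end

end Col

end

end RealKK

namespace RealKK

noncomputable section

open Filter Topology HilbertModule

/-! ### Embedding of countably generated modules into the columns -/

section Embedding

variable (D J : Type v) [RealCStarAlgebra D] [RealCStarAlgebra J] [Stabilization D J]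

local notation "ev" => (Stabilization.even (D := D) (J := J) : 𝓜(ℝ, J))
local notation "od" => (Stabilization.odd (D := D) (J := J) : 𝓜(ℝ, J))

theorem odd_mul_star_even : od * star ev = 0 := by
  have := congrArg star (Stabilization.even_mul_star_odd (D := D) (J := J))
  rwa [star_mul, star_star, star_zero] at this

theorem colMap_even_star (x : Col D J) : colMap D ev (colMap D (star ev) x) = x := by
  change colMap D (ev * star ev) x = x
  rw [Stabilization.even_mul_star]
  rfl

theorem colMap_odd_star (x : Col D J) : colMap D od (colMap D (star od) x) = x := by
  change colMap D (od * star od) x = x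
  rw [Stabilization.odd_mul_star]
  rfl

theorem colMap_even_star_odd (x : Col D J) : colMap D ev (colMap D (star od) x) = 0 := by
  change colMap D (ev * star od) x = 0
  rw [Stabilization.even_mul_star_odd]
  rfl

theorem colMap_odd_star_even (x : Col D J) : colMap D od (colMap D (star ev) x) = 0 := by
  change colMap D (od * star ev) x = 0
  rw [odd_mul_star_even]
  rfl

theorem inner_colMap_star_odd (x y : Col D J) :
    inner D (colMap D (star od) x) (colMap D (star od) y) = inner D x y := by
  rw [← isAdj_colMap, colMap_odd_star]

theorem norm_colMap_star_odd (x : Col D J) : ‖colMap D (star od) x‖ = ‖x‖ := by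
  refine (sq_eq_sq₀ (norm_nonneg _) (norm_nonneg _)).1 ?_
  rw [HilbertModule.norm_sq (B := D), inner_colMap_star_odd, ← HilbertModule.norm_sq]

/-- The isometric inclusions of countably many orthogonal copies of the columns. -/
def slot : ℕ → 𝓜(ℝ, J)
  | 0 => star ev
  | n + 1 => star od * slot n

theorem colMap_star_slot_slot (i j : ℕ) (x : Col D J) :
    colMap D (star (slot D J i)) (colMap D (slot D J j) x) = if i = j then x else 0 := by
  induction i generalizing j with
  | zero =>
    cases j with
    | zero => rw [slot, star_star, colMap_even_star, if_pos rfl]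
    | succ j =>
      rw [slot, slot, star_star, if_neg (Nat.succ_ne_zero j).symm]
      change colMap D ev (colMap D (star od) (colMap D (slot D J j) x)) = 0
      exact colMap_even_star_odd D J _
  | succ i ih =>
    cases j with
    | zero =>
      rw [slot, slot, star_mul, star_star, if_neg (Nat.succ_ne_zero i)]
      change colMap D (star (slot D J i)) (colMap D od (colMap D (star ev) x)) = 0
      rw [colMap_odd_star_even, map_zero]
    | succ j =>
      rw [slot, slot, star_mul, star_star]
      change colMap D (star (slot D J i)) (colMap D od (colMap D (star od)
        (colMap D (slot D J j) x))) = _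
      rw [colMap_odd_star, ih]
      simp

theorem inner_colMap_slot (i : ℕ) (x y : Col D J) :
    inner D (colMap D (slot D J i) x) (colMap D (slot D J i) y) = inner D x y := by
  rw [isAdj_colMap, colMap_star_slot_slot, if_pos rfl]

theorem norm_colMap_slot (i : ℕ) (x : Col D J) : ‖colMap D (slot D J i) x‖ = ‖x‖ := by
  refine (sq_eq_sq₀ (norm_nonneg _) (norm_nonneg _)).1 ?_
  rw [HilbertModule.norm_sq (B := D), inner_colMap_slot, ← HilbertModule.norm_sq]

variable (E : Type*) [NormedAddCommGroup E] [NormedSpace ℝ E] [HilbertModule D E]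

variable {D E} in
theorem norm_rankOne_le {F : Type*} [NormedAddCommGroup F] [NormedSpace ℝ F] [HilbertModule D F]
    (x : F) (y : E) : ‖rankOne D x y‖ ≤ ‖x‖ * ‖y‖ := by
  refine ContinuousLinearMap.opNorm_le_bound _ (by positivity) fun z => ?_
  rw [rankOne_apply, mul_assoc]
  exact (norm_act_le _ _).trans (by gcongr; exact norm_inner_le _ _)

/-- Rescaling y by a positive number does not change the span. The bounds are chosen to sum to one,
so that the operator built from them is a contraction. -/
theorem exists_dense_act_norm_le [CompleteSpace E] [TopologicalSpace.SeparableSpace D]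
    [TopologicalSpace.SeparableSpace E] : ∃ (y : ℕ → E) (d : ℕ → D),
      (∀ x, x ∈ (Submodule.span ℝ (Set.range fun n => act (y n) (d n))).topologicalClosure) ∧
      ∀ n, ‖d n‖ * ‖y n‖ ≤ 1 / 2 / 2 ^ n := by
  obtain ⟨y, d, h⟩ := exists_dense_act D E
  have hc : ∀ n, 0 < 1 / 2 / 2 ^ n / (‖d n‖ * ‖y n‖ + 1) := fun n => by positivity
  refine ⟨fun n => (1 / 2 / 2 ^ n / (‖d n‖ * ‖y n‖ + 1)) • y n, d, fun x => ?_, fun n => ?_⟩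
  · refine closure_mono ?_ (h x)
    rintro _ ⟨n, rfl⟩
    have : act (y n) (d n) = (1 / 2 / 2 ^ n / (‖d n‖ * ‖y n‖ + 1))⁻¹ •
        act ((1 / 2 / 2 ^ n / (‖d n‖ * ‖y n‖ + 1)) • y n) (d n) := by
      rw [smul_act, smul_smul, inv_mul_cancel₀ (hc n).ne', one_smul]
    change act (y n) (d n) ∈ Submodule.span ℝ _
    rw [this]
    exact Submodule.smul_mem _ _ (Submodule.subset_span ⟨n, rfl⟩)
  · rw [norm_smul, Real.norm_of_nonneg (hc n).le]
    have h0 : (0 : ℝ) < 1 / 2 / 2 ^ n := by positivity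
    have h1 : 0 ≤ ‖d n‖ * ‖y n‖ := by positivity
    calc _ = 1 / 2 / 2 ^ n * (‖d n‖ * ‖y n‖ / (‖d n‖ * ‖y n‖ + 1)) := by ring
      _ ≤ 1 / 2 / 2 ^ n * 1 := by
        gcongr
        rw [div_le_one (by positivity)]
        linarith
      _ = _ := mul_one _

/-- W writes ⟪gᵢ, e⟫ into the i-th copy of the columns, for a generating sequence gᵢ = yᵢ·dᵢ. The
i-th component alone accounts for ⟪e, gᵢ⟫ ⟪gᵢ, e⟫, so W*W dominates each of these forms. That is the
hypothesis under which the powers of √(1 − W*W) tend to zero. -/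
theorem exists_gram [CompleteSpace E] [TopologicalSpace.SeparableSpace D]
    [TopologicalSpace.SeparableSpace E] :
    ∃ (W : E →L[ℝ] Col D J) (W' : Col D J →L[ℝ] E) (s : Set E), IsAdj D W W' ∧ ‖W‖ ≤ 1 ∧
      (∀ x, x ∈ (Submodule.span ℝ s).topologicalClosure) ∧
      ∀ g ∈ s, ∀ e, inner D (W e) (W e) - inner D e g * inner D g e ∈ posCone D := by
  obtain ⟨y, d, hdense, hnorm⟩ := exists_dense_act_norm_le D E
  -- The vector aᵢ·⟪yᵢ, e⟫ has the single entry dᵢ* ⟪yᵢ, e⟫ = ⟪yᵢ·dᵢ, e⟫.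
  let a : ℕ → Col D J := fun i => colMap D (slot D J i) (colCorner D J (star (d i)))
  have ha : ∀ i, ‖a i‖ = ‖d i‖ := fun i => by
    rw [norm_colMap_slot, norm_colCorner, norm_star]
  have hn : ∀ i, ‖rankOne D (a i) (y i)‖ ≤ 1 / 2 / 2 ^ i := fun i =>
    (norm_rankOne_le _ _).trans (by rw [ha]; exact hnorm i)
  have hn' : ∀ i, ‖rankOne D (y i) (a i)‖ ≤ 1 / 2 / 2 ^ i := fun i =>
    (norm_rankOne_le _ _).trans (by rw [ha, mul_comm]; exact hnorm i)
  have hgeo : HasSum (fun i : ℕ => (1 : ℝ) / 2 / 2 ^ i) 1 := hasSum_geometric_two' 1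
  have hW : HasSum (fun i => rankOne D (a i) (y i)) (∑' i, rankOne D (a i) (y i)) :=
    (hgeo.summable.of_norm_bounded hn).hasSum
  have hW' : HasSum (fun i => rankOne D (y i) (a i)) (∑' i, rankOne D (y i) (a i)) :=
    (hgeo.summable.of_norm_bounded hn').hasSum
  set W := ∑' i, rankOne D (a i) (y i) with hWdef
  set W' := ∑' i, rankOne D (y i) (a i) with hWdef'
  refine ⟨W, W', Set.range fun n => act (y n) (d n), ?_, ?_, hdense, ?_⟩
  · refine IsAdj.of_tendsto (l := atTop) (T := fun s => ∑ i ∈ s, rankOne D (a i) (y i))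
      (S := fun s => ∑ i ∈ s, rankOne D (y i) (a i)) (fun x => ?_) (fun x => ?_) fun s =>
      IsAdj.sum s fun i _ => isAdj_rankOne _ _
    · exact ((ContinuousLinearMap.apply ℝ _ x).continuous.tendsto W).comp hW
    · exact ((ContinuousLinearMap.apply ℝ _ x).continuous.tendsto W').comp hW'
  · exact tsum_of_norm_bounded hgeo hn
  · rintro _ ⟨i, rfl⟩ e
    have h1 : HasSum (fun j => rankOne D (a j) (y j) e) (W e) :=
      hW.mapL (ContinuousLinearMap.apply ℝ (Col D J) e)
    have h2 := h1.mapL (colMap D (star (slot D J i)))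
    have h3 : colMap D (star (slot D J i)) (W e) = colCorner D J (inner D (act (y i) (d i)) e) := by
      have h4 : ∀ j, colMap D (star (slot D J i)) (rankOne D (a j) (y j) e) =
          if i = j then colCorner D J (inner D (act (y i) (d i)) e) else 0 := fun j => by
        rw [rankOne_apply, (isAdj_colMap _).map_act, colMap_star_slot_slot]
        split_ifs with hij
        · subst hij
          rw [colCorner_act, inner_act_left]
        · exact zero_act _
      rw [funext h4] at h2
      refine h2.unique ?_
      have := hasSum_ite_eq i (colCorner D J (inner D (act (y i) (d i)) e))
      simpa only [eq_comm] using this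
    set g := act (y i) (d i)
    have h5 : inner D e g * inner D g e = inner D (colMap D (star (slot D J i)) (W e))
        (colMap D (star (slot D J i)) (W e)) := by
      rw [h3, inner_colCorner, HilbertModule.star_inner]
    set x := W e
    -- p is the orthogonal projection of W e to the i-th copy; what remains, x − p, has a positive
    -- inner square.
    set p := colMap D (slot D J i) (colMap D (star (slot D J i)) x) with hp
    have h6 : inner D x x - inner D e g * inner D g e = inner D (x - p) (x - p) := by
      have h7 : inner D p x = inner D (colMap D (star (slot D J i)) x)
        (colMap D (star (slot D J i)) x) := isAdj_colMap _ _ _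
      have h8 : inner D p p = inner D p x := by rw [h7, hp, inner_colMap_slot]
      have h9 : inner D x p = inner D p x := by
        rw [← HilbertModule.star_inner p x, h7, HilbertModule.star_inner]
      rw [HilbertModule.inner_sub_left, HilbertModule.inner_sub_right,
        HilbertModule.inner_sub_right, h8, h9, h5, h7]
      abel
    rw [h6]
    exact inner_self_mem _

/-! ### Approximate isometric embeddings and their limit -/

section Limit

variable {D J E} (R : E →L[ℝ] E) (W : E →L[ℝ] Col D J) (W' : Col D J →L[ℝ] E)

/-- The approximations `∑ k < n, s k * W * R ^ k` of an isometric embedding. -/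
def embApprox : ℕ → E →L[ℝ] Col D J
  | 0 => 0
  | n + 1 => colMap D (star ev) ∘L W + colMap D (star od) ∘L embApprox n ∘L R

/-- The adjoints of `embApprox`. -/
def embApproxAdj : ℕ → Col D J →L[ℝ] E
  | 0 => 0
  | n + 1 => W' ∘L colMap D ev + R ∘L embApproxAdj n ∘L colMap D od

variable {R W W'}

theorem isAdj_embApprox (hR : IsAdj D R R) (hW : IsAdj D W W') (n : ℕ) :
    IsAdj D (embApprox R W n) (embApproxAdj R W' n) := by
  induction n with
  | zero => exact IsAdj.zero _ _ _
  | succ n ih =>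
    exact (hW.comp (isAdj_colMap ev).symm).add ((hR.comp ih).comp (isAdj_colMap od).symm)

/-- The summands have orthogonal ranges, and ⟪R e, R f⟫ = ⟪e, f⟫ − ⟪W e, W f⟫ makes their inner
products telescope. The defect from being isometric is thus governed by Rⁿ. -/
theorem inner_embApprox (hR : IsAdj D R R) (hW : IsAdj D W W') (hRS : R * R = 1 - W' ∘L W) (n : ℕ)
    (e f : E) : inner D (embApprox R W n e) (embApprox R W n f) =
      inner D e f - inner D ((R ^ n) e) ((R ^ n) f) := by
  induction n generalizing e f with
  | zero =>
    change inner D (0 : Col D J) (0 : Col D J) = inner D e f - inner D e f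
    rw [HilbertModule.inner_zero_left, sub_self]
  | succ n ih =>
    change inner D (colMap D (star ev) (W e) + colMap D (star od) (embApprox R W n (R e)))
      (colMap D (star ev) (W f) + colMap D (star od) (embApprox R W n (R f))) = _
    have h1 : R (R f) = f - W' (W f) := congrArg (fun T : E →L[ℝ] E => T f) hRS
    have h2 : inner D (R e) (R f) = inner D e f - inner D (W e) (W f) := by
      rw [hR, h1, HilbertModule.inner_sub_right, hW]
    have h3 : R ^ (n + 1) = R ^ n * R := pow_succ R n
    rw [HilbertModule.inner_add_left, HilbertModule.inner_add_right, HilbertModule.inner_add_right,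
      ← isAdj_colMap, ← isAdj_colMap, ← isAdj_colMap, ← isAdj_colMap, colMap_even_star,
      colMap_odd_star, colMap_odd_star_even, colMap_even_star_odd, HilbertModule.inner_zero_left,
      HilbertModule.inner_zero_left, ih, h2, h3]
    change _ = inner D e f - inner D ((R ^ n) (R e)) ((R ^ n) (R f))
    abel

/-- The tail after N terms is an approximation again, applied to Rᴺ e and then shifted
isometrically, so its size is governed by Rᴺ e. For the adjoints in `embApproxAdj_add` it is
governed by the N-th power of `odd`. -/
theorem embApprox_add (N m : ℕ) (e : E) : embApprox R W (N + m) e =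
    embApprox R W N e + (colMap D (star od) ^ N) (embApprox R W m ((R ^ N) e)) := by
  induction N generalizing e with
  | zero =>
    rw [zero_add]
    exact (zero_add _).symm
  | succ N ih =>
    rw [show N + 1 + m = N + m + 1 by ring, pow_succ', pow_succ]
    change colMap D (star ev) (W e) + colMap D (star od) (embApprox R W (N + m) (R e)) =
      colMap D (star ev) (W e) + colMap D (star od) (embApprox R W N (R e)) +
        colMap D (star od) ((colMap D (star od) ^ N) (embApprox R W m ((R ^ N) (R e))))
    rw [ih, map_add, add_assoc]

theorem embApproxAdj_add (N m : ℕ) (c : Col D J) : embApproxAdj R W' (N + m) c =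
    embApproxAdj R W' N c + (R ^ N) (embApproxAdj R W' m ((colMap D od ^ N) c)) := by
  induction N generalizing c with
  | zero =>
    rw [zero_add]
    exact (zero_add _).symm
  | succ N ih =>
    rw [show N + 1 + m = N + m + 1 by ring, pow_succ', pow_succ]
    change W' (colMap D ev c) + R (embApproxAdj R W' (N + m) (colMap D od c)) =
      W' (colMap D ev c) + R (embApproxAdj R W' N (colMap D od c)) +
        R ((R ^ N) (embApproxAdj R W' m ((colMap D od ^ N) (colMap D od c))))
    rw [ih, map_add, add_assoc]

theorem norm_pow_apply_le {X : Type*} [NormedAddCommGroup X] [NormedSpace ℝ X] {T : X →L[ℝ] X}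
    (h : ∀ x, ‖T x‖ ≤ ‖x‖) (n : ℕ) (x : X) : ‖(T ^ n) x‖ ≤ ‖x‖ := by
  induction n with
  | zero => exact le_rfl
  | succ n ih => rw [pow_succ']; exact (h _).trans ih

theorem cauchySeq_of_norm_sub_le {X : Type*} [NormedAddCommGroup X] {u : ℕ → X} {b : ℕ → ℝ}
    (hb : Tendsto b atTop (𝓝 0)) (h : ∀ N m, ‖u (N + m) - u N‖ ≤ b N) : CauchySeq u := by
  refine Metric.cauchySeq_iff'.2 fun ε hε => ?_
  obtain ⟨N, hN⟩ := (hb.eventually (gt_mem_nhds hε)).exists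
  refine ⟨N, fun n hn => ?_⟩
  obtain ⟨m, rfl⟩ := Nat.exists_eq_add_of_le hn
  rw [dist_eq_norm]
  exact (h N m).trans_lt hN

theorem exists_tendsto_of_cauchySeq {X Y : Type*} [NormedAddCommGroup X] [NormedSpace ℝ X]
    [CompleteSpace X] [NormedAddCommGroup Y] [NormedSpace ℝ Y] [CompleteSpace Y] {T : ℕ → X →L[ℝ] Y}
    (h : ∀ x, CauchySeq fun n => T n x) :
    ∃ S : X →L[ℝ] Y, ∀ x, Tendsto (fun n => T n x) atTop (𝓝 (S x)) := by
  choose v hv using fun x => cauchySeq_tendsto_of_complete (h x)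
  exact ⟨continuousLinearMapOfTendsto T (tendsto_pi_nhds.2 hv), hv⟩

theorem tendsto_inner {X : Type*} [NormedAddCommGroup X] [NormedSpace ℝ X] [HilbertModule D X]
    {u u' : ℕ → X} {x x' : X} (h : Tendsto u atTop (𝓝 x)) (h' : Tendsto u' atTop (𝓝 x')) :
    Tendsto (fun n => inner D (u n) (u' n)) atTop (𝓝 (inner D x x')) :=
  (HilbertModule.continuous_inner.tendsto (x, x')).comp (h.prodMk_nhds h')

theorem exists_isAdj_of_cauchySeq [CompleteSpace E] (hR : IsAdj D R R) (hW : IsAdj D W W')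
    (hRS : R * R = 1 - W' ∘L W) (ht : ∀ e, Tendsto (fun n => (R ^ n) e) atTop (𝓝 0))
    (hc1 : ∀ e, CauchySeq fun n => embApprox R W n e)
    (hc2 : ∀ c, CauchySeq fun n => embApproxAdj R W' n c) :
    ∃ (v : E →L[ℝ] Col D J) (v' : Col D J →L[ℝ] E), IsAdj D v v' ∧ v' ∘L v = 1 := by
  obtain ⟨v, hv⟩ := exists_tendsto_of_cauchySeq hc1
  obtain ⟨v', hv'⟩ := exists_tendsto_of_cauchySeq hc2
  have hadj : IsAdj D v v' := fun e c =>
    tendsto_nhds_unique (tendsto_inner (hv e) tendsto_const_nhds)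
      ((tendsto_inner tendsto_const_nhds (hv' c)).congr fun n => (isAdj_embApprox hR hW n e c).symm)
  refine ⟨v, v', hadj, ContinuousLinearMap.ext fun f => ext_inner_left D fun e => ?_⟩
  change inner D e (v' (v f)) = inner D e f
  rw [← hadj]
  have h1 := tendsto_inner (D := D) (hv e) (hv f)
  have h2 := (tendsto_const_nhds (x := inner D e f)).sub (tendsto_inner (D := D) (ht e) (ht f))
  rw [HilbertModule.inner_zero_left, sub_zero] at h2
  simp only [inner_embApprox hR hW hRS] at h1
  exact tendsto_nhds_unique h1 h2

end Limit

/-- A countably generated Hilbert module over a separable C*-algebra is a complemented submodule of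
the columns. -/
theorem exists_isometric_embedding [CompleteSpace E] [TopologicalSpace.SeparableSpace D]
    [TopologicalSpace.SeparableSpace E] :
    ∃ (v : E →L[ℝ] Col D J) (v' : Col D J →L[ℝ] E), IsAdj D v v' ∧ v' ∘L v = 1 := by
  obtain ⟨W, W', s, hW, hW1, hs, hg⟩ := exists_gram D J E
  have hS1 : ‖W' ∘L W‖ ≤ 1 := (ContinuousLinearMap.opNorm_comp_le _ _).trans
    (mul_le_one₀ (hW.norm_le zero_le_one hW1) (norm_nonneg _) hW1)
  -- The embedding is v = ∑ sₖ W Rᵏ with sₖ the inclusion of the k-th copy. It is isometric because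
  -- ∑ Rᵏ W*W Rᵏ = 1 strongly, where W*W = 1 − R².
  obtain ⟨R, hR, hRS⟩ := exists_sqrt_one_sub D hS1 (hW.comp hW.symm)
  have hin : ∀ e, inner D e ((W' ∘L W) e) = inner D (W e) (W e) := fun e => (hW e (W e)).symm
  have hR1 : ∀ e, ‖R e‖ ≤ ‖e‖ := norm_apply_le_of_mul_self hR hRS fun e => by
    rw [hin]
    exact inner_self_mem _
  have ht : ∀ e, Tendsto (fun n => (R ^ n) e) atTop (𝓝 0) := fun e =>
    tendsto_apply_zero_of_mem_closure (norm_pow_apply_le hR1)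
      (fun g hgs => tendsto_pow_apply_zero hR hRS fun e => by rw [hin]; exact hg g hgs e) (hs e)
  have hodd : ∀ c : Col D J, Tendsto (fun n => (colMap D od ^ n) c) atTop (𝓝 0) := fun c => by
    rw [tendsto_zero_iff_norm_tendsto_zero]
    refine (tendsto_zero_iff_norm_tendsto_zero.1
      (Stabilization.tendsto_odd_pow (D := D) (c : J))).congr fun n => ?_
    rw [← colMap_pow]
    rfl
  have hT1 : ∀ n, ‖embApprox R W n‖ ≤ 1 := fun n =>
    ContinuousLinearMap.opNorm_le_bound _ zero_le_one fun e => by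
      rw [one_mul]
      refine le_of_sq_le_sq ?_ (norm_nonneg e)
      rw [HilbertModule.norm_sq (B := D), HilbertModule.norm_sq (B := D)]
      refine norm_le_norm_of_sub_mem (inner_self_mem _) ?_
      rw [inner_embApprox hR hW hRS, sub_sub_cancel]
      exact inner_self_mem _
  have hT2 : ∀ n, ‖embApproxAdj R W' n‖ ≤ 1 := fun n =>
    (isAdj_embApprox hR hW n).norm_le zero_le_one (hT1 n)
  have hc1 : ∀ e, CauchySeq fun n => embApprox R W n e := fun e =>
    cauchySeq_of_norm_sub_le (tendsto_zero_iff_norm_tendsto_zero.1 (ht e)) fun N m => by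
      rw [embApprox_add, add_sub_cancel_left]
      refine (norm_pow_apply_le (fun x => (norm_colMap_star_odd D J x).le) N _).trans ?_
      simpa using (embApprox R W m).le_of_opNorm_le (hT1 m) ((R ^ N) e)
  have hc2 : ∀ c, CauchySeq fun n => embApproxAdj R W' n c := fun c =>
    cauchySeq_of_norm_sub_le (tendsto_zero_iff_norm_tendsto_zero.1 (hodd c)) fun N m => by
      rw [embApproxAdj_add, add_sub_cancel_left]
      refine (norm_pow_apply_le hR1 N _).trans ?_
      simpa using (embApproxAdj R W' m).le_of_opNorm_le (hT2 m) ((colMap D od ^ N) c)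
  exact exists_isAdj_of_cauchySeq hR hW hRS ht hc1 hc2

end Embedding

end

end RealKK

namespace RealKK

noncomputable section

open Filter Topology HilbertModule

/-! ### `𝒦 ⊗ B` as a stabilization of `B` -/

section MatrixUnits

variable {H : Type v} [NormedAddCommGroup H] [InnerProductSpace ℝ H]

theorem matrixUnit_mul_matrixUnit (i j k l : ℕ) (S T : H →L[ℝ] H) :
    matrixUnit i j S * matrixUnit k l T = if j = k then matrixUnit i l (S * T) else 0 := by
  refine ContinuousLinearMap.ext fun ξ => ?_
  change L2.single H i (S (L2.coord H j (L2.single H k (T (L2.coord H l ξ))))) = _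
  split_ifs with h
  · subst h
    rw [L2.coord_single_self]
    rfl
  · rw [L2.coord_single_of_ne h, map_zero, map_zero]
    rfl

theorem matrixUnit_add (i j : ℕ) (S T : H →L[ℝ] H) :
    matrixUnit i j (S + T) = matrixUnit i j S + matrixUnit i j T :=
  ContinuousLinearMap.ext fun _ => map_add (L2.single H i) _ _

theorem matrixUnit_smul (i j : ℕ) (r : ℝ) (T : H →L[ℝ] H) :
    matrixUnit i j (r • T) = r • matrixUnit i j T :=
  ContinuousLinearMap.ext fun _ => map_smul (L2.single H i) _ _

theorem norm_single_apply (i : ℕ) (h : H) : ‖L2.single H i h‖ = ‖h‖ :=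
  lp.norm_single (E := fun _ : ℕ => H) (by norm_num) i h

theorem norm_coord_apply_le (i : ℕ) (ξ : L2 H) : ‖L2.coord H i ξ‖ ≤ ‖ξ‖ :=
  lp.norm_apply_le_norm (by norm_num) ξ i

theorem norm_matrixUnit (i j : ℕ) (T : H →L[ℝ] H) : ‖matrixUnit i j T‖ = ‖T‖ := by
  refine le_antisymm ?_ ?_
  · refine ContinuousLinearMap.opNorm_le_bound _ (norm_nonneg _) fun ξ => ?_
    change ‖L2.single H i (T (L2.coord H j ξ))‖ ≤ _
    rw [norm_single_apply]
    exact (T.le_opNorm _).trans (by gcongr; exact norm_coord_apply_le j ξ)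
  · refine ContinuousLinearMap.opNorm_le_bound _ (norm_nonneg _) fun h => ?_
    have h1 := (matrixUnit i j T).le_opNorm (L2.single H j h)
    rw [norm_single_apply] at h1
    change ‖L2.single H i (T (L2.coord H j (L2.single H j h)))‖ ≤ _ at h1
    rwa [L2.coord_single_self, norm_single_apply] at h1

theorem restriction_single (σ : ℕ ↪ ℕ) (m : ℕ) (h : H) :
    restriction σ (L2.single H (σ m) h) = L2.single H m h := L2.ext fun k => by
  rw [coord_restriction]
  by_cases hk : k = m
  · subst hk
    rw [L2.coord_single_self, L2.coord_single_self]
  · rw [L2.coord_single_of_ne hk, L2.coord_single_of_ne (fun h' => hk (σ.injective h'))]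

theorem restriction_single_of_notMem (σ : ℕ ↪ ℕ) {n : ℕ} (hn : n ∉ Set.range σ) (h : H) :
    restriction σ (L2.single H n h) = 0 := L2.ext fun k => by
  rw [coord_restriction, L2.coord_single_of_ne fun h' => hn ⟨k, h'⟩, map_zero]

theorem norm_restriction_apply_le (σ : ℕ ↪ ℕ) (ξ : L2 H) : ‖restriction σ ξ‖ ≤ ‖ξ‖ := by
  have h : ‖(restriction σ : L2 H →L[ℝ] L2 H)‖ ≤ 1 := LinearMap.mkContinuous_norm_le _ zero_le_one _
  simpa using ContinuousLinearMap.le_of_opNorm_le _ h ξ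

/-- Restriction to the odd numbers moves row 2k + 1 to row k and kills the even rows, so row i is
gone after at most i + 1 steps. -/
theorem restriction_oddEmb_pow_mul_matrixUnit (i j : ℕ) (T : H →L[ℝ] H) (n : ℕ) (hn : i < n) :
    (restriction oddEmb : L2 H →L[ℝ] L2 H) ^ n * matrixUnit i j T = 0 := by
  induction n generalizing i with
  | zero => omega
  | succ n ih =>
    rw [pow_succ, mul_assoc]
    by_cases hi : i ∈ Set.range oddEmb
    · obtain ⟨k, rfl⟩ := hi
      rw [restriction_mul_matrixUnit]
      refine ih k ?_
      change 2 * k + 1 < n + 1 at hn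
      omega
    · rw [restriction_mul_matrixUnit_of_notMem _ _ _ hi, mul_zero]

/-- The two summands are the projections to the even and to the odd coordinates, which together
exhaust ℕ. -/
theorem star_restriction_mul_add [CompleteSpace H] :
    star (restriction evenEmb : L2 H →L[ℝ] L2 H) * restriction evenEmb +
      star (restriction oddEmb) * restriction oddEmb = 1 := by
  have key : ∀ (σ : ℕ ↪ ℕ) (n : ℕ) (h : H) (ξ : L2 H),
      inner ℝ h (L2.coord H n (star (restriction σ) (restriction σ ξ))) =
        inner ℝ (restriction σ (L2.single H n h)) (restriction σ ξ) := fun σ n h ξ => by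
    rw [← L2.inner_single_left, ContinuousLinearMap.star_eq_adjoint,
      ContinuousLinearMap.adjoint_inner_right]
  refine ContinuousLinearMap.ext fun ξ => L2.ext fun n => ext_inner_left ℝ fun h => ?_
  change inner ℝ h (L2.coord H n (star (restriction evenEmb) (restriction evenEmb ξ) +
    star (restriction oddEmb) (restriction oddEmb ξ))) = inner ℝ h (L2.coord H n ξ)
  rw [map_add, _root_.inner_add_right, key, key]
  obtain ⟨m, rfl | rfl⟩ := n.even_or_odd'
  · rw [restriction_single_of_notMem oddEmb (n := 2 * m)]
    · rw [_root_.inner_zero_left, add_zero]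
      change inner ℝ (restriction evenEmb (L2.single H (evenEmb m) h)) _ = _
      rw [restriction_single, L2.inner_single_left, coord_restriction]
      rfl
    · rintro ⟨k, hk⟩
      change 2 * k + 1 = 2 * m at hk
      omega
  · rw [restriction_single_of_notMem evenEmb (n := 2 * m + 1)]
    · rw [_root_.inner_zero_left, zero_add]
      change inner ℝ (restriction oddEmb (L2.single H (oddEmb m) h)) _ = _
      rw [restriction_single, L2.inner_single_left, coord_restriction]
      rfl
    · rintro ⟨k, hk⟩
      change 2 * k = 2 * m + 1 at hk
      omega

end MatrixUnits

section KTensor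

variable (B : Type v) [RealCStarAlgebra B]

/-- The matrix unit `e i j ⊗ b` in `𝒦 ⊗ B`. -/
def kUnit (i j : ℕ) (b : B) : KTensor B :=
  ⟨matrixUnit i j (rep B b), subset_closure (matrixUnit_mem_adjoin (rep B) i j b)⟩

variable {B}

theorem kUnit_mul_kUnit (i j k l : ℕ) (b c : B) :
    kUnit B i j b * kUnit B k l c = if j = k then kUnit B i l (b * c) else 0 := by
  refine Subtype.ext ?_
  change matrixUnit i j (rep B b) * matrixUnit k l (rep B c) = _
  rw [matrixUnit_mul_matrixUnit]
  split_ifs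
  · rw [← map_mul]
    rfl
  · rfl

theorem star_kUnit (i j : ℕ) (b : B) : star (kUnit B i j b) = kUnit B j i (star b) := by
  refine Subtype.ext ?_
  change star (matrixUnit i j (rep B b)) = matrixUnit j i (rep B (star b))
  rw [star_matrixUnit, map_star]

theorem norm_kUnit (i j : ℕ) (b : B) : ‖kUnit B i j b‖ = ‖b‖ :=
  (norm_matrixUnit i j (rep B b)).trans ((AddMonoidHomClass.isometry_iff_norm _).1 (isometry_rep B) b)

/-- The matrix unit `e i j ⊗ b` is linear in `b`. -/
def kUnitL (i j : ℕ) : B →L[ℝ] KTensor B :=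
  LinearMap.mkContinuous
    { toFun := kUnit B i j
      map_add' := fun b c => Subtype.ext (by
        change matrixUnit i j (rep B (b + c)) = _
        rw [map_add, matrixUnit_add]
        rfl)
      map_smul' := fun r b => Subtype.ext (by
        change matrixUnit i j (rep B (r • b)) = _
        rw [map_smul, matrixUnit_smul]
        rfl) } 1 (fun b => by
    rw [one_mul]
    exact (norm_kUnit i j b).le)

variable (B) in
/-- The inclusion `b ↦ e 0 0 ⊗ b` of a corner. -/
def kCorner : B →⋆ₙₐ[ℝ] KTensor B where
  toFun := kUnit B 0 0
  map_smul' r b := (kUnitL (B := B) 0 0).map_smul r b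
  map_zero' := (kUnitL (B := B) 0 0).map_zero
  map_add' := (kUnitL (B := B) 0 0).map_add
  map_mul' b c := by rw [kUnit_mul_kUnit, if_pos rfl]
  map_star' b := (star_kUnit 0 0 b).symm

/-- Products and adjoints of matrix units are matrix units or zero, so the generated *-algebra is no
larger than their span. -/
theorem mem_span_of_mem_adjoin {T : L2 (RepSpace B) →L[ℝ] L2 (RepSpace B)}
    (hT : T ∈ NonUnitalStarAlgebra.adjoin ℝ
      {T : L2 (RepSpace B) →L[ℝ] L2 (RepSpace B) | ∃ i j b, T = matrixUnit i j (rep B b)}) :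
    ∃ x ∈ Submodule.span ℝ {z : KTensor B | ∃ i j b, z = kUnit B i j b}, x.1 = T := by
  have hmul : ∀ x ∈ Submodule.span ℝ {z : KTensor B | ∃ i j b, z = kUnit B i j b},
      ∀ y ∈ Submodule.span ℝ {z : KTensor B | ∃ i j b, z = kUnit B i j b},
      x * y ∈ Submodule.span ℝ {z : KTensor B | ∃ i j b, z = kUnit B i j b} := fun x hx y hy => by
    induction hx, hy using Submodule.span_induction₂ with
    | mem_mem x y hx hy =>
      obtain ⟨i, j, b, rfl⟩ := hx
      obtain ⟨k, l, c, rfl⟩ := hy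
      rw [kUnit_mul_kUnit]
      split_ifs
      · exact Submodule.subset_span ⟨_, _, _, rfl⟩
      · exact zero_mem _
    | zero_left y hy => rw [zero_mul]; exact zero_mem _
    | zero_right x hx => rw [mul_zero]; exact zero_mem _
    | add_left x y z _ _ _ hx hy => rw [add_mul]; exact add_mem hx hy
    | add_right x y z _ _ _ hx hy => rw [mul_add]; exact add_mem hx hy
    | smul_left r x y _ _ h => rw [smul_mul_assoc]; exact Submodule.smul_mem _ r h
    | smul_right r x y _ _ h => rw [mul_smul_comm]; exact Submodule.smul_mem _ r h
  have hstar : ∀ x ∈ Submodule.span ℝ {z : KTensor B | ∃ i j b, z = kUnit B i j b},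
      star x ∈ Submodule.span ℝ {z : KTensor B | ∃ i j b, z = kUnit B i j b} := fun x hx => by
    induction hx using Submodule.span_induction with
    | mem x hx =>
      obtain ⟨i, j, b, rfl⟩ := hx
      rw [star_kUnit]
      exact Submodule.subset_span ⟨_, _, _, rfl⟩
    | zero => rw [star_zero]; exact zero_mem _
    | add x y _ _ hx hy => rw [star_add]; exact add_mem hx hy
    | smul r x _ hx => rw [star_smul, star_trivial]; exact Submodule.smul_mem _ r hx
  induction hT using NonUnitalStarAlgebra.adjoin_induction with
  | mem x hx =>
    obtain ⟨i, j, b, rfl⟩ := hx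
    exact ⟨kUnit B i j b, Submodule.subset_span ⟨_, _, _, rfl⟩, rfl⟩
  | add x y _ _ hx hy =>
    obtain ⟨x, hx, rfl⟩ := hx
    obtain ⟨y, hy, rfl⟩ := hy
    exact ⟨x + y, add_mem hx hy, rfl⟩
  | zero => exact ⟨0, zero_mem _, rfl⟩
  | mul x y _ _ hx hy =>
    obtain ⟨x, hx, rfl⟩ := hx
    obtain ⟨y, hy, rfl⟩ := hy
    exact ⟨x * y, hmul x hx y hy, rfl⟩
  | smul r x _ hx =>
    obtain ⟨x, hx, rfl⟩ := hx
    exact ⟨r • x, Submodule.smul_mem _ r hx, rfl⟩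
  | star x _ hx =>
    obtain ⟨x, hx, rfl⟩ := hx
    exact ⟨star x, hstar x hx, rfl⟩

theorem dense_span_kUnit (x : KTensor B) :
    x ∈ (Submodule.span ℝ {z : KTensor B | ∃ i j b, z = kUnit B i j b}).topologicalClosure := by
  refine Metric.mem_closure_iff.2 fun ε hε => ?_
  obtain ⟨y, hy, hxy⟩ := Metric.mem_closure_iff.1 x.2 ε hε
  obtain ⟨y, hy', rfl⟩ := mem_span_of_mem_adjoin hy
  exact ⟨y, hy', hxy⟩

theorem restrictionMultiplier_fst_pow (σ : ℕ ↪ ℕ) (n : ℕ) (x : KTensor B) :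
    ((restrictionMultiplier B σ ^ n).fst x).1 = restriction σ ^ n * x.1 := by
  induction n generalizing x with
  | zero => exact (one_mul x.1).symm
  | succ n ih =>
    rw [pow_succ, pow_succ]
    exact (ih _).trans (mul_assoc _ _ _).symm

theorem star_star_mul_mul {R : Type*} [NonUnitalRing R] [StarRing R] (r x : R) :
    star (star (r * x) * r) = star r * r * x := by rw [star_mul, star_star, mul_assoc]

theorem star_mul_star_mul {R : Type*} [NonUnitalRing R] [StarRing R] (r x : R) :
    star (r * star x) * r = x * (star r * r) := by rw [star_mul, star_star, mul_assoc]

instance : Stabilization B (KTensor B) where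
  corner := kCorner B
  isometry_corner := (AddMonoidHomClass.isometry_iff_norm _).2 (norm_kUnit 0 0)
  even := restrictionMultiplier B evenEmb
  odd := restrictionMultiplier B oddEmb
  even_mul_star := restrictionMultiplier_mul_star_self evenEmb
  odd_mul_star := restrictionMultiplier_mul_star_self oddEmb
  even_mul_star_odd := restrictionMultiplier_mul_star_of_ne fun m n h => by
    change 2 * m + 1 = 2 * n at h
    omega
  star_mul_add := by
    have h := star_restriction_mul_add (H := RepSpace B)
    refine DoubleCentralizer.ext ℝ (KTensor B) _ _ (Prod.ext (ContinuousLinearMap.ext fun x =>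
      Subtype.ext (Eq.trans ?_ (one_mul x.1))) (ContinuousLinearMap.ext fun x =>
      Subtype.ext (Eq.trans ?_ (mul_one x.1))))
    · rw [← h]
      refine Eq.trans ?_ (add_mul _ _ x.1).symm
      exact congrArg₂ (· + ·) (star_star_mul_mul _ _) (star_star_mul_mul _ _)
    · rw [← h]
      refine Eq.trans ?_ (mul_add x.1 _ _).symm
      exact congrArg₂ (· + ·) (star_mul_star_mul _ _) (star_mul_star_mul _ _)
  tendsto_odd_pow x := by
    have h0 : ∀ n (x : KTensor B), ((restrictionMultiplier B oddEmb).fst ^ n) x =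
        (restrictionMultiplier B oddEmb ^ n).fst x := fun n x => by
      rw [DoubleCentralizer.pow_fst]
    simp only [← h0]
    refine tendsto_apply_zero_of_mem_closure (norm_pow_apply_le fun x => ?_) ?_ (dense_span_kUnit x)
    · change ‖(restriction oddEmb : L2 (RepSpace B) →L[ℝ] L2 (RepSpace B)) * x.1‖ ≤ ‖x.1‖
      refine ContinuousLinearMap.opNorm_le_bound _ (norm_nonneg _) fun ξ => ?_
      exact (norm_restriction_apply_le _ _).trans (x.1.le_opNorm ξ)
    · rintro _ ⟨i, j, b, rfl⟩
      refine tendsto_const_nhds.congr' ?_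
      filter_upwards [eventually_gt_atTop i] with n hn
      refine Subtype.ext ?_
      rw [h0, restrictionMultiplier_fst_pow]
      exact (restriction_oddEmb_pow_mul_matrixUnit i j _ n hn).symm
  corner_mul_mul a b x := by
    let W : Submodule ℝ (KTensor B) := LinearMap.range (kCorner B : B →ₗ[ℝ] KTensor B)
    have hW : IsClosed (W : Set (KTensor B)) :=
      ((AddMonoidHomClass.isometry_iff_norm (kCorner B)).2
        (norm_kUnit 0 0)).isClosedEmbedding.isClosed_range
    obtain ⟨d, hd⟩ := map_mem_of_mem_closure
      ((ContinuousLinearMap.mul ℝ (KTensor B)).flip (kCorner B b) ∘L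
        ContinuousLinearMap.mul ℝ (KTensor B) (kCorner B a)) hW (by
      rintro _ ⟨i, j, c, rfl⟩
      change kUnit B 0 0 a * kUnit B i j c * kUnit B 0 0 b ∈ W
      rw [kUnit_mul_kUnit]
      split_ifs with hi
      · rw [kUnit_mul_kUnit]
        split_ifs with hj
        · exact ⟨_, rfl⟩
        · exact zero_mem _
      · rw [zero_mul]
        exact zero_mem _) (dense_span_kUnit x)
    exact ⟨d, hd.symm⟩
  dense_span x := by
    refine map_mem_of_mem_closure (ContinuousLinearMap.id ℝ _)
      (Submodule.isClosed_topologicalClosure _) ?_ (dense_span_kUnit x)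
    rintro _ ⟨i, j, b, rfl⟩
    -- In e i j ⊗ b c d = (e i 0 ⊗ b) (e 0 0 ⊗ c) (e 0 j ⊗ d) the middle factor lies in the corner;
    -- approximating by products twice supplies the three factors.
    have h1 : ∀ W : Submodule ℝ (KTensor B), IsClosed (W : Set (KTensor B)) → ∀ (b : B),
        (∀ c, kUnit B i j (b * c) ∈ W) → kUnit B i j b ∈ W := fun W hW b h =>
      hW.closure_subset (map_mem_closure (f := kUnit B i j) (kUnitL (B := B) i j).continuous
        (mem_closure_mul b) (by rintro _ ⟨c, rfl⟩; exact h c))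
    have hW := Submodule.isClosed_topologicalClosure
      (Submodule.span ℝ {z : KTensor B | ∃ x d y, z = x * kCorner B d * y})
    refine h1 _ hW b fun c => h1 _ hW _ fun d => subset_closure (Submodule.subset_span ?_)
    refine ⟨kUnit B i 0 b, c, kUnit B 0 j d, ?_⟩
    change _ = kUnit B i 0 b * kUnit B 0 0 c * kUnit B 0 j d
    rw [kUnit_mul_kUnit, if_pos rfl, kUnit_mul_kUnit, if_pos rfl]

instance [TopologicalSpace.SeparableSpace B] : TopologicalSpace.SeparableSpace (KTensor B) := by
  let s : Set (KTensor B) := ⋃ p : ℕ × ℕ, Set.range (kUnit B p.1 p.2)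
  have hs : TopologicalSpace.IsSeparable s := TopologicalSpace.IsSeparable.iUnion fun p =>
    TopologicalSpace.isSeparable_range (kUnitL (B := B) p.1 p.2).continuous
  refine TopologicalSpace.isSeparable_univ_iff.1 ((hs.span (R := ℝ)).closure.mono fun x _ => ?_)
  refine closure_mono (Submodule.span_mono ?_) (dense_span_kUnit x)
  rintro _ ⟨i, j, b, rfl⟩
  exact Set.mem_iUnion.2 ⟨(i, j), b, rfl⟩

end KTensor

end

end RealKK

namespace RealKK

noncomputable section

open Filter Topology HilbertModule

/-! ### Paths of multipliers -/

section Path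

variable {J : Type v} [RealCStarAlgebra J]

variable (J) in
/-- A multiplier as left multiplication, depending continuously on the multiplier. -/
def multiplierFst : 𝓜(ℝ, J) →L[ℝ] J →L[ℝ] J :=
  LinearMap.mkContinuous
    { toFun := fun m => m.fst
      map_add' := fun _ _ => rfl
      map_smul' := fun _ _ => rfl } 1 (fun m => by
    rw [one_mul]
    exact m.norm_fst.le)

variable (J) in
/-- A multiplier as right multiplication, depending continuously on the multiplier. -/
def multiplierSnd : 𝓜(ℝ, J) →L[ℝ] J →L[ℝ] J :=
  LinearMap.mkContinuous
    { toFun := fun m => m.snd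
      map_add' := fun _ _ => rfl
      map_smul' := fun _ _ => rfl } 1 (fun m => by
    rw [one_mul]
    exact m.norm_snd.le)

/-- A continuous family of operators, acting pointwise on continuous functions. -/
def pointwiseMap (F : C(unitInterval, J →L[ℝ] J)) : C(unitInterval, J) →L[ℝ] C(unitInterval, J) :=
  LinearMap.mkContinuous
    { toFun := fun f => ⟨fun t => F t (f t), F.continuous.clm_apply f.continuous⟩
      map_add' := fun f g => ContinuousMap.ext fun t => map_add (F t) _ _
      map_smul' := fun r f => ContinuousMap.ext fun t => map_smul (F t) _ _ } ‖F‖ (fun f => by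
    refine (ContinuousMap.norm_le _ (by positivity)).2 fun t => ?_
    exact ((F t).le_opNorm _).trans
      (mul_le_mul (F.norm_coe_le_norm t) (f.norm_coe_le_norm t) (norm_nonneg _) (norm_nonneg F)))

/-- A norm continuous path of multipliers of `J`, as a multiplier of `C([0, 1], J)`. -/
def pathMultiplier (F : C(unitInterval, 𝓜(ℝ, J))) : 𝓜(ℝ, C(unitInterval, J)) where
  fst := pointwiseMap ((multiplierFst J : C(𝓜(ℝ, J), J →L[ℝ] J)).comp F)
  snd := pointwiseMap ((multiplierSnd J : C(𝓜(ℝ, J), J →L[ℝ] J)).comp F)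
  central f g := ContinuousMap.ext fun t => (F t).central (f t) (g t)

/-- The value of m.fst f at t depends only on f t and on the evaluation of m at t, and likewise for
m.snd. -/
theorem path_multiplier_ext {m n : 𝓜(ℝ, C(unitInterval, J))}
    (h : ∀ t, multiplierEval t m = multiplierEval t n) : m = n := by
  refine DoubleCentralizer.ext ℝ _ _ _ (Prod.ext (ContinuousLinearMap.ext fun f =>
    ContinuousMap.ext fun t => ?_) (ContinuousLinearMap.ext fun f => ContinuousMap.ext fun t => ?_))
  · change m.fst f t = n.fst f t
    rw [← multiplierEval_fst, ← multiplierEval_fst, h]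
  · change m.snd f t = n.snd f t
    rw [← multiplierEval_snd, ← multiplierEval_snd, h]

theorem multiplierEval_pathMultiplier (t : unitInterval) (F : C(unitInterval, 𝓜(ℝ, J))) :
    multiplierEval t (pathMultiplier F) = F t :=
  DoubleCentralizer.ext ℝ J _ _ (Prod.ext rfl rfl)

theorem multiplierEval_add (t : unitInterval) (m n : 𝓜(ℝ, C(unitInterval, J))) :
    multiplierEval t (m + n) = multiplierEval t m + multiplierEval t n :=
  DoubleCentralizer.ext ℝ J _ _ (Prod.ext rfl rfl)

theorem multiplierEval_sub (t : unitInterval) (m n : 𝓜(ℝ, C(unitInterval, J))) :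
    multiplierEval t (m - n) = multiplierEval t m - multiplierEval t n :=
  DoubleCentralizer.ext ℝ J _ _ (Prod.ext rfl rfl)

theorem multiplierEval_smul (t : unitInterval) (r : ℝ) (m : 𝓜(ℝ, C(unitInterval, J))) :
    multiplierEval t (r • m) = r • multiplierEval t m :=
  DoubleCentralizer.ext ℝ J _ _ (Prod.ext rfl rfl)

theorem multiplierEval_zero (t : unitInterval) :
    multiplierEval t (0 : 𝓜(ℝ, C(unitInterval, J))) = 0 :=
  DoubleCentralizer.ext ℝ J _ _ (Prod.ext rfl rfl)

theorem multiplierEval_one (t : unitInterval) :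
    multiplierEval t (1 : 𝓜(ℝ, C(unitInterval, J))) = 1 :=
  DoubleCentralizer.ext ℝ J _ _ (Prod.ext rfl rfl)

theorem multiplierEval_mul (t : unitInterval) (m n : 𝓜(ℝ, C(unitInterval, J))) :
    multiplierEval t (m * n) = multiplierEval t m * multiplierEval t n := by
  refine DoubleCentralizer.ext ℝ J _ _ (Prod.ext (ContinuousLinearMap.ext fun x => ?_)
    (ContinuousLinearMap.ext fun x => ?_))
  · exact (multiplierEval_fst t m (n.fst (ContinuousMap.const _ x))).symm
  · exact (multiplierEval_snd t n (m.snd (ContinuousMap.const _ x))).symm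

theorem multiplierEval_star (t : unitInterval) (m : 𝓜(ℝ, C(unitInterval, J))) :
    multiplierEval t (star m) = star (multiplierEval t m) :=
  DoubleCentralizer.ext ℝ J _ _ (Prod.ext rfl rfl)

/-- `J` embeds isometrically into its multipliers, so the preimages of a continuous path of
multipliers form a continuous path. -/
theorem pathMultiplier_mem {F : C(unitInterval, 𝓜(ℝ, J))}
    (hF : ∀ t, F t ∈ Set.range (DoubleCentralizer.coe ℝ : J → 𝓜(ℝ, J))) :
    pathMultiplier F ∈ Set.range (DoubleCentralizer.coe ℝ : C(unitInterval, J) → _) := by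
  choose f hf using hF
  have hc : Continuous f := isometry_coe_multiplier.isEmbedding.continuous_iff.2
    (F.continuous.congr fun t => (hf t).symm)
  refine ⟨⟨f, hc⟩, path_multiplier_ext fun t => ?_⟩
  rw [multiplierEval_pathMultiplier, ← hf]
  exact DoubleCentralizer.ext ℝ J _ _ (Prod.ext rfl rfl)

theorem smul_mem_range_coe (r : ℝ) {m : 𝓜(ℝ, J)}
    (hm : m ∈ Set.range (DoubleCentralizer.coe ℝ : J → 𝓜(ℝ, J))) :
    r • m ∈ Set.range (DoubleCentralizer.coe ℝ : J → 𝓜(ℝ, J)) := by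
  obtain ⟨x, rfl⟩ := hm
  exact ⟨r • x, coe_multiplier_smul r x⟩

theorem add_mem_range_coe {m n : 𝓜(ℝ, J)}
    (hm : m ∈ Set.range (DoubleCentralizer.coe ℝ : J → 𝓜(ℝ, J)))
    (hn : n ∈ Set.range (DoubleCentralizer.coe ℝ : J → 𝓜(ℝ, J))) :
    m + n ∈ Set.range (DoubleCentralizer.coe ℝ : J → 𝓜(ℝ, J)) := by
  obtain ⟨x, rfl⟩ := hm
  obtain ⟨y, rfl⟩ := hn
  exact ⟨x + y, coe_multiplier_add x y⟩

/-- The constant path at a multiplier. -/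
def constMultiplier (m : 𝓜(ℝ, J)) : 𝓜(ℝ, C(unitInterval, J)) :=
  pathMultiplier (ContinuousMap.const _ m)

theorem multiplierEval_constMultiplier (t : unitInterval) (m : 𝓜(ℝ, J)) :
    multiplierEval t (constMultiplier m) = m :=
  multiplierEval_pathMultiplier t _

variable {A : Type u} [RealCStarAlgebra A]

/-- The constant path at a homomorphism into the multiplier algebra. -/
def constHom (φ : A →⋆ₙₐ[ℝ] 𝓜(ℝ, J)) : A →⋆ₙₐ[ℝ] 𝓜(ℝ, C(unitInterval, J)) where
  toFun a := constMultiplier (φ a)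
  map_smul' r a := path_multiplier_ext fun t => by
    rw [multiplierEval_constMultiplier, map_smul]
    exact (congrArg (r • ·) (multiplierEval_constMultiplier t (φ a))).symm
  map_zero' := path_multiplier_ext fun t => by
    rw [multiplierEval_constMultiplier, map_zero, multiplierEval_zero]
  map_add' a b := path_multiplier_ext fun t => by
    simp only [multiplierEval_add, multiplierEval_constMultiplier, map_add]
  map_mul' a b := path_multiplier_ext fun t => by
    simp only [multiplierEval_mul, multiplierEval_constMultiplier, map_mul]
  map_star' a := path_multiplier_ext fun t => by
    simp only [multiplierEval_star, multiplierEval_constMultiplier, map_star]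

theorem multiplierEval_constHom (t : unitInterval) (φ : A →⋆ₙₐ[ℝ] 𝓜(ℝ, J)) (a : A) :
    multiplierEval t (constHom φ a) = φ a :=
  multiplierEval_constMultiplier t _

end Path

/-! ### Paths in a stabilization -/

section PathStabilization

variable {B J : Type v} [RealCStarAlgebra B] [RealCStarAlgebra J] [Stabilization B J]

theorem norm_odd_fst_le (x : J) : ‖(Stabilization.odd (D := B) (J := J)).fst x‖ ≤ ‖x‖ := by
  have h1 : ‖(Stabilization.odd (D := B) (J := J))‖ * ‖(Stabilization.odd (D := B) (J := J))‖ ≤ 1 := by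
    rw [← CStarRing.norm_self_mul_star, Stabilization.odd_mul_star, ← DoubleCentralizer.norm_fst]
    exact ContinuousLinearMap.norm_id_le
  have h2 : ‖(Stabilization.odd (D := B) (J := J)).fst‖ ≤ 1 := by
    rw [DoubleCentralizer.norm_fst]
    nlinarith
  simpa using ContinuousLinearMap.le_of_opNorm_le _ h2 x

/-- The continuous linear map `x ↦ g ⊗ x`. -/
def smulConst {V : Type*} [NormedAddCommGroup V] [NormedSpace ℝ V] (g : C(unitInterval, ℝ)) :
    V →L[ℝ] C(unitInterval, V) :=
  LinearMap.mkContinuous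
    { toFun := fun x => g • ContinuousMap.const unitInterval x
      map_add' := fun x y => ContinuousMap.ext fun t => smul_add (g t) x y
      map_smul' := fun r x => ContinuousMap.ext fun t => smul_comm (g t) r x } ‖g‖ (fun x => by
    refine (ContinuousMap.norm_le _ (by positivity)).2 fun t => ?_
    change ‖g t • x‖ ≤ _
    rw [norm_smul]
    gcongr
    exact g.norm_coe_le_norm t)

theorem path_mem_closure_span (f : C(unitInterval, J)) : f ∈ (Submodule.span ℝ
    {h : C(unitInterval, J) | ∃ (g : C(unitInterval, ℝ)) (x : J),
      h = g • ContinuousMap.const unitInterval x}).topologicalClosure :=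
  mem_of_forall_smul_const_mem (Submodule.isClosed_topologicalClosure _) fun g t =>
    subset_closure (Submodule.subset_span ⟨g, f t, rfl⟩)

variable (B J) in
/-- The pointwise inclusion of the corner. -/
def pathCorner : C(unitInterval, B) →⋆ₙₐ[ℝ] C(unitInterval, J) where
  toFun f := ⟨fun t => Stabilization.corner (f t),
    Stabilization.isometry_corner.continuous.comp f.continuous⟩
  map_smul' r f := ContinuousMap.ext fun t => map_smul Stabilization.corner r (f t)
  map_zero' := ContinuousMap.ext fun _ => map_zero Stabilization.corner
  map_add' f g := ContinuousMap.ext fun t => map_add Stabilization.corner (f t) (g t)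
  map_mul' f g := ContinuousMap.ext fun t => map_mul Stabilization.corner (f t) (g t)
  map_star' f := ContinuousMap.ext fun t => map_star Stabilization.corner (f t)

theorem pathCorner_apply (f : C(unitInterval, B)) (t : unitInterval) :
    pathCorner B J f t = Stabilization.corner (f t) := rfl

/-- A homotopy over B becomes an ordinary object over C([0, 1], B): whatever is proved for an
arbitrary stabilization applies to paths as it stands. -/
instance : Stabilization C(unitInterval, B) C(unitInterval, J) where
  corner := pathCorner B J
  isometry_corner := (AddMonoidHomClass.isometry_iff_norm _).2 fun f => by
    refine le_antisymm ((ContinuousMap.norm_le _ (norm_nonneg _)).2 fun t => ?_)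
      ((ContinuousMap.norm_le _ (norm_nonneg _)).2 fun t => ?_)
    · rw [pathCorner_apply, norm_corner]
      exact f.norm_coe_le_norm t
    · rw [← norm_corner B J, ← pathCorner_apply]
      exact ContinuousMap.norm_coe_le_norm _ t
  even := constMultiplier (Stabilization.even (D := B))
  odd := constMultiplier (Stabilization.odd (D := B))
  even_mul_star := path_multiplier_ext fun t => by
    rw [multiplierEval_mul, multiplierEval_star, multiplierEval_constMultiplier, multiplierEval_one,
      Stabilization.even_mul_star]
  odd_mul_star := path_multiplier_ext fun t => by
    rw [multiplierEval_mul, multiplierEval_star, multiplierEval_constMultiplier, multiplierEval_one,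
      Stabilization.odd_mul_star]
  even_mul_star_odd := path_multiplier_ext fun t => by
    rw [multiplierEval_mul, multiplierEval_star, multiplierEval_constMultiplier,
      multiplierEval_constMultiplier, multiplierEval_zero, Stabilization.even_mul_star_odd]
  star_mul_add := path_multiplier_ext fun t => by
    rw [multiplierEval_add, multiplierEval_mul, multiplierEval_star, multiplierEval_constMultiplier,
      multiplierEval_mul, multiplierEval_star, multiplierEval_constMultiplier, multiplierEval_one,
      Stabilization.star_mul_add]
  tendsto_odd_pow f := by
    have h0 : ∀ n (f : C(unitInterval, J)),
        ((constMultiplier (Stabilization.odd (D := B) (J := J))).fst ^ n) f =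
        (constMultiplier (Stabilization.odd (D := B) (J := J)) ^ n).fst f := fun n x => by
      rw [DoubleCentralizer.pow_fst]
    simp only [← h0]
    -- Strong convergence on the elementary tensors g ⊗ x comes from that in `J`; contractivity
    -- extends it to their closed span.
    refine tendsto_apply_zero_of_mem_closure (norm_pow_apply_le fun f => ?_) ?_
      (path_mem_closure_span f)
    · refine (ContinuousMap.norm_le _ (norm_nonneg _)).2 fun t => ?_
      exact (norm_odd_fst_le (B := B) (f t)).trans (f.norm_coe_le_norm t)
    · rintro _ ⟨g, x, rfl⟩
      have h1 : ∀ n, ((constMultiplier (Stabilization.odd (D := B) (J := J))).fst ^ n)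
          (g • ContinuousMap.const unitInterval x) = g • ContinuousMap.const unitInterval
            ((Stabilization.odd (D := B) (J := J) ^ n).fst x) := fun n => by
        induction n with
        | zero => rfl
        | succ n ih =>
          rw [pow_succ', pow_succ']
          change (constMultiplier (Stabilization.odd (D := B) (J := J))).fst
            (((constMultiplier (Stabilization.odd (D := B) (J := J))).fst ^ n)
              (g • ContinuousMap.const unitInterval x)) = _
          rw [ih]
          exact ContinuousMap.ext fun t =>
            map_smul (Stabilization.odd (D := B) (J := J)).fst (g t) _
      have h3 := (((smulConst g).continuous.tendsto 0).comp
        (Stabilization.tendsto_odd_pow (D := B) x)).congr fun n => (h1 n).symm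
      rwa [map_zero] at h3
  corner_mul_mul a b f := by
    choose d hd using fun t => Stabilization.corner_mul_mul (D := B) (J := J) (a t) (b t) (f t)
    -- The elements d t depend continuously on t, because the inclusion of the corner is an
    -- isometric embedding.
    have hc : Continuous d :=
      (Stabilization.isometry_corner (D := B) (J := J)).isEmbedding.continuous_iff.2
        ((pathCorner B J a * f * pathCorner B J b).continuous.congr hd)
    exact ⟨⟨d, hc⟩, ContinuousMap.ext hd⟩
  dense_span f := by
    refine mem_of_forall_smul_const_mem (Submodule.isClosed_topologicalClosure _) fun g t => ?_
    change smulConst g (f t) ∈ _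
    refine map_mem_of_mem_closure (smulConst g) (Submodule.isClosed_topologicalClosure _) ?_
      (Stabilization.dense_span (D := B) (f t))
    rintro _ ⟨x, d, y, rfl⟩
    refine subset_closure (Submodule.subset_span ?_)
    refine ⟨g • ContinuousMap.const unitInterval x, ContinuousMap.const unitInterval d,
      ContinuousMap.const unitInterval y, ContinuousMap.ext fun s => ?_⟩
    change g s • (x * Stabilization.corner d * y) = g s • x * Stabilization.corner d * y
    rw [smul_mul_assoc, smul_mul_assoc]

end PathStabilization

end

end RealKK

namespace RealKK

noncomputable section

open Filter Topology HilbertModule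

/-! ### Conjugation of Fredholm cycles by partial isometries -/

namespace FredholmCycle

variable {A : Type u} [RealCStarAlgebra A] {J : Type v} [RealCStarAlgebra J]

/-- `star s * s` and `star r * r` act as the identity on the cycle `x`. -/
structure IsSupport (x : FredholmCycle A J) (s r : 𝓜(ℝ, J)) : Prop where
  pos (a : A) : star s * s * x.φpos a = x.φpos a
  neg (a : A) : star r * r * x.φneg a = x.φneg a
  right : x.U * (star s * s) = x.U
  left : star r * r * x.U = x.U

theorem isSupport_of_isometry (x : FredholmCycle A J) {s r : 𝓜(ℝ, J)} (hs : star s * s = 1)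
    (hr : star r * r = 1) : x.IsSupport s r :=
  ⟨fun a => by rw [hs, one_mul], fun a => by rw [hr, one_mul], by rw [hs, mul_one],
    by rw [hr, one_mul]⟩

/-- `y` is the conjugate of `x` by `s` and `r`. -/
structure IsConj (s r : 𝓜(ℝ, J)) (x y : FredholmCycle A J) : Prop where
  pos (a : A) : y.φpos a = s * x.φpos a * star s
  neg (a : A) : y.φneg a = r * x.φneg a * star r
  op : y.U = r * x.U * star s

/-- The conjugate of a homomorphism by `s`, where `star s * s` acts on it as the identity. -/
def conjHom (φ : A →⋆ₙₐ[ℝ] 𝓜(ℝ, J)) (s : 𝓜(ℝ, J)) (h : ∀ a, star s * s * φ a = φ a) :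
    A →⋆ₙₐ[ℝ] 𝓜(ℝ, J) where
  toFun a := s * φ a * star s
  map_smul' r a := by rw [map_smul, mul_smul_comm, smul_mul_assoc]; rfl
  map_zero' := by rw [map_zero, mul_zero, zero_mul]
  map_add' a b := by rw [map_add, mul_add, add_mul]
  map_mul' a b := by
    calc s * φ (a * b) * star s = s * (φ a * (star s * s * φ b)) * star s := by rw [h, map_mul]
      _ = _ := by noncomm_ring
  map_star' a := by rw [map_star, star_mul, star_mul, star_star, mul_assoc]

theorem mem_of_mul_mul {s r m k : 𝓜(ℝ, J)}
    (hk : k ∈ Set.range (DoubleCentralizer.coe ℝ : J → 𝓜(ℝ, J))) (h : m = s * k * r) :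
    m ∈ Set.range (DoubleCentralizer.coe ℝ : J → 𝓜(ℝ, J)) := by
  rw [h]
  exact coe_mul_mem _ (mul_coe_mem _ hk)

theorem IsSupport.pos' {x : FredholmCycle A J} {s r : 𝓜(ℝ, J)} (h : x.IsSupport s r) (a : A) :
    x.φpos a * (star s * s) = x.φpos a := by
  have := congrArg star (h.pos (star a))
  rwa [star_mul, star_mul, star_star, map_star, star_star] at this

theorem IsSupport.neg' {x : FredholmCycle A J} {s r : 𝓜(ℝ, J)} (h : x.IsSupport s r) (a : A) :
    x.φneg a * (star r * r) = x.φneg a := by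
  have := congrArg star (h.neg (star a))
  rwa [star_mul, star_mul, star_star, map_star, star_star] at this

/-- The conjugate of a cycle. -/
def conj (x : FredholmCycle A J) (s r : 𝓜(ℝ, J)) (h : x.IsSupport s r) : FredholmCycle A J where
  φpos := conjHom x.φpos s h.pos
  φneg := conjHom x.φneg r h.neg
  U := r * x.U * star s
  intertwine_mem a := by
    refine mem_of_mul_mul (s := r) (r := star s) (x.intertwine_mem a) ?_
    change r * x.U * star s * (s * x.φpos a * star s) - r * x.φneg a * star r * (r * x.U * star s) = _
    calc _ = r * (x.U * (star s * s) * x.φpos a - x.φneg a * (star r * r) * x.U) * star s := by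
          noncomm_ring
      _ = _ := by rw [h.right, h.neg']
  pos_mem a := by
    refine mem_of_mul_mul (s := s) (r := star s) (x.pos_mem a) ?_
    change s * x.φpos a * star s * (star (r * x.U * star s) * (r * x.U * star s) - 1) = _
    rw [star_mul, star_mul, star_star]
    calc _ = s * (x.φpos a * (star s * s) * (star x.U * (star r * r * x.U)) - x.φpos a) * star s := by
          noncomm_ring
      _ = _ := by rw [h.left, h.pos', mul_sub (x.φpos a), mul_one]
  neg_mem a := by
    refine mem_of_mul_mul (s := r) (r := star r) (x.neg_mem a) ?_
    change r * x.φneg a * star r * (r * x.U * star s * star (r * x.U * star s) - 1) = _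
    rw [star_mul, star_mul, star_star]
    calc _ = r * (x.φneg a * (star r * r) * (x.U * (star s * s) * star x.U) - x.φneg a) * star r := by
          noncomm_ring
      _ = _ := by rw [h.right, h.neg', mul_sub (x.φneg a), mul_one]

/-! ### Homotopies of Fredholm cycles -/

theorem mem_range_coe_of_eval {m : 𝓜(ℝ, C(unitInterval, J))} (F : C(unitInterval, 𝓜(ℝ, J)))
    (h : ∀ t, multiplierEval t m = F t)
    (hF : ∀ t, F t ∈ Set.range (DoubleCentralizer.coe ℝ : J → 𝓜(ℝ, J))) :
    m ∈ Set.range (DoubleCentralizer.coe ℝ : C(unitInterval, J) → _) := by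
  obtain rfl : m = pathMultiplier F := path_multiplier_ext fun t => by
    rw [h, multiplierEval_pathMultiplier]
  exact pathMultiplier_mem hF

/-- The constant path at a cycle. -/
def constPath (x : FredholmCycle A J) : FredholmCycle A C(unitInterval, J) where
  φpos := constHom x.φpos
  φneg := constHom x.φneg
  U := constMultiplier x.U
  intertwine_mem a := mem_range_coe_of_eval (ContinuousMap.const _ _) (fun t => by
    simp only [multiplierEval_sub, multiplierEval_mul, multiplierEval_constHom,
      multiplierEval_constMultiplier]
    rfl) fun _ => x.intertwine_mem a
  pos_mem a := mem_range_coe_of_eval (ContinuousMap.const _ _) (fun t => by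
    simp only [multiplierEval_sub, multiplierEval_mul, multiplierEval_constHom,
      multiplierEval_constMultiplier, multiplierEval_star, multiplierEval_one]
    rfl) fun _ => x.pos_mem a
  neg_mem a := mem_range_coe_of_eval (ContinuousMap.const _ _) (fun t => by
    simp only [multiplierEval_sub, multiplierEval_mul, multiplierEval_constHom,
      multiplierEval_constMultiplier, multiplierEval_star, multiplierEval_one]
    rfl) fun _ => x.neg_mem a

/-- The homotopy is the conjugate of the constant path at x by a path of supporting elements, so no
compactness has to be verified anew. -/
theorem homotopic_of_path (x : FredholmCycle A J) (S R : C(unitInterval, 𝓜(ℝ, J)))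
    (h : ∀ t, x.IsSupport (S t) (R t)) {y z : FredholmCycle A J} (hy : IsConj (S 0) (R 0) x y)
    (hz : IsConj (S 1) (R 1) x z) : Homotopic y z := by
  have hs : x.constPath.IsSupport (pathMultiplier S) (pathMultiplier R) := by
    refine ⟨fun a => path_multiplier_ext fun t => ?_, fun a => path_multiplier_ext fun t => ?_,
      path_multiplier_ext fun t => ?_, path_multiplier_ext fun t => ?_⟩
    · have := (h t).pos a
      simpa only [multiplierEval_mul, multiplierEval_star, multiplierEval_pathMultiplier, constPath,
        multiplierEval_constHom] using this
    · have := (h t).neg a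
      simpa only [multiplierEval_mul, multiplierEval_star, multiplierEval_pathMultiplier, constPath,
        multiplierEval_constHom] using this
    · have := (h t).right
      simpa only [multiplierEval_mul, multiplierEval_star, multiplierEval_pathMultiplier, constPath,
        multiplierEval_constMultiplier] using this
    · have := (h t).left
      simpa only [multiplierEval_mul, multiplierEval_star, multiplierEval_pathMultiplier, constPath,
        multiplierEval_constMultiplier] using this
  have h1 : ∀ t a, multiplierEval t ((x.constPath.conj _ _ hs).φpos a) =
      S t * x.φpos a * star (S t) := fun t a => by
    change multiplierEval t (pathMultiplier S * constHom x.φpos a * star (pathMultiplier S)) = _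
    rw [multiplierEval_mul, multiplierEval_mul, multiplierEval_star, multiplierEval_pathMultiplier,
      multiplierEval_constHom]
  have h2 : ∀ t a, multiplierEval t ((x.constPath.conj _ _ hs).φneg a) =
      R t * x.φneg a * star (R t) := fun t a => by
    change multiplierEval t (pathMultiplier R * constHom x.φneg a * star (pathMultiplier R)) = _
    rw [multiplierEval_mul, multiplierEval_mul, multiplierEval_star, multiplierEval_pathMultiplier,
      multiplierEval_constHom]
  have h3 : ∀ t, multiplierEval t (x.constPath.conj _ _ hs).U = R t * x.U * star (S t) := fun t => by
    change multiplierEval t (pathMultiplier R * constMultiplier x.U * star (pathMultiplier S)) = _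
    rw [multiplierEval_mul, multiplierEval_mul, multiplierEval_star, multiplierEval_pathMultiplier,
      multiplierEval_pathMultiplier, multiplierEval_constMultiplier]
  exact ⟨x.constPath.conj _ _ hs,
    ⟨fun a => (h1 0 a).trans (hy.pos a).symm, fun a => (h2 0 a).trans (hy.neg a).symm,
      (h3 0).trans hy.op.symm⟩,
    ⟨fun a => (h1 1 a).trans (hz.pos a).symm, fun a => (h2 1 a).trans (hz.neg a).symm,
      (h3 1).trans hz.op.symm⟩⟩

/-- The path `u cos⁺(π t) + v sin(π t) + w cos⁻(π t)` from `u` to `w`. -/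
def rotationPath (u v w : 𝓜(ℝ, J)) : C(unitInterval, 𝓜(ℝ, J)) where
  toFun t := max (Real.cos (Real.pi * t)) 0 • u + Real.sin (Real.pi * t) • v +
    max (-Real.cos (Real.pi * t)) 0 • w

theorem rotationPath_zero (u v w : 𝓜(ℝ, J)) : rotationPath u v w 0 = u := by
  change max (Real.cos (Real.pi * (0 : ℝ))) 0 • u + Real.sin (Real.pi * (0 : ℝ)) • v +
    max (-Real.cos (Real.pi * (0 : ℝ))) 0 • w = u
  simp

theorem rotationPath_one (u v w : 𝓜(ℝ, J)) : rotationPath u v w 1 = w := by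
  change max (Real.cos (Real.pi * (1 : ℝ))) 0 • u + Real.sin (Real.pi * (1 : ℝ)) • v +
    max (-Real.cos (Real.pi * (1 : ℝ))) 0 • w = w
  simp

variable (J) in
-- At every time cos⁺ or cos⁻ vanishes, so no product of u with w occurs and no relation between u
-- and w is needed; v is orthogonal to both. The squares of the three coefficients sum to one.
theorem exists_star_rotationPath_mul (t : unitInterval) : ∃ a b c : ℝ, a + b + c = 1 ∧
    ∀ {u v w : 𝓜(ℝ, J)}, star u * v = 0 → star w * v = 0 →
      star (rotationPath u v w t) * rotationPath u v w t =
        a • (star u * u) + b • (star v * v) + c • (star w * w) := by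
  set x := Real.cos (Real.pi * t) with hx
  set y := Real.sin (Real.pi * t) with hy
  have hac : max x 0 * max (-x) 0 = 0 := by
    rcases le_total 0 x with h | h
    · rw [max_eq_right (neg_nonpos.2 h), mul_zero]
    · rw [max_eq_right h, zero_mul]
  have hsum : max x 0 * max x 0 + y * y + max (-x) 0 * max (-x) 0 = 1 := by
    have h1 := Real.sin_sq_add_cos_sq (Real.pi * t)
    rw [← hx, ← hy] at h1
    rcases le_total 0 x with h | h
    · rw [max_eq_right (neg_nonpos.2 h), max_eq_left h]
      linarith
    · rw [max_eq_right h, max_eq_left (neg_nonneg.2 h)]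
      linarith
  refine ⟨_, _, _, hsum, fun {u v w} huv hwv => ?_⟩
  have hvu : star v * u = 0 := by
    have := congrArg star huv
    rwa [star_mul, star_star, star_zero] at this
  have hvw : star v * w = 0 := by
    have := congrArg star hwv
    rwa [star_mul, star_star, star_zero] at this
  change star (max x 0 • u + y • v + max (-x) 0 • w) * (max x 0 • u + y • v + max (-x) 0 • w) = _
  simp only [star_add, star_smul, star_trivial, add_mul, mul_add, smul_mul_smul_comm, huv, hvu, hwv,
    hvw, hac, mul_comm (max (-x) 0) (max x 0), zero_smul, smul_zero, add_zero, zero_add]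

/-- An affine combination of elements that act as the identity on the cycle acts as the identity on
it. -/
theorem isSupport_rotationPath {x : FredholmCycle A J} {u v w u' v' w' : 𝓜(ℝ, J)}
    (hu : x.IsSupport u u') (hv : x.IsSupport v v') (hw : x.IsSupport w w') (huv : star u * v = 0)
    (hwv : star w * v = 0) (huv' : star u' * v' = 0) (hwv' : star w' * v' = 0) (t : unitInterval) :
    x.IsSupport (rotationPath u v w t) (rotationPath u' v' w' t) := by
  obtain ⟨a, b, c, habc, h⟩ := exists_star_rotationPath_mul J t
  have key : ∀ m : 𝓜(ℝ, J), a • m + b • m + c • m = m := fun m => by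
    rw [← add_smul, ← add_smul, habc, one_smul]
  constructor
  · intro d
    rw [h huv hwv, add_mul, add_mul, smul_mul_assoc, smul_mul_assoc, smul_mul_assoc, hu.pos, hv.pos,
      hw.pos, key]
  · intro d
    rw [h huv' hwv', add_mul, add_mul, smul_mul_assoc, smul_mul_assoc, smul_mul_assoc, hu.neg,
      hv.neg, hw.neg, key]
  · rw [h huv hwv, mul_add, mul_add, mul_smul_comm, mul_smul_comm, mul_smul_comm, hu.right, hv.right,
      hw.right, key]
  · rw [h huv' hwv', add_mul, add_mul, smul_mul_assoc, smul_mul_assoc, smul_mul_assoc, hu.left,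
      hv.left, hw.left, key]

/-- Conjugates of a cycle by `u` and by `w` are homotopic if there is a `v` that is orthogonal to
both. -/
theorem homotopic_of_isConj {x y z : FredholmCycle A J} {u v w u' v' w' : 𝓜(ℝ, J)}
    (hu : x.IsSupport u u') (hv : x.IsSupport v v') (hw : x.IsSupport w w') (huv : star u * v = 0)
    (hwv : star w * v = 0) (huv' : star u' * v' = 0) (hwv' : star w' * v' = 0)
    (hy : IsConj u u' x y) (hz : IsConj w w' x z) : Homotopic y z :=
  -- The rotation first goes from u to v and then from v to w.
  x.homotopic_of_path (rotationPath u v w) (rotationPath u' v' w')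
    (isSupport_rotationPath hu hv hw huv hwv huv' hwv')
    (by rwa [rotationPath_zero, rotationPath_zero]) (by rwa [rotationPath_one, rotationPath_one])

/-- The path of operators `cos U + sin V`. -/
def cosSinPath (U V : 𝓜(ℝ, J)) : C(unitInterval, 𝓜(ℝ, J)) where
  toFun t := Real.cos (Real.pi / 2 * t) • U + Real.sin (Real.pi / 2 * t) • V

/-- Along cos · U + sin · V the mixed terms cancel by `h` and `h'`. The defects of unitarity are
thus cos² times those of U, and the intertwining defect is cos times that of U. They stay in `J` and
vanish at the end of the path. -/
theorem homotopic_of_anticommute {x y : FredholmCycle A J} {V : 𝓜(ℝ, J)} (hV : star V * V = 1)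
    (hV' : V * star V = 1) (hcomm : ∀ a, V * x.φpos a = x.φneg a * V)
    (h : star x.U * V + star V * x.U = 0) (h' : x.U * star V + V * star x.U = 0)
    (hpos : ∀ a, y.φpos a = x.φpos a) (hneg : ∀ a, y.φneg a = x.φneg a) (hU : y.U = V) :
    Homotopic x y := by
  have hF : ∀ t, multiplierEval t (pathMultiplier (cosSinPath x.U V)) =
      Real.cos (Real.pi / 2 * t) • x.U + Real.sin (Real.pi / 2 * t) • V := fun t => by
    rw [multiplierEval_pathMultiplier]
    rfl
  have hcs : ∀ t : unitInterval, Real.sin (Real.pi / 2 * t) * Real.sin (Real.pi / 2 * t) =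
      1 - Real.cos (Real.pi / 2 * t) * Real.cos (Real.pi / 2 * t) := fun t => by
    have := Real.sin_sq_add_cos_sq (Real.pi / 2 * t)
    linarith
  have e1 : ∀ (c s : ℝ), s * s = 1 - c * c → star (c • x.U + s • V) * (c • x.U + s • V) - 1 =
      (c * c) • (star x.U * x.U - 1) := fun c s hs => by
    calc _ = (c * c) • (star x.U * x.U) + (c * s) • (star x.U * V + star V * x.U) +
          (s * s) • (star V * V) - 1 := by
          simp only [star_add, star_smul, star_trivial, add_mul, mul_add, smul_mul_smul_comm,
            mul_comm s c, smul_add]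
          abel
      _ = _ := by
          rw [h, hV, hs, smul_zero, sub_smul, smul_sub, one_smul]
          abel
  have e2 : ∀ (c s : ℝ), s * s = 1 - c * c → (c • x.U + s • V) * star (c • x.U + s • V) - 1 =
      (c * c) • (x.U * star x.U - 1) := fun c s hs => by
    calc _ = (c * c) • (x.U * star x.U) + (c * s) • (x.U * star V + V * star x.U) +
          (s * s) • (V * star V) - 1 := by
          simp only [star_add, star_smul, star_trivial, add_mul, mul_add, smul_mul_smul_comm,
            mul_comm s c, smul_add]
          abel
      _ = _ := by
          rw [h', hV', hs, smul_zero, sub_smul, smul_sub, one_smul]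
          abel
  let cosP : C(unitInterval, ℝ) := ⟨fun t => Real.cos (Real.pi / 2 * t), by fun_prop⟩
  refine ⟨⟨constHom x.φpos, constHom x.φneg, pathMultiplier (cosSinPath x.U V), fun a => ?_,
    fun a => ?_, fun a => ?_⟩, ⟨fun a => ?_, fun a => ?_, ?_⟩, ⟨fun a => ?_, fun a => ?_, ?_⟩⟩
  · refine mem_range_coe_of_eval ⟨fun t => cosP t • (x.U * x.φpos a - x.φneg a * x.U), by fun_prop⟩
      (fun t => ?_) fun t => smul_mem_range_coe _ (x.intertwine_mem a)
    rw [multiplierEval_sub, multiplierEval_mul, multiplierEval_mul, hF, multiplierEval_constHom,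
      multiplierEval_constHom, add_mul, mul_add, smul_mul_assoc, smul_mul_assoc, hcomm,
      mul_smul_comm, mul_smul_comm, add_sub_add_right_eq_sub, ← smul_sub]
    rfl
  · refine mem_range_coe_of_eval ⟨fun t => (cosP t * cosP t) • (x.φpos a * (star x.U * x.U - 1)),
      by fun_prop⟩ (fun t => ?_) fun t => smul_mem_range_coe _ (x.pos_mem a)
    rw [multiplierEval_mul, multiplierEval_sub, multiplierEval_mul, multiplierEval_star, hF,
      multiplierEval_constHom, multiplierEval_one, e1 _ _ (hcs t), mul_smul_comm]
    rfl
  · refine mem_range_coe_of_eval ⟨fun t => (cosP t * cosP t) • (x.φneg a * (x.U * star x.U - 1)),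
      by fun_prop⟩ (fun t => ?_) fun t => smul_mem_range_coe _ (x.neg_mem a)
    rw [multiplierEval_mul, multiplierEval_sub, multiplierEval_mul, multiplierEval_star, hF,
      multiplierEval_constHom, multiplierEval_one, e2 _ _ (hcs t), mul_smul_comm]
    rfl
  · exact multiplierEval_constHom 0 _ a
  · exact multiplierEval_constHom 0 _ a
  · refine (hF 0).trans ?_
    change Real.cos (Real.pi / 2 * (0 : ℝ)) • x.U + Real.sin (Real.pi / 2 * (0 : ℝ)) • V = x.U
    simp
  · exact (multiplierEval_constHom 1 _ a).trans (hpos a).symm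
  · exact (multiplierEval_constHom 1 _ a).trans (hneg a).symm
  · refine (hF 1).trans ?_
    change Real.cos (Real.pi / 2 * (1 : ℝ)) • x.U + Real.sin (Real.pi / 2 * (1 : ℝ)) • V = y.U
    simp [hU]

end FredholmCycle

end

end RealKK

namespace RealKK

noncomputable section

open Filter Topology HilbertModule

/-! ### The group structure of the Fredholm picture -/

/-- The relations of the Cuntz algebra with two generators. -/
structure CuntzRel {R : Type*} [Ring R] [StarRing R] (p q : R) : Prop where
  pp : p * star p = 1
  qq : q * star q = 1
  pq : p * star q = 0
  qp : q * star p = 0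
  sum : star p * p + star q * q = 1

namespace CuntzRel

variable {R : Type*} [Ring R] [StarRing R] {p q : R}

theorem pp' (h : CuntzRel p q) (x : R) : p * (star p * x) = x := by rw [← mul_assoc, h.pp, one_mul]

theorem qq' (h : CuntzRel p q) (x : R) : q * (star q * x) = x := by rw [← mul_assoc, h.qq, one_mul]

theorem pq' (h : CuntzRel p q) (x : R) : p * (star q * x) = 0 := by rw [← mul_assoc, h.pq, zero_mul]

theorem qp' (h : CuntzRel p q) (x : R) : q * (star p * x) = 0 := by rw [← mul_assoc, h.qp, zero_mul]

/-- The flip of the two summands. -/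
theorem star_flip (h : CuntzRel p q) :
    star (star p * q + star q * p) * (star p * q + star q * p) = 1 := by
  simp only [star_add, star_mul, star_star, mul_add, add_mul, mul_assoc, h.pp', h.qq', h.pq', h.qp',
    mul_zero, add_zero, zero_add]
  rw [add_comm, h.sum]

theorem flip_conj (h : CuntzRel p q) (x y : R) :
    star p * y * p + star q * x * q =
      (star p * q + star q * p) * (star p * x * p + star q * y * q) *
        star (star p * q + star q * p) := by
  simp only [star_add, star_mul, star_star, mul_add, add_mul, mul_assoc, h.pp', h.qq', h.pq',
    h.qp', mul_zero, add_zero, zero_add]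

/-- The associator of the sum. -/
theorem star_assoc (h : CuntzRel p q) :
    star (star p * p * p + star q * star p * q * p + star q * star q * q) *
      (star p * p * p + star q * star p * q * p + star q * star q * q) = 1 := by
  simp only [star_add, star_mul, star_star, mul_add, add_mul, mul_assoc, h.pp', h.qq', h.pq', h.qp',
    mul_zero, add_zero, zero_add]
  rw [← mul_add, ← mul_assoc (star p) p, ← mul_assoc (star q) q p, ← add_mul, h.sum, one_mul, h.sum]

theorem assoc_conj (h : CuntzRel p q) (x y z : R) :
    star p * x * p + star q * (star p * y * p + star q * z * q) * q =
      (star p * p * p + star q * star p * q * p + star q * star q * q) *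
        (star p * (star p * x * p + star q * y * q) * p + star q * z * q) *
        star (star p * p * p + star q * star p * q * p + star q * star q * q) := by
  simp only [star_add, star_mul, star_star, mul_add, add_mul, mul_assoc, h.pp', h.qq', h.pq',
    h.qp', mul_zero, add_zero, zero_add]
  abel

/-- The exchange of the last two of three summands. -/
theorem star_swap (h : CuntzRel p q) :
    star (star p * star p * p * p + star q * q * p + star p * star q * q) *
      (star p * star p * p * p + star q * q * p + star p * star q * q) = 1 := by
  simp only [star_add, star_mul, star_star, mul_add, add_mul, mul_assoc, h.pp', h.qq', h.pq', h.qp',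
    mul_zero, add_zero, zero_add]
  rw [← mul_add, ← mul_assoc (star p) p, ← mul_assoc (star q) q p, ← add_mul, h.sum, one_mul, h.sum]

theorem swap_conj (h : CuntzRel p q) (x y z : R) :
    star p * (star p * x * p + star q * z * q) * p + star q * y * q =
      (star p * star p * p * p + star q * q * p + star p * star q * q) *
        (star p * (star p * x * p + star q * y * q) * p + star q * z * q) *
        star (star p * star p * p * p + star q * q * p + star p * star q * q) := by
  simp only [star_add, star_mul, star_star, mul_add, add_mul, mul_assoc, h.pp', h.qq', h.pq',
    h.qp', mul_zero, add_zero, zero_add]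
  abel

/-- This isometry fixes the first summand and moves the second one into its own first half. The
range of `star q * star q` stays free, as room for a rotation. -/
theorem star_absorb (h : CuntzRel p q) :
    star (star p * p + star q * star p * q) * (star p * p + star q * star p * q) = 1 := by
  simp only [star_add, star_mul, star_star, mul_add, add_mul, mul_assoc, h.pp', h.qq', h.pq', h.qp',
    mul_zero, add_zero, zero_add]
  exact h.sum

theorem absorb_conj (h : CuntzRel p q) (x y : R) :
    star p * x * p + star q * (star p * y * p + star q * 0 * q) * q =
      (star p * p + star q * star p * q) * (star p * x * p + star q * y * q) *
        star (star p * p + star q * star p * q) := by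
  simp only [star_add, star_mul, star_star, mul_add, add_mul, mul_assoc, h.pp', h.qq', h.pq',
    h.qp', mul_zero, zero_mul, add_zero, zero_add]

end CuntzRel

theorem cuntzRel (D J : Type v) [RealCStarAlgebra D] [RealCStarAlgebra J] [Stabilization D J] :
    CuntzRel (Stabilization.even (D := D) (J := J)) (Stabilization.odd (D := D) (J := J)) where
  pp := Stabilization.even_mul_star
  qq := Stabilization.odd_mul_star
  pq := Stabilization.even_mul_star_odd
  qp := odd_mul_star_even D J
  sum := Stabilization.star_mul_add

namespace FredholmCycle

variable {A : Type u} [RealCStarAlgebra A]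

section

variable {J : Type v} [RealCStarAlgebra J]

/-- The homomorphism `0`, `0` and the operator `0`. -/
def zero (A : Type u) [RealCStarAlgebra A] (J : Type v) [RealCStarAlgebra J] :
    FredholmCycle A J where
  φpos := 0
  φneg := 0
  U := 0
  intertwine_mem a := ⟨0, by
    rw [zero_mul, mul_zero, sub_zero]
    exact coe_multiplier_zero⟩
  pos_mem a := ⟨0, coe_multiplier_zero.trans (zero_mul _).symm⟩
  neg_mem a := ⟨0, coe_multiplier_zero.trans (zero_mul _).symm⟩

theorem isDegenerate_zero : (zero A J).IsDegenerate := fun a => by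
  refine ⟨?_, zero_mul _, zero_mul _⟩
  change 0 * (0 : 𝓜(ℝ, J)) - 0 * 0 = 0
  rw [zero_mul, sub_zero]

/-- The cycle `(φ₋, φ₊, U*)`. -/
def inverse (x : FredholmCycle A J) : FredholmCycle A J where
  φpos := x.φneg
  φneg := x.φpos
  U := star x.U
  intertwine_mem a := by
    obtain ⟨y, hy⟩ := x.intertwine_mem (star a)
    refine ⟨-star y, ?_⟩
    have h1 := map_star (DoubleCentralizer.coeHom (𝕜 := ℝ) (A := J)) y
    have h2 := map_neg (DoubleCentralizer.coeHom (𝕜 := ℝ) (A := J)) (star y)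
    refine h2.trans ((congrArg (fun z => -z) h1).trans ?_)
    change -star (DoubleCentralizer.coe ℝ y : 𝓜(ℝ, J)) = _
    rw [hy, star_sub, star_mul, star_mul, map_star, map_star, star_star, star_star, neg_sub]
  pos_mem a := by
    rw [star_star]
    exact x.neg_mem a
  neg_mem a := by
    rw [star_star]
    exact x.pos_mem a

end

section Sum

variable {B : Type v} [RealCStarAlgebra B]

local notation "ev" => (Stabilization.even (D := B) (J := KTensor B) : 𝓜(ℝ, KTensor B))
local notation "od" => (Stabilization.odd (D := B) (J := KTensor B) : 𝓜(ℝ, KTensor B))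

theorem cornerSum_eq (m n : 𝓜(ℝ, KTensor B)) :
    cornerSum m n = star ev * m * ev + star od * n * od := rfl

theorem sum_φpos (x y : FredholmCycle A (KTensor B)) (a : A) :
    (x.sum y).φpos a = cornerSum (x.φpos a) (y.φpos a) := rfl

theorem sum_φneg (x y : FredholmCycle A (KTensor B)) (a : A) :
    (x.sum y).φneg a = cornerSum (x.φneg a) (y.φneg a) := rfl

theorem sum_U (x y : FredholmCycle A (KTensor B)) :
    (x.sum y).U = cornerSum x.U y.U := rfl

theorem cornerSum_one : cornerSum (1 : 𝓜(ℝ, KTensor B)) 1 = 1 := by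
  rw [cornerSum_eq, mul_one, mul_one, (cuntzRel B (KTensor B)).sum]

theorem IsDegenerate.sum {x y : FredholmCycle A (KTensor B)} (hx : x.IsDegenerate)
    (hy : y.IsDegenerate) : (x.sum y).IsDegenerate := fun a => by
  refine ⟨?_, ?_, ?_⟩
  · rw [sum_U, sum_φpos, sum_φneg, cornerSum_mul, cornerSum_mul, ← cornerSum_sub, (hx a).1, (hy a).1,
      cornerSum_zero]
  · rw [sum_U, sum_φpos, cornerSum_star, cornerSum_mul, ← cornerSum_one, ← cornerSum_sub,
      cornerSum_mul, (hx a).2.1, (hy a).2.1, cornerSum_zero]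
  · rw [sum_U, sum_φneg, cornerSum_star, cornerSum_mul, ← cornerSum_one, ← cornerSum_sub,
      cornerSum_mul, (hx a).2.2, (hy a).2.2, cornerSum_zero]

/-- Adding the zero cycle is conjugation by the isometry `star even`; it leaves the range of `star
odd` unoccupied. -/
theorem isConj_sum_zero {x y : FredholmCycle A (KTensor B)} {s r : 𝓜(ℝ, KTensor B)}
    (h : IsConj s r x y) : IsConj (star ev * s) (star ev * r) x (y.sum (zero A (KTensor B))) := by
  have key : ∀ m, cornerSum m 0 = star ev * m * ev := fun m => by
    rw [cornerSum_eq, mul_zero, zero_mul, add_zero]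
  refine ⟨fun a => ?_, fun a => ?_, ?_⟩
  · refine (key _).trans ?_
    rw [h.pos, star_mul, star_star]
    simp only [mul_assoc]
  · refine (key _).trans ?_
    rw [h.neg, star_mul, star_star]
    simp only [mul_assoc]
  · refine (key _).trans ?_
    rw [h.op, star_mul, star_star]
    simp only [mul_assoc]

theorem isConj_one (x : FredholmCycle A (KTensor B)) : IsConj 1 1 x x := by
  constructor <;> intros <;> rw [star_one, mul_one, one_mul]

theorem IsSupport.star_even_mul {x : FredholmCycle A (KTensor B)} {s r : 𝓜(ℝ, KTensor B)}
    (h : x.IsSupport s r) : x.IsSupport (star ev * s) (star ev * r) := by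
  have key : ∀ m : 𝓜(ℝ, KTensor B), star (star ev * m) * (star ev * m) = star m * m := fun m => by
    rw [star_mul, star_star, mul_assoc, (cuntzRel B (KTensor B)).pp']
  refine ⟨?_, ?_, ?_, ?_⟩
  · simpa only [key] using h.pos
  · simpa only [key] using h.neg
  · simpa only [key] using h.right
  · simpa only [key] using h.left

/-- Once a zero cycle is added, both cycles are conjugates of x by elements with range in the even
half. The rotation between them passes through `star odd`. -/
theorem equivalent_of_isConj {x y : FredholmCycle A (KTensor B)} {s r : 𝓜(ℝ, KTensor B)}
    (h : x.IsSupport s r) (hc : IsConj s r x y) : Equivalent y x := by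
  have hr := cuntzRel B (KTensor B)
  refine ⟨_, _, isDegenerate_zero, isDegenerate_zero, homotopic_of_isConj (v := star od)
    (v' := star od) h.star_even_mul (x.isSupport_of_isometry ?_ ?_)
    (x.isSupport_of_isometry (s := 1) (r := 1) ?_ ?_).star_even_mul ?_ ?_ ?_ ?_
    (isConj_sum_zero hc) (isConj_sum_zero x.isConj_one)⟩
  · rw [star_star, hr.qq]
  · rw [star_star, hr.qq]
  · rw [star_one, one_mul]
  · rw [star_one, one_mul]
  · rw [star_mul, star_star, mul_assoc, hr.pq, mul_zero]
  · rw [star_mul, star_star, mul_assoc, hr.pq, mul_zero]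
  · rw [star_mul, star_star, mul_assoc, hr.pq, mul_zero]
  · rw [star_mul, star_star, mul_assoc, hr.pq, mul_zero]

/-- Both (x ⊕ d) ⊕ 0 and x ⊕ (d ⊕ 0) are conjugates of x ⊕ d by isometries, and the range of `star
od * star od` is orthogonal to the ranges of both. The summand d ⊕ 0 on the side of x is degenerate.
-/
theorem equivalent_sum_of_isDegenerate (x : FredholmCycle A (KTensor B))
    {d : FredholmCycle A (KTensor B)} (hd : d.IsDegenerate) : Equivalent (x.sum d) x := by
  have hr := cuntzRel B (KTensor B)
  refine ⟨_, _, isDegenerate_zero, hd.sum isDegenerate_zero, homotopic_of_isConj (x := x.sum d)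
    (u := star ev * 1) (u' := star ev * 1)
    (v := star od * star od) (v' := star od * star od) (w := star ev * ev + star od * star ev * od)
    (w' := star ev * ev + star od * star ev * od)
    (isSupport_of_isometry _ (s := 1) (r := 1) ?_ ?_).star_even_mul
    (isSupport_of_isometry _ ?_ ?_) (isSupport_of_isometry _ hr.star_absorb hr.star_absorb)
    ?_ ?_ ?_ ?_ (isConj_sum_zero (isConj_one _)) ⟨fun a => ?_, fun a => ?_, ?_⟩⟩
  · rw [star_one, one_mul]
  · rw [star_one, one_mul]
  · rw [star_mul, star_star, mul_assoc, hr.qq', hr.qq]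
  · rw [star_mul, star_star, mul_assoc, hr.qq', hr.qq]
  · rw [mul_one, star_star, hr.pq']
  · simp only [star_add, star_mul, star_star, add_mul, mul_assoc, hr.pq', hr.qq', hr.pq, mul_zero,
      add_zero]
  · rw [mul_one, star_star, hr.pq']
  · simp only [star_add, star_mul, star_star, add_mul, mul_assoc, hr.pq', hr.qq', hr.pq, mul_zero,
      add_zero]
  · exact hr.absorb_conj (x.φpos a) (d.φpos a)
  · exact hr.absorb_conj (x.φneg a) (d.φneg a)
  · exact hr.absorb_conj x.U d.U

theorem equivalent_sum_comm (x y : FredholmCycle A (KTensor B)) :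
    Equivalent (y.sum x) (x.sum y) := by
  have hr := cuntzRel B (KTensor B)
  exact equivalent_of_isConj (isSupport_of_isometry _ hr.star_flip hr.star_flip)
    ⟨fun a => hr.flip_conj _ _, fun a => hr.flip_conj _ _, hr.flip_conj _ _⟩

theorem equivalent_sum_assoc (x y z : FredholmCycle A (KTensor B)) :
    Equivalent (x.sum (y.sum z)) ((x.sum y).sum z) := by
  have hr := cuntzRel B (KTensor B)
  exact equivalent_of_isConj (isSupport_of_isometry _ hr.star_assoc hr.star_assoc)
    ⟨fun a => hr.assoc_conj _ _ _, fun a => hr.assoc_conj _ _ _, hr.assoc_conj _ _ _⟩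

theorem equivalent_sum_swap (x y z : FredholmCycle A (KTensor B)) :
    Equivalent ((x.sum z).sum y) ((x.sum y).sum z) := by
  have hr := cuntzRel B (KTensor B)
  exact equivalent_of_isConj (isSupport_of_isometry _ hr.star_swap hr.star_swap)
    ⟨fun a => hr.swap_conj _ _ _, fun a => hr.swap_conj _ _ _, hr.swap_conj _ _ _⟩

/-- The diagonal sum of two paths of multipliers. -/
def pathSum (m n : 𝓜(ℝ, C(unitInterval, KTensor B))) : 𝓜(ℝ, C(unitInterval, KTensor B)) :=
  star (constMultiplier ev) * m * constMultiplier ev +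
    star (constMultiplier od) * n * constMultiplier od

theorem multiplierEval_pathSum (t : unitInterval) (m n : 𝓜(ℝ, C(unitInterval, KTensor B))) :
    multiplierEval t (pathSum m n) = cornerSum (multiplierEval t m) (multiplierEval t n) := by
  rw [pathSum, multiplierEval_add, multiplierEval_mul, multiplierEval_mul, multiplierEval_mul,
    multiplierEval_mul, multiplierEval_star, multiplierEval_star, multiplierEval_constMultiplier,
    multiplierEval_constMultiplier, cornerSum_eq]

theorem pathSum_mem {m n : 𝓜(ℝ, C(unitInterval, KTensor B))}
    (hm : m ∈ Set.range (DoubleCentralizer.coe ℝ : C(unitInterval, KTensor B) → _))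
    (hn : n ∈ Set.range (DoubleCentralizer.coe ℝ : C(unitInterval, KTensor B) → _)) :
    pathSum m n ∈ Set.range (DoubleCentralizer.coe ℝ : C(unitInterval, KTensor B) → _) :=
  add_mem_range_coe (coe_mul_mem _ (mul_coe_mem _ hm)) (coe_mul_mem _ (mul_coe_mem _ hn))

/-- The diagonal sum of two paths of homomorphisms. -/
def pathSumHom (φ ψ : A →⋆ₙₐ[ℝ] 𝓜(ℝ, C(unitInterval, KTensor B))) :
    A →⋆ₙₐ[ℝ] 𝓜(ℝ, C(unitInterval, KTensor B)) where
  toFun a := pathSum (φ a) (ψ a)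
  map_smul' r a := path_multiplier_ext fun t => by
    change multiplierEval t (pathSum (φ (r • a)) (ψ (r • a))) =
      multiplierEval t (r • pathSum (φ a) (ψ a))
    rw [map_smul, map_smul, multiplierEval_smul, multiplierEval_pathSum, multiplierEval_pathSum,
      multiplierEval_smul, multiplierEval_smul, cornerSum_smul]
  map_zero' := path_multiplier_ext fun t => by
    rw [map_zero, map_zero, multiplierEval_pathSum, multiplierEval_zero, cornerSum_zero]
  map_add' a b := path_multiplier_ext fun t => by
    simp only [multiplierEval_pathSum, multiplierEval_add, map_add, cornerSum_add]
  map_mul' a b := path_multiplier_ext fun t => by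
    simp only [multiplierEval_pathSum, multiplierEval_mul, map_mul, cornerSum_mul]
  map_star' a := path_multiplier_ext fun t => by
    simp only [multiplierEval_pathSum, multiplierEval_star, map_star, cornerSum_star]

theorem Homotopic.sum {x x' : FredholmCycle A (KTensor B)} (h : Homotopic x x')
    (y : FredholmCycle A (KTensor B)) : Homotopic (x.sum y) (x'.sum y) := by
  obtain ⟨z, ⟨h1, h2, h3⟩, h1', h2', h3'⟩ := h
  have e := multiplierEval_pathSum (B := B)
  refine ⟨⟨pathSumHom z.φpos y.constPath.φpos, pathSumHom z.φneg y.constPath.φneg,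
    pathSum z.U y.constPath.U, fun a => ?_, fun a => ?_, fun a => ?_⟩,
    ⟨fun a => ?_, fun a => ?_, ?_⟩, ⟨fun a => ?_, fun a => ?_, ?_⟩⟩
  · have := pathSum_mem (z.intertwine_mem a) (y.constPath.intertwine_mem a)
    refine Eq.mp (congrArg (· ∈ _) (path_multiplier_ext fun t => ?_)) this
    change _ = multiplierEval t (pathSum _ _ * pathSum _ _ - pathSum _ _ * pathSum _ _)
    simp only [e, multiplierEval_sub, multiplierEval_mul, cornerSum_mul, cornerSum_sub]
  · have := pathSum_mem (z.pos_mem a) (y.constPath.pos_mem a)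
    refine Eq.mp (congrArg (· ∈ _) (path_multiplier_ext fun t => ?_)) this
    change _ = multiplierEval t (pathSum _ _ * (star (pathSum _ _) * pathSum _ _ - 1))
    simp only [e, multiplierEval_sub, multiplierEval_mul, multiplierEval_star, multiplierEval_one,
      cornerSum_star, cornerSum_mul]
    rw [← cornerSum_mul, cornerSum_sub, cornerSum_one]
  · have := pathSum_mem (z.neg_mem a) (y.constPath.neg_mem a)
    refine Eq.mp (congrArg (· ∈ _) (path_multiplier_ext fun t => ?_)) this
    change _ = multiplierEval t (pathSum _ _ * (pathSum _ _ * star (pathSum _ _) - 1))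
    simp only [e, multiplierEval_sub, multiplierEval_mul, multiplierEval_star, multiplierEval_one,
      cornerSum_star, cornerSum_mul]
    rw [← cornerSum_mul, cornerSum_sub, cornerSum_one]
  · refine (e 0 _ _).trans ?_
    rw [h1]
    exact congrArg _ (multiplierEval_constHom 0 y.φpos a)
  · refine (e 0 _ _).trans ?_
    rw [h2]
    exact congrArg _ (multiplierEval_constHom 0 y.φneg a)
  · refine (e 0 _ _).trans ?_
    rw [h3]
    exact congrArg _ (multiplierEval_constMultiplier 0 y.U)
  · refine (e 1 _ _).trans ?_
    rw [h1']
    exact congrArg _ (multiplierEval_constHom 1 y.φpos a)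
  · refine (e 1 _ _).trans ?_
    rw [h2']
    exact congrArg _ (multiplierEval_constHom 1 y.φneg a)
  · refine (e 1 _ _).trans ?_
    rw [h3']
    exact congrArg _ (multiplierEval_constMultiplier 1 y.U)

theorem Homotopic.equivalent {x x' : FredholmCycle A (KTensor B)} (h : Homotopic x x') :
    Equivalent x x' :=
  ⟨_, _, isDegenerate_zero, isDegenerate_zero, h.sum _⟩

/-- On the sum of x with (φ₋, φ₊, U*) the operator is diag(U, U*). The unitary V, a matrix with rows
(0, −1) and (1, 0), intertwines φ₊ ⊕ φ₋ with φ₋ ⊕ φ₊, and its mixed terms with diag(U, U*) cancel.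
So the operator rotates into V, which has no defect. -/
theorem exists_homotopic_isDegenerate (x : FredholmCycle A (KTensor B)) :
    ∃ d : FredholmCycle A (KTensor B), d.IsDegenerate ∧ Homotopic (x.sum x.inverse) d := by
  have hr := cuntzRel B (KTensor B)
  set V : 𝓜(ℝ, KTensor B) := star od * ev - star ev * od with hVdef
  have hV : star V * V = 1 := by
    simp only [hVdef, star_sub, star_mul, star_star, sub_mul, mul_sub, mul_assoc, hr.qq', hr.pp',
      hr.pq', hr.qp', mul_zero, sub_zero, zero_sub, sub_neg_eq_add]
    exact hr.sum
  have hV' : V * star V = 1 := by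
    simp only [hVdef, star_sub, star_mul, star_star, sub_mul, mul_sub, mul_assoc, hr.qq', hr.pp',
      hr.pq', hr.qp', mul_zero, sub_zero, zero_sub, sub_neg_eq_add]
    rw [add_comm, hr.sum]
  have hcomm : ∀ m n, V * cornerSum m n = cornerSum n m * V := fun m n => by
    simp only [cornerSum_eq, hVdef, add_mul, mul_add, sub_mul, mul_sub, mul_assoc, hr.qq', hr.pp',
      hr.pq', hr.qp', mul_zero, sub_zero, zero_sub, add_zero, zero_add]
    abel
  have hanti : ∀ m n, cornerSum n m * V + star V * cornerSum m n = 0 := fun m n => by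
    simp only [cornerSum_eq, hVdef, star_sub, star_mul, star_star, add_mul, mul_add, sub_mul,
      mul_sub, mul_assoc, hr.qq', hr.pp', hr.pq', hr.qp', mul_zero, sub_zero, zero_sub, add_zero,
      zero_add]
    abel
  have hanti' : ∀ m n, cornerSum m n * star V + V * cornerSum n m = 0 := fun m n => by
    simp only [cornerSum_eq, hVdef, star_sub, star_mul, star_star, add_mul, mul_add, sub_mul,
      mul_sub, mul_assoc, hr.qq', hr.pp', hr.pq', hr.qp', mul_zero, sub_zero, zero_sub, add_zero,
      zero_add]
    abel
  have h1 : ∀ a, V * (x.sum x.inverse).φpos a = (x.sum x.inverse).φneg a * V := fun a => hcomm _ _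
  have h2 : star (x.sum x.inverse).U * V + star V * (x.sum x.inverse).U = 0 := by
    rw [sum_U, cornerSum_star]
    change cornerSum (star x.U) (star (star x.U)) * V + _ * cornerSum x.U (star x.U) = 0
    rw [star_star]
    exact hanti _ _
  have h3 : (x.sum x.inverse).U * star V + V * star (x.sum x.inverse).U = 0 := by
    rw [sum_U, cornerSum_star]
    change cornerSum x.U (star x.U) * star V + V * cornerSum (star x.U) (star (star x.U)) = 0
    rw [star_star]
    exact hanti' _ _
  have h0 := coe_multiplier_zero (J := KTensor B)
  refine ⟨⟨(x.sum x.inverse).φpos, (x.sum x.inverse).φneg, V, fun a => ⟨0, ?_⟩, fun a => ⟨0, ?_⟩,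
    fun a => ⟨0, ?_⟩⟩, fun a => ⟨?_, ?_, ?_⟩,
    homotopic_of_anticommute hV hV' h1 h2 h3 (fun _ => rfl) (fun _ => rfl) rfl⟩
  · rw [h1, sub_self, h0]
  · rw [hV, sub_self, mul_zero, h0]
  · rw [hV', sub_self, mul_zero, h0]
  · exact sub_eq_zero.2 (h1 a)
  · exact (congrArg ((x.sum x.inverse).φpos a * ·) (sub_eq_zero.2 hV)).trans (mul_zero _)
  · exact (congrArg ((x.sum x.inverse).φneg a * ·) (sub_eq_zero.2 hV')).trans (mul_zero _)

end Sum

end FredholmCycle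

namespace FredholmKK

variable {A : Type u} [RealCStarAlgebra A] {B : Type v} [RealCStarAlgebra B]

open FredholmCycle

theorem mk_eq {x y : FredholmCycle A (KTensor B)} (h : Equivalent x y) : mk x = mk y :=
  Quot.sound h

theorem mk_sum_of_isDegenerate (x : FredholmCycle A (KTensor B))
    {d : FredholmCycle A (KTensor B)} (hd : d.IsDegenerate) : mk (x.sum d) = mk x :=
  mk_eq (equivalent_sum_of_isDegenerate x hd)

theorem mk_sum_comm (x y : FredholmCycle A (KTensor B)) : mk (x.sum y) = mk (y.sum x) :=
  mk_eq (equivalent_sum_comm y x)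

theorem mk_sum_assoc (x y z : FredholmCycle A (KTensor B)) :
    mk ((x.sum y).sum z) = mk (x.sum (y.sum z)) :=
  (mk_eq (equivalent_sum_assoc x y z)).symm

/-- The degenerate summands are exchanged with y and then dropped. -/
theorem mk_sum_congr_left {x x' : FredholmCycle A (KTensor B)} (h : Equivalent x x')
    (y : FredholmCycle A (KTensor B)) : mk (x.sum y) = mk (x'.sum y) := by
  obtain ⟨d, e, hd, he, h⟩ := h
  have hperm : ∀ {x d : FredholmCycle A (KTensor B)}, d.IsDegenerate →
      mk ((x.sum d).sum y) = mk (x.sum y) := fun {x d} hd =>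
    (mk_eq (equivalent_sum_swap x y d)).trans (mk_sum_of_isDegenerate _ hd)
  rw [← hperm hd, mk_eq (h.sum y).equivalent, hperm he]

/-- The sum of two classes. -/
def add : FredholmKK A B → FredholmKK A B → FredholmKK A B :=
  Quot.lift₂ (fun x y => mk (x.sum y))
    (fun x y y' h => by
      have h0 := mk_sum_comm (A := A) (B := B)
      rw [h0, h0 x y']
      exact mk_sum_congr_left h x)
    (fun x x' y h => mk_sum_congr_left h y)

theorem exists_add_eq (ξ : FredholmKK A B) : ∃ η : FredholmKK A B,
    η.add ξ = mk (FredholmCycle.zero A (KTensor B)) := by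
  induction ξ using Quot.ind with
  | mk x =>
    obtain ⟨d, hd, h⟩ := exists_homotopic_isDegenerate x
    refine ⟨mk x.inverse, ?_⟩
    change mk (x.inverse.sum x) = _
    -- The class of a degenerate cycle is that of zero: d, d ⊕ 0, 0 ⊕ d and 0 have the same class.
    rw [mk_sum_comm, mk_eq h.equivalent,
      ← mk_sum_of_isDegenerate d (isDegenerate_zero (J := KTensor B)), mk_sum_comm,
      mk_sum_of_isDegenerate _ hd]

/-- The diagonal sum makes the Fredholm picture into an abelian group. -/
instance : AddCommGroup (FredholmKK A B) :=
  letI : Add (FredholmKK A B) := ⟨add⟩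
  letI : Zero (FredholmKK A B) := ⟨mk (FredholmCycle.zero A (KTensor B))⟩
  letI : Neg (FredholmKK A B) := ⟨fun ξ => (exists_add_eq ξ).choose⟩
  { AddGroup.ofLeftAxioms
      (fun ξ η ζ : FredholmKK A B => by
        induction ξ using Quot.ind with
        | mk x =>
          induction η using Quot.ind with
          | mk y =>
            induction ζ using Quot.ind with
            | mk z => exact mk_sum_assoc x y z)
      (fun ξ => by
        induction ξ using Quot.ind with
        | mk x => exact (mk_sum_comm _ x).trans (mk_sum_of_isDegenerate x isDegenerate_zero))
      (fun ξ => (exists_add_eq ξ).choose_spec) with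
    add_comm := fun ξ η => by
      induction ξ using Quot.ind with
      | mk x =>
        induction η using Quot.ind with
        | mk y => exact mk_sum_comm x y }

theorem mk_add_mk (x y : FredholmCycle A (KTensor B)) : mk x + mk y = mk (x.sum y) := rfl

end FredholmKK

end

end RealKK

namespace RealKK

noncomputable section

open Filter Topology HilbertModule

/-! ### The even and the odd part of a Kasparov bimodule -/

namespace KasparovBimodule

variable {A : Type u} [RealCStarAlgebra A] {D : Type v} [RealCStarAlgebra D]
variable (x : KasparovBimodule A D)

/-- The projection to the even part. -/
def evenProj : x.E →L[ℝ] x.E := (1 / 2 : ℝ) • (1 + x.γ)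

/-- The projection to the odd part. -/
def oddProj : x.E →L[ℝ] x.E := (1 / 2 : ℝ) • (1 - x.γ)

theorem even_add_odd : x.evenProj + x.oddProj = 1 := by
  unfold evenProj oddProj
  module

theorem even_sub_odd : x.evenProj - x.oddProj = x.γ := by
  unfold evenProj oddProj
  module

theorem even_mul_even : x.evenProj * x.evenProj = x.evenProj := by
  unfold evenProj
  rw [smul_mul_smul_comm, mul_add, add_mul, add_mul, x.γ_sq, mul_one, one_mul, mul_one]
  module

theorem odd_mul_odd : x.oddProj * x.oddProj = x.oddProj := by
  unfold oddProj
  rw [smul_mul_smul_comm, mul_sub, sub_mul, sub_mul, x.γ_sq, mul_one, one_mul, mul_one]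
  module

theorem even_mul_odd : x.evenProj * x.oddProj = 0 := by
  unfold oddProj evenProj
  rw [smul_mul_smul_comm, mul_sub, add_mul, add_mul, x.γ_sq, mul_one, one_mul, mul_one]
  module

theorem odd_mul_even : x.oddProj * x.evenProj = 0 := by
  unfold oddProj evenProj
  rw [smul_mul_smul_comm, mul_add, sub_mul, sub_mul, x.γ_sq, mul_one, one_mul, mul_one]
  module

theorem isAdj_γ : IsAdj D x.γ x.γ := fun e f => by
  rw [← x.γ_inner e (x.γ f)]
  congr 1
  exact (congrArg (fun T : x.E →L[ℝ] x.E => T f) x.γ_sq).symm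

theorem isAdj_φ (a : A) : IsAdj D (x.φ a) (x.φ (star a)) := x.φ_star a

theorem isAdj_T : IsAdj D x.T x.Tadj := x.T_adjoint

theorem isAdj_even : IsAdj D x.evenProj x.evenProj :=
  ((IsAdj.one D x.E).add x.isAdj_γ).smul _

theorem isAdj_odd : IsAdj D x.oddProj x.oddProj :=
  ((IsAdj.one D x.E).sub x.isAdj_γ).smul _

theorem even_mul_φ (a : A) : x.evenProj * x.φ a = x.φ a * x.evenProj := by
  unfold evenProj
  rw [smul_mul_assoc, mul_smul_comm, add_mul, mul_add, x.φ_even, one_mul, mul_one]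

theorem odd_mul_φ (a : A) : x.oddProj * x.φ a = x.φ a * x.oddProj := by
  unfold oddProj
  rw [smul_mul_assoc, mul_smul_comm, sub_mul, mul_sub, x.φ_even, one_mul, mul_one]

theorem odd_mul_T : x.oddProj * x.T = x.T * x.evenProj := by
  unfold oddProj evenProj
  rw [smul_mul_assoc, mul_smul_comm, sub_mul, mul_add, x.T_odd, one_mul, mul_one, sub_neg_eq_add]

theorem even_mul_T : x.evenProj * x.T = x.T * x.oddProj := by
  unfold oddProj evenProj
  rw [smul_mul_assoc, mul_smul_comm, add_mul, mul_sub, x.T_odd, one_mul, mul_one, ← sub_eq_add_neg]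

theorem even_mul_Tadj : x.evenProj * x.Tadj = x.Tadj * x.oddProj := by
  have h := x.isAdj_T.mul x.isAdj_even
  rw [← odd_mul_T] at h
  exact h.unique (x.isAdj_odd.mul x.isAdj_T)

theorem odd_mul_Tadj : x.oddProj * x.Tadj = x.Tadj * x.evenProj := by
  have h := x.isAdj_T.mul x.isAdj_odd
  rw [← even_mul_T] at h
  exact h.unique (x.isAdj_even.mul x.isAdj_T)

/-- T*T differs from T² by (T* − T) T, and moving this last T past φ a costs one commutator. -/
theorem adjoint_mul_compact (a : A) : (x.Tadj * x.T - 1) * x.φ a ∈ compactOperators D x.E := by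
  have h1 : (x.Tadj - x.T) * x.φ a ∈ compactOperators D x.E := by
    have := neg_mem (x.compact_adjoint a)
    rwa [← neg_mul, neg_sub] at this
  have e : (x.Tadj * x.T - 1) * x.φ a = (x.Tadj - x.T) * (x.T * x.φ a - x.φ a * x.T) +
      (x.Tadj - x.T) * x.φ a * x.T + (x.T * x.T - 1) * x.φ a := by noncomm_ring
  rw [e]
  exact add_mem (add_mem
    (mul_mem_compactOperators (x.isAdj_T.symm.sub x.isAdj_T) (x.compact_commutator a))
    (mem_compactOperators_mul x.isAdj_T h1)) (x.compact_square a)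

theorem mul_adjoint_compact (a : A) : (x.T * x.Tadj - 1) * x.φ a ∈ compactOperators D x.E := by
  have e : (x.T * x.Tadj - 1) * x.φ a = (x.T * x.T - 1) * x.φ a -
      x.T * ((x.T - x.Tadj) * x.φ a) := by noncomm_ring
  rw [e]
  exact sub_mem (x.compact_square a) (mul_mem_compactOperators x.isAdj_T (x.compact_adjoint a))

/-- Adjoints of compact operators are compact; this moves φ a from the right to the left of a
defect. -/
theorem compact_mul_φ {k k' : x.E →L[ℝ] x.E} (hk : IsAdj D k k')
    (h : ∀ a, k * x.φ a ∈ compactOperators D x.E) (a : A) : x.φ a * k' ∈ compactOperators D x.E := by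
  have h1 := hk.mul (x.isAdj_φ (star a))
  rw [star_star] at h1
  exact h1.mem_compactOperators (h (star a))

end KasparovBimodule

/-! ### From Kasparov bimodules to Fredholm cycles -/

section Lift

variable {D J : Type v} [RealCStarAlgebra D] [RealCStarAlgebra J] [Stabilization D J]
variable {E : Type*} [NormedAddCommGroup E] [NormedSpace ℝ E] [HilbertModule D E]
variable {v : E →L[ℝ] Col D J} {v' : Col D J →L[ℝ] E} {T S T' S' : E →L[ℝ] E}

/-- The multiplier that is given by an operator on a complemented submodule of the columns. -/
def lift (hv : IsAdj D v v') (hT : IsAdj D T S) : 𝓜(ℝ, J) :=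
  toMultiplier ((hv.symm.comp hT).comp hv)

theorem colMap_lift (hv : IsAdj D v v') (hT : IsAdj D T S) :
    colMap D (lift hv hT) = v ∘L T ∘L v' :=
  colMap_toMultiplier _

theorem lift_eq {m : 𝓜(ℝ, J)} (hv : IsAdj D v v') (hT : IsAdj D T S)
    (h : colMap D m = v ∘L T ∘L v') : m = lift hv hT :=
  multiplier_ext (D := D) (h.trans (colMap_lift hv hT).symm)

theorem lift_congr (hv : IsAdj D v v') (hT : IsAdj D T S) (hT' : IsAdj D T' S') (h : T = T') :
    lift hv hT = lift hv hT' := by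
  subst h
  exact lift_eq hv hT' (colMap_lift hv hT)

theorem lift_mul (hv : IsAdj D v v') (hvv : v' ∘L v = 1) (hT : IsAdj D T S) (hT' : IsAdj D T' S') :
    lift hv hT * lift hv hT' = lift hv (hT.mul hT') := by
  refine lift_eq hv _ ?_
  rw [colMap_mul, colMap_lift, colMap_lift]
  refine ContinuousLinearMap.ext fun c => ?_
  change v (T ((v' ∘L v) (T' (v' c)))) = v (T (T' (v' c)))
  rw [hvv]
  rfl

theorem lift_add (hv : IsAdj D v v') (hT : IsAdj D T S) (hT' : IsAdj D T' S') :
    lift hv hT + lift hv hT' = lift hv (hT.add hT') := by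
  refine lift_eq hv _ ?_
  rw [colMap_add, colMap_lift, colMap_lift]
  exact ContinuousLinearMap.ext fun c => (map_add v _ _).symm

theorem lift_sub (hv : IsAdj D v v') (hT : IsAdj D T S) (hT' : IsAdj D T' S') :
    lift hv hT - lift hv hT' = lift hv (hT.sub hT') := by
  refine lift_eq hv _ ?_
  rw [colMap_sub, colMap_lift, colMap_lift]
  exact ContinuousLinearMap.ext fun c => (map_sub v _ _).symm

theorem star_eq_of_isAdj {m n : 𝓜(ℝ, J)} (h : IsAdj D (colMap D m) (colMap D n)) : star m = n :=
  multiplier_ext (D := D) ((isAdj_colMap m).unique h)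

theorem star_lift (hv : IsAdj D v v') (hT : IsAdj D T S) :
    star (lift hv hT) = lift hv hT.symm := by
  refine star_eq_of_isAdj (D := D) ?_
  rw [colMap_lift, colMap_lift]
  exact (hv.symm.comp hT).comp hv

theorem lift_mem (hv : IsAdj D v v') (hT : IsAdj D T S) (h : T ∈ compactOperators D E) :
    lift hv hT ∈ Set.range (DoubleCentralizer.coe ℝ : J → 𝓜(ℝ, J)) :=
  mem_range_coe_of_colMap_eq hv h (colMap_lift hv hT)

variable {A : Type u} [RealCStarAlgebra A]

/-- The homomorphism that is given by a homomorphism `φ` and a projection `e` that commutes with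
it. -/
def liftHom (hv : IsAdj D v v') (hvv : v' ∘L v = 1) (φ : A →ₙₐ[ℝ] (E →L[ℝ] E))
    (hφ : ∀ a, IsAdj D (φ a) (φ (star a))) {e : E →L[ℝ] E} (he : IsAdj D e e) (hee : e * e = e)
    (heφ : ∀ a, e * φ a = φ a * e) : A →⋆ₙₐ[ℝ] 𝓜(ℝ, J) where
  toFun a := lift hv ((hφ a).mul he)
  map_smul' r a := by
    refine (lift_eq hv _ ?_).symm
    change r • colMap D _ = _
    rw [colMap_lift, map_smul]
    exact ContinuousLinearMap.ext fun c => (map_smul v r _).symm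
  map_zero' := by
    refine (lift_eq hv _ ?_).symm
    rw [colMap_zero, map_zero]
    exact ContinuousLinearMap.ext fun c => (map_zero v).symm
  map_add' a b := by
    rw [lift_add]
    exact lift_congr hv _ _ (by rw [map_add, add_mul])
  map_mul' a b := by
    rw [lift_mul hv hvv]
    exact lift_congr hv _ _ (by rw [map_mul, mul_assoc, mul_assoc, ← mul_assoc e, heφ, mul_assoc, hee])
  map_star' a := by
    rw [star_lift]
    exact lift_congr hv _ _ (heφ _).symm

theorem liftHom_apply (hv : IsAdj D v v') (hvv : v' ∘L v = 1) (φ : A →ₙₐ[ℝ] (E →L[ℝ] E))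
    (hφ : ∀ a, IsAdj D (φ a) (φ (star a))) {e : E →L[ℝ] E} (he : IsAdj D e e) (hee : e * e = e)
    (heφ : ∀ a, e * φ a = φ a * e) (a : A) :
    liftHom hv hvv φ hφ he hee heφ a = lift hv ((hφ a).mul he) := rfl

end Lift

namespace KasparovBimodule

variable {A : Type u} [RealCStarAlgebra A]
variable {D J : Type v} [RealCStarAlgebra D] [RealCStarAlgebra J] [Stabilization D J]

/-- The Fredholm cycle of a Kasparov bimodule whose module is embedded into the columns. -/
def toCycle (x : KasparovBimodule A D) {v : x.E →L[ℝ] Col D J} {v' : Col D J →L[ℝ] x.E}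
    (hv : IsAdj D v v') (hvv : v' ∘L v = 1) : FredholmCycle A J where
  φpos := liftHom hv hvv x.φ x.isAdj_φ x.isAdj_even x.even_mul_even x.even_mul_φ
  φneg := liftHom hv hvv x.φ x.isAdj_φ x.isAdj_odd x.odd_mul_odd x.odd_mul_φ
  U := lift hv (x.isAdj_T.mul x.isAdj_even)
  intertwine_mem a := by
    rw [liftHom_apply, liftHom_apply, lift_mul hv hvv, lift_mul hv hvv, lift_sub]
    refine lift_mem hv _ ?_
    -- T exchanges the two parts and φ a preserves them, so the defect is the commutator of T and φ
    -- a, restricted to the even part.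
    have e : x.T * x.evenProj * (x.φ a * x.evenProj) - x.φ a * x.oddProj * (x.T * x.evenProj) =
        (x.T * x.φ a - x.φ a * x.T) * x.evenProj := by
      calc _ = x.T * (x.evenProj * x.φ a) * x.evenProj -
            x.φ a * (x.oddProj * x.T) * x.evenProj := by noncomm_ring
        _ = (x.T * x.φ a - x.φ a * x.T) * (x.evenProj * x.evenProj) := by
            rw [x.even_mul_φ, x.odd_mul_T]
            noncomm_ring
        _ = _ := by rw [x.even_mul_even]
    rw [e]
    exact mem_compactOperators_mul x.isAdj_even (x.compact_commutator a)
  pos_mem a := by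
    rw [liftHom_apply, mul_sub, mul_one, star_lift, lift_mul hv hvv, lift_mul hv hvv, lift_sub]
    refine lift_mem hv _ ?_
    -- T*T preserves the even part, so U*U is its restriction there.
    have e : x.φ a * x.evenProj * (x.evenProj * x.Tadj * (x.T * x.evenProj)) - x.φ a * x.evenProj =
        x.φ a * (x.Tadj * x.T - 1) * x.evenProj := by
      calc _ = x.φ a * (x.evenProj * x.evenProj * x.Tadj * x.T * x.evenProj) -
            x.φ a * x.evenProj := by noncomm_ring
        _ = x.φ a * (x.Tadj * x.T * x.evenProj) - x.φ a * x.evenProj := by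
            rw [x.even_mul_even, x.even_mul_Tadj, mul_assoc x.Tadj, x.odd_mul_T]
            simp only [mul_assoc, x.even_mul_even]
        _ = _ := by noncomm_ring
    rw [e]
    exact mem_compactOperators_mul x.isAdj_even (x.compact_mul_φ
      ((x.isAdj_T.symm.mul x.isAdj_T).sub (IsAdj.one D x.E)).symm x.adjoint_mul_compact a)
  neg_mem a := by
    rw [liftHom_apply, mul_sub, mul_one, star_lift, lift_mul hv hvv, lift_mul hv hvv, lift_sub]
    refine lift_mem hv _ ?_
    have e : x.φ a * x.oddProj * (x.T * x.evenProj * (x.evenProj * x.Tadj)) - x.φ a * x.oddProj =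
        x.φ a * (x.T * x.Tadj - 1) * x.oddProj := by
      calc _ = x.φ a * (x.oddProj * x.T * (x.evenProj * x.evenProj) * x.Tadj) -
            x.φ a * x.oddProj := by noncomm_ring
        _ = x.φ a * (x.T * (x.evenProj * x.evenProj * x.Tadj)) - x.φ a * x.oddProj := by
            rw [x.odd_mul_T]
            simp only [mul_assoc]
            rw [← mul_assoc x.evenProj x.evenProj (x.evenProj * _), x.even_mul_even]
        _ = _ := by
            rw [x.even_mul_even, x.even_mul_Tadj]
            noncomm_ring
    rw [e]
    exact mem_compactOperators_mul x.isAdj_odd (x.compact_mul_φ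
      ((x.isAdj_T.mul x.isAdj_T.symm).sub (IsAdj.one D x.E)).symm x.mul_adjoint_compact a)

section

variable (x : KasparovBimodule A D) {v : x.E →L[ℝ] Col D J} {v' : Col D J →L[ℝ] x.E}
    (hv : IsAdj D v v') (hvv : v' ∘L v = 1)

theorem colMap_toCycle_φpos (a : A) :
    colMap D ((x.toCycle hv hvv).φpos a) = v ∘L (x.φ a * x.evenProj) ∘L v' :=
  colMap_lift hv ((x.isAdj_φ a).mul x.isAdj_even)

theorem colMap_toCycle_φneg (a : A) :
    colMap D ((x.toCycle hv hvv).φneg a) = v ∘L (x.φ a * x.oddProj) ∘L v' :=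
  colMap_lift hv ((x.isAdj_φ a).mul x.isAdj_odd)

theorem colMap_toCycle_U : colMap D (x.toCycle hv hvv).U = v ∘L (x.T * x.evenProj) ∘L v' :=
  colMap_lift hv (x.isAdj_T.mul x.isAdj_even)

end

end KasparovBimodule

end

end RealKK

namespace RealKK

noncomputable section

open Filter Topology HilbertModule

/-! ### From Fredholm cycles to Kasparov bimodules -/

theorem star_mem_range_coe {J : Type v} [RealCStarAlgebra J] {m : 𝓜(ℝ, J)}
    (hm : m ∈ Set.range (DoubleCentralizer.coe ℝ : J → 𝓜(ℝ, J))) :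
    star m ∈ Set.range (DoubleCentralizer.coe ℝ : J → 𝓜(ℝ, J)) := by
  obtain ⟨x, rfl⟩ := hm
  exact ⟨star x, map_star (DoubleCentralizer.coeHom (𝕜 := ℝ) (A := J)) x⟩

theorem neg_mem_range_coe {J : Type v} [RealCStarAlgebra J] {m : 𝓜(ℝ, J)}
    (hm : m ∈ Set.range (DoubleCentralizer.coe ℝ : J → 𝓜(ℝ, J))) :
    -m ∈ Set.range (DoubleCentralizer.coe ℝ : J → 𝓜(ℝ, J)) := by
  obtain ⟨x, rfl⟩ := hm
  exact ⟨-x, map_neg (DoubleCentralizer.coeHom (𝕜 := ℝ) (A := J)) x⟩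

namespace FredholmCycle

variable {A : Type u} [RealCStarAlgebra A]
variable {D J : Type v} [RealCStarAlgebra D] [RealCStarAlgebra J] [Stabilization D J]

local notation "ev" => (Stabilization.even (D := D) (J := J) : 𝓜(ℝ, J))
local notation "od" => (Stabilization.odd (D := D) (J := J) : 𝓜(ℝ, J))

theorem pos_mem' (x : FredholmCycle A J) (a : A) : (star x.U * x.U - 1) * x.φpos a ∈
    Set.range (DoubleCentralizer.coe ℝ : J → 𝓜(ℝ, J)) := by
  have h := star_mem_range_coe (x.pos_mem (star a))
  rwa [star_mul, star_sub, star_mul, star_star, star_one, map_star, star_star] at h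

theorem neg_mem' (x : FredholmCycle A J) (a : A) : (x.U * star x.U - 1) * x.φneg a ∈
    Set.range (DoubleCentralizer.coe ℝ : J → 𝓜(ℝ, J)) := by
  have h := star_mem_range_coe (x.neg_mem (star a))
  rwa [star_mul, star_sub, star_mul, star_star, star_one, map_star, star_star] at h

theorem intertwine_mem' (x : FredholmCycle A J) (a : A) : star x.U * x.φneg a - x.φpos a * star x.U ∈
    Set.range (DoubleCentralizer.coe ℝ : J → 𝓜(ℝ, J)) := by
  have h := star_mem_range_coe (neg_mem_range_coe (x.intertwine_mem (star a)))
  rwa [neg_sub, star_sub, star_mul, star_mul, map_star, map_star, star_star, star_star] at h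

variable (D J) in
/-- The grading on the columns. -/
def gradingOp : 𝓜(ℝ, J) :=
  star ev * ev - star od * od

variable (D) in
/-- The representation on the columns. -/
def repOp (x : FredholmCycle A J) (a : A) : 𝓜(ℝ, J) :=
  star ev * x.φpos a * ev + star od * x.φneg a * od

variable (D) in
/-- The operator on the columns. -/
def fredOp (x : FredholmCycle A J) : 𝓜(ℝ, J) :=
  star ev * star x.U * od + star od * x.U * ev

theorem star_repOp (x : FredholmCycle A J) (a : A) : star (x.repOp D a) = x.repOp D (star a) := by
  simp only [repOp, star_add, star_mul, star_star, map_star, mul_assoc]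

theorem star_fredOp (x : FredholmCycle A J) : star (x.fredOp D) = x.fredOp D := by
  simp only [fredOp, star_add, star_mul, star_star, mul_assoc]
  rw [add_comm]

theorem repOp_mul (x : FredholmCycle A J) (a b : A) :
    x.repOp D (a * b) = x.repOp D a * x.repOp D b := by
  have h := cuntzRel D J
  simp only [repOp, mul_add, add_mul, mul_assoc, map_mul, h.pp', h.qq', h.pq', h.qp', mul_zero,
    add_zero, zero_add]

theorem gradingOp_mul_repOp (x : FredholmCycle A J) (a : A) :
    gradingOp D J * x.repOp D a = x.repOp D a * gradingOp D J := by
  have h := cuntzRel D J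
  simp only [gradingOp, repOp, mul_add, add_mul, mul_sub, sub_mul, mul_assoc, h.pp', h.qq', h.pq',
    h.qp', mul_zero, add_zero, zero_add, sub_zero, zero_sub]
  abel

theorem gradingOp_mul_fredOp (x : FredholmCycle A J) :
    gradingOp D J * x.fredOp D = -(x.fredOp D * gradingOp D J) := by
  have h := cuntzRel D J
  simp only [gradingOp, fredOp, mul_add, add_mul, mul_sub, sub_mul, mul_assoc, h.pp', h.qq', h.pq',
    h.qp', mul_zero, add_zero, zero_add, sub_zero, zero_sub]
  abel

theorem gradingOp_sq : gradingOp D J * gradingOp D J = 1 := by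
  have h := cuntzRel D J
  rw [← h.sum]
  simp only [gradingOp, mul_sub, sub_mul, mul_assoc, h.pp', h.qq', h.pq', h.qp', mul_zero, sub_zero,
    zero_sub, sub_neg_eq_add]

theorem star_gradingOp : star (gradingOp D J) = gradingOp D J := by
  simp only [gradingOp, star_sub, star_mul, star_star]

/-- The square of the matrix with corners U* and U is diagonal with entries U*U and UU*. -/
theorem fredOp_sq_mul (x : FredholmCycle A J) (a : A) :
    (x.fredOp D * x.fredOp D - 1) * x.repOp D a =
      star ev * ((star x.U * x.U - 1) * x.φpos a) * ev +
        star od * ((x.U * star x.U - 1) * x.φneg a) * od := by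
  have h := cuntzRel D J
  rw [sub_mul, one_mul]
  simp only [repOp, fredOp, mul_add, add_mul, mul_sub, sub_mul, mul_assoc, one_mul, h.pp', h.qq',
    h.pq', h.qp', mul_zero, add_zero, zero_add]
  abel

theorem fredOp_commutator (x : FredholmCycle A J) (a : A) :
    x.fredOp D * x.repOp D a - x.repOp D a * x.fredOp D =
      star ev * (star x.U * x.φneg a - x.φpos a * star x.U) * od +
        star od * (x.U * x.φpos a - x.φneg a * x.U) * ev := by
  have h := cuntzRel D J
  simp only [repOp, fredOp, mul_add, add_mul, mul_sub, sub_mul, mul_assoc, h.pp', h.qq', h.pq',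
    h.qp', mul_zero, add_zero, zero_add]
  abel

variable (D J) in
theorem separableSpace_col [TopologicalSpace.SeparableSpace J] :
    TopologicalSpace.SeparableSpace (Col D J) := by
  have := UniformSpace.secondCountable_of_separable J
  exact inferInstanceAs (TopologicalSpace.SeparableSpace (colSubmodule D J))

variable (D) in
/-- The Kasparov bimodule of a Fredholm cycle. -/
def toBimodule [TopologicalSpace.SeparableSpace J] (x : FredholmCycle A J) : KasparovBimodule A D where
  E := Col D J
  countablyGenerated :=
    haveI := separableSpace_col D J
    countablyGenerated_of_separableSpace D (Col D J)
  γ := colMap D (gradingOp D J)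
  γ_sq := by rw [← colMap_mul, gradingOp_sq, colMap_one]
  γ_act e d := (isAdj_colMap _).map_act e d
  γ_inner e f := by
    rw [isAdj_colMap, star_gradingOp]
    change inner D e ((colMap D (gradingOp D J) * colMap D (gradingOp D J)) f) = _
    rw [← colMap_mul, gradingOp_sq, colMap_one]
    rfl
  φ :=
    { toFun := fun a => colMap D (x.repOp D a)
      map_smul' := fun r a => by
        change _ = r • colMap D (x.repOp D a)
        rw [← colMap_smul, repOp, repOp, map_smul, map_smul, smul_add]
        simp only [mul_smul_comm, smul_mul_assoc]
      map_zero' := by rw [repOp, map_zero, map_zero, mul_zero, zero_mul, mul_zero, zero_mul, add_zero,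
        colMap_zero]
      map_add' := fun a b => by
        rw [← colMap_add]
        congr 1
        simp only [repOp, map_add, mul_add, add_mul]
        abel
      map_mul' := fun a b => by rw [← colMap_mul, repOp_mul] }
  φ_star a := by
    change IsAdj D (colMap D (x.repOp D a)) (colMap D (x.repOp D (star a)))
    rw [← star_repOp]
    exact isAdj_colMap _
  φ_even a := congrArg (colMap D) (x.gradingOp_mul_repOp a)
  T := colMap D (x.fredOp D)
  Tadj := colMap D (x.fredOp D)
  T_adjoint := by
    have h := isAdj_colMap (D := D) (x.fredOp D)
    rwa [star_fredOp] at h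
  T_odd := congrArg (colMap D) x.gradingOp_mul_fredOp
  compact_adjoint a := by
    rw [sub_self, zero_mul]
    exact zero_mem _
  compact_square a := by
    change colMap D ((x.fredOp D * x.fredOp D - 1) * x.repOp D a) ∈ _
    refine colMap_mem_compactOperators D ?_
    rw [fredOp_sq_mul]
    exact add_mem_range_coe (coe_mul_mem _ (mul_coe_mem _ (x.pos_mem' a)))
      (coe_mul_mem _ (mul_coe_mem _ (x.neg_mem' a)))
  compact_commutator a := by
    change colMap D (x.fredOp D * x.repOp D a - x.repOp D a * x.fredOp D) ∈ _
    refine colMap_mem_compactOperators D ?_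
    rw [fredOp_commutator]
    exact add_mem_range_coe (coe_mul_mem _ (mul_coe_mem _ (x.intertwine_mem' a)))
      (coe_mul_mem _ (mul_coe_mem _ (x.intertwine_mem a)))

section

variable [TopologicalSpace.SeparableSpace J] (x : FredholmCycle A J)

theorem evenProj_toBimodule : (x.toBimodule D).evenProj = colMap D (star ev * ev) := by
  have h : (1 : Col D J →L[ℝ] Col D J) = colMap D (star ev * ev + star od * od) := by
    rw [(cuntzRel D J).sum, colMap_one]
  change (1 / 2 : ℝ) • ((1 : Col D J →L[ℝ] Col D J) + colMap D (star ev * ev - star od * od)) = _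
  rw [h, colMap_add, colMap_sub]
  module

theorem oddProj_toBimodule : (x.toBimodule D).oddProj = colMap D (star od * od) := by
  have h : (1 : Col D J →L[ℝ] Col D J) = colMap D (star ev * ev + star od * od) := by
    rw [(cuntzRel D J).sum, colMap_one]
  change (1 / 2 : ℝ) • ((1 : Col D J →L[ℝ] Col D J) - colMap D (star ev * ev - star od * od)) = _
  rw [h, colMap_add, colMap_sub]
  module

/-- The even and the odd part of the bimodule are the ranges of `star even` and `star odd`, which v
then moves into the columns. The two resulting isometries differ, which is why conjugation is
formulated for a pair. -/
theorem exists_isConj_toCycle_toBimodule {v v' : Col D J →L[ℝ] Col D J} (hv : IsAdj D v v')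
    (hvv : v' ∘L v = 1) : ∃ s r : 𝓜(ℝ, J), x.IsSupport s r ∧
      IsConj s r x ((x.toBimodule D).toCycle (v := v) (v' := v') hv hvv) := by
  have h := cuntzRel D J
  set m : 𝓜(ℝ, J) := toMultiplier hv with hm
  have hmv : colMap D m = v := colMap_toMultiplier hv
  have hmv' : colMap D (star m) = v' := (isAdj_colMap m).unique (by rw [hmv]; exact hv)
  have hmm : star m * m = 1 := multiplier_ext (D := D) (by
    rw [colMap_mul, hmv, hmv', colMap_one]
    exact hvv)
  have hs : ∀ {p : 𝓜(ℝ, J)}, p * star p = 1 → star (m * star p) * (m * star p) = 1 := fun hp => by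
    rw [star_mul, star_star, mul_assoc, ← mul_assoc (star m), hmm, one_mul, hp]
  refine ⟨m * star ev, m * star od, isSupport_of_isometry _ (hs h.pp) (hs h.qq),
    fun a => multiplier_ext (D := D) ?_, fun a => multiplier_ext (D := D) ?_,
    multiplier_ext (D := D) ?_⟩
  · refine ((x.toBimodule D).colMap_toCycle_φpos hv hvv a).trans ?_
    rw [evenProj_toBimodule]
    change v * (colMap D (x.repOp D a) * colMap D (star ev * ev)) * v' = _
    rw [← hmv, ← hmv', ← colMap_mul, ← colMap_mul, ← colMap_mul]
    congr 1
    simp only [repOp, star_mul, star_star, add_mul, mul_assoc, h.pp', h.qp', mul_zero, add_zero]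
  · refine ((x.toBimodule D).colMap_toCycle_φneg hv hvv a).trans ?_
    rw [oddProj_toBimodule]
    change v * (colMap D (x.repOp D a) * colMap D (star od * od)) * v' = _
    rw [← hmv, ← hmv', ← colMap_mul, ← colMap_mul, ← colMap_mul]
    congr 1
    simp only [repOp, star_mul, star_star, add_mul, mul_assoc, h.qq', h.pq', mul_zero, zero_add]
  · refine ((x.toBimodule D).colMap_toCycle_U hv hvv).trans ?_
    rw [evenProj_toBimodule]
    change v * (colMap D (x.fredOp D) * colMap D (star ev * ev)) * v' = _
    rw [← hmv, ← hmv', ← colMap_mul, ← colMap_mul, ← colMap_mul]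
    congr 1
    simp only [fredOp, star_mul, star_star, add_mul, mul_assoc, h.pp', h.qp', mul_zero, zero_add]

end

end FredholmCycle

/-! ### Change of the embedding, and embeddings of direct sums -/

namespace KasparovBimodule

variable {A : Type u} [RealCStarAlgebra A]

/-- The multiplier w v* conjugates one cycle into the other. It is only a partial isometry, but its
initial projection v v* acts as the identity on everything that is transported by v. -/
theorem exists_isConj_toCycle {D J : Type v} [RealCStarAlgebra D] [RealCStarAlgebra J]
    [Stabilization D J] (x : KasparovBimodule A D) {v w : x.E →L[ℝ] Col D J}
    {v' w' : Col D J →L[ℝ] x.E} (hv : IsAdj D v v') (hvv : v' ∘L v = 1) (hw : IsAdj D w w')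
    (hww : w' ∘L w = 1) : ∃ s : 𝓜(ℝ, J), (x.toCycle hv hvv).IsSupport s s ∧
      FredholmCycle.IsConj s s (x.toCycle hv hvv) (x.toCycle hw hww) := by
  set m : 𝓜(ℝ, J) := toMultiplier (hv.symm.comp hw) with hm
  have hmv : colMap D m = w ∘L v' := colMap_toMultiplier _
  have hmv' : colMap D (star m) = v ∘L w' := (isAdj_colMap m).unique (by
    rw [hmv]
    exact hv.symm.comp hw)
  have e1 : ∀ e, v' (v e) = e := fun e => congrArg (fun T : x.E →L[ℝ] x.E => T e) hvv
  have e2 : ∀ e, w' (w e) = e := fun e => congrArg (fun T : x.E →L[ℝ] x.E => T e) hww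
  refine ⟨m, ⟨fun a => multiplier_ext (D := D) ?_, fun a => multiplier_ext (D := D) ?_,
    multiplier_ext (D := D) ?_, multiplier_ext (D := D) ?_⟩, fun a => multiplier_ext (D := D) ?_,
    fun a => multiplier_ext (D := D) ?_, multiplier_ext (D := D) ?_⟩
  · rw [colMap_mul, colMap_mul, hmv, hmv', colMap_toCycle_φpos]
    refine ContinuousLinearMap.ext fun c => ?_
    change v (w' (w (v' (v (x.φ a (x.evenProj (v' c))))))) = v (x.φ a (x.evenProj (v' c)))
    rw [e1, e2]
  · rw [colMap_mul, colMap_mul, hmv, hmv', colMap_toCycle_φneg]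
    refine ContinuousLinearMap.ext fun c => ?_
    change v (w' (w (v' (v (x.φ a (x.oddProj (v' c))))))) = v (x.φ a (x.oddProj (v' c)))
    rw [e1, e2]
  · rw [colMap_mul, colMap_mul, hmv, hmv', colMap_toCycle_U]
    refine ContinuousLinearMap.ext fun c => ?_
    change v (x.T (x.evenProj (v' (v (w' (w (v' c))))))) = v (x.T (x.evenProj (v' c)))
    rw [e1, e2]
  · rw [colMap_mul, colMap_mul, hmv, hmv', colMap_toCycle_U]
    refine ContinuousLinearMap.ext fun c => ?_
    change v (w' (w (v' (v (x.T (x.evenProj (v' c))))))) = v (x.T (x.evenProj (v' c)))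
    rw [e1, e2]
  · rw [colMap_mul, colMap_mul, hmv, hmv', colMap_toCycle_φpos, colMap_toCycle_φpos]
    refine ContinuousLinearMap.ext fun c => ?_
    change w (x.φ a (x.evenProj (w' c))) = w (v' (v (x.φ a (x.evenProj (v' (v (w' c)))))))
    rw [e1, e1]
  · rw [colMap_mul, colMap_mul, hmv, hmv', colMap_toCycle_φneg, colMap_toCycle_φneg]
    refine ContinuousLinearMap.ext fun c => ?_
    change w (x.φ a (x.oddProj (w' c))) = w (v' (v (x.φ a (x.oddProj (v' (v (w' c)))))))
    rw [e1, e1]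
  · rw [colMap_mul, colMap_mul, hmv, hmv', colMap_toCycle_U, colMap_toCycle_U]
    refine ContinuousLinearMap.ext fun c => ?_
    change w (x.T (x.evenProj (w' c))) = w (v' (v (x.T (x.evenProj (v' (v (w' c)))))))
    rw [e1, e1]

section Sum

variable {B : Type v} [RealCStarAlgebra B] (x y : KasparovBimodule A B)

local notation "ev" => (Stabilization.even (D := B) (J := KTensor B) : 𝓜(ℝ, KTensor B))
local notation "od" => (Stabilization.odd (D := B) (J := KTensor B) : 𝓜(ℝ, KTensor B))

/-- The embedding of a direct sum that is given by embeddings of the summands. -/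
def sumEmbedding (v : x.E →L[ℝ] Col B (KTensor B)) (w : y.E →L[ℝ] Col B (KTensor B)) :
    (x.sum y).E →L[ℝ] Col B (KTensor B) :=
  ((colMap B (star ev) ∘L v).coprod (colMap B (star od) ∘L w)) ∘L
    (HilbertSum.equivL B x.E y.E : HilbertSum B x.E y.E →L[ℝ] x.E × y.E)

/-- The adjoint of `sumEmbedding`. -/
def sumEmbeddingAdj (v' : Col B (KTensor B) →L[ℝ] x.E) (w' : Col B (KTensor B) →L[ℝ] y.E) :
    Col B (KTensor B) →L[ℝ] (x.sum y).E :=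
  ((HilbertSum.equivL B x.E y.E).symm : x.E × y.E →L[ℝ] HilbertSum B x.E y.E) ∘L
    ((v' ∘L colMap B ev).prod (w' ∘L colMap B od))

variable {v : x.E →L[ℝ] Col B (KTensor B)} {w : y.E →L[ℝ] Col B (KTensor B)}
  {v' : Col B (KTensor B) →L[ℝ] x.E} {w' : Col B (KTensor B) →L[ℝ] y.E}

theorem isAdj_sumEmbedding (hv : IsAdj B v v') (hw : IsAdj B w w') :
    IsAdj B (sumEmbedding x y v w) (sumEmbeddingAdj x y v' w') := fun e c => by
  change inner B (colMap B (star ev) (v (HilbertSum.fst e)) +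
    colMap B (star od) (w (HilbertSum.snd e))) c = _
  rw [HilbertModule.inner_add_left, isAdj_colMap, isAdj_colMap, star_star,
    star_star, hv, hw]
  rfl

theorem sumEmbeddingAdj_comp (hvv : v' ∘L v = 1) (hww : w' ∘L w = 1) :
    sumEmbeddingAdj x y v' w' ∘L sumEmbedding x y v w = 1 := by
  refine ContinuousLinearMap.ext fun e => ?_
  refine HilbertSum.ext ?_ ?_
  · change v' (colMap B ev (colMap B (star ev) (v (HilbertSum.fst e)) +
      colMap B (star od) (w (HilbertSum.snd e)))) = HilbertSum.fst e
    rw [map_add (colMap B ev), colMap_even_star, colMap_even_star_odd, add_zero]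
    exact congrArg (fun T : x.E →L[ℝ] x.E => T (HilbertSum.fst e)) hvv
  · change w' (colMap B od (colMap B (star ev) (v (HilbertSum.fst e)) +
      colMap B (star od) (w (HilbertSum.snd e)))) = HilbertSum.snd e
    rw [map_add (colMap B od), colMap_odd_star, colMap_odd_star_even, zero_add]
    exact congrArg (fun T : y.E →L[ℝ] y.E => T (HilbertSum.snd e)) hww

/-- If one summand is embedded into the even half of the columns and the other into the odd half,
the cycle of the sum is the diagonal sum on the nose, hence the trivial conjugation. -/
theorem isConj_toCycle_sum (hv : IsAdj B v v') (hw : IsAdj B w w') (hvv : v' ∘L v = 1)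
    (hww : w' ∘L w = 1) : FredholmCycle.IsConj 1 1
      ((x.toCycle hv hvv).sum (y.toCycle hw hww))
      ((x.sum y).toCycle (isAdj_sumEmbedding x y hv hw) (sumEmbeddingAdj_comp x y hvv hww)) := by
  have key : ∀ {m n k : 𝓜(ℝ, KTensor B)} {S : x.E →L[ℝ] x.E} {T : y.E →L[ℝ] y.E},
      colMap B m = v ∘L S ∘L v' → colMap B n = w ∘L T ∘L w' → colMap B k =
        sumEmbedding x y v w ∘L (HilbertSum.diag B S T) ∘L sumEmbeddingAdj x y v' w' →
      k = 1 * cornerSum m n * star 1 := fun {m n k S T} hm hn hk => by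
    rw [star_one, mul_one, one_mul, FredholmCycle.cornerSum_eq]
    refine multiplier_ext (D := B) ?_
    rw [hk, colMap_add, colMap_mul, colMap_mul, colMap_mul, colMap_mul, hm, hn]
    rfl
  refine ⟨fun a => ?_, fun a => ?_, ?_⟩
  · exact key (colMap_toCycle_φpos _ hv hvv a) (colMap_toCycle_φpos _ hw hww a)
      (colMap_toCycle_φpos _ _ _ a)
  · exact key (colMap_toCycle_φneg _ hv hvv a) (colMap_toCycle_φneg _ hw hww a)
      (colMap_toCycle_φneg _ _ _ a)
  · exact key (colMap_toCycle_U _ hv hvv) (colMap_toCycle_U _ hw hww)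
      (colMap_toCycle_U _ _ _)

end Sum

end KasparovBimodule

end

end RealKK

namespace RealKK

noncomputable section

open Filter Topology HilbertModule

/-! ### Push-forwards -/

section ActTensor

variable {B : Type v} [RealCStarAlgebra B] {V F : Type*} [AddCommGroup V] [Module ℝ V]
  [NormedAddCommGroup F] [NormedSpace ℝ F] [HilbertModule B F]

variable (B) in
/-- The linear map `e ⊗ b ↦ L e · b`. -/
def actTensor (L : V →ₗ[ℝ] F) : V ⊗[ℝ] B →ₗ[ℝ] F :=
  TensorProduct.lift ((ContinuousLinearMap.coeLM ℝ) ∘ₗ (actL B F : F →ₗ[ℝ] B →L[ℝ] F) ∘ₗ L)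

theorem actTensor_tmul (L : V →ₗ[ℝ] F) (e : V) (b : B) :
    actTensor B L (e ⊗ₜ b) = act (L e) b := rfl

theorem denseRange_actTensor [CompleteSpace F] {L : V →ₗ[ℝ] F} (hL : DenseRange L) :
    DenseRange (actTensor B L) := by
  have h : ∀ e, L e ∈ closure (Set.range (actTensor B L)) := fun e => by
    refine closure_mono ?_ (mem_closure_range_act B (L e))
    rintro _ ⟨b, rfl⟩
    exact ⟨e ⊗ₜ b, actTensor_tmul L e b⟩
  refine fun x => isClosed_closure.closure_subset (closure_mono ?_ (hL x))
  rintro _ ⟨e, rfl⟩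
  exact h e

end ActTensor

namespace KasparovBimodule

variable {A : Type u} [RealCStarAlgebra A] {B B' : Type v} [RealCStarAlgebra B]
  [RealCStarAlgebra B']

/-- The tensor product is realized by e ⊗ b ↦ L e · b. Its range is dense because L e lies in the
closure of L e · B'. -/
theorem isPushforward_of_map {β : B →⋆ₙₐ[ℝ] B'} {x : KasparovBimodule A B}
    {y : KasparovBimodule A B'} (L : x.E →ₗ[ℝ] y.E) (hL : DenseRange L)
    (hi : ∀ e f, inner B' (L e) (L f) = β (inner B e f)) (hγ : ∀ e, y.γ (L e) = L (x.γ e))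
    (hφ : ∀ a e, y.φ a (L e) = L (x.φ a e)) (hT : ∀ e, y.T (L e) = L (x.T e)) :
    IsPushforward β x y := by
  refine ⟨actTensor B' L, denseRange_actTensor hL, fun e b c => act_mul _ _ _,
    fun e f b c => ?_, fun e b => ?_, fun a e b => ?_, fun e b => ?_⟩
  · rw [actTensor_tmul, actTensor_tmul, HilbertModule.inner_act_left,
      HilbertModule.inner_act_right, hi, mul_assoc]
  · rw [actTensor_tmul, actTensor_tmul, y.γ_act, hγ]
  · rw [actTensor_tmul, actTensor_tmul, (isAdj_φ y a).map_act, hφ]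
  · rw [actTensor_tmul, actTensor_tmul, (isAdj_T y).map_act, hT]

theorem UnitarilyEquivalent.refl (x : KasparovBimodule A B) : UnitarilyEquivalent x x :=
  ⟨LinearEquiv.refl ℝ x.E, fun _ _ => rfl, fun _ => rfl, fun _ _ => rfl, fun _ => rfl⟩

end KasparovBimodule

/-! ### Modules of paths -/

section Path

variable {B : Type v} [RealCStarAlgebra B] {F : Type w} [NormedAddCommGroup F] [NormedSpace ℝ F]
  [HilbertModule B F] {P : F →L[ℝ] F}

/-- The paths in `F` that begin in the range of the projection `P`. -/
def pathSubmodule (P : F →L[ℝ] F) : Submodule ℝ C(unitInterval, F) :=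
  LinearMap.ker ((((P - 1) ∘L ContinuousMap.evalCLM ℝ 0 : C(unitInterval, F) →L[ℝ] F) :
    C(unitInterval, F) →ₗ[ℝ] F))

theorem mem_pathSubmodule {f : C(unitInterval, F)} : f ∈ pathSubmodule P ↔ P (f 0) = f 0 :=
  sub_eq_zero

theorem isClosed_pathSubmodule : IsClosed (pathSubmodule P : Set C(unitInterval, F)) :=
  ContinuousLinearMap.isClosed_ker ((P - 1) ∘L ContinuousMap.evalCLM ℝ 0)

/-- The Hilbert `C([0, 1], B)`-module of the paths in `F` that begin in the range of `P`. -/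
def PathModule (_ : IsAdj B P P) : Type w := pathSubmodule P

namespace PathModule

variable (hP : IsAdj B P P)

instance : NormedAddCommGroup (PathModule hP) :=
  inferInstanceAs (NormedAddCommGroup (pathSubmodule P))

instance : NormedSpace ℝ (PathModule hP) := inferInstanceAs (NormedSpace ℝ (pathSubmodule P))

instance [CompleteSpace F] : CompleteSpace (PathModule hP) :=
  isClosed_pathSubmodule.completeSpace_coe

/-- The path of an element of `PathModule`. -/
def incl : PathModule hP →L[ℝ] C(unitInterval, F) := (pathSubmodule P).subtypeL

variable {hP}

theorem ext {f g : PathModule hP} (h : ∀ t, incl hP f t = incl hP g t) : f = g :=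
  Subtype.ext (ContinuousMap.ext h)

theorem incl_zero_mem (f : PathModule hP) : P (incl hP f 0) = incl hP f 0 :=
  mem_pathSubmodule.1 f.2

theorem norm_incl (f : PathModule hP) : ‖incl hP f‖ = ‖f‖ := rfl

variable (hP) in
/-- A path that begins in the range of `P`, as an element of `PathModule`. -/
def mk (f : C(unitInterval, F)) (hf : P (f 0) = f 0) : PathModule hP := ⟨f, mem_pathSubmodule.2 hf⟩

instance : HilbertModule C(unitInterval, B) (PathModule hP) where
  inner f g := ⟨fun t => inner B (incl hP f t) (incl hP g t),
    continuous_inner.comp ((incl hP f).continuous.prodMk (incl hP g).continuous)⟩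
  act f b := mk hP ⟨fun t => act (incl hP f t) (b t),
    continuous_act.comp ((incl hP f).continuous.prodMk b.continuous)⟩ (by
      change P (act _ _) = act _ _
      rw [hP.map_act, incl_zero_mem])
  add_act _ _ _ := ext fun _ => add_act _ _ _
  act_add _ _ _ := ext fun _ => act_add _ _ _
  smul_act _ _ _ := ext fun _ => smul_act _ _ _
  act_smul _ _ _ := ext fun _ => act_smul _ _ _
  act_mul _ _ _ := ext fun _ => act_mul _ _ _
  inner_add_right _ _ _ := ContinuousMap.ext fun _ => HilbertModule.inner_add_right _ _ _
  inner_smul_right _ _ _ := ContinuousMap.ext fun _ => HilbertModule.inner_smul_right _ _ _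
  inner_act_right _ _ _ := ContinuousMap.ext fun _ => HilbertModule.inner_act_right _ _ _
  star_inner _ _ := ContinuousMap.ext fun _ => HilbertModule.star_inner _ _
  inner_self_mem f := mem_posCone_of_forall fun _ => HilbertModule.inner_self_mem _
  norm_sq f := by
    rw [← norm_incl]
    refine le_antisymm ?_ ?_
    · refine Real.le_sqrt (norm_nonneg _) (norm_nonneg _) |>.1 ?_
      refine (ContinuousMap.norm_le _ (Real.sqrt_nonneg _)).2 fun t => ?_
      refine Real.le_sqrt_of_sq_le ?_
      rw [HilbertModule.norm_sq (B := B)]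
      exact ContinuousMap.norm_coe_le_norm (⟨fun t => inner B (incl hP f t) (incl hP f t),
        continuous_inner.comp ((incl hP f).continuous.prodMk (incl hP f).continuous)⟩ :
          C(unitInterval, B)) t
    · refine (ContinuousMap.norm_le _ (by positivity)).2 fun t => ?_
      change ‖inner B (incl hP f t) (incl hP f t)‖ ≤ _
      rw [← HilbertModule.norm_sq (B := B)]
      gcongr
      exact ContinuousMap.norm_coe_le_norm _ t

theorem separableSpace [TopologicalSpace.SeparableSpace F] :
    TopologicalSpace.SeparableSpace (PathModule hP) := by
  have := UniformSpace.secondCountable_of_separable F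
  exact inferInstanceAs (TopologicalSpace.SeparableSpace (pathSubmodule P))

/-- A path of operators that respects the range of `P` acts on `PathModule`. -/
def map (X : C(unitInterval, F →L[ℝ] F)) (hX : ∀ v, P v = v → P (X 0 v) = X 0 v) :
    PathModule hP →L[ℝ] PathModule hP :=
  LinearMap.mkContinuous
    { toFun := fun f => mk hP ⟨fun t => X t (incl hP f t),
        X.continuous.clm_apply (incl hP f).continuous⟩ (hX _ (incl_zero_mem f))
      map_add' := fun f g => ext fun t => (X t).map_add (incl hP f t) (incl hP g t)
      map_smul' := fun r f => ext fun t => (X t).map_smul r (incl hP f t) } ‖X‖ fun f =>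
    (ContinuousMap.norm_le _ (by positivity)).2 fun t =>
      ((X t).le_opNorm _).trans (mul_le_mul (ContinuousMap.norm_coe_le_norm X t)
        (ContinuousMap.norm_coe_le_norm (incl hP f) t) (norm_nonneg _) (by positivity))

theorem isAdj_map {X X' : C(unitInterval, F →L[ℝ] F)} {hX : ∀ v, P v = v → P (X 0 v) = X 0 v}
    {hX' : ∀ v, P v = v → P (X' 0 v) = X' 0 v} (h : ∀ t, IsAdj B (X t) (X' t)) :
    IsAdj C(unitInterval, B) (map (hP := hP) X hX) (map X' hX') := fun _ _ =>
  ContinuousMap.ext fun t => h t _ _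

variable (hP) in
/-- The compression of a path of operators, depending linearly on the path. -/
def compression (hPP : P * P = P) :
    C(unitInterval, F →L[ℝ] F) →L[ℝ] (PathModule hP →L[ℝ] PathModule hP) :=
  LinearMap.mkContinuous
    { toFun := fun X : C(unitInterval, F →L[ℝ] F) => map (hP := hP) ⟨fun t => P * X t * P, by fun_prop⟩ fun v _ =>
        congrArg (fun T : F →L[ℝ] F => T (X 0 (P v))) hPP
      map_add' := fun X Y => ContinuousLinearMap.ext fun f => ext fun t => by
        change P ((X t + Y t) (P (incl hP f t))) =
          P (X t (P (incl hP f t))) + P (Y t (P (incl hP f t)))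
        exact P.map_add _ _
      map_smul' := fun r X => ContinuousLinearMap.ext fun f => ext fun t => by
        change P ((r • X t) (P (incl hP f t))) = r • P (X t (P (incl hP f t)))
        exact P.map_smul r _ }
    (‖P‖ * ‖P‖) fun X : C(unitInterval, F →L[ℝ] F) => ContinuousLinearMap.opNorm_le_bound _ (by positivity) fun f =>
      (ContinuousMap.norm_le _ (by positivity)).2 fun t => by
        change ‖(P * X t * P) (incl hP f t)‖ ≤ _
        refine (ContinuousLinearMap.le_opNorm _ _).trans ?_
        refine mul_le_mul ?_ (ContinuousMap.norm_coe_le_norm (incl hP f) t) (norm_nonneg _)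
          (by positivity)
        calc ‖P * X t * P‖ ≤ ‖P‖ * ‖X t‖ * ‖P‖ :=
              (norm_mul_le _ _).trans (by gcongr; exact norm_mul_le _ _)
          _ ≤ ‖P‖ * ‖X‖ * ‖P‖ := by gcongr; exact ContinuousMap.norm_coe_le_norm X t
          _ = ‖P‖ * ‖P‖ * ‖X‖ := by ring

/-- Approximation reduces this to X = g ⊗ k with k the rank one operator of ξ and η. The compression
is then the rank one operator of the path g ⊗ P ξ and the constant path P η. Without the projections
these paths would not belong to the module. -/
theorem compression_mem (hPP : P * P = P) {X : C(unitInterval, F →L[ℝ] F)}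
    (hX : ∀ t, X t ∈ compactOperators B F) :
    compression hP hPP X ∈ compactOperators C(unitInterval, B) (PathModule hP) := by
  have hW := (isClosed_compactOperators C(unitInterval, B) (PathModule hP)).preimage
    (compression hP hPP).continuous
  refine mem_of_forall_smul_const_mem (W := (compactOperators C(unitInterval, B)
    (PathModule hP)).comap (compression hP hPP).toLinearMap) hW
    fun g t => ?_
  refine map_mem_of_mem_closure (compression hP hPP ∘L smulConst g)
    (isClosed_compactOperators _ _) ?_ (hX t)
  rintro k ⟨ξ, η, hk⟩
  have hPv : ∀ v, P (P v) = P v := fun v => congrArg (fun T : F →L[ℝ] F => T v) hPP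
  have : compression hP hPP (smulConst g k) = rankOne C(unitInterval, B)
      (mk hP (smulConst g (P ξ)) (by
        change P (g 0 • P ξ) = g 0 • P ξ
        rw [map_smul, hPv]))
      (mk hP (ContinuousMap.const unitInterval (P η)) (hPv η)) := by
    refine ContinuousLinearMap.ext fun f => ext fun t => ?_
    change P (g t • k (P (incl hP f t))) = act (g t • P ξ) (inner B (P η) (incl hP f t))
    rw [map_smul, hk, hP.map_act, smul_act, hP η]
  rw [ContinuousLinearMap.comp_apply, this]
  exact rankOne_mem _ _

/-- A path of operators that lives on the range of P equals its own compression. -/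
theorem map_mem_compactOperators (hPP : P * P = P) {X : C(unitInterval, F →L[ℝ] F)}
    {hX : ∀ v, P v = v → P (X 0 v) = X 0 v} (hk : ∀ t, X t ∈ compactOperators B F)
    (hPX : ∀ t, P * X t * P = X t) :
    map X hX ∈ compactOperators C(unitInterval, B) (PathModule hP) := by
  have : map X hX = compression hP hPP X := ContinuousLinearMap.ext fun f => ext fun t =>
    (congrArg (fun T : F →L[ℝ] F => T (incl hP f t)) (hPX t)).symm
  rw [this]
  exact compression_mem hPP hk

end PathModule

end Path

end

end RealKK

namespace RealKK

noncomputable section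

open Filter Topology HilbertModule

namespace KasparovBimodule

/-! ### Homotopies on modules of paths -/

section OperatorPath

variable {A : Type u} [RealCStarAlgebra A] {B : Type v} [RealCStarAlgebra B]

/-- A path of Fredholm operators for the module and the representation of `y`, for which the
projection `P` and its complement are reducing, and that is degenerate on the complement. -/
structure IsOperatorPath (y : KasparovBimodule A B) (P : y.E →L[ℝ] y.E)
    (X X' : C(unitInterval, y.E →L[ℝ] y.E)) : Prop where
  adj_P : IsAdj B P P
  P_mul : P * P = P
  γ_mul : y.γ * P = P * y.γ
  φ_mul (a : A) : y.φ a * P = P * y.φ a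
  adj (t : unitInterval) : IsAdj B (X t) (X' t)
  odd (t : unitInterval) : y.γ * X t = -(X t * y.γ)
  X_mul (t : unitInterval) : X t * P = P * X t
  compact_adjoint (t : unitInterval) (a : A) : (X t - X' t) * y.φ a ∈ compactOperators B y.E
  compact_square (t : unitInterval) (a : A) : (X t * X t - 1) * y.φ a ∈ compactOperators B y.E
  compact_commutator (t : unitInterval) (a : A) :
    X t * y.φ a - y.φ a * X t ∈ compactOperators B y.E
  adjoint_mul (t : unitInterval) (a : A) : (X t - X' t) * y.φ a * P = (X t - X' t) * y.φ a
  square_mul (t : unitInterval) (a : A) : (X t * X t - 1) * y.φ a * P = (X t * X t - 1) * y.φ a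
  commutator_mul (t : unitInterval) (a : A) :
    (X t * y.φ a - y.φ a * X t) * P = X t * y.φ a - y.φ a * X t

namespace IsOperatorPath

variable {y : KasparovBimodule A B} {P : y.E →L[ℝ] y.E}
  {X X' : C(unitInterval, y.E →L[ℝ] y.E)}

theorem apply_mem {T : y.E →L[ℝ] y.E} (hT : T * P = P * T) (v : y.E) (hv : P v = v) :
    P (T v) = T v := by
  have : T (P v) = P (T v) := congrArg (fun S : y.E →L[ℝ] y.E => S v) hT
  rw [← this, hv]

theorem X'_mul (h : IsOperatorPath y P X X') (t : unitInterval) : X' t * P = P * X' t :=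
  ((h.adj_P.mul (h.adj t)).unique (by rw [← h.X_mul]; exact (h.adj t).mul h.adj_P)).symm ▸ rfl

theorem compress {k : y.E →L[ℝ] y.E} (hk : k * P = k) (hc : k * P = P * k) :
    P * k * P = k := by
  rw [mul_assoc, hk, ← hc, hk]

theorem sub_mul_comm {S T : y.E →L[ℝ] y.E} (hS : S * P = P * S) (hT : T * P = P * T) :
    (S - T) * P = P * (S - T) := by
  rw [sub_mul, mul_sub, hS, hT]

theorem mul_mul_comm {S T : y.E →L[ℝ] y.E} (hS : S * P = P * S) (hT : T * P = P * T) :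
    S * T * P = P * (S * T) := by
  rw [mul_assoc, hT, ← mul_assoc, hS, mul_assoc]

variable [TopologicalSpace.SeparableSpace B]

/-- The Kasparov bimodule over `C([0, 1], B)` of a path of operators. -/
def toBimodule (h : IsOperatorPath y P X X') : KasparovBimodule A C(unitInterval, B) where
  E := PathModule h.adj_P
  countablyGenerated :=
    have := y.countablyGenerated.separableSpace
    have := PathModule.separableSpace (hP := h.adj_P)
    countablyGenerated_of_separableSpace _ _
  γ := PathModule.map (.const _ y.γ) (apply_mem h.γ_mul)
  γ_sq := ContinuousLinearMap.ext fun f => PathModule.ext fun t =>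
    congrArg (fun T : y.E →L[ℝ] y.E => T (PathModule.incl h.adj_P f t)) y.γ_sq
  γ_act f b := PathModule.ext fun t => y.γ_act _ _
  γ_inner f g := ContinuousMap.ext fun t => y.γ_inner _ _
  φ :=
    { toFun := fun a => PathModule.map (.const _ (y.φ a)) (apply_mem (h.φ_mul a))
      map_smul' := fun r a => ContinuousLinearMap.ext fun f => PathModule.ext fun t =>
        congrArg (fun T : y.E →L[ℝ] y.E => T (PathModule.incl h.adj_P f t)) (map_smul y.φ r a)
      map_zero' := ContinuousLinearMap.ext fun f => PathModule.ext fun t =>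
        congrArg (fun T : y.E →L[ℝ] y.E => T (PathModule.incl h.adj_P f t)) (map_zero y.φ)
      map_add' := fun a b => ContinuousLinearMap.ext fun f => PathModule.ext fun t =>
        congrArg (fun T : y.E →L[ℝ] y.E => T (PathModule.incl h.adj_P f t)) (map_add y.φ a b)
      map_mul' := fun a b => ContinuousLinearMap.ext fun f => PathModule.ext fun t =>
        congrArg (fun T : y.E →L[ℝ] y.E => T (PathModule.incl h.adj_P f t)) (map_mul y.φ a b) }
  φ_star a := PathModule.isAdj_map (hX := apply_mem (h.φ_mul a))
    (hX' := apply_mem (h.φ_mul (star a))) fun _ => y.φ_star a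
  φ_even a := ContinuousLinearMap.ext fun f => PathModule.ext fun t =>
    congrArg (fun T : y.E →L[ℝ] y.E => T (PathModule.incl h.adj_P f t)) (y.φ_even a)
  T := PathModule.map X (apply_mem (h.X_mul 0))
  Tadj := PathModule.map X' (apply_mem (h.X'_mul 0))
  T_adjoint := PathModule.isAdj_map h.adj
  T_odd := ContinuousLinearMap.ext fun f => PathModule.ext fun t =>
    congrArg (fun T : y.E →L[ℝ] y.E => T (PathModule.incl h.adj_P f t)) (h.odd t)
  compact_adjoint a := PathModule.map_mem_compactOperators (hP := h.adj_P)
    (X := ⟨fun t => (X t - X' t) * y.φ a, by fun_prop⟩)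
    (hX := apply_mem (mul_mul_comm (sub_mul_comm (h.X_mul 0) (h.X'_mul 0)) (h.φ_mul a)))
    h.P_mul (fun t => h.compact_adjoint t a) (fun t => compress (h.adjoint_mul t a)
      (mul_mul_comm (sub_mul_comm (h.X_mul t) (h.X'_mul t)) (h.φ_mul a)))
  compact_square a := PathModule.map_mem_compactOperators (hP := h.adj_P)
    (X := ⟨fun t => (X t * X t - 1) * y.φ a, by fun_prop⟩)
    (hX := apply_mem (mul_mul_comm (sub_mul_comm (mul_mul_comm (h.X_mul 0) (h.X_mul 0))
      (by rw [one_mul, mul_one])) (h.φ_mul a)))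
    h.P_mul (fun t => h.compact_square t a) (fun t => compress (h.square_mul t a)
      (mul_mul_comm (sub_mul_comm (mul_mul_comm (h.X_mul t) (h.X_mul t))
      (by rw [one_mul, mul_one])) (h.φ_mul a)))
  compact_commutator a := PathModule.map_mem_compactOperators (hP := h.adj_P)
    (X := ⟨fun t => X t * y.φ a - y.φ a * X t, by fun_prop⟩)
    (hX := apply_mem (sub_mul_comm (mul_mul_comm (h.X_mul 0) (h.φ_mul a))
      (mul_mul_comm (h.φ_mul a) (h.X_mul 0))))
    h.P_mul (fun t => h.compact_commutator t a) (fun t => compress (h.commutator_mul t a)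
      (sub_mul_comm (mul_mul_comm (h.X_mul t) (h.φ_mul a)) (mul_mul_comm (h.φ_mul a) (h.X_mul t))))

/-- The fibre at 0 of the module of paths is the range of P, a copy of the module of x, and the
fibre at 1 is the whole module of y. The complement of P is thus switched on along the path, which
is admissible because nothing on it has to be compensated by compact operators. -/
theorem homotopic (h : IsOperatorPath y P X X') {x : KasparovBimodule A B} {w : x.E →L[ℝ] y.E}
    {w' : y.E →L[ℝ] x.E} (hw : IsAdj B w w') (hww : w' ∘L w = 1) (hwP : w ∘L w' = P)
    (hγ : y.γ ∘L w = w ∘L x.γ) (hφ : ∀ a, y.φ a ∘L w = w ∘L x.φ a) (h0 : X 0 ∘L w = w ∘L x.T)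
    (h1 : X 1 = y.T) : Homotopic x y := by
  refine ⟨h.toBimodule, x, y, ?_, .refl x, ?_, .refl y⟩
  -- Whatever w intertwines is intertwined by its adjoint on the range of P, where w w* is the
  -- identity.
  · have key : ∀ {S : x.E →L[ℝ] x.E} {T : y.E →L[ℝ] y.E}, T ∘L w = w ∘L S → ∀ f : y.E,
        P f = f → S (w' f) = w' (T f) := fun {S T} hST f hf => by
      have e1 : w (w' f) = f := (congrArg (fun T : y.E →L[ℝ] y.E => T f) hwP).trans hf
      have e2 : T (w (w' f)) = w (S (w' f)) :=
        congrArg (fun T : x.E →L[ℝ] y.E => T (w' f)) hST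
      have e3 : w' (w (S (w' f))) = S (w' f) :=
        congrArg (fun T : x.E →L[ℝ] x.E => T (S (w' f))) hww
      rw [e1] at e2
      rw [e2, e3]
    refine isPushforward_of_map (x := h.toBimodule) ((w' ∘L ContinuousMap.evalCLM ℝ 0 ∘L
      PathModule.incl h.adj_P : PathModule h.adj_P →L[ℝ] x.E) : PathModule h.adj_P →ₗ[ℝ] x.E)
      ?_ (fun f g => ?_) (fun f => key hγ _ (PathModule.incl_zero_mem (hP := h.adj_P) f))
      (fun a f => key (hφ a) _ (PathModule.incl_zero_mem (hP := h.adj_P) f))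
      (fun f => key h0 _ (PathModule.incl_zero_mem (hP := h.adj_P) f))
    · refine Function.Surjective.denseRange fun e => ?_
      have e1 : w' (w e) = e := congrArg (fun T : x.E →L[ℝ] x.E => T e) hww
      refine ⟨PathModule.mk h.adj_P (.const _ (w e)) ?_, e1⟩
      change P (w e) = w e
      rw [← hwP]
      exact congrArg w e1
    · change inner B (w' (PathModule.incl h.adj_P f 0)) (w' (PathModule.incl h.adj_P g 0)) =
        inner B (PathModule.incl h.adj_P f 0) (PathModule.incl h.adj_P g 0)
      rw [hw.symm]
      exact congrArg _ ((congrArg (fun T : y.E →L[ℝ] y.E => T (PathModule.incl h.adj_P g 0))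
        hwP).trans (PathModule.incl_zero_mem g))
  · refine isPushforward_of_map (x := h.toBimodule) ((ContinuousMap.evalCLM ℝ 1 ∘L
      PathModule.incl h.adj_P : PathModule h.adj_P →L[ℝ] y.E) : PathModule h.adj_P →ₗ[ℝ] y.E)
      ?_ (fun f g => rfl) (fun f => rfl) (fun a f => rfl) fun f => ?_
    · refine Function.Surjective.denseRange fun e => ?_
      -- A path that starts at zero satisfies the initial condition and may end at any vector.
      refine ⟨PathModule.mk h.adj_P ⟨fun t => (t : ℝ) • e, by fun_prop⟩ ?_, ?_⟩
      · change P ((0 : ℝ) • e) = (0 : ℝ) • e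
        rw [zero_smul, map_zero]
      · exact one_smul ℝ e
    · rw [← h1]
      rfl

end IsOperatorPath

end OperatorPath

end KasparovBimodule

end

end RealKK

namespace RealKK

noncomputable section

open Filter Topology HilbertModule

/-! ### Compact perturbations -/

namespace KasparovBimodule

section Perturbation

variable {A : Type u} [RealCStarAlgebra A] {B : Type v} [RealCStarAlgebra B]

section Compact

variable (y : KasparovBimodule A B) {D D' : y.E →L[ℝ] y.E}

theorem perturb_adjoint_compact (hD : ∀ a, D * y.φ a ∈ compactOperators B y.E)
    (hD' : ∀ a, D' * y.φ a ∈ compactOperators B y.E) (s : ℝ) (a : A) :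
    (y.T + s • D - (y.Tadj + s • D')) * y.φ a ∈ compactOperators B y.E := by
  have : (y.T + s • D - (y.Tadj + s • D')) * y.φ a =
      (y.T - y.Tadj) * y.φ a + s • (D * y.φ a - D' * y.φ a) := by
    simp only [sub_mul, add_mul, smul_mul_assoc]
    module
  rw [this]
  exact add_mem (y.compact_adjoint a) (Submodule.smul_mem _ _ (sub_mem (hD a) (hD' a)))

/-- The only term of the expansion that is not compact at sight is D T φ a; it equals D [T, φ a] + D
φ a T. -/
theorem perturb_square_compact (h : IsAdj B D D') (hD : ∀ a, D * y.φ a ∈ compactOperators B y.E)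
    (s : ℝ) (a : A) :
    ((y.T + s • D) * (y.T + s • D) - 1) * y.φ a ∈ compactOperators B y.E := by
  have : ((y.T + s • D) * (y.T + s • D) - 1) * y.φ a = (y.T * y.T - 1) * y.φ a +
      s • (y.T * (D * y.φ a) + D * (y.T * y.φ a - y.φ a * y.T) + D * y.φ a * y.T) +
        (s * s) • (D * (D * y.φ a)) := by
    simp only [sub_mul, add_mul, mul_sub, mul_add, smul_mul_assoc, mul_smul_comm, one_mul, mul_assoc]
    module
  rw [this]
  exact add_mem (add_mem (y.compact_square a) (Submodule.smul_mem _ _ (add_mem (add_mem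
    (mul_mem_compactOperators y.isAdj_T (hD a))
    (mul_mem_compactOperators h (y.compact_commutator a)))
    (mem_compactOperators_mul y.isAdj_T (hD a)))))
    (Submodule.smul_mem _ _ (mul_mem_compactOperators h (hD a)))

theorem perturb_commutator_compact (h : IsAdj B D D')
    (hD : ∀ a, D * y.φ a ∈ compactOperators B y.E)
    (hD' : ∀ a, D' * y.φ a ∈ compactOperators B y.E) (s : ℝ) (a : A) :
    (y.T + s • D) * y.φ a - y.φ a * (y.T + s • D) ∈ compactOperators B y.E := by
  have : (y.T + s • D) * y.φ a - y.φ a * (y.T + s • D) =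
      y.T * y.φ a - y.φ a * y.T + s • (D * y.φ a - y.φ a * D) := by
    simp only [add_mul, mul_add, smul_mul_assoc, mul_smul_comm]
    module
  rw [this]
  exact add_mem (y.compact_commutator a) (Submodule.smul_mem _ _ (sub_mem (hD a)
    (y.compact_mul_φ h.symm hD' a)))

end Compact

variable [TopologicalSpace.SeparableSpace B] {x y : KasparovBimodule A B}
  {w : x.E →L[ℝ] y.E} {w' : y.E →L[ℝ] x.E} {S S' : x.E →L[ℝ] x.E}

/-- If `y` is degenerate on the complement of a copy of the module of `x`, on which its operator is a
compact perturbation of that of `x`, then `x` and `y` are homotopic. -/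
theorem homotopic_of_isometry (hw : IsAdj B w w') (hww : w' ∘L w = 1)
    (hγ : y.γ ∘L w = w ∘L x.γ) (hφ : ∀ a, y.φ a ∘L w = w ∘L x.φ a)
    (hS : IsAdj B S S') (hTw : y.T ∘L w = w ∘L S) (hwT : w' ∘L y.T = S ∘L w')
    (hadj : ∀ a, (y.T - y.Tadj) * y.φ a * (w ∘L w') = (y.T - y.Tadj) * y.φ a)
    (hsq : ∀ a, (y.T * y.T - 1) * y.φ a * (w ∘L w') = (y.T * y.T - 1) * y.φ a)
    (hcomm : ∀ a, (y.T * y.φ a - y.φ a * y.T) * (w ∘L w') = y.T * y.φ a - y.φ a * y.T)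
    (hc : ∀ a, (x.T - S) * x.φ a ∈ compactOperators B x.E)
    (hc' : ∀ a, (x.Tadj - S') * x.φ a ∈ compactOperators B x.E) : Homotopic x y := by
  have hwφ : ∀ a, w' ∘L y.φ a = x.φ a ∘L w' := fun a => by
    have h1 := (hw.comp (y.isAdj_φ (star a)))
    have h2 := (x.isAdj_φ (star a)).comp hw
    rw [hφ] at h1
    rw [star_star] at h1 h2
    exact h1.unique h2
  have hwγ : w' ∘L y.γ = x.γ ∘L w' := by
    have h1 := hw.comp y.isAdj_γ
    rw [hγ] at h1
    exact h1.unique (x.isAdj_γ.comp hw)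
  -- The isometry w intertwines S with `y.T` and the two gradings, so S inherits the oddness of
  -- `y.T`.
  have hSodd : x.γ * S = -(S * x.γ) := by
    have e1 : w ∘L (x.γ * S) = w ∘L (-(S * x.γ)) := by
      calc w ∘L (x.γ * S) = (w ∘L x.γ) ∘L S := rfl
        _ = y.γ ∘L (w ∘L S) := by rw [← hγ]; rfl
        _ = (y.γ * y.T) ∘L w := by rw [← hTw]; rfl
        _ = -(y.T ∘L (y.γ ∘L w)) := by rw [y.T_odd]; rfl
        _ = -((y.T ∘L w) ∘L x.γ) := by rw [hγ]; rfl
        _ = -(w ∘L (S * x.γ)) := by rw [hTw]; rfl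
        _ = w ∘L (-(S * x.γ)) := (ContinuousLinearMap.comp_neg _ _).symm
    have e2 := congrArg (fun T => w' ∘L T) e1
    change (w' ∘L w) ∘L (x.γ * S) = (w' ∘L w) ∘L (-(S * x.γ)) at e2
    rwa [hww] at e2
  set R := x.T - S with hR
  set D : y.E →L[ℝ] y.E := w ∘L R ∘L w' with hDdef
  set D' : y.E →L[ℝ] y.E := w ∘L (x.Tadj - S') ∘L w' with hD'def
  set P : y.E →L[ℝ] y.E := w ∘L w' with hPdef
  have hP : IsAdj B P P := hw.symm.comp hw
  have hRadj : IsAdj B R (x.Tadj - S') := x.isAdj_T.sub hS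
  have hD : IsAdj B D D' := (hw.symm.comp hRadj).comp hw
  have hDφ : ∀ a, D * y.φ a ∈ compactOperators B y.E := fun a => by
    have : D * y.φ a = w ∘L (R * x.φ a) ∘L w' := by
      change w ∘L R ∘L (w' ∘L y.φ a) = _
      rw [hwφ]; rfl
    rw [this]
    exact comp_mem_compactOperators hw hw (hc a)
  have hD'φ : ∀ a, D' * y.φ a ∈ compactOperators B y.E := fun a => by
    have : D' * y.φ a = w ∘L ((x.Tadj - S') * x.φ a) ∘L w' := by
      change w ∘L (x.Tadj - S') ∘L (w' ∘L y.φ a) = _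
      rw [hwφ]; rfl
    rw [this]
    exact comp_mem_compactOperators hw hw (hc' a)
  have hPP : P * P = P := by
    change w ∘L (w' ∘L w) ∘L w' = _
    rw [hww]; rfl
  have hDP : D * P = D := by
    change w ∘L R ∘L (w' ∘L w) ∘L w' = _
    rw [hww]; rfl
  have hD'P : D' * P = D' := by
    change w ∘L (x.Tadj - S') ∘L (w' ∘L w) ∘L w' = _
    rw [hww]; rfl
  have hPD : P * D = D := by
    change w ∘L (w' ∘L w) ∘L R ∘L w' = _
    rw [hww]; rfl
  have hφP : ∀ a, y.φ a * P = P * y.φ a := fun a => by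
    change (y.φ a ∘L w) ∘L w' = w ∘L (w' ∘L y.φ a)
    rw [hφ, hwφ]; rfl
  have hTP : y.T * P = P * y.T := by
    change (y.T ∘L w) ∘L w' = w ∘L (w' ∘L y.T)
    rw [hTw, hwT]; rfl
  have hγD : y.γ * D = -(D * y.γ) := by
    have e1 : x.γ * R = -(R * x.γ) := by
      rw [hR, mul_sub, sub_mul, x.T_odd, hSodd]
      abel
    calc y.γ * D = (y.γ ∘L w) ∘L R ∘L w' := rfl
      _ = w ∘L (x.γ * R) ∘L w' := by rw [hγ]; rfl
      _ = -(w ∘L R ∘L (x.γ ∘L w')) := by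
        rw [e1]
        exact ContinuousLinearMap.ext fun e => map_neg w _
      _ = -(D * y.γ) := by rw [← hwγ]; rfl
  -- At t = 0 the operator acts as `x.T` on the copy of x and as `y.T` on the complement. Since D =
  -- P D P, nothing changes on the complement, and the defects stay on the range of P.
  have h : IsOperatorPath y P ⟨fun t => y.T + (1 - (t : ℝ)) • D, by fun_prop⟩
      ⟨fun t => y.Tadj + (1 - (t : ℝ)) • D', by fun_prop⟩ :=
    { adj_P := hP
      P_mul := hPP
      γ_mul := by
        change (y.γ ∘L w) ∘L w' = w ∘L (w' ∘L y.γ)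
        rw [hγ, hwγ]; rfl
      φ_mul := hφP
      adj := fun t => y.isAdj_T.add (hD.smul _)
      odd := fun t => by
        change y.γ * (y.T + _ • D) = -((y.T + _ • D) * y.γ)
        rw [mul_add, add_mul, mul_smul_comm, smul_mul_assoc, y.T_odd, hγD, neg_add, smul_neg]
      X_mul := fun t => by
        change (y.T + _ • D) * P = P * (y.T + _ • D)
        rw [mul_add, add_mul, mul_smul_comm, smul_mul_assoc, hTP, hDP, hPD]
      compact_adjoint := fun t a => y.perturb_adjoint_compact hDφ hD'φ _ a
      compact_square := fun t a => y.perturb_square_compact hD hDφ _ a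
      compact_commutator := fun t a => y.perturb_commutator_compact hD hDφ hD'φ _ a
      adjoint_mul := fun t a => by
        change (y.T + (1 - (t : ℝ)) • D - (y.Tadj + (1 - (t : ℝ)) • D')) * y.φ a * P =
          (y.T + (1 - (t : ℝ)) • D - (y.Tadj + (1 - (t : ℝ)) • D')) * y.φ a
        have e : (y.T + (1 - (t : ℝ)) • D - (y.Tadj + (1 - (t : ℝ)) • D')) =
          (y.T - y.Tadj) + (1 - (t : ℝ)) • (D - D') := by module
        rw [e, add_mul, add_mul, hadj, smul_mul_assoc, smul_mul_assoc, mul_assoc _ _ P, hφP,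
          ← mul_assoc _ P, sub_mul D D' P, hDP, hD'P]
      square_mul := fun t a => by
        change ((y.T + (1 - (t : ℝ)) • D) * (y.T + (1 - (t : ℝ)) • D) - 1) * y.φ a * P =
          ((y.T + (1 - (t : ℝ)) • D) * (y.T + (1 - (t : ℝ)) • D) - 1) * y.φ a
        have e : (y.T + (1 - (t : ℝ)) • D) * (y.T + (1 - (t : ℝ)) • D) - 1 = (y.T * y.T - 1) +
            ((1 - (t : ℝ)) • (y.T * D + D * y.T) + ((1 - (t : ℝ)) * (1 - (t : ℝ))) • (D * D)) := by
          simp only [mul_add, add_mul, mul_smul_comm, smul_mul_assoc]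
          module
        have e' : ((1 - (t : ℝ)) • (y.T * D + D * y.T) +
            ((1 - (t : ℝ)) * (1 - (t : ℝ))) • (D * D)) * P = ((1 - (t : ℝ)) • (y.T * D + D * y.T) +
            ((1 - (t : ℝ)) * (1 - (t : ℝ))) • (D * D)) := by
          rw [add_mul, smul_mul_assoc, smul_mul_assoc, add_mul, mul_assoc _ _ P, mul_assoc _ _ P,
            mul_assoc _ _ P, hDP, hTP, ← mul_assoc D P, hDP]
        rw [e, add_mul, add_mul, hsq, mul_assoc _ _ P, hφP, ← mul_assoc _ P, e']
      commutator_mul := fun t a => by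
        change ((y.T + (1 - (t : ℝ)) • D) * y.φ a - y.φ a * (y.T + (1 - (t : ℝ)) • D)) * P =
          (y.T + (1 - (t : ℝ)) • D) * y.φ a - y.φ a * (y.T + (1 - (t : ℝ)) • D)
        have e : (y.T + (1 - (t : ℝ)) • D) * y.φ a - y.φ a * (y.T + (1 - (t : ℝ)) • D) =
            (y.T * y.φ a - y.φ a * y.T) + (1 - (t : ℝ)) • (D * y.φ a - y.φ a * D) := by
          simp only [mul_add, add_mul, mul_smul_comm, smul_mul_assoc]
          module
        rw [e, add_mul, hcomm, smul_mul_assoc, sub_mul, mul_assoc _ _ P, mul_assoc _ _ P, hφP, hDP,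
          ← mul_assoc D P, hDP] }
  refine h.homotopic hw hww rfl hγ hφ ?_ ?_
  · change (y.T + (1 - (0 : ℝ)) • D) ∘L w = w ∘L x.T
    rw [sub_zero, one_smul, ContinuousLinearMap.add_comp, hTw]
    change w ∘L S + w ∘L R ∘L (w' ∘L w) = _
    rw [hww, ← ContinuousLinearMap.comp_add]
    refine congrArg (fun T => w ∘L T) ?_
    change S + R = x.T
    rw [hR]
    abel
  · change y.T + (1 - (1 : ℝ)) • D = y.T
    rw [sub_self, zero_smul, add_zero]

end Perturbation

end KasparovBimodule

end

end RealKK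

namespace RealKK

noncomputable section

open Filter Topology HilbertModule

/-! ### Evaluation of columns -/

section EvalCol

variable {B J : Type v} [RealCStarAlgebra B] [RealCStarAlgebra J] [Stabilization B J]

instance separableSpace_path [TopologicalSpace.SeparableSpace J] :
    TopologicalSpace.SeparableSpace C(unitInterval, J) :=
  have := UniformSpace.secondCountable_of_separable J
  inferInstance

theorem eval_mem_colSubmodule (t : unitInterval) {f : C(unitInterval, J)}
    (hf : f ∈ colSubmodule C(unitInterval, B) C(unitInterval, J)) : f t ∈ colSubmodule B J := by
  refine map_mem_of_mem_closure (ContinuousMap.evalCLM ℝ t) (isClosed_colSubmodule B J) ?_ hf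
  rintro _ ⟨x, d, rfl⟩
  exact mul_corner_mem B J (x t) (d t)

variable (B J) in
/-- Evaluation of a path of columns. -/
def evalCol (t : unitInterval) : Col C(unitInterval, B) C(unitInterval, J) →L[ℝ] Col B J :=
  ContinuousLinearMap.codRestrict (ContinuousMap.evalCLM ℝ t ∘L Col.incl C(unitInterval, B)
    C(unitInterval, J)) (colSubmodule B J) fun x => eval_mem_colSubmodule t x.2

theorem inner_evalCol (t : unitInterval) (f g : Col C(unitInterval, B) C(unitInterval, J)) :
    inner B (evalCol B J t f) (evalCol B J t g) = (inner C(unitInterval, B) f g) t :=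
  eq_of_corner_eq (J := J) ((corner_inner _ _).trans
    (congrArg (fun h : C(unitInterval, J) => h t) (corner_inner f g)).symm)

theorem evalCol_colMap (t : unitInterval) (m : 𝓜(ℝ, C(unitInterval, J)))
    (f : Col C(unitInterval, B) C(unitInterval, J)) :
    evalCol B J t (colMap C(unitInterval, B) m f) = colMap B (multiplierEval t m) (evalCol B J t f) :=
  Subtype.ext (multiplierEval_fst t m (Col.incl C(unitInterval, B) C(unitInterval, J) f)).symm

/-- Every column is the value of the constant path at it; that this path is a column over C([0, 1],
B) is checked on generators. -/
theorem surjective_evalCol (t : unitInterval) : Function.Surjective (evalCol B J t) := fun c => by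
  have h : smulConst 1 (c : J) ∈ colSubmodule C(unitInterval, B) C(unitInterval, J) := by
    refine map_mem_of_mem_closure (smulConst 1)
      (isClosed_colSubmodule C(unitInterval, B) C(unitInterval, J)) ?_ c.2
    rintro _ ⟨x, d, rfl⟩
    have : smulConst 1 (x * Stabilization.corner d) = smulConst 1 x *
        Stabilization.corner (J := C(unitInterval, J)) (ContinuousMap.const unitInterval d) :=
      ContinuousMap.ext fun s => (smul_mul_assoc (1 : ℝ) x _).symm
    rw [this]
    exact mul_corner_mem C(unitInterval, B) C(unitInterval, J) _ _
  exact ⟨⟨_, h⟩, Subtype.ext (one_smul ℝ (c : J))⟩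

end EvalCol

/-! ### Bimodules of homotopic cycles and of degenerate summands -/

namespace FredholmCycle

variable {A : Type u} [RealCStarAlgebra A]

/-- Evaluation of columns realizes the push-forward of the module, and it carries the action of a
multiplier to that of its value at t. The generators `even` and `odd` of the path stabilization are
constant, so grading, representation and operator correspond. -/
theorem isPushforward_toBimodule {B J : Type v} [RealCStarAlgebra B] [RealCStarAlgebra J]
    [Stabilization B J] [TopologicalSpace.SeparableSpace J] {z : FredholmCycle A C(unitInterval, J)}
    {x : FredholmCycle A J} {t : unitInterval} (h : (∀ a, multiplierEval t (z.φpos a) = x.φpos a) ∧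
      (∀ a, multiplierEval t (z.φneg a) = x.φneg a) ∧ multiplierEval t z.U = x.U) :
    KasparovBimodule.IsPushforward (evalAt B t) (z.toBimodule C(unitInterval, B))
      (x.toBimodule B) := by
  have hev : multiplierEval t (Stabilization.even (D := C(unitInterval, B))
    (J := C(unitInterval, J))) = Stabilization.even (D := B) := multiplierEval_constMultiplier t _
  have hod : multiplierEval t (Stabilization.odd (D := C(unitInterval, B))
    (J := C(unitInterval, J))) = Stabilization.odd (D := B) := multiplierEval_constMultiplier t _
  have key : ∀ {m : 𝓜(ℝ, C(unitInterval, J))} {n : 𝓜(ℝ, J)}, multiplierEval t m = n →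
      ∀ f, colMap B n (evalCol B J t f) = evalCol B J t (colMap _ m f) := fun h f => by
    rw [evalCol_colMap, h]
  refine KasparovBimodule.isPushforward_of_map (x := z.toBimodule C(unitInterval, B))
    (y := x.toBimodule B) (evalCol B J t).toLinearMap (surjective_evalCol t).denseRange
    (inner_evalCol t) (key ?_) (fun a => key ?_) (key ?_)
  · simp only [gradingOp, multiplierEval_sub, multiplierEval_mul, multiplierEval_star, hev, hod]
  · simp only [repOp, multiplierEval_add, multiplierEval_mul, multiplierEval_star, hev, hod, h.1,
      h.2.1]
  · simp only [fredOp, multiplierEval_add, multiplierEval_mul, multiplierEval_star, hev, hod, h.2.2]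

theorem Homotopic.toBimodule {B J : Type v} [RealCStarAlgebra B] [RealCStarAlgebra J]
    [Stabilization B J] [TopologicalSpace.SeparableSpace J] {x y : FredholmCycle A J}
    (h : Homotopic x y) :
    KasparovBimodule.Homotopic (x.toBimodule B) (y.toBimodule B) := by
  obtain ⟨z, h0, h1⟩ := h
  exact ⟨z.toBimodule _, _, _, isPushforward_toBimodule h0, .refl _, isPushforward_toBimodule h1,
    .refl _⟩

section Degenerate

variable {B : Type v} [RealCStarAlgebra B]

local notation "ev" => (Stabilization.even (D := B) (J := KTensor B) : 𝓜(ℝ, KTensor B))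
local notation "od" => (Stabilization.odd (D := B) (J := KTensor B) : 𝓜(ℝ, KTensor B))

theorem IsDegenerate.star_eq {d : FredholmCycle A (KTensor B)} (hd : d.IsDegenerate) (a : A) :
    star d.U * d.φneg a - d.φpos a * star d.U = 0 ∧ (star d.U * d.U - 1) * d.φpos a = 0 ∧
      (d.U * star d.U - 1) * d.φneg a = 0 := by
  obtain ⟨h1, h2, h3⟩ := hd (star a)
  have h1 := congrArg Star.star h1
  have h2 := congrArg Star.star h2
  have h3 := congrArg Star.star h3
  simp only [star_sub, star_mul, star_star, map_star, star_zero, star_one] at h1 h2 h3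
  exact ⟨by rw [← neg_sub, h1, neg_zero], h2, h3⟩

/-- The isometry ω places the columns of x as the first summand in the even and in the odd half. As
the defects of d vanish, those of the sum live on the range of ω, and `homotopic_of_isometry`
applies with no perturbation at all. -/
theorem homotopic_toBimodule_sum [TopologicalSpace.SeparableSpace B] (x : FredholmCycle A (KTensor B))
    {d : FredholmCycle A (KTensor B)} (hd : d.IsDegenerate) :
    KasparovBimodule.Homotopic (x.toBimodule B) ((x.sum d).toBimodule B) := by
  have h := cuntzRel B (KTensor B)
  set ω : 𝓜(ℝ, KTensor B) := star ev * star ev * ev + star od * star ev * od with hω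
  have hωω : star ω * ω = 1 := by
    simp only [hω, star_add, star_mul, star_star, mul_add, add_mul, mul_assoc, h.pp', h.qq', h.pq',
      h.qp', mul_zero, add_zero, zero_add]
    exact h.sum
  have hpos : ∀ a, (x.sum d).φpos a = star ev * x.φpos a * ev + star od * d.φpos a * od :=
    fun a => cornerSum_eq _ _
  have hneg : ∀ a, (x.sum d).φneg a = star ev * x.φneg a * ev + star od * d.φneg a * od :=
    fun a => cornerSum_eq _ _
  have hU : (x.sum d).U = star ev * x.U * ev + star od * d.U * od := cornerSum_eq _ _
  have hT : (x.sum d).fredOp B * ω = ω * x.fredOp B := by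
    simp only [fredOp, hU, hω, star_add, star_mul, star_star, mul_add, add_mul, mul_assoc, h.pp',
      h.qq', h.pq', h.qp', mul_zero, add_zero, zero_add]
    exact add_comm _ _
  have hT' : star ω * (x.sum d).fredOp B = x.fredOp B * star ω := by
    have := congrArg Star.star hT
    rwa [star_mul, star_mul, star_fredOp, star_fredOp] at this
  have hγ : gradingOp B (KTensor B) * ω = ω * gradingOp B (KTensor B) := by
    simp only [gradingOp, hω, mul_add, add_mul, sub_mul, mul_sub, mul_assoc, h.pp', h.qq', h.pq',
      h.qp', mul_zero, add_zero, zero_add, sub_zero, zero_sub]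
    abel
  have hφ : ∀ a, (x.sum d).repOp B a * ω = ω * x.repOp B a := fun a => by
    simp only [repOp, hpos, hneg, hω, mul_add, add_mul, mul_assoc, h.pp',
      h.qq', h.pq', h.qp', mul_zero, add_zero, zero_add]
  have hsq : ∀ a, ((x.sum d).fredOp B * (x.sum d).fredOp B - 1) * (x.sum d).repOp B a *
      (ω * star ω) = ((x.sum d).fredOp B * (x.sum d).fredOp B - 1) * (x.sum d).repOp B a :=
    fun a => by
      rw [fredOp_sq_mul, sum_U, sum_φpos, sum_φneg, cornerSum_star, cornerSum_mul, cornerSum_mul,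
        ← cornerSum_one, ← cornerSum_sub, ← cornerSum_sub, cornerSum_mul, cornerSum_mul,
        (hd.star_eq a).2.1, (hd.star_eq a).2.2, cornerSum_eq, cornerSum_eq]
      generalize (star x.U * x.U - 1) * x.φpos a = k
      generalize (x.U * star x.U - 1) * x.φneg a = l
      simp only [hω, star_add, star_mul, star_star, mul_add, add_mul, mul_assoc, h.pp',
        h.qq', h.pq', h.qp', mul_zero, zero_mul, add_zero, zero_add]
  have hcomm : ∀ a, ((x.sum d).fredOp B * (x.sum d).repOp B a -
      (x.sum d).repOp B a * (x.sum d).fredOp B) * (ω * star ω) =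
      (x.sum d).fredOp B * (x.sum d).repOp B a - (x.sum d).repOp B a * (x.sum d).fredOp B :=
    fun a => by
      rw [fredOp_commutator, sum_U, sum_φpos, sum_φneg, cornerSum_star, cornerSum_mul,
        cornerSum_mul, cornerSum_mul, cornerSum_mul, ← cornerSum_sub, ← cornerSum_sub,
        (hd.star_eq a).1, (hd a).1, cornerSum_eq, cornerSum_eq]
      generalize star x.U * x.φneg a - x.φpos a * star x.U = k
      generalize x.U * x.φpos a - x.φneg a * x.U = l
      simp only [hω, star_add, star_mul, star_star, mul_add, add_mul, mul_assoc, h.pp',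
        h.qq', h.pq', h.qp', mul_zero, zero_mul, add_zero, zero_add]
      exact add_comm _ _
  have hop : ∀ {m n : 𝓜(ℝ, KTensor B)}, m = n → colMap B m = colMap B n := fun h => by rw [h]
  have hsq' : ∀ a, (colMap B ((x.sum d).fredOp B) * colMap B ((x.sum d).fredOp B) - 1) *
      colMap B ((x.sum d).repOp B a) * (colMap B ω * colMap B (star ω)) =
      (colMap B ((x.sum d).fredOp B) * colMap B ((x.sum d).fredOp B) - 1) *
        colMap B ((x.sum d).repOp B a) := fun a => by
    simpa only [colMap_mul, colMap_sub, colMap_one] using hop (hsq a)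
  have hcomm' : ∀ a, (colMap B ((x.sum d).fredOp B) * colMap B ((x.sum d).repOp B a) -
      colMap B ((x.sum d).repOp B a) * colMap B ((x.sum d).fredOp B)) *
      (colMap B ω * colMap B (star ω)) =
      colMap B ((x.sum d).fredOp B) * colMap B ((x.sum d).repOp B a) -
        colMap B ((x.sum d).repOp B a) * colMap B ((x.sum d).fredOp B) := fun a => by
    simpa only [colMap_mul, colMap_sub] using hop (hcomm a)
  refine KasparovBimodule.homotopic_of_isometry (x := x.toBimodule B) (y := (x.sum d).toBimodule B)
    (w := colMap B ω) (w' := colMap B (star ω)) (S := (x.toBimodule B).T)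
    (S' := (x.toBimodule B).Tadj) (isAdj_colMap ω) (hop hωω)
    (hop hγ) (fun a => hop (hφ a))
    (x.toBimodule B).isAdj_T (hop hT) (hop hT')
    (fun a => ?_) hsq' hcomm'
    (fun a => ?_) (fun a => ?_)
  · have : ((x.sum d).toBimodule B).T - ((x.sum d).toBimodule B).Tadj = 0 := sub_self _
    rw [this, zero_mul, zero_mul]
  · rw [sub_self, zero_mul]
    exact zero_mem _
  · rw [sub_self, zero_mul]
    exact zero_mem _

end Degenerate

end FredholmCycle

end

end RealKK

namespace RealKK

noncomputable section

open Filter Topology HilbertModule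

/-! ### Cycles of homotopic bimodules -/

namespace KasparovBimodule

variable {A : Type u} [RealCStarAlgebra A]

section

variable {B B' : Type v} [RealCStarAlgebra B] [RealCStarAlgebra B'] {β : B →⋆ₙₐ[ℝ] B'}

/-- It merges the two stages in the definition of a homotopy, so that its end points are themselves
push-forwards. -/
theorem IsPushforward.of_unitarilyEquivalent {z : KasparovBimodule A B}
    {x y : KasparovBimodule A B'} (h : IsPushforward β z x) (h' : UnitarilyEquivalent x y) :
    IsPushforward β z y := by
  obtain ⟨j, hd, hact, hi, hγ, hφ, hT⟩ := h
  obtain ⟨u, ui, uγ, uφ, uT⟩ := h'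
  have hnorm : ∀ e, ‖u e‖ = ‖e‖ := fun e => by
    refine (sq_eq_sq₀ (norm_nonneg _) (norm_nonneg _)).1 ?_
    rw [HilbertModule.norm_sq (B := B'), HilbertModule.norm_sq (B := B'), ui]
  have hiso : Isometry u := AddMonoidHomClass.isometry_of_norm u hnorm
  -- A surjection that preserves inner products is linear over `B'`.
  have huact : ∀ e c, u (act e c) = act (u e) c := fun e c => ext_inner_left B' fun f => by
    obtain ⟨f, rfl⟩ := u.surjective f
    rw [ui, HilbertModule.inner_act_right, HilbertModule.inner_act_right, ui]
  refine ⟨u.toLinearMap ∘ₗ j, u.surjective.denseRange.comp hd hiso.continuous, fun e b c => ?_,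
    fun e f b c => (ui _ _).trans (hi e f b c), fun e b => ?_, fun a e b => ?_, fun e b => ?_⟩
  · exact (congrArg u (hact e b c)).trans (huact _ _)
  · exact (uγ _).symm.trans (congrArg u (hγ e b))
  · exact (uφ _ _).symm.trans (congrArg u (hφ a e b))
  · exact (uT _).symm.trans (congrArg u (hT e b))

end

section Homotopy

variable {B J : Type v} [RealCStarAlgebra B] [RealCStarAlgebra J] [Stabilization B J]

theorem isInteriorTensor_evalCol (t : unitInterval) :
    IsInteriorTensor (evalAt B t) (actTensor B (evalCol B J t).toLinearMap) where
  denseRange := denseRange_actTensor (surjective_evalCol t).denseRange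
  inner_tmul e f b c := by
    rw [actTensor_tmul, actTensor_tmul, HilbertModule.inner_act_left,
      HilbertModule.inner_act_right]
    exact (mul_assoc _ _ _).symm.trans
      (congrArg (fun d => star b * d * c) (inner_evalCol t e f))

variable {z : KasparovBimodule A C(unitInterval, B)} {x : KasparovBimodule A B} {t : unitInterval}
  {V : z.E →L[ℝ] Col C(unitInterval, B) C(unitInterval, J)}
  {V' : Col C(unitInterval, B) C(unitInterval, J) →L[ℝ] z.E}

/-- The cycle of a push-forward is the evaluation of the cycle of a path. -/
theorem IsPushforward.exists_toCycle (h : IsPushforward (evalAt B t) z x)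
    (hV : IsAdj C(unitInterval, B) V V') (hVV : V' ∘L V = 1) :
    ∃ (v : x.E →L[ℝ] Col B J) (v' : Col B J →L[ℝ] x.E) (hv : IsAdj B v v') (hvv : v' ∘L v = 1),
      (∀ a, multiplierEval t ((z.toCycle hV hVV).φpos a) = (x.toCycle hv hvv).φpos a) ∧
      (∀ a, multiplierEval t ((z.toCycle hV hVV).φneg a) = (x.toCycle hv hvv).φneg a) ∧
      multiplierEval t (z.toCycle hV hVV).U = (x.toCycle hv hvv).U := by
  obtain ⟨j, hd, hact, hi, hγ, hφ, hT⟩ := h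
  have hj : IsInteriorTensor (evalAt B t) j := ⟨hd, hi⟩
  set j' := actTensor B (evalCol B J t).toLinearMap with hj'def
  have hj' : IsInteriorTensor (evalAt B t) j' := isInteriorTensor_evalCol t
  -- V ⊗ 1 embeds the push-forward of the module of z into that of the columns of paths, which is
  -- the module of columns of `J`.
  have hv : IsAdj B (tensorMap j j' V) (tensorMap j' j V') := hj.isAdj_tensorMap hj' hV
  have e1 : ∀ e b, tensorMap j j' V (j (e ⊗ₜ b)) = j' (V e ⊗ₜ b) := fun e b =>
    hj.tensorMap_apply hj' hV (e ⊗ₜ b)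
  have e2 : ∀ f b, tensorMap j' j V' (j' (f ⊗ₜ b)) = j (V' f ⊗ₜ b) := fun f b =>
    hj'.tensorMap_apply hj hV.symm (f ⊗ₜ b)
  have hvv : tensorMap j' j V' ∘L tensorMap j j' V = 1 := by
    refine ContinuousLinearMap.coeFn_injective (hd.equalizer (by fun_prop) (by fun_prop) ?_)
    funext ζ
    induction ζ using TensorProduct.induction_on with
    | zero => simp only [Function.comp_apply, map_zero]
    | add ζ ξ hζ hξ =>
      simp only [Function.comp_apply, map_add] at hζ hξ ⊢
      rw [hζ, hξ]
    | tmul e b =>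
      change tensorMap j' j V' (tensorMap j j' V (j (e ⊗ₜ b))) = j (e ⊗ₜ b)
      rw [e1, e2]
      exact congrArg (fun T : z.E →L[ℝ] z.E => j (T e ⊗ₜ b)) hVV
  -- An operator and its push-forward, each carried to the columns, give a multiplier of paths and
  -- its value at t; both sides are compared on the dense range of the tensor product.
  have key : ∀ {X : z.E →L[ℝ] z.E} {Y : x.E →L[ℝ] x.E} {m : 𝓜(ℝ, C(unitInterval, J))}
      {n : 𝓜(ℝ, J)}, (∀ e b, Y (j (e ⊗ₜ b)) = j (X e ⊗ₜ b)) →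
      colMap C(unitInterval, B) m = V ∘L X ∘L V' →
      colMap B n = tensorMap j j' V ∘L Y ∘L tensorMap j' j V' → multiplierEval t m = n :=
    fun {X Y m n} hXY hm hn => by
      refine multiplier_ext (D := B) ?_
      rw [hn]
      refine ContinuousLinearMap.coeFn_injective
        (hj'.denseRange.equalizer (by fun_prop) (by fun_prop) ?_)
      funext ζ
      induction ζ using TensorProduct.induction_on with
      | zero => simp only [Function.comp_apply, map_zero]
      | add ζ ξ hζ hξ =>
        simp only [Function.comp_apply, map_add] at hζ hξ ⊢
        rw [hζ, hξ]
      | tmul f b =>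
        change colMap B (multiplierEval t m) (j' (f ⊗ₜ b)) =
          tensorMap j j' V (Y (tensorMap j' j V' (j' (f ⊗ₜ b))))
        rw [e2, hXY, e1]
        change colMap B (multiplierEval t m) (act (evalCol B J t f) b) =
          act (evalCol B J t (V (X (V' f)))) b
        rw [(isAdj_colMap _).map_act, ← evalCol_colMap, hm]
        rfl
  have heven : ∀ e b, x.evenProj (j (e ⊗ₜ b)) = j (z.evenProj e ⊗ₜ b) := fun e b => by
    change (1 / 2 : ℝ) • (j (e ⊗ₜ b) + x.γ (j (e ⊗ₜ b))) =
      j (((1 / 2 : ℝ) • (e + z.γ e)) ⊗ₜ b)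
    rw [hγ, ← map_add, ← TensorProduct.add_tmul, ← map_smul, TensorProduct.smul_tmul']
  have hodd : ∀ e b, x.oddProj (j (e ⊗ₜ b)) = j (z.oddProj e ⊗ₜ b) := fun e b => by
    change (1 / 2 : ℝ) • (j (e ⊗ₜ b) - x.γ (j (e ⊗ₜ b))) =
      j (((1 / 2 : ℝ) • (e - z.γ e)) ⊗ₜ b)
    rw [hγ, ← map_sub, ← TensorProduct.sub_tmul, ← map_smul, TensorProduct.smul_tmul']
  refine ⟨_, _, hv, hvv, fun a => key (fun e b => ?_) (z.colMap_toCycle_φpos hV hVV a)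
    (x.colMap_toCycle_φpos hv hvv a), fun a => key (fun e b => ?_)
    (z.colMap_toCycle_φneg hV hVV a) (x.colMap_toCycle_φneg hv hvv a), key (fun e b => ?_)
    (z.colMap_toCycle_U hV hVV) (x.colMap_toCycle_U hv hvv)⟩
  · exact (congrArg (x.φ a) (heven e b)).trans (hφ a _ b)
  · exact (congrArg (x.φ a) (hodd e b)).trans (hφ a _ b)
  · exact (congrArg x.T (heven e b)).trans (hT _ b)

variable [TopologicalSpace.SeparableSpace B]

variable (J) in
theorem exists_embedding (x : KasparovBimodule A B) :
    ∃ (v : x.E →L[ℝ] Col B J) (v' : Col B J →L[ℝ] x.E), IsAdj B v v' ∧ v' ∘L v = 1 :=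
  have := x.countablyGenerated.separableSpace
  exists_isometric_embedding B J x.E

variable (J) in
-- One embedding of the homotopy induces embeddings at both ends. These cannot be prescribed, but
-- the class of a cycle does not depend on the embedding, see `mk_toCycle_eq`.
theorem Homotopic.exists_toCycle {x y : KasparovBimodule A B} (h : Homotopic x y) :
    ∃ (v : x.E →L[ℝ] Col B J) (v' : Col B J →L[ℝ] x.E) (hv : IsAdj B v v') (hvv : v' ∘L v = 1)
      (w : y.E →L[ℝ] Col B J) (w' : Col B J →L[ℝ] y.E) (hw : IsAdj B w w') (hww : w' ∘L w = 1),
      FredholmCycle.Homotopic (x.toCycle hv hvv) (y.toCycle hw hww) := by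
  obtain ⟨z, x', y', hx, hx', hy, hy'⟩ := h
  obtain ⟨V, V', hV, hVV⟩ := z.exists_embedding C(unitInterval, J)
  obtain ⟨v, v', hv, hvv, h0⟩ := (hx.of_unitarilyEquivalent hx').exists_toCycle hV hVV
  obtain ⟨w, w', hw, hww, h1⟩ := (hy.of_unitarilyEquivalent hy').exists_toCycle hV hVV
  exact ⟨v, v', hv, hvv, w, w', hw, hww, z.toCycle hV hVV, h0, h1⟩

end Homotopy

end KasparovBimodule

end

end RealKK

namespace RealKK

noncomputable section

open Filter Topology HilbertModule

open FredholmCycle (gradingOp)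

/-! ### From a bimodule to its cycle and back -/

namespace KasparovBimodule

variable {A : Type u} [RealCStarAlgebra A]

section Return

variable {D J : Type v} [RealCStarAlgebra D] [RealCStarAlgebra J] [Stabilization D J]
  [TopologicalSpace.SeparableSpace D] [TopologicalSpace.SeparableSpace J]

local notation "ev" => (Stabilization.even (D := D) (J := J) : 𝓜(ℝ, J))
local notation "od" => (Stabilization.odd (D := D) (J := J) : 𝓜(ℝ, J))

/-- The isometry w sends the even part of E to the even half of the columns and the odd part to the
odd half. The operator of the returned bimodule acts on this copy of E as the self-adjoint S that
shares with T the corner from the even to the odd part; on the complement the representation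
vanishes. So `homotopic_of_isometry` applies with the perturbation T − S. -/
theorem homotopic_toBimodule_toCycle (x : KasparovBimodule A D) {v : x.E →L[ℝ] Col D J}
    {v' : Col D J →L[ℝ] x.E} (hv : IsAdj D v v') (hvv : v' ∘L v = 1) :
    Homotopic x ((x.toCycle hv hvv).toBimodule D) := by
  have hpp := colMap_even_star D J
  have hqq := colMap_odd_star D J
  have hpq := colMap_even_star_odd D J
  have hqp := colMap_odd_star_even D J
  have happ : ∀ {S T : x.E →L[ℝ] x.E}, S = T → ∀ e, S e = T e := fun h e => by rw [h]
  have hvv' : ∀ e, v' (v e) = e := happ hvv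
  have hee : ∀ e, x.evenProj (x.evenProj e) = x.evenProj e := happ x.even_mul_even
  have hff : ∀ e, x.oddProj (x.oddProj e) = x.oddProj e := happ x.odd_mul_odd
  have hef : ∀ e, x.evenProj (x.oddProj e) = 0 := happ x.even_mul_odd
  have hfe : ∀ e, x.oddProj (x.evenProj e) = 0 := happ x.odd_mul_even
  have heφ : ∀ a e, x.evenProj (x.φ a e) = x.φ a (x.evenProj e) := fun a => happ (x.even_mul_φ a)
  have hfφ : ∀ a e, x.oddProj (x.φ a e) = x.φ a (x.oddProj e) := fun a => happ (x.odd_mul_φ a)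
  have heT : ∀ e, x.evenProj (x.T e) = x.T (x.oddProj e) := happ x.even_mul_T
  have hfT : ∀ e, x.oddProj (x.T e) = x.T (x.evenProj e) := happ x.odd_mul_T
  have heT' : ∀ e, x.evenProj (x.Tadj e) = x.Tadj (x.oddProj e) := happ x.even_mul_Tadj
  have hfT' : ∀ e, x.oddProj (x.Tadj e) = x.Tadj (x.evenProj e) := happ x.odd_mul_Tadj
  set c := x.toCycle hv hvv with hc
  have hU' : colMap D (star c.U) = v ∘L (x.evenProj * x.Tadj) ∘L v' :=
    (isAdj_colMap c.U).unique (by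
      rw [hc, x.colMap_toCycle_U hv hvv]
      exact (hv.symm.comp (x.isAdj_T.mul x.isAdj_even)).comp hv)
  have hyφ : ∀ a k, colMap D (c.repOp D a) k =
      colMap D (star ev) (v (x.φ a (x.evenProj (v' (colMap D ev k))))) +
        colMap D (star od) (v (x.φ a (x.oddProj (v' (colMap D od k))))) := fun a k => by
    change colMap D (star ev) (colMap D (c.φpos a) (colMap D ev k)) +
      colMap D (star od) (colMap D (c.φneg a) (colMap D od k)) = _
    rw [hc, x.colMap_toCycle_φpos hv hvv, x.colMap_toCycle_φneg hv hvv]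
    rfl
  have hyT : ∀ k, colMap D (c.fredOp D) k =
      colMap D (star ev) (v (x.Tadj (x.oddProj (v' (colMap D od k))))) +
        colMap D (star od) (v (x.T (x.evenProj (v' (colMap D ev k))))) := fun k => by
    change colMap D (star ev) (colMap D (star c.U) (colMap D od k)) +
      colMap D (star od) (colMap D c.U (colMap D ev k)) = _
    rw [hU', hc, x.colMap_toCycle_U hv hvv, ← heT']
    rfl
  have hyγ : ∀ k, colMap D (gradingOp D J) k = colMap D (star ev) (colMap D ev k) -
      colMap D (star od) (colMap D od k) := fun k => rfl
  set w : x.E →L[ℝ] Col D J :=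
    colMap D (star ev) ∘L v ∘L x.evenProj + colMap D (star od) ∘L v ∘L x.oddProj with hw
  set w' : Col D J →L[ℝ] x.E :=
    x.evenProj ∘L v' ∘L colMap D ev + x.oddProj ∘L v' ∘L colMap D od with hw'
  have hwapp : ∀ e, w e = colMap D (star ev) (v (x.evenProj e)) +
      colMap D (star od) (v (x.oddProj e)) := fun e => rfl
  have hw'app : ∀ k, w' k = x.evenProj (v' (colMap D ev k)) +
      x.oddProj (v' (colMap D od k)) := fun k => rfl
  set S : x.E →L[ℝ] x.E := x.evenProj * x.Tadj * x.oddProj + x.oddProj * x.T * x.evenProj with hS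
  have hSapp : ∀ e, S e = x.Tadj (x.oddProj e) + x.T (x.evenProj e) := fun e => by
    change x.evenProj (x.Tadj (x.oddProj e)) + x.oddProj (x.T (x.evenProj e)) = _
    rw [heT', hfT, hff, hee]
  have hwadj : IsAdj D w w' := by
    have h1 := isAdj_colMap (D := D) (star ev)
    have h2 := isAdj_colMap (D := D) (star od)
    rw [star_star] at h1 h2
    exact ((x.isAdj_even.comp hv).comp h1).add ((x.isAdj_odd.comp hv).comp h2)
  have hww : w' ∘L w = 1 := ContinuousLinearMap.ext fun e => by
    rw [ContinuousLinearMap.comp_apply, hwapp, hw'app]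
    simp only [map_add, hpp, hqq, hpq, hqp, hvv', hee, hff, add_zero, zero_add]
    exact happ x.even_add_odd e
  have hSadj : IsAdj D S S := by
    have h1 := (x.isAdj_even.mul x.isAdj_T.symm).mul x.isAdj_odd
    have h2 := (x.isAdj_odd.mul x.isAdj_T).mul x.isAdj_even
    have h3 := h1.add h2
    rwa [← mul_assoc, ← mul_assoc, add_comm (x.oddProj * x.T * x.evenProj)] at h3
  have hTw : colMap D (c.fredOp D) ∘L w = w ∘L S := ContinuousLinearMap.ext fun e => by
    rw [ContinuousLinearMap.comp_apply, ContinuousLinearMap.comp_apply, hyT, hwapp, hwapp, hSapp]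
    simp only [map_add, hpp, hqq, hpq, hqp, hvv', hee, hff, hef, hfe, heT, hfT, heT', hfT',
      map_zero, add_zero, zero_add]
  have hwT : w' ∘L colMap D (c.fredOp D) = S ∘L w' := ContinuousLinearMap.ext fun k => by
    rw [ContinuousLinearMap.comp_apply, ContinuousLinearMap.comp_apply, hyT, hw'app, hw'app, hSapp]
    simp only [map_add, hpp, hqq, hpq, hqp, hvv', hee, hff, hef, hfe, hfT, heT',
      add_zero, zero_add]
  -- The representation lives on the range of w, and therefore so do all defects.
  have hφP : ∀ a, colMap D (c.repOp D a) * (w ∘L w') = colMap D (c.repOp D a) := fun a =>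
    ContinuousLinearMap.ext fun k => by
      change colMap D (c.repOp D a) (w (w' k)) = colMap D (c.repOp D a) k
      rw [hyφ, hyφ, hwapp, hw'app]
      simp only [map_add, hpp, hqq, hpq, hqp, hvv', hee, hff, hef, hfe, add_zero,
        zero_add]
  have hTP : colMap D (c.fredOp D) * (w ∘L w') = (w ∘L w') * colMap D (c.fredOp D) := by
    change (colMap D (c.fredOp D) ∘L w) ∘L w' = w ∘L (w' ∘L colMap D (c.fredOp D))
    rw [hTw, hwT]
    rfl
  have hγw : colMap D (gradingOp D J) ∘L w = w ∘L x.γ := ContinuousLinearMap.ext fun e => by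
    rw [ContinuousLinearMap.comp_apply, ContinuousLinearMap.comp_apply, hyγ, hwapp, hwapp,
      ← x.even_sub_odd]
    simp only [map_add, map_sub, sub_apply, hpp, hqq, hpq, hqp, hee, hff, hef, hfe,
      add_zero, zero_add, sub_zero, zero_sub, map_neg]
    exact sub_eq_add_neg _ _
  have hφw : ∀ a, colMap D (c.repOp D a) ∘L w = w ∘L x.φ a := fun a =>
    ContinuousLinearMap.ext fun e => by
      rw [ContinuousLinearMap.comp_apply, ContinuousLinearMap.comp_apply, hyφ, hwapp, hwapp]
      simp only [map_add, hpp, hqq, hpq, hqp, hvv', hee, hff, heφ, hfφ, add_zero,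
        zero_add]
  have hcomm : ∀ a, (colMap D (c.fredOp D) * colMap D (c.repOp D a) -
      colMap D (c.repOp D a) * colMap D (c.fredOp D)) * (w ∘L w') =
      colMap D (c.fredOp D) * colMap D (c.repOp D a) -
        colMap D (c.repOp D a) * colMap D (c.fredOp D) := fun a => by
    rw [sub_mul, mul_assoc, hφP, mul_assoc, hTP, ← mul_assoc, hφP]
  have hmul : ∀ (k : Col D J →L[ℝ] Col D J) (a : A), k * colMap D (c.repOp D a) * (w ∘L w') =
      k * colMap D (c.repOp D a) := fun k a => by
    rw [mul_assoc, hφP]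
  refine homotopic_of_isometry (y := c.toBimodule D) hwadj hww hγw hφw hSadj hTw hwT
    (fun a => hmul _ a) (fun a => hmul _ a) hcomm (fun a => ?_) (fun a => ?_)
  -- T and S differ only in the corner from the odd to the even part, where S has T* in place of T.
  · have : (x.T - S) * x.φ a = x.evenProj * ((x.T - x.Tadj) * x.φ a) * x.oddProj :=
      ContinuousLinearMap.ext fun e => by
        change x.T (x.φ a e) - S (x.φ a e) =
          x.evenProj (x.T (x.φ a (x.oddProj e)) - x.Tadj (x.φ a (x.oddProj e)))
        have h1 : x.T (x.φ a e) = x.T (x.evenProj (x.φ a e)) + x.T (x.oddProj (x.φ a e)) := by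
          rw [← map_add]
          exact congrArg x.T (happ x.even_add_odd _).symm
        rw [hSapp, h1]
        simp only [map_sub, heT, heT', hfφ, hff]
        abel
    rw [this]
    exact mem_compactOperators_mul x.isAdj_odd
      (mul_mem_compactOperators x.isAdj_even (x.compact_adjoint a))
  · have : (x.Tadj - S) * x.φ a = -(x.oddProj * ((x.T - x.Tadj) * x.φ a) * x.evenProj) :=
      ContinuousLinearMap.ext fun e => by
        change x.Tadj (x.φ a e) - S (x.φ a e) =
          -(x.oddProj (x.T (x.φ a (x.evenProj e)) - x.Tadj (x.φ a (x.evenProj e))))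
        have h1 : x.Tadj (x.φ a e) = x.Tadj (x.evenProj (x.φ a e)) +
            x.Tadj (x.oddProj (x.φ a e)) := by
          rw [← map_add]
          exact congrArg x.Tadj (happ x.even_add_odd _).symm
        rw [hSapp, h1]
        simp only [map_sub, hfT, hfT', heφ, hee]
        abel
    rw [this]
    exact neg_mem (mem_compactOperators_mul x.isAdj_even
      (mul_mem_compactOperators x.isAdj_odd (x.compact_adjoint a)))

end Return

end KasparovBimodule

/-! ### The isomorphism -/

variable {A : Type u} [RealCStarAlgebra A] {B : Type v} [RealCStarAlgebra B]

theorem mk_toCycle_eq (x : KasparovBimodule A B) {v w : x.E →L[ℝ] Col B (KTensor B)}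
    {v' w' : Col B (KTensor B) →L[ℝ] x.E} (hv : IsAdj B v v') (hvv : v' ∘L v = 1)
    (hw : IsAdj B w w') (hww : w' ∘L w = 1) :
    FredholmKK.mk (x.toCycle hw hww) = FredholmKK.mk (x.toCycle hv hvv) := by
  obtain ⟨s, hs, hc⟩ := x.exists_isConj_toCycle hv hvv hw hww
  exact FredholmKK.mk_eq (FredholmCycle.equivalent_of_isConj hs hc)

variable [TopologicalSpace.SeparableSpace B]

/-- The class in `KK(A, B)` of a class in the Fredholm picture. -/
def FredholmKK.toKK : FredholmKK A B → KK A B :=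
  Quot.lift (fun x => KK.mk (x.toBimodule B)) fun x y h => by
    obtain ⟨d, e, hd, he, h⟩ := h
    -- The chain is x, x ⊕ d, y ⊕ e, y, with consecutive bimodules homotopic.
    exact (Quot.sound (FredholmCycle.homotopic_toBimodule_sum x hd)).trans
      ((Quot.sound h.toBimodule).trans
        (Quot.sound (FredholmCycle.homotopic_toBimodule_sum y he)).symm)

/-- The Fredholm cycle of a Kasparov bimodule, for a chosen embedding into the columns. -/
def KasparovBimodule.chosenCycle (x : KasparovBimodule A B) : FredholmCycle A (KTensor B) :=
  x.toCycle (x.exists_embedding (KTensor B)).choose_spec.choose_spec.1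
    (x.exists_embedding (KTensor B)).choose_spec.choose_spec.2

theorem KasparovBimodule.mk_chosenCycle (x : KasparovBimodule A B)
    {v : x.E →L[ℝ] Col B (KTensor B)} {v' : Col B (KTensor B) →L[ℝ] x.E} (hv : IsAdj B v v')
    (hvv : v' ∘L v = 1) : FredholmKK.mk x.chosenCycle = FredholmKK.mk (x.toCycle hv hvv) :=
  mk_toCycle_eq x hv hvv _ _

/-- The class in the Fredholm picture of a class in `KK(A, B)`. -/
def KK.toFredholmKK : KK A B → FredholmKK A B :=
  Quot.lift (fun x => FredholmKK.mk x.chosenCycle) fun x y h => by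
    obtain ⟨v, v', hv, hvv, w, w', hw, hww, h⟩ := h.exists_toCycle (KTensor B)
    rw [x.mk_chosenCycle hv hvv, y.mk_chosenCycle hw hww]
    exact FredholmKK.mk_eq h.equivalent

theorem KK.toFredholmKK_mk (x : KasparovBimodule A B) :
    (mk x).toFredholmKK = FredholmKK.mk x.chosenCycle := rfl

theorem KK.toKK_toFredholmKK (ξ : KK A B) : ξ.toFredholmKK.toKK = ξ := by
  induction ξ using Quot.ind with
  | mk x => exact (Quot.sound (x.homotopic_toBimodule_toCycle _ _)).symm

theorem FredholmKK.toFredholmKK_toKK (ξ : FredholmKK A B) : ξ.toKK.toFredholmKK = ξ := by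
  induction ξ using Quot.ind with
  | mk x =>
    change mk (x.toBimodule B).chosenCycle = mk x
    obtain ⟨v, v', hv, hvv⟩ := (x.toBimodule B).exists_embedding (KTensor B)
    rw [(x.toBimodule B).mk_chosenCycle hv hvv]
    obtain ⟨s, r, hs, hc⟩ := x.exists_isConj_toCycle_toBimodule (D := B) (v := v) (v' := v') hv hvv
    exact mk_eq (FredholmCycle.equivalent_of_isConj hs hc)

variable (A B) in
/-- Both pictures of KK-theory have the same elements. -/
def KK.equivFredholmKK : KK A B ≃ FredholmKK A B where
  toFun := toFredholmKK
  invFun := FredholmKK.toKK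
  left_inv := toKK_toFredholmKK
  right_inv := FredholmKK.toFredholmKK_toKK

/-- The structure is transported along the bijection; `KK.mk_add_mk` identifies the addition with
the direct sum. -/
instance : AddCommGroup (KK A B) := (KK.equivFredholmKK A B).addCommGroup

/-- Any embedding computes the class, so the direct sum may be embedded by means of embeddings of
its summands. -/
theorem KK.toFredholmKK_mk_sum (x y : KasparovBimodule A B) :
    (mk (x.sum y)).toFredholmKK = (mk x).toFredholmKK + (mk y).toFredholmKK := by
  obtain ⟨v, v', hv, hvv⟩ := x.exists_embedding (KTensor B)
  obtain ⟨w, w', hw, hww⟩ := y.exists_embedding (KTensor B)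
  rw [toFredholmKK_mk, toFredholmKK_mk, toFredholmKK_mk, x.mk_chosenCycle hv hvv,
    y.mk_chosenCycle hw hww, (x.sum y).mk_chosenCycle
      (KasparovBimodule.isAdj_sumEmbedding x y hv hw)
      (KasparovBimodule.sumEmbeddingAdj_comp x y hvv hww), FredholmKK.mk_add_mk]
  have h1 : star (1 : 𝓜(ℝ, KTensor B)) * 1 = 1 := by rw [star_one, one_mul]
  exact FredholmKK.mk_eq (FredholmCycle.equivalent_of_isConj
    (FredholmCycle.isSupport_of_isometry _ h1 h1)
    (KasparovBimodule.isConj_toCycle_sum x y hv hw hvv hww))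

theorem KK.mk_add_mk (x y : KasparovBimodule A B) : mk x + mk y = mk (x.sum y) :=
  (KK.equivFredholmKK A B).injective
    (((KK.equivFredholmKK A B).apply_symm_apply _).trans (toFredholmKK_mk_sum x y).symm)

end

end RealKK

/-- For separable real C*-algebras `A` and `B`, direct sum makes both `KK(A, B)` and the Fredholm picture
`𝐊𝐊(A, B)` into abelian groups, and these groups are isomorphic. -/
theorem mainTheorem6 (A : Type u) (B : Type v) [RealKK.RealCStarAlgebra A]
    [RealKK.RealCStarAlgebra B] [TopologicalSpace.SeparableSpace A]
    [TopologicalSpace.SeparableSpace B] :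
    ∃ (_ : AddCommGroup (RealKK.KK A B)) (_ : AddCommGroup (RealKK.FredholmKK A B)),
      (∀ x y : RealKK.KasparovBimodule A B,
        RealKK.KK.mk x + RealKK.KK.mk y = RealKK.KK.mk (x.sum y)) ∧
      (∀ x y : RealKK.FredholmCycle A (RealKK.KTensor B),
        RealKK.FredholmKK.mk x + RealKK.FredholmKK.mk y = RealKK.FredholmKK.mk (x.sum y)) ∧
      Nonempty (RealKK.KK A B ≃+ RealKK.FredholmKK A B) :=
  ⟨inferInstance, inferInstance, RealKK.KK.mk_add_mk, RealKK.FredholmKK.mk_add_mk,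
    ⟨(RealKK.KK.equivFredholmKK A B).addEquiv⟩⟩
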